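/- Consider the Hamiltonian lattice $$H=\sum_{n=1}^N\Big[\tfrac12 p_n^2+V(x_n)+W(x_{n+1}-x_n)\Big],\qquad x_{n+N}=x_n,\quad N \text{ even},$$ where $V$ and $W$ are analytic at $0$ with $V(x)=\sum_{\mu\ge2}\frac1\mu v_\mu x^\mu$, $W(x)=\sum_{\mu\ge2}\frac1\mu\phi_\mu x^\mu$ near $0$, and $v_2,\phi_2>0$. The *out-of-phase mode* is the family of periodic orbits $x_n(t)=Q_0(t)+(-1)^nQ_\pi(t)$, even in $t$, parametrized by the energy per site $\varepsilon>0$ (small), with frequency $\omega(\varepsilon)$ such that $\omega(\varepsilon)^2\to v_2+4\phi_2$ and, uniformly in $\tau$, $$\frac{(Q_0,Q_\pi)(\tau/\omega(\varepsilon))}{\sqrt{2\varepsilon/(v_2+4\phi_2)}}\to(0,\cos\tau)\qquad(\varepsilon\to0).$$ It is *non-isochronous* if $\omega(\varepsilon)^2=v_2+4\phi_2+\gamma\varepsilon+o(\varepsilon)$ with $\gamma\ne0$. Likewise, the small oscillations $\ddot q=-V'(q)$ of a single particle, even in time, of energy $\varepsilon$ and frequency $\omega_0(\varepsilon)$, are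 characterized by $\omega_0(\varepsilon)^2\to v_2$ and $q(\tau/\omega_0(\varepsilon))/\sqrt{2\varepsilon/v_2}\to\cos\tau$ uniformly. The onsite potential is *partially isochronous* if $\omega_0(\varepsilon)^2=v_2+\gamma\varepsilon^n+o(\varepsilon^n)$ for some $n\ge2$, $\gamma\neq0$, or $\omega_0(\varepsilon)^2=v_2$ for all small $\varepsilon$. The mode has its *tangent bifurcation* in the lattice of $N$ sites at the energy per site $\varepsilon^*>0$ if (i) for every energy in $(0,\varepsilon^*)$ the variational equation along the mode has neither a real Floquet multiplier $>1$ nor a solution with the period of the mode that breaks the symmetry $n\mapsto n+2$; (ii) at $\varepsilon^*$ there is such a symmetry-breaking periodic solution; (iii) for every $r>1$ there is a real Floquet multiplier in $(1,r)$ for all energies slightly above $\varepsilon^*$. The mode *bifurcates* if there are $\varepsilon_N\to0$ ($N\to\infty$, $N$ even) such that, for all large even $N$, it has its tangent bifurcation at $\varepsilon_N$. It *does not bifurcate at low energy* if there is $E>0$ such that, for every even $N\ge2$ and every energy per site in $(0,E)$, there is neither a real multiplier $>1$ nor a symmetry-breaking periodic solution as in (i). Then the out-of-phase mode and the small onsite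 oscillations exist, the term $\frac{2v_3^2}{3v_2+16\phi_2}-\frac{4v_3^2}{v_2}$ is negative whenever $v_3\ne0$, and if $V$ is partially isochronous then $10v_3^2=9v_2v_4$. The out-of-phase mode is non-isochronous if and only if $$D:=3(v_4+16\phi_4)+\frac{2v_3^2}{3v_2+16\phi_2}-\frac{4v_3^2}{v_2}\neq0.$$ If it is non-isochronous, then: 1. If $\varepsilon_N\to 0$ are its tangent bifurcation energies for large even $N$, then $$\varepsilon_N\sim\frac{4(v_2+4\phi_2)\phi_2}{D}\,\sin^2\!\Big(\frac{\pi}{N}\Big)\qquad(N\to\infty,\ N\text{ even}).$$ 2. It bifurcates if and only if $$v_3^2<\frac{3v_2(v_4+16\phi_4)(3v_2+16\phi_2)}{2(5v_2+32\phi_2)},$$ and otherwise it does not bifurcate at low energy. 3. If $10v_3^2=9v_2v_4$ (in particular if $V$ is partially isochronous), it bifurcates if and only if $$\phi_4>\frac15\,\frac{v_4\phi_2}{3v_2+16\phi_2};$$ in particular, if moreover $W(x)=\frac{\phi_2}{2}x^2$ near $0$ (harmonic coupling), it does not bifurcate at low energy. -/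

import Mathlib

open Filter Topology Asymptotics

noncomputable section

/-! ### The lattice -/

/-- The coefficient `c_μ` in the expansion `V(x) = ∑_{μ ≥ 2} c_μ x^μ / μ`. -/
def potentialCoeff (V : ℝ → ℝ) (μ : ℕ) : ℝ :=
  iteratedDeriv μ V 0 / ((μ - 1).factorial : ℝ)

/-- `V(x) = ∑_{μ ≥ 2} c_μ x^μ / μ` near `0`, with `c_2 > 0`. -/
structure IsPotential (V : ℝ → ℝ) : Prop where
  analytic : AnalyticAt ℝ V 0
  zero : V 0 = 0
  deriv_zero : deriv V 0 = 0
  coeff_two_pos : 0 < potentialCoeff V 2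

/-- `x` is twice differentiable with second derivative `f`. -/
def HasSecondDeriv (x f : ℝ → ℝ) : Prop :=
  Differentiable ℝ x ∧ ∀ t, HasDerivAt (deriv x) (f t) t

/-- Hamilton's equations for `∑ n, (p_n ^ 2 / 2 + V (x_n) + W (x_{n+1} - x_n))`. -/
def IsLatticeSolution (V W : ℝ → ℝ) (x : ℤ → ℝ → ℝ) : Prop :=
  ∀ n, HasSecondDeriv (x n) fun t =>
    -deriv V (x n t) - deriv W (x n t - x (n - 1) t) + deriv W (x (n + 1) t - x n t)

/-- The energy of an `N`-periodic configuration (`N` sites). -/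
def latticeEnergy (V W : ℝ → ℝ) (N : ℕ) (x : ℤ → ℝ → ℝ) (t : ℝ) : ℝ :=
  ∑ n ∈ Finset.range N,
    (deriv (x n) t ^ 2 / 2 + V (x n t) + W (x (n + 1) t - x n t))

/-! ### The out-of-phase mode -/

/-- The configuration `x_n = Q₀ + (-1)^n Q_π`. -/
def dimer (Q₀ Qπ : ℝ → ℝ) : ℤ → ℝ → ℝ := fun n t => Q₀ t + (-1 : ℝ) ^ n * Qπ t

/-- The squared linear frequency `v₂ + 4 φ₂` of the out-of-phase mode. -/
def piFreqSq (V W : ℝ → ℝ) : ℝ := potentialCoeff V 2 + 4 * potentialCoeff W 2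

/-- The nonlinear out-of-phase mode, parametrized by its energy per site `ε`, for small `ε > 0`:
time-reversal symmetric periodic orbits `x_n = Q₀ + (-1)^n Q_π` with frequency `ω ε` which, after
rescaling to unit amplitude and unit frequency, converge to the linear mode
`(Q₀, Q_π) = (0, cos τ)` as `ε → 0`. -/
structure IsOutOfPhaseMode (V W : ℝ → ℝ) (Q₀ Qπ : ℝ → ℝ → ℝ) (ω : ℝ → ℝ) : Prop where
  freq_pos : ∀ᶠ ε in 𝓝[>] 0, 0 < ω ε
  solution : ∀ᶠ ε in 𝓝[>] 0, IsLatticeSolution V W (dimer (Q₀ ε) (Qπ ε))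
  energy : ∀ᶠ ε in 𝓝[>] 0, ∀ N : ℕ, Even N → ∀ t,
    latticeEnergy V W N (dimer (Q₀ ε) (Qπ ε)) t = N * ε
  periodic : ∀ᶠ ε in 𝓝[>] 0, Function.Periodic (Q₀ ε) (2 * Real.pi / ω ε) ∧
    Function.Periodic (Qπ ε) (2 * Real.pi / ω ε)
  symmetric : ∀ᶠ ε in 𝓝[>] 0, Function.Even (Q₀ ε) ∧ Function.Even (Qπ ε)
  freq_tendsto : Tendsto (fun ε => ω ε ^ 2) (𝓝[>] 0) (𝓝 (piFreqSq V W))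
  tendsto_zero : TendstoUniformly
    (fun ε τ => Q₀ ε (τ / ω ε) / √(2 * ε / piFreqSq V W)) (fun _ => 0) (𝓝[>] 0)
  tendsto_pi : TendstoUniformly
    (fun ε τ => Qπ ε (τ / ω ε) / √(2 * ε / piFreqSq V W)) Real.cos (𝓝[>] 0)

/-! ### A single oscillator in the onsite potential -/

/-- The small oscillations of a single particle in the potential `V`, parametrized by their
energy `ε`, with frequency `ω ε`. -/
structure IsOnsiteMode (V : ℝ → ℝ) (q : ℝ → ℝ → ℝ) (ω : ℝ → ℝ) : Prop where
  freq_pos : ∀ᶠ ε in 𝓝[>] 0, 0 < ω ε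
  solution : ∀ᶠ ε in 𝓝[>] 0, HasSecondDeriv (q ε) fun t => -deriv V (q ε t)
  energy : ∀ᶠ ε in 𝓝[>] 0, ∀ t, deriv (q ε) t ^ 2 / 2 + V (q ε t) = ε
  periodic : ∀ᶠ ε in 𝓝[>] 0, Function.Periodic (q ε) (2 * Real.pi / ω ε)
  symmetric : ∀ᶠ ε in 𝓝[>] 0, Function.Even (q ε)
  freq_tendsto : Tendsto (fun ε => ω ε ^ 2) (𝓝[>] 0) (𝓝 (potentialCoeff V 2))
  tendsto_cos : TendstoUniformly
    (fun ε τ => q ε (τ / ω ε) / √(2 * ε / potentialCoeff V 2)) Real.cos (𝓝[>] 0)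

/-! ### Isochronism -/

/-- `ω(ε)² = Ω + γ ε^n + o(ε^n)` with `γ ≠ 0`. For `n = 1` the mode is non-isochronous. -/
def IsochronousUpToOrder (ω : ℝ → ℝ) (Ω : ℝ) (n : ℕ) : Prop :=
  ∃ γ : ℝ, γ ≠ 0 ∧ (fun ε => ω ε ^ 2 - Ω - γ * ε ^ n) =o[𝓝[>] 0] fun ε => ε ^ n

/-- Partial isochronism (of some order `n ≥ 2`) or complete isochronism. -/
def PartiallyIsochronous (ω : ℝ → ℝ) (Ω : ℝ) : Prop :=
  (∃ n, 2 ≤ n ∧ IsochronousUpToOrder ω Ω n) ∨ ∀ᶠ ε in 𝓝[>] 0, ω ε ^ 2 = Ω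

/-! ### Tangent bifurcation -/

/-- `ξ` solves, on the lattice of `N` sites, the variational equations along `x`. -/
def IsVariation (V W : ℝ → ℝ) (N : ℕ) (x ξ : ℤ → ℝ → ℝ) : Prop :=
  (∀ n, ξ (n + N) = ξ n) ∧
  ∀ n, HasSecondDeriv (ξ n) fun t =>
    -deriv (deriv V) (x n t) * ξ n t
      - deriv (deriv W) (x n t - x (n - 1) t) * (ξ n t - ξ (n - 1) t)
      + deriv (deriv W) (x (n + 1) t - x n t) * (ξ (n + 1) t - ξ n t)

/-- The real number `μ` is a Floquet multiplier of the `T`-periodic orbit `x`. -/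
def IsRealMultiplier (V W : ℝ → ℝ) (N : ℕ) (x : ℤ → ℝ → ℝ) (T μ : ℝ) : Prop :=
  ∃ ξ, IsVariation V W N x ξ ∧ (∃ n t, ξ n t ≠ 0) ∧ ∀ n t, ξ n (t + T) = μ * ξ n t

/-- There is a `T`-periodic perturbation along `x` (Floquet multiplier `1`) which breaks the
invariance under `n ↦ n + 2`. -/
def HasBreakingPeriodicVariation (V W : ℝ → ℝ) (N : ℕ) (x : ℤ → ℝ → ℝ) (T : ℝ) : Prop :=
  ∃ ξ, IsVariation V W N x ξ ∧ (∃ n t, ξ (n + 2) t ≠ ξ n t) ∧ ∀ n t, ξ n (t + T) = ξ n t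

/-- For no energy per site in `(0, E)` does the mode have a symmetry breaking periodic
perturbation or a real Floquet multiplier `> 1`: on the lattice of `N` sites, no tangent
bifurcation has occurred below `E`. -/
def NoTangentBifurcationBelow (V W : ℝ → ℝ) (Q₀ Qπ : ℝ → ℝ → ℝ) (ω : ℝ → ℝ)
    (N : ℕ) (E : ℝ) : Prop :=
  ∀ ε, 0 < ε → ε < E →
    ¬ HasBreakingPeriodicVariation V W N (dimer (Q₀ ε) (Qπ ε)) (2 * Real.pi / ω ε) ∧
    ∀ μ, 1 < μ → ¬ IsRealMultiplier V W N (dimer (Q₀ ε) (Qπ ε)) (2 * Real.pi / ω ε) μ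

/-- On the lattice of `N` sites the mode undergoes its (first) tangent bifurcation at the energy
per site `E`: nothing happens below `E`; at `E` there is a symmetry breaking periodic
perturbation; right above `E` the mode is unstable, with a real multiplier `> 1` which tends to
`1` as the energy decreases to `E`. -/
def IsBifurcationEnergy (V W : ℝ → ℝ) (Q₀ Qπ : ℝ → ℝ → ℝ) (ω : ℝ → ℝ)
    (N : ℕ) (E : ℝ) : Prop :=
  0 < E ∧
  NoTangentBifurcationBelow V W Q₀ Qπ ω N E ∧
  HasBreakingPeriodicVariation V W N (dimer (Q₀ E) (Qπ E)) (2 * Real.pi / ω E) ∧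
  ∀ r, 1 < r → ∀ᶠ ε in 𝓝[>] E, ∃ μ, 1 < μ ∧ μ < r ∧
    IsRealMultiplier V W N (dimer (Q₀ ε) (Qπ ε)) (2 * Real.pi / ω ε) μ

/-- `N → ∞` through even numbers. -/
def evenAtTop : Filter ℕ := atTop ⊓ 𝓟 {N | Even N}

/-- `E N` is, for all large even `N`, the tangent bifurcation energy of the mode in the lattice
of `N` sites, and it lies in the low-energy regime: `E N → 0`. -/
def AreBifurcationEnergies (V W : ℝ → ℝ) (Q₀ Qπ : ℝ → ℝ → ℝ) (ω : ℝ → ℝ)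
    (E : ℕ → ℝ) : Prop :=
  Tendsto E evenAtTop (𝓝 0) ∧ ∀ᶠ N in evenAtTop, IsBifurcationEnergy V W Q₀ Qπ ω N (E N)

/-- The mode undergoes a tangent bifurcation at low energy. -/
def Bifurcates (V W : ℝ → ℝ) (Q₀ Qπ : ℝ → ℝ → ℝ) (ω : ℝ → ℝ) : Prop :=
  ∃ E : ℕ → ℝ, AreBifurcationEnergies V W Q₀ Qπ ω E

/-- The mode does not bifurcate tangently at low energy: there is an energy, independent of
the size of the lattice, below which there is no tangent bifurcation. -/
def NeverBifurcates (V W : ℝ → ℝ) (Q₀ Qπ : ℝ → ℝ → ℝ) (ω : ℝ → ℝ) : Prop :=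
  ∃ E : ℝ, 0 < E ∧ ∀ N : ℕ, 2 ≤ N → Even N → NoTangentBifurcationBelow V W Q₀ Qπ ω N E

end

/-! Write `Ω = v₂ + 4φ₂`. An even periodic orbit is determined by half a period, at both ends of
which the velocities vanish. After scaling out the amplitude `r` and the half period `√Λ`, the mode
becomes a Neumann problem on `[0, 1]` for `(X₀, X_π, Λ)`. It is analytic up to `r = 0`, because the
forces enter through `V'(x)/x` and `W'(x)/x`. At `r = 0` its solution is `(0, cos πt)` with `Λ =
π²/Ω`, and the linearization there is invertible: the in-phase oscillator advances its phase by only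
`θ = π √(v₂/Ω) < π` and is not resonant, while the resonance of the out-of-phase oscillator is
absorbed by the unknown `Λ`. The implicit function theorem gives an analytic branch
(`exists_isModeBranch`), and local uniqueness puts every mode with the prescribed limits on it
(`IsOutOfPhaseMode.eventually_eq_branch`). Testing the out-of-phase equation with `cos πt` yields
`π²/Λ = Ω + (D/4) r² + o(r²)` (`IsModeBranch.tendsto_frequency`). As the energy per site is `Ω r²/2
+ o(r²)`, non-isochronism means `D ≠ 0`. The same computation for one particle gives `10 v₃² = 9 v₂
v₄` under partial isochronism.

For stability, a Fourier transform over the sites splits the variational equations into Hermitian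
2×2 systems `Z'' = -A(t) Z`, one for each quasimomentum `q`, with `A` even in time. Splitting a
solution with multiplier `μ = (1+k)/(1-k)` into its even and odd parts turns the Floquet condition
into a matching condition at half a period, `k C x = S p` and `C' x = k S' p` (`HasMatch`).
Conservation of Wronskians makes the normalized boundary matrices Hermitian. Hence, for small `r`
and `q`, matching is the single real equation `E·O + k² (c + k² d) = 0` with `c > 0`, where `E` and
`O` are the normalized determinants of the even and the odd periodic problem
(`IsModeBranch.exists_char`). Away from `q = k = 0`, the linear limit has no matching solutions, and
compactness extends this to small amplitudes.

The odd determinant vanishes at `q = 0`, because the velocity of the mode is an odd periodic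
perturbation, and it is negative for small `q ≠ 0`. The amplitude derivative of the mode is an even
solution of the variational equation up to a term proportional to `Λ'(r)`. This ties the even
determinant to the frequency shift: `E = K ((D/4) r² - (φ₂/2) q²) + o(r² + q²)` with `K > 0`
(`IsModeBranch.tendsto_det_endCosDeriv`, `IsModeBranch.hasQuadraticExpansion`). For `q ≠ 0`,
therefore, `E < 0` excludes real multipliers `≥ 1`, `E = 0` gives a periodic perturbation, and a
small `E > 0` gives a multiplier slightly above `1` (`IsModeBranch.exists_match_threshold`).

If `D < 0`, then `E < 0` for all small `r` and `q ≠ 0`, uniformly in the lattice size. If `D > 0`,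
then `E` increases with `r` and decreases with `|q|`, so the smallest wave number `q = 2π/N`
destabilizes first, at `r² ∼ (2φ₂/D) q²`, that is at energy `(Ω φ₂/D) q²`. The explicit criteria are
rewritings of `D > 0`. -/

noncomputable section

/-! ### Iterated integrals on the unit interval -/

section Volterra

variable {E : Type*} [NormedAddCommGroup E]

/-- The extension of a function on `[0, 1]` to the line by its boundary values. -/
def extendI (f : C(unitInterval, E)) (t : ℝ) : E := f (Set.projIcc 0 1 zero_le_one t)

theorem continuous_extendI (f : C(unitInterval, E)) : Continuous (extendI f) :=
  f.continuous.comp continuous_projIcc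

theorem extendI_coe (f : C(unitInterval, E)) (t : unitInterval) : extendI f t = f t := by
  simp [extendI]

theorem extendI_of_mem (f : C(unitInterval, E)) {t : ℝ} (ht : t ∈ Set.Icc (0 : ℝ) 1) :
    extendI f t = f ⟨t, ht⟩ := extendI_coe f ⟨t, ht⟩

variable [NormedSpace ℝ E]

/-- The primitive vanishing at `0`. -/
def primitive : C(unitInterval, E) →L[ℝ] C(unitInterval, E) :=
  LinearMap.mkContinuous
    { toFun := fun f => ⟨fun t => ∫ s in (0 : ℝ)..t, extendI f s,
        (intervalIntegral.continuous_primitive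
          (fun _ _ => (continuous_extendI f).intervalIntegrable _ _) 0).comp continuous_subtype_val⟩
      map_add' := fun f g => by
        ext t
        exact intervalIntegral.integral_add ((continuous_extendI f).intervalIntegrable _ _)
          ((continuous_extendI g).intervalIntegrable _ _)
      map_smul' := fun c f => by
        ext t
        exact intervalIntegral.integral_smul c _ }
    1 fun f => by
      rw [one_mul, ContinuousMap.norm_le _ (norm_nonneg _)]
      intro t
      refine (intervalIntegral.norm_integral_le_of_norm_le_const
        (C := ‖f‖) fun s _ => f.norm_coe_le_norm _).trans ?_
      rw [sub_zero, abs_of_nonneg t.2.1]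
      exact mul_le_of_le_one_right (norm_nonneg _) t.2.2

theorem primitive_apply (f : C(unitInterval, E)) (t : unitInterval) :
    primitive f t = ∫ s in (0 : ℝ)..t, extendI f s := rfl

theorem primitive_zero (f : C(unitInterval, E)) : primitive f 0 = 0 := by
  simp [primitive_apply]

theorem primitive_one (f : C(unitInterval, E)) :
    primitive f 1 = ∫ s in (0 : ℝ)..1, extendI f s := by
  simp [primitive_apply]

theorem hasDerivAt_integral_extendI [CompleteSpace E] (f : C(unitInterval, E)) (t : ℝ) :
    HasDerivAt (fun t => ∫ s in (0 : ℝ)..t, extendI f s) (extendI f t) t :=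
  (continuous_extendI f).integral_hasStrictDerivAt 0 t |>.hasDerivAt

/-- Each integration raises the power of `t` and divides by the new exponent. Iterating this
produces the factorials that make Volterra operators quasinilpotent. -/
theorem norm_primitive_le_of_le {f : C(unitInterval, E)} {c : ℝ} {n : ℕ}
    (hf : ∀ t, ‖f t‖ ≤ c * (t : ℝ) ^ n) (t : unitInterval) :
    ‖primitive f t‖ ≤ c / (n + 1) * (t : ℝ) ^ (n + 1) := by
  have h : ‖primitive f t‖ ≤ ∫ s in (0 : ℝ)..t, c * s ^ n := by
    refine intervalIntegral.norm_integral_le_of_norm_le t.2.1 ?_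
      ((continuous_const.mul (continuous_pow n)).intervalIntegrable _ _)
    refine Eventually.of_forall fun s hs => ?_
    rw [extendI_of_mem f ⟨hs.1.le, hs.2.trans t.2.2⟩]
    exact hf _
  refine h.trans (le_of_eq ?_)
  rw [intervalIntegral.integral_const_mul, integral_pow]
  simp
  ring

/-- Volterra operators `1 + ∬ B` are invertible. -/
theorem isUnit_one_add_primitive_primitive [CompleteSpace E]
    (B : C(unitInterval, E) →L[ℝ] C(unitInterval, E)) {M : ℝ}
    (hB : ∀ f t, ‖B f t‖ ≤ M * ‖f t‖) : IsUnit (1 + primitive * primitive * B) := by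
  have hM : 0 ≤ |M| := abs_nonneg M
  set T := primitive * primitive * (-B) with hT
  -- One of the two integrations in each factor already produces `1/n!`; the gain of the other one
  -- is discarded using `t ≤ 1`.
  have key : ∀ (n : ℕ) (f : C(unitInterval, E)) (t : unitInterval),
      ‖(T ^ n) f t‖ ≤ ‖f‖ * (|M| ^ n / n.factorial) * (t : ℝ) ^ n := by
    intro n
    induction n with
    | zero => intro f t; simpa using f.norm_coe_le_norm t
    | succ n ih =>
      intro f t
      have h0 : ∀ s, ‖(-B) ((T ^ n) f) s‖ ≤ |M| * (‖f‖ * (|M| ^ n / n.factorial)) * (s : ℝ) ^ n := by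
        intro s
        calc _ = ‖B ((T ^ n) f) s‖ := by simp
          _ ≤ M * ‖(T ^ n) f s‖ := hB _ _
          _ ≤ |M| * ‖(T ^ n) f s‖ := by gcongr; exact le_abs_self M
          _ ≤ |M| * (‖f‖ * (|M| ^ n / n.factorial) * (s : ℝ) ^ n) := by gcongr; exact ih f s
          _ = _ := by ring
      have h1 := norm_primitive_le_of_le h0
      have h2 := norm_primitive_le_of_le h1 t
      have h3 : (T ^ (n + 1)) f = primitive (primitive ((-B) ((T ^ n) f))) := by
        rw [pow_succ']; rfl
      rw [h3]
      refine h2.trans ?_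
      have hc : |M| * (‖f‖ * (|M| ^ n / n.factorial)) / (n + 1) =
          ‖f‖ * (|M| ^ (n + 1) / (n + 1).factorial) := by
        rw [Nat.factorial_succ]; push_cast; field_simp; ring
      rw [hc]
      have hcn : 0 ≤ ‖f‖ * (|M| ^ (n + 1) / (n + 1).factorial) := by positivity
      have ht0 : 0 ≤ (t : ℝ) := t.2.1
      have ht1 : (t : ℝ) ≤ 1 := t.2.2
      have : (t : ℝ) ^ (n + 1 + 1) ≤ (t : ℝ) ^ (n + 1) := pow_le_pow_of_le_one ht0 ht1 (by omega)
      have h4 : (‖f‖ * (|M| ^ (n + 1) / (n + 1).factorial)) / ((n + 1 : ℕ) + 1 : ℝ) ≤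
          ‖f‖ * (|M| ^ (n + 1) / (n + 1).factorial) :=
        div_le_self hcn (by push_cast; linarith [(Nat.cast_nonneg n : (0 : ℝ) ≤ n)])
      calc _ ≤ (‖f‖ * (|M| ^ (n + 1) / (n + 1).factorial)) * (t : ℝ) ^ (n + 1 + 1) := by
            gcongr
        _ ≤ _ := by gcongr
  have hlim : Tendsto (fun n : ℕ => |M| ^ n / n.factorial) atTop (𝓝 0) :=
    FloorSemiring.tendsto_pow_div_factorial_atTop _
  obtain ⟨n, hn⟩ := ((hlim.eventually (gt_mem_nhds (one_half_pos (α := ℝ)))).and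
    (eventually_ge_atTop 1)).exists
  have hnorm : ‖T ^ n‖ < 1 := by
    have : ‖T ^ n‖ ≤ 1 / 2 := by
      refine ContinuousLinearMap.opNorm_le_bound _ (by norm_num) fun f => ?_
      rw [ContinuousMap.norm_le _ (by positivity)]
      intro t
      refine (key n f t).trans ?_
      have ht : (t : ℝ) ^ n ≤ 1 := pow_le_one₀ t.2.1 t.2.2
      have h1 := hn.1.le
      have h2 : 0 ≤ |M| ^ n / n.factorial := by positivity
      have h3 : (0 : ℝ) ≤ (t : ℝ) ^ n := pow_nonneg t.2.1 n
      have h4 : |M| ^ n / n.factorial * (t : ℝ) ^ n ≤ 1 / 2 := by nlinarith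
      calc _ = ‖f‖ * (|M| ^ n / n.factorial * (t : ℝ) ^ n) := by ring
        _ ≤ ‖f‖ * (1 / 2) := mul_le_mul_of_nonneg_left h4 (norm_nonneg _)
        _ = _ := by ring
    linarith
  have hu : IsUnit (1 - T ^ n) :=
    isUnit_one_sub_of_norm_lt_one (R := C(unitInterval, E) →L[ℝ] C(unitInterval, E)) hnorm
  -- Only some power `T ^ n` is known to be small. Since `1 - T` is a commuting factor of the unit
  -- `1 - T ^ n`, it is a unit itself.
  rw [← mul_neg_geom_sum T n] at hu
  have hc : Commute (1 - T) (∑ i ∈ Finset.range n, T ^ i) := by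
    refine Commute.sum_right _ _ _ fun i _ => Commute.pow_right ?_ i
    exact (Commute.one_left _).sub_left (Commute.refl T)
  have h1T : 1 - T = 1 + primitive * primitive * B := by
    ext f t
    simp [hT]
  rw [← h1T]
  exact (hc.isUnit_mul_iff.mp hu).1

/-- `f` has initial velocity `v` and acceleration `F`. -/
def HasAccel (f : C(unitInterval, E)) (v : E) (F : C(unitInterval, E)) : Prop :=
  ∀ t : unitInterval, f t = f 0 + (t : ℝ) • v + primitive (primitive F) t

theorem HasAccel.eq {f : C(unitInterval, E)} {v : E} {F : C(unitInterval, E)}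
    (h : HasAccel f v F) (t : unitInterval) :
    f t = f 0 + (t : ℝ) • v + primitive (primitive F) t := h t

theorem integral_extendI_primitive [CompleteSpace E] (F : C(unitInterval, E)) (t : ℝ) :
    HasDerivAt (fun t => ∫ s in (0 : ℝ)..t, ∫ u in (0 : ℝ)..s, extendI F u)
      (∫ u in (0 : ℝ)..t, extendI F u) t := by
  have hc : Continuous fun t => ∫ u in (0 : ℝ)..t, extendI F u :=
    intervalIntegral.continuous_primitive
      (fun _ _ => (continuous_extendI F).intervalIntegrable _ _) 0
  exact (hc.integral_hasStrictDerivAt 0 t).hasDerivAt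

theorem primitive_primitive_apply (F : C(unitInterval, E)) (t : unitInterval) :
    primitive (primitive F) t = ∫ s in (0 : ℝ)..t, ∫ u in (0 : ℝ)..s, extendI F u := by
  rw [primitive_apply]
  refine intervalIntegral.integral_congr fun s hs => ?_
  rw [Set.uIcc_of_le t.2.1] at hs
  exact extendI_of_mem _ ⟨hs.1, hs.2.trans t.2.2⟩

/-- A function with an acceleration extends to a twice differentiable function. -/
theorem HasAccel.exists_extension [CompleteSpace E] {f : C(unitInterval, E)} {v : E} {F : C(unitInterval, E)}
    (h : HasAccel f v F) :
    ∃ x x' : ℝ → E, (∀ t, HasDerivAt x (x' t) t) ∧ (∀ t, HasDerivAt x' (extendI F t) t) ∧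
      x' 0 = v ∧ x' 1 = v + primitive F 1 ∧ ∀ t : unitInterval, x t = f t := by
  refine ⟨fun t => f 0 + t • v + ∫ s in (0 : ℝ)..t, ∫ u in (0 : ℝ)..s, extendI F u,
    fun t => v + ∫ u in (0 : ℝ)..t, extendI F u, fun t => ?_, fun t => ?_, ?_, ?_, fun t => ?_⟩
  · have := (((hasDerivAt_id t).smul_const v).const_add (f 0)).add
      (integral_extendI_primitive F t)
    simpa using! this
  · simpa using! (hasDerivAt_integral_extendI F t).const_add v
  · simp
  · simp [primitive_one]
  · rw [h.eq t, primitive_primitive_apply]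

theorem integral_eq_of_hasDerivAt_Icc [CompleteSpace E] {x x' : ℝ → E} {t : ℝ} (ht : t ∈ Set.Icc (0 : ℝ) 1)
    (hx : ∀ s ∈ Set.Icc (0 : ℝ) 1, HasDerivAt x (x' s) s)
    (hc : ContinuousOn x' (Set.Icc 0 1)) : ∫ s in (0 : ℝ)..t, x' s = x t - x 0 := by
  refine intervalIntegral.integral_eq_sub_of_hasDerivAt (fun s hs => ?_) ?_
  · rw [Set.uIcc_of_le ht.1] at hs
    exact hx s ⟨hs.1, hs.2.trans ht.2⟩
  · refine (hc.mono ?_).intervalIntegrable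
    rw [Set.uIcc_of_le ht.1]
    exact Set.Icc_subset_Icc_right ht.2

theorem primitive_eq_of_hasDerivAt [CompleteSpace E] {x' : ℝ → E} {F : C(unitInterval, E)}
    (hx' : ∀ t : unitInterval, HasDerivAt x' (F t) t) (t : unitInterval) :
    primitive F t = x' t - x' 0 := by
  rw [primitive_apply]
  refine integral_eq_of_hasDerivAt_Icc t.2 (fun s hs => ?_) (continuous_extendI F).continuousOn
  rw [extendI_of_mem F hs]
  exact hx' ⟨s, hs⟩

theorem hasAccel_of_hasDerivAt [CompleteSpace E] {x x' : ℝ → E} {f F : C(unitInterval, E)}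
    (hx : ∀ t : unitInterval, HasDerivAt x (x' t) t)
    (hx' : ∀ t : unitInterval, HasDerivAt x' (F t) t)
    (hf : ∀ t : unitInterval, f t = x t) : HasAccel f (x' 0) F := by
  intro t
  have h1 : ∫ s in (0 : ℝ)..t, x' s = x t - x 0 :=
    integral_eq_of_hasDerivAt_Icc t.2 (fun s hs => hx ⟨s, hs⟩)
      (fun s hs => (hx' ⟨s, hs⟩).continuousAt.continuousWithinAt)
  have h2 : primitive (primitive F) t = ∫ s in (0 : ℝ)..t, (x' s - x' 0) := by
    rw [primitive_apply]
    refine intervalIntegral.integral_congr fun s hs => ?_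
    rw [Set.uIcc_of_le t.2.1] at hs
    have hs' : s ∈ Set.Icc (0 : ℝ) 1 := ⟨hs.1, hs.2.trans t.2.2⟩
    simp only [extendI_of_mem _ hs']
    exact primitive_eq_of_hasDerivAt hx' ⟨s, hs'⟩
  have hint : IntervalIntegrable x' MeasureTheory.volume 0 t := by
    refine ContinuousOn.intervalIntegrable fun s hs => ?_
    rw [Set.uIcc_of_le t.2.1] at hs
    exact (hx' ⟨s, hs.1, hs.2.trans t.2.2⟩).continuousAt.continuousWithinAt
  rw [h2, intervalIntegral.integral_sub hint intervalIntegrable_const, h1, hf t, hf 0]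
  simp

/-- Green's identity. -/
theorem HasAccel.green {R : Type*} [NormedRing R] [NormedAlgebra ℝ R] [CompleteSpace R]
    {f F g G : C(unitInterval, R)} {v w : R} (hf : HasAccel f v F) (hg : HasAccel g w G) :
    primitive (f * G - F * g) 1 =
      f 1 * (w + primitive G 1) - (v + primitive F 1) * g 1 - (f 0 * w - v * g 0) := by
  obtain ⟨x, x', hx, hx', h0, h1, hxf⟩ := hf.exists_extension
  obtain ⟨y, y', hy, hy', k0, k1, hyg⟩ := hg.exists_extension
  have hd : ∀ t : unitInterval, HasDerivAt (fun t => x t * y' t - x' t * y t)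
      ((f * G - F * g) t) t := by
    intro t
    have := ((hx t).mul (hy' t)).sub ((hx' t).mul (hy t))
    convert! this using 1
    simp only [ContinuousMap.sub_apply, ContinuousMap.mul_apply, extendI_coe, hxf, hyg]
    abel
  rw [primitive_eq_of_hasDerivAt hd 1]
  have e1 := hxf 1
  have e0 := hxf 0
  have d1 := hyg 1
  have d0 := hyg 0
  simp only [Set.Icc.coe_one, Set.Icc.coe_zero] at e1 e0 d1 d0 ⊢
  rw [e1, e0, d1, d0, h0, h1, k0, k1]

end Volterra

end

noncomputable section

/-! ### Composition operators and Taylor coefficients -/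

section Nemytskii

/-- The composition operator `u ↦ g ∘ u`. -/
def nem (g : ℝ → ℝ) (u : C(unitInterval, ℝ)) : C(unitInterval, ℝ) :=
  open Classical in if h : Continuous fun t => g (u t) then ⟨fun t => g (u t), h⟩ else 0

theorem nem_eq_of_forall {g : ℝ → ℝ} {u v : C(unitInterval, ℝ)} (h : ∀ t, v t = g (u t)) :
    nem g u = v := by
  have hc : Continuous fun t => g (u t) := by
    simp_rw [← h]; exact v.continuous
  ext t
  simp [nem, hc, h]

/-- The Taylor coefficients of `g` also define a power series in the Banach algebra of continuous
functions, with at least the same radius of convergence. Evaluation at `t` is a continuous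
homomorphism, so the sum is pointwise `g (u t)`. In particular the default value `0` of `nem` is not
taken near `0`. -/
theorem exists_analyticAt_nem {g : ℝ → ℝ} (hg : AnalyticAt ℝ g 0) :
    AnalyticAt ℝ (nem g) 0 ∧ ∀ᶠ u in 𝓝 (0 : C(unitInterval, ℝ)), ∀ t, nem g u t = g (u t) := by
  obtain ⟨p, r, hp⟩ := hg
  set q := FormalMultilinearSeries.ofScalars (𝕜 := ℝ) C(unitInterval, ℝ) p.coeff with hq
  have hle : ∀ n, ‖q n‖ ≤ ‖p n‖ := by
    intro n
    rw [hq, FormalMultilinearSeries.ofScalars_norm]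
    exact FormalMultilinearSeries.norm_apply_eq_norm_coef.symm.le
  have hrad : p.radius ≤ q.radius := by
    refine ENNReal.le_of_forall_nnreal_lt fun ρ hρ => ?_
    obtain ⟨C, hC, h⟩ := p.norm_mul_pow_le_of_lt_radius hρ
    exact q.le_radius_of_bound C fun n =>
      (mul_le_mul_of_nonneg_right (hle n) (by positivity)).trans (h n)
  have hrq : r ≤ q.radius := hp.r_le.trans hrad
  have hq0 := q.hasFPowerSeriesOnBall (hp.r_pos.trans_le hrq)
  have hval : ∀ u ∈ Metric.eball (0 : C(unitInterval, ℝ)) r, ∀ t, q.sum u t = g (u t) := by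
    intro u hu t
    have h1 : HasSum (fun n : ℕ => q n fun _ => u) (q.sum (0 + u)) :=
      hq0.hasSum (Metric.eball_subset_eball hrq hu)
    have h2 := (ContinuousMap.evalCLM ℝ t).hasSum h1
    have hut : u t ∈ Metric.eball (0 : ℝ) r := by
      rw [Metric.mem_eball] at hu ⊢
      refine lt_of_le_of_lt ?_ hu
      rw [edist_dist, edist_dist]
      exact ENNReal.ofReal_le_ofReal (by simpa using ContinuousMap.dist_apply_le_dist (f := u) (g := 0) t)
    have h3 := hp.hasSum hut
    rw [zero_add] at h2 h3
    refine h2.unique ?_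
    have h4 : (fun n : ℕ => p n fun _ => u t) =
        (fun b => (ContinuousMap.evalCLM ℝ t) b) ∘ fun n : ℕ => q n fun _ => u := by
      funext n
      rw [Function.comp_apply, hq, FormalMultilinearSeries.ofScalars_apply_eq,
        FormalMultilinearSeries.apply_eq_pow_smul_coeff]
      simp [mul_comm]
    exact (congrArg (fun k => HasSum k (g (u t))) h4).mp h3
  have hball : Metric.eball (0 : C(unitInterval, ℝ)) r ∈ 𝓝 (0 : C(unitInterval, ℝ)) :=
    Metric.eball_mem_nhds _ hp.r_pos
  have heq : ∀ᶠ u in 𝓝 (0 : C(unitInterval, ℝ)), q.sum u = nem g u := by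
    filter_upwards [hball] with u hu
    exact (nem_eq_of_forall (hval u hu)).symm
  refine ⟨hq0.analyticAt.congr heq, ?_⟩
  filter_upwards [heq, hball] with u h1 h2 t
  rw [← h1, hval u h2]

end Nemytskii

/-! ### Taylor coefficients of the forces by iterated divided differences. -/

section Taylor

/-- `f x = c₀ + c₁ x + c₂ x² + x³ g(x)` for a function `g` analytic at `0`. -/
theorem analyticAt_dslope {f : ℝ → ℝ} (hf : AnalyticAt ℝ f 0) : AnalyticAt ℝ (dslope f 0) 0 := by
  obtain ⟨p, hp⟩ := hf
  exact ⟨_, hp.has_fpower_series_dslope_fslope⟩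

theorem eq_add_mul_dslope (f : ℝ → ℝ) (x : ℝ) : f x = f 0 + x * dslope f 0 x := by
  have := sub_smul_dslope f 0 x
  simp at this
  linarith

/-- The quotient `V'(x) / x`. -/
def forceQuot (V : ℝ → ℝ) : ℝ → ℝ := dslope (deriv V) 0

/-- The cubic remainder `(V'(x) - v₂ x - v₃ x²) / x³`. -/
def forceRem (V : ℝ → ℝ) : ℝ → ℝ := dslope (dslope (dslope (deriv V) 0) 0) 0

variable {V : ℝ → ℝ}

theorem IsPotential.analyticAt_deriv (hV : IsPotential V) : AnalyticAt ℝ (deriv V) 0 :=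
  hV.analytic.deriv

theorem IsPotential.analyticAt_deriv_deriv (hV : IsPotential V) :
    AnalyticAt ℝ (deriv (deriv V)) 0 := hV.analytic.deriv.deriv

theorem IsPotential.analyticAt_forceQuot (hV : IsPotential V) : AnalyticAt ℝ (forceQuot V) 0 :=
  analyticAt_dslope hV.analyticAt_deriv

theorem IsPotential.analyticAt_forceRem (hV : IsPotential V) : AnalyticAt ℝ (forceRem V) 0 :=
  analyticAt_dslope (analyticAt_dslope (analyticAt_dslope hV.analyticAt_deriv))

theorem IsPotential.deriv_eq (hV : IsPotential V) (x : ℝ) : deriv V x = x * forceQuot V x := by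
  rw [eq_add_mul_dslope (deriv V) x, hV.deriv_zero, zero_add]; rfl

/-- Each divided difference at `0` shifts the Taylor series by one place, so the constant term left
after `n` of them is the `n`-th coefficient. -/
theorem iterate_dslope_apply_zero {f : ℝ → ℝ} (hf : AnalyticAt ℝ f 0) (n : ℕ) :
    ((Function.swap dslope (0 : ℝ))^[n] f) 0 = iteratedDeriv n f 0 / n.factorial := by
  have h := hf.hasFPowerSeriesAt
  have h1 := (h.has_fpower_series_iterate_dslope_fslope n)
  have h2 := h1.coeff_zero ![]
  rw [← h2]
  have h3 : ((FormalMultilinearSeries.fslope^[n]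
      (FormalMultilinearSeries.ofScalars ℝ fun k => iteratedDeriv k f 0 / k.factorial)).coeff 0) =
      iteratedDeriv n f 0 / n.factorial := by
    rw [FormalMultilinearSeries.coeff_iterate_fslope, FormalMultilinearSeries.coeff_ofScalars,
      zero_add]
  rw [← h3, FormalMultilinearSeries.coeff]
  congr 1
  exact Subsingleton.elim _ _

theorem potentialCoeff_succ (V : ℝ → ℝ) (n : ℕ) :
    potentialCoeff V (n + 1) = iteratedDeriv n (deriv V) 0 / n.factorial := by
  rw [potentialCoeff, iteratedDeriv_succ', Nat.add_sub_cancel]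

theorem IsPotential.forceQuot_zero (hV : IsPotential V) :
    forceQuot V 0 = potentialCoeff V 2 := by
  rw [potentialCoeff_succ]
  exact iterate_dslope_apply_zero hV.analyticAt_deriv 1

theorem IsPotential.forceRem_zero (hV : IsPotential V) :
    forceRem V 0 = potentialCoeff V 4 := by
  rw [potentialCoeff_succ]
  exact iterate_dslope_apply_zero hV.analyticAt_deriv 3

theorem IsPotential.deriv_eq_cubic (hV : IsPotential V) (x : ℝ) :
    deriv V x = potentialCoeff V 2 * x + potentialCoeff V 3 * x ^ 2 + x ^ 3 * forceRem V x := by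
  have h2 : dslope (dslope (deriv V) 0) 0 0 = potentialCoeff V 3 := by
    rw [potentialCoeff_succ]
    exact iterate_dslope_apply_zero hV.analyticAt_deriv 2
  have h1 : dslope (deriv V) 0 0 = potentialCoeff V 2 := hV.forceQuot_zero
  rw [eq_add_mul_dslope (deriv V) x, hV.deriv_zero, eq_add_mul_dslope (dslope (deriv V) 0) x, h1,
    eq_add_mul_dslope (dslope (dslope (deriv V) 0) 0) x, h2]
  rw [forceRem]
  ring

theorem deriv_deriv_zero (V : ℝ → ℝ) :
    deriv (deriv V) 0 = potentialCoeff V 2 := by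
  rw [potentialCoeff_succ]
  simp [iteratedDeriv_one]

theorem IsPotential.hasDerivAt (hV : IsPotential V) : ∀ᶠ x in 𝓝 0, HasDerivAt V (deriv V x) x :=
  hV.analytic.eventually_analyticAt.mono fun _ h => h.differentiableAt.hasDerivAt

theorem IsPotential.hasDerivAt_deriv (hV : IsPotential V) :
    ∀ᶠ x in 𝓝 0, HasDerivAt (deriv V) (deriv (deriv V) x) x :=
  hV.analyticAt_deriv.eventually_analyticAt.mono fun _ h => h.differentiableAt.hasDerivAt

end Taylor

end

noncomputable section

/-! ### Branches of solutions of Neumann problems -/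

section Neumann

open scoped ContDiff

/-- `t ↦ cos (θ t)` on the unit interval. -/
def cosI (θ : ℝ) : C(unitInterval, ℝ) := ⟨fun t => Real.cos (θ * t), by fun_prop⟩

@[simp] theorem cosI_apply (θ : ℝ) (t : unitInterval) : cosI θ t = Real.cos (θ * t) := rfl

/-- `t ↦ t sin (π t)` on the unit interval. -/
def secularI : C(unitInterval, ℝ) :=
  ⟨fun t => t * Real.sin (Real.pi * t), by fun_prop⟩

theorem hasAccel_cosI (θ : ℝ) : HasAccel (cosI θ) 0 (-(θ ^ 2) • cosI θ) := by
  have h := hasAccel_of_hasDerivAt (x := fun t => Real.cos (θ * t))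
    (x' := fun t => -θ * Real.sin (θ * t)) (f := cosI θ) (F := -(θ ^ 2) • cosI θ)
    (fun t => by
      have := (((hasDerivAt_id (t : ℝ)).const_mul θ).cos)
      convert! this using 1
      simp; ring)
    (fun t => by
      have := (((hasDerivAt_id (t : ℝ)).const_mul θ).sin).const_mul (-θ)
      convert! this using 1
      simp; ring)
    (fun t => rfl)
  simpa using h

theorem primitive_cosI_one {θ : ℝ} (hθ : θ ≠ 0) : primitive (cosI θ) 1 = Real.sin θ / θ := by
  have h := primitive_eq_of_hasDerivAt (x' := fun t => Real.sin (θ * t) / θ) (F := cosI θ)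
    (fun t => by
      have := (((hasDerivAt_id (t : ℝ)).const_mul θ).sin).div_const θ
      convert! this using 1
      simp; field_simp) 1
  simpa using h

/-- The secular function is the response of the out-of-phase oscillator to resonant forcing by `cos
πt`. It is the direction along which a change of the period acts, and its nonzero integral below is
what makes the resonant block invertible. -/
theorem hasAccel_secularI : HasAccel secularI 0
    (-(Real.pi ^ 2) • secularI + (2 * Real.pi) • cosI Real.pi) := by
  have h := hasAccel_of_hasDerivAt (x := fun t => t * Real.sin (Real.pi * t))
    (x' := fun t => Real.sin (Real.pi * t) + t * (Real.pi * Real.cos (Real.pi * t)))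
    (f := secularI) (F := -(Real.pi ^ 2) • secularI + (2 * Real.pi) • cosI Real.pi)
    (fun t => by
      have := (hasDerivAt_id (t : ℝ)).mul (((hasDerivAt_id (t : ℝ)).const_mul Real.pi).sin)
      convert! this using 1
      simp only [id_eq]; ring)
    (fun t => by
      have := (((hasDerivAt_id (t : ℝ)).const_mul Real.pi).sin).add ((hasDerivAt_id (t : ℝ)).mul
        ((((hasDerivAt_id (t : ℝ)).const_mul Real.pi).cos).const_mul Real.pi))
      convert! this using 1
      simp [secularI]; ring)
    (fun t => rfl)
  simpa using h

theorem primitive_secularI_one : primitive secularI 1 = 1 / Real.pi := by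
  have h := primitive_eq_of_hasDerivAt (F := secularI)
    (x' := fun t => Real.sin (Real.pi * t) / Real.pi ^ 2 - t * Real.cos (Real.pi * t) / Real.pi)
    (fun t => by
      have := ((((hasDerivAt_id (t : ℝ)).const_mul Real.pi).sin).div_const (Real.pi ^ 2)).sub
        (((hasDerivAt_id (t : ℝ)).mul
        ((((hasDerivAt_id (t : ℝ)).const_mul Real.pi).cos))).div_const Real.pi)
      convert! this using 1
      simp [secularI]; field_simp; ring) 1
  rw [h]
  simp [neg_div]

theorem isUnit_one_add_smul_primitive (c : ℝ) :
    IsUnit (1 + c • (primitive * primitive) :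
      C(unitInterval, ℝ) →L[ℝ] C(unitInterval, ℝ)) := by
  have := isUnit_one_add_primitive_primitive (E := ℝ) (M := |c|) (c • 1) fun f t => by
    simp
  convert this using 2
  ext f t
  simp

/-- A bordered operator. -/
def bordered (T : C(unitInterval, ℝ) →L[ℝ] C(unitInterval, ℝ)) (c : C(unitInterval, ℝ))
    (φ : C(unitInterval, ℝ) →L[ℝ] ℝ) (x : C(unitInterval, ℝ) × ℝ) : C(unitInterval, ℝ) × ℝ :=
  (T x.1 - x.2 • c, φ x.1)

/-- The first equation gives `x = T⁻¹ a + η d`, where `d` is the preimage of the border column. The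
remaining scalar equation then determines `η` because `φ d ≠ 0`. -/
theorem bordered_bijective {T : C(unitInterval, ℝ) →L[ℝ] C(unitInterval, ℝ)} (hT : IsUnit T)
    {c d : C(unitInterval, ℝ)} (hd : T d = c) {φ : C(unitInterval, ℝ) →L[ℝ] ℝ} (hφ : φ d ≠ 0) :
    Function.Bijective (bordered T c φ) := by
  obtain ⟨T, rfl⟩ := hT
  have hinv : ∀ x, (T⁻¹ : (C(unitInterval, ℝ) →L[ℝ] C(unitInterval, ℝ))ˣ).1 (T.1 x) = x :=
    fun x => congrArg (fun S => S x) T.inv_mul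
  have hinv' : ∀ x, T.1 ((T⁻¹ : (C(unitInterval, ℝ) →L[ℝ] C(unitInterval, ℝ))ˣ).1 x) = x :=
    fun x => congrArg (fun S => S x) T.mul_inv
  constructor
  · rintro ⟨x, η⟩ ⟨y, ζ⟩ h
    simp only [bordered, Prod.mk.injEq] at h
    have h1 : T.1 (x - η • d) = T.1 (y - ζ • d) := by
      simp [hd, h.1]
    have h2 : x - η • d = y - ζ • d := by rw [← hinv (x - η • d), h1, hinv]
    have h3 := congrArg φ h2
    simp only [map_sub, map_smul, h.2, smul_eq_mul, sub_right_inj] at h3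
    have h4 : η = ζ := mul_right_cancel₀ hφ h3
    subst h4
    simpa using h2
  · rintro ⟨a, α⟩
    set b := (T⁻¹ : (C(unitInterval, ℝ) →L[ℝ] C(unitInterval, ℝ))ˣ).1 a with hb
    refine ⟨(b + ((α - φ b) / φ d) • d, (α - φ b) / φ d), ?_⟩
    simp only [bordered, map_add, map_smul, hd, hb, hinv', add_sub_cancel_right, smul_eq_mul]
    rw [div_mul_cancel₀ _ hφ, add_sub_cancel]

/-- The space of unknowns `((X₀, y), (X_π, Λ))` of a Neumann problem. -/
abbrev NeumannSpace := (C(unitInterval, ℝ) × ℝ) × (C(unitInterval, ℝ) × ℝ)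

/-- The Neumann problem `X₀'' = -Λ f₀`, `X_π'' = -Λ f_π` with `X₀(0) = y`, `X_π(0) = 1`. -/
def neumannMap (f₀ fπ : ℝ × C(unitInterval, ℝ) × C(unitInterval, ℝ) → C(unitInterval, ℝ))
    (p : ℝ × NeumannSpace) : NeumannSpace :=
  ((p.2.1.1 - p.2.1.2 • 1 +
      p.2.2.2 • primitive (primitive (f₀ (p.1, p.2.1.1, p.2.2.1))),
    primitive (f₀ (p.1, p.2.1.1, p.2.2.1)) 1),
   (p.2.2.1 - 1 + p.2.2.2 • primitive (primitive (fπ (p.1, p.2.1.1, p.2.2.1))),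
    primitive (fπ (p.1, p.2.1.1, p.2.2.1)) 1))

/-- The solution of the linearized Neumann problem. -/
def neumannBase (l : ℝ) : NeumannSpace := ((0, 0), (cosI Real.pi, Real.pi ^ 2 / l))

theorem contDiff_eval {n : WithTop ℕ∞} (t : unitInterval) :
    ContDiff ℝ n fun u : C(unitInterval, ℝ) => u t :=
  (ContinuousMap.evalCLM ℝ t : C(unitInterval, ℝ) →L[ℝ] ℝ).contDiff

theorem contDiffAt_neumannMap
    {f₀ fπ : ℝ × C(unitInterval, ℝ) × C(unitInterval, ℝ) → C(unitInterval, ℝ)} {l : ℝ}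
    (hf₀ : ContDiffAt ℝ ω f₀ (0, 0, cosI Real.pi)) (hfπ : ContDiffAt ℝ ω fπ (0, 0, cosI Real.pi)) :
    ContDiffAt ℝ ω (neumannMap f₀ fπ) (0, neumannBase l) := by
  have hr : ContDiffAt ℝ ω (fun p : ℝ × NeumannSpace => (p.1, p.2.1.1, p.2.2.1))
      (0, neumannBase l) := by fun_prop
  have h0 : ContDiffAt ℝ ω (fun p : ℝ × NeumannSpace => f₀ (p.1, p.2.1.1, p.2.2.1))
      (0, neumannBase l) := hf₀.comp (0, neumannBase l) hr
  have hπ : ContDiffAt ℝ ω (fun p : ℝ × NeumannSpace => fπ (p.1, p.2.1.1, p.2.2.1))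
      (0, neumannBase l) := hfπ.comp (0, neumannBase l) hr
  unfold neumannMap
  have e : ContDiff ℝ ω fun u : C(unitInterval, ℝ) => u 1 := contDiff_eval 1
  refine ContDiffAt.prodMk (ContDiffAt.prodMk ?_ ?_) (ContDiffAt.prodMk ?_ ?_)
  · fun_prop
  · exact e.contDiffAt.comp (0, neumannBase l) (by fun_prop :
      ContDiffAt ℝ ω (fun p : ℝ × NeumannSpace => primitive (f₀ (p.1, p.2.1.1, p.2.2.1))) _)
  · fun_prop
  · exact e.contDiffAt.comp (0, neumannBase l) (by fun_prop :
      ContDiffAt ℝ ω (fun p : ℝ × NeumannSpace => primitive (fπ (p.1, p.2.1.1, p.2.2.1))) _)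

theorem neumannMap_base
    {f₀ fπ : ℝ × C(unitInterval, ℝ) × C(unitInterval, ℝ) → C(unitInterval, ℝ)} {l₀ l : ℝ}
    (hl : l ≠ 0)
    (h₀ : ∀ X, f₀ (0, X) = l₀ • X.1) (hπ : ∀ X, fπ (0, X) = l • X.2) :
    neumannMap f₀ fπ (0, neumannBase l) = 0 := by
  simp only [neumannMap, neumannBase, h₀, hπ]
  refine Prod.ext (Prod.ext ?_ ?_) (Prod.ext ?_ ?_)
  · simp
  · simp
  · ext t
    have := (hasAccel_cosI Real.pi).eq t
    simp at this ⊢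
    rw [this]
    field_simp
    ring
  · simp [primitive_cosI_one Real.pi_ne_zero]

/-- At the cosine solution the linearization is a product of two bordered Volterra operators. In the
in-phase block the border is the unknown initial value; the relevant direction is `cos θt`, with
integral `sin θ / θ`, nonzero by nonresonance. In the resonant out-of-phase block the border is the
unknown `Λ`; the direction is a multiple of `t sin πt`, with nonzero integral. -/
theorem isInvertible_fderiv_neumannMap
    {f₀ fπ : ℝ × C(unitInterval, ℝ) × C(unitInterval, ℝ) → C(unitInterval, ℝ)} {l₀ l : ℝ}
    (hl₀ : 0 < l₀) (hl : 0 < l) (hres : Real.sin (√(l₀ / l) * Real.pi) ≠ 0)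
    (hf₀ : ContDiffAt ℝ ω f₀ (0, 0, cosI Real.pi)) (hfπ : ContDiffAt ℝ ω fπ (0, 0, cosI Real.pi))
    (h₀ : ∀ X, f₀ (0, X) = l₀ • X.1) (hπ : ∀ X, fπ (0, X) = l • X.2) :
    (fderiv ℝ (neumannMap f₀ fπ) (0, neumannBase l) ∘L .inr ℝ ℝ NeumannSpace).IsInvertible := by
  have hd : HasFDerivAt (neumannMap f₀ fπ) (fderiv ℝ (neumannMap f₀ fπ) (0, neumannBase l))
      (0, neumannBase l) :=
    ((contDiffAt_neumannMap hf₀ hfπ).differentiableAt (by simp)).hasFDerivAt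
  have hd2 : HasFDerivAt (fun v => neumannMap f₀ fπ (0, v))
      (fderiv ℝ (neumannMap f₀ fπ) (0, neumannBase l) ∘L .inr ℝ ℝ NeumannSpace) (neumannBase l) :=
    hd.comp (neumannBase l) (hasFDerivAt_prodMk_right (0 : ℝ) (neumannBase l))
  set P : C(unitInterval, ℝ) →L[ℝ] C(unitInterval, ℝ) := primitive * primitive with hP
  set φ : C(unitInterval, ℝ) →L[ℝ] ℝ := (ContinuousMap.evalCLM ℝ 1) ∘L primitive with hφ
  have hX : HasFDerivAt (fun v : NeumannSpace => v.1.1)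
      ((ContinuousLinearMap.fst ℝ C(unitInterval, ℝ) ℝ) ∘L (ContinuousLinearMap.fst ℝ
        (C(unitInterval, ℝ) × ℝ) (C(unitInterval, ℝ) × ℝ))) (neumannBase l) :=
    HasFDerivAt.comp (neumannBase l) hasFDerivAt_fst hasFDerivAt_fst
  have hy : HasFDerivAt (fun v : NeumannSpace => v.1.2)
      ((ContinuousLinearMap.snd ℝ C(unitInterval, ℝ) ℝ) ∘L (ContinuousLinearMap.fst ℝ
        (C(unitInterval, ℝ) × ℝ) (C(unitInterval, ℝ) × ℝ))) (neumannBase l) :=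
    HasFDerivAt.comp (neumannBase l) hasFDerivAt_snd hasFDerivAt_fst
  have hY : HasFDerivAt (fun v : NeumannSpace => v.2.1)
      ((ContinuousLinearMap.fst ℝ C(unitInterval, ℝ) ℝ) ∘L (ContinuousLinearMap.snd ℝ
        (C(unitInterval, ℝ) × ℝ) (C(unitInterval, ℝ) × ℝ))) (neumannBase l) :=
    HasFDerivAt.comp (neumannBase l) hasFDerivAt_fst hasFDerivAt_snd
  have hΛ : HasFDerivAt (fun v : NeumannSpace => v.2.2)
      ((ContinuousLinearMap.snd ℝ C(unitInterval, ℝ) ℝ) ∘L (ContinuousLinearMap.snd ℝ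
        (C(unitInterval, ℝ) × ℝ) (C(unitInterval, ℝ) × ℝ))) (neumannBase l) :=
    HasFDerivAt.comp (neumannBase l) hasFDerivAt_snd hasFDerivAt_snd
  have hfun : (fun v => neumannMap f₀ fπ (0, v)) = fun v : NeumannSpace =>
      ((v.1.1 - v.1.2 • 1 + v.2.2 • P (l₀ • v.1.1), φ (l₀ • v.1.1)),
        (v.2.1 - 1 + v.2.2 • P (l • v.2.1), φ (l • v.2.1))) := by
    funext v
    simp only [neumannMap, h₀, hπ]
    rfl
  rw [hfun] at hd2
  have hd3 := (((hX.sub (hy.smul_const (1 : C(unitInterval, ℝ)))).add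
      (hΛ.smul ((P.hasFDerivAt).comp (neumannBase l) (hX.const_smul l₀)))).prodMk
      ((φ.hasFDerivAt).comp (neumannBase l) (hX.const_smul l₀))).prodMk
    (((hY.sub_const (1 : C(unitInterval, ℝ))).add
      (hΛ.smul ((P.hasFDerivAt).comp (neumannBase l) (hY.const_smul l)))).prodMk
      ((φ.hasFDerivAt).comp (neumannBase l) (hY.const_smul l)))
  have huniq := hd2.unique hd3
  set θ := √(l₀ / l) * Real.pi with hθ
  have hθ2 : θ ^ 2 = Real.pi ^ 2 / l * l₀ := by
    rw [hθ, mul_pow, Real.sq_sqrt (by positivity)]; ring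
  have hθ0 : θ ≠ 0 := by rw [hθ]; positivity
  -- The two blocks decouple: since `X₀ = 0` at the base point, varying `Λ` does not act on the
  -- in-phase equation. The factors `θ ^ 2` and `π ^ 2` are `Λ l₀` and `Λ l` at the base value of
  -- `Λ`.
  have happ : ∀ v : NeumannSpace,
      (fderiv ℝ (neumannMap f₀ fπ) (0, neumannBase l) ∘L .inr ℝ ℝ NeumannSpace) v =
      Prod.map (bordered (1 + θ ^ 2 • P) 1 (l₀ • φ))
        (bordered (1 + Real.pi ^ 2 • P) (-l • P (cosI Real.pi)) (l • φ)) v := by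
    intro v
    rw [huniq, hθ2]
    have hl' : l ≠ 0 := hl.ne'
    refine Prod.ext (Prod.ext ?_ ?_) (Prod.ext ?_ ?_)
    · ext t
      simp [bordered, neumannBase]
      ring
    · simp [bordered]
    · ext t
      simp [bordered, neumannBase]
      field_simp
      ring
    · simp [bordered]
  have hb0 : Function.Bijective (bordered (1 + θ ^ 2 • P) 1 (l₀ • φ)) := by
    refine bordered_bijective (isUnit_one_add_smul_primitive _) (d := cosI θ) ?_ ?_
    · ext t
      have := (hasAccel_cosI θ).eq t
      simp at this
      simp [this]
    · have : φ (cosI θ) = Real.sin θ / θ := primitive_cosI_one hθ0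
      simp only [_root_.smul_apply, smul_eq_mul, this]
      exact mul_ne_zero hl₀.ne' (div_ne_zero hres hθ0)
  have hbπ : Function.Bijective
      (bordered (1 + Real.pi ^ 2 • P) (-l • P (cosI Real.pi)) (l • φ)) := by
    refine bordered_bijective (isUnit_one_add_smul_primitive _)
      (d := (-l / (2 * Real.pi)) • secularI) ?_ ?_
    · ext t
      have := hasAccel_secularI.eq t
      simp at this
      have h0 : secularI 0 = 0 := by simp [secularI]
      rw [h0] at this
      have hpi := Real.pi_ne_zero
      simp [hP]
      linear_combination (norm := skip) (-l / (2 * Real.pi)) * this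
      field_simp
      ring
    · have : φ secularI = 1 / Real.pi := primitive_secularI_one
      simp only [_root_.smul_apply, smul_eq_mul, map_smul, this]
      exact mul_ne_zero (div_ne_zero (neg_ne_zero.2 hl.ne') (by positivity))
        (mul_ne_zero hl.ne' (by positivity))
  have hbij : Function.Bijective
      (fderiv ℝ (neumannMap f₀ fπ) (0, neumannBase l) ∘L .inr ℝ ℝ NeumannSpace) := by
    have := hb0.prodMap hbπ
    convert this using 1
    funext v
    exact happ v
  exact ⟨ContinuousLinearEquiv.ofBijective _ (LinearMap.ker_eq_bot.2 hbij.1)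
    (LinearMap.range_eq_top.2 hbij.2), ContinuousLinearEquiv.coe_ofBijective _ _ _⟩

/-- Nonresonant Neumann problems have a unique analytic branch of solutions. -/
theorem exists_neumann_branch
    {f₀ fπ : ℝ × C(unitInterval, ℝ) × C(unitInterval, ℝ) → C(unitInterval, ℝ)} {l₀ l : ℝ}
    (hl₀ : 0 < l₀) (hl : 0 < l) (hres : Real.sin (√(l₀ / l) * Real.pi) ≠ 0)
    (hf₀ : ContDiffAt ℝ ω f₀ (0, 0, cosI Real.pi)) (hfπ : ContDiffAt ℝ ω fπ (0, 0, cosI Real.pi))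
    (h₀ : ∀ X, f₀ (0, X) = l₀ • X.1) (hπ : ∀ X, fπ (0, X) = l • X.2) :
    ∃ ψ : ℝ → NeumannSpace, ContDiffAt ℝ ω ψ 0 ∧ ψ 0 = neumannBase l ∧
      (∀ᶠ r in 𝓝 0, neumannMap f₀ fπ (r, ψ r) = 0) ∧
      ∀ᶠ p in 𝓝 ((0 : ℝ), neumannBase l), neumannMap f₀ fπ p = 0 → ψ p.1 = p.2 := by
  have hc := contDiffAt_neumannMap (l := l) hf₀ hfπ
  have hi := isInvertible_fderiv_neumannMap hl₀ hl hres hf₀ hfπ h₀ hπ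
  have hb := neumannMap_base hl.ne' h₀ hπ
  refine ⟨hc.implicitFunction (by simp) hi, hc.contDiffAt_implicitFunction (by simp) hi,
    hc.implicitFunction_apply_self (by simp) hi, ?_, ?_⟩
  · have := hc.eventually_apply_implicitFunction (by simp) hi
    simpa only [hb] using this
  · have := hc.eventually_apply_eq_iff_implicitFunction (by simp) hi
    rw [hb] at this
    exact this.mono fun p hp => hp.1

/-- Half a period of an oscillation: `X₀` and `X_π` have vanishing velocities at both ends. -/
structure IsNeumannSol
    (f₀ fπ : ℝ × C(unitInterval, ℝ) × C(unitInterval, ℝ) → C(unitInterval, ℝ))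
    (r : ℝ) (X₀ Xπ : C(unitInterval, ℝ)) (Λ : ℝ) : Prop where
  normalized : Xπ 0 = 1
  accel_zero : HasAccel X₀ 0 (-Λ • f₀ (r, X₀, Xπ))
  accel_pi : HasAccel Xπ 0 (-Λ • fπ (r, X₀, Xπ))
  velocity_zero : primitive (f₀ (r, X₀, Xπ)) 1 = 0
  velocity_pi : primitive (fπ (r, X₀, Xπ)) 1 = 0

/-- Both integral terms vanish at `t = 0`. There the two integral equations reduce to the
normalization `X_π(0) = 1` and to the fact that the auxiliary unknown is `X₀(0)`. -/
theorem isNeumannSol_iff {f₀ fπ : ℝ × C(unitInterval, ℝ) × C(unitInterval, ℝ) → C(unitInterval, ℝ)}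
    {r : ℝ} {X₀ Xπ : C(unitInterval, ℝ)} {Λ : ℝ} :
    IsNeumannSol f₀ fπ r X₀ Xπ Λ ↔ neumannMap f₀ fπ (r, ((X₀, X₀ 0), (Xπ, Λ))) = 0 := by
  constructor
  · intro h
    refine Prod.ext (Prod.ext ?_ h.velocity_zero) (Prod.ext ?_ h.velocity_pi)
    · ext t
      have := h.accel_zero.eq t
      simp [neumannMap] at this ⊢
      rw [this]; ring
    · ext t
      have := h.accel_pi.eq t
      simp [neumannMap, h.normalized] at this ⊢
      rw [this]; ring
  · intro h
    simp only [neumannMap, Prod.ext_iff, Prod.fst_zero, Prod.snd_zero] at h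
    obtain ⟨⟨h1, h2⟩, h3, h4⟩ := h
    have h5 : ∀ t, X₀ t - X₀ 0 + Λ * primitive (primitive (f₀ (r, X₀, Xπ))) t = 0 :=
      fun t => by simpa using congrArg (fun u : C(unitInterval, ℝ) => u t) h1
    have h6 : ∀ t, Xπ t - 1 + Λ * primitive (primitive (fπ (r, X₀, Xπ))) t = 0 :=
      fun t => by simpa using congrArg (fun u : C(unitInterval, ℝ) => u t) h3
    have h7 : Xπ 0 = 1 := by
      have := h6 0
      rw [primitive_zero] at this
      linarith
    refine ⟨h7, fun t => ?_, fun t => ?_, h2, h4⟩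
    · have := h5 t
      simp
      linarith
    · have := h6 t
      simp [h7]
      linarith

/-- An analytic branch of solutions, parametrized by the amplitude, which contains all solutions
close to the linear oscillation. -/
structure IsNeumannBranch
    (f₀ fπ : ℝ × C(unitInterval, ℝ) × C(unitInterval, ℝ) → C(unitInterval, ℝ)) (l : ℝ)
    (X₀ Xπ : ℝ → C(unitInterval, ℝ)) (Λ : ℝ → ℝ) : Prop where
  contDiffAt_zero : ContDiffAt ℝ ω X₀ 0
  contDiffAt_pi : ContDiffAt ℝ ω Xπ 0
  contDiffAt_time : ContDiffAt ℝ ω Λ 0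
  zero_zero : X₀ 0 = 0
  pi_zero : Xπ 0 = cosI Real.pi
  time_zero : Λ 0 = Real.pi ^ 2 / l
  sol : ∀ᶠ r in 𝓝 0, IsNeumannSol f₀ fπ r (X₀ r) (Xπ r) (Λ r)
  unique : ∀ᶠ p : ℝ × (C(unitInterval, ℝ) × C(unitInterval, ℝ)) × ℝ in
    𝓝 (0, (0, cosI Real.pi), Real.pi ^ 2 / l),
    IsNeumannSol f₀ fπ p.1 p.2.1.1 p.2.1.2 p.2.2 →
      p.2.1.1 = X₀ p.1 ∧ p.2.1.2 = Xπ p.1 ∧ p.2.2 = Λ p.1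

theorem exists_isNeumannBranch
    {f₀ fπ : ℝ × C(unitInterval, ℝ) × C(unitInterval, ℝ) → C(unitInterval, ℝ)} {l₀ l : ℝ}
    (hl₀ : 0 < l₀) (hl : 0 < l) (hres : Real.sin (√(l₀ / l) * Real.pi) ≠ 0)
    (hf₀ : ContDiffAt ℝ ω f₀ (0, 0, cosI Real.pi)) (hfπ : ContDiffAt ℝ ω fπ (0, 0, cosI Real.pi))
    (h₀ : ∀ X, f₀ (0, X) = l₀ • X.1) (hπ : ∀ X, fπ (0, X) = l • X.2) :
    ∃ X₀ Xπ Λ, IsNeumannBranch f₀ fπ l X₀ Xπ Λ := by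
  obtain ⟨ψ, hψ, hψ0, hsol, huniq⟩ := exists_neumann_branch hl₀ hl hres hf₀ hfπ h₀ hπ
  refine ⟨fun r => (ψ r).1.1, fun r => (ψ r).2.1, fun r => (ψ r).2.2, by fun_prop, by fun_prop,
    by fun_prop, by simp [hψ0, neumannBase], by simp [hψ0, neumannBase],
    by simp [hψ0, neumannBase], ?_, ?_⟩
  · filter_upwards [hsol] with r hr
    have hy : (ψ r).1.2 = (ψ r).1.1 0 := by
      have h1 := congrArg (fun u : NeumannSpace => u.1.1 0) hr
      simp only [neumannMap] at h1
      simp [primitive_zero] at h1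
      linarith
    rw [isNeumannSol_iff]
    convert hr using 3
    exact Prod.ext (Prod.ext rfl hy.symm) rfl
  · have hc : ContinuousAt (fun p : ℝ × (C(unitInterval, ℝ) × C(unitInterval, ℝ)) × ℝ =>
        (p.1, (((p.2.1.1, p.2.1.1 0), (p.2.1.2, p.2.2)) : NeumannSpace)))
        (0, (0, cosI Real.pi), Real.pi ^ 2 / l) := by
      have : Continuous fun u : C(unitInterval, ℝ) => u 0 := (contDiff_eval (n := 0) 0).continuous
      fun_prop
    have := hc.eventually (p := fun p => neumannMap f₀ fπ p = 0 → ψ p.1 = p.2)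
      (by simpa [neumannBase] using huniq)
    filter_upwards [this] with p hp hs
    have h : ψ p.1 = ((p.2.1.1, p.2.1.1 0), (p.2.1.2, p.2.2)) := hp (isNeumannSol_iff.1 hs)
    simp only [h, and_self]

end Neumann

end

noncomputable section

/-! ### The branch of out-of-phase modes -/

section Dimer

open scoped ContDiff

/-- The rescaled in-phase force. -/
def dimerForceZero (V : ℝ → ℝ) (p : ℝ × C(unitInterval, ℝ) × C(unitInterval, ℝ)) :
    C(unitInterval, ℝ) :=
  (1 / 2 : ℝ) • ((p.2.1 + p.2.2) * nem (forceQuot V) (p.1 • (p.2.1 + p.2.2)) +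
    (p.2.1 - p.2.2) * nem (forceQuot V) (p.1 • (p.2.1 - p.2.2)))

/-- The rescaled out-of-phase force. -/
def dimerForcePi (V W : ℝ → ℝ) (p : ℝ × C(unitInterval, ℝ) × C(unitInterval, ℝ)) :
    C(unitInterval, ℝ) :=
  (1 / 2 : ℝ) • ((p.2.1 + p.2.2) * nem (forceQuot V) (p.1 • (p.2.1 + p.2.2)) -
    (p.2.1 - p.2.2) * nem (forceQuot V) (p.1 • (p.2.1 - p.2.2))) +
    (2 : ℝ) • (p.2.2 * (nem (forceQuot W) (p.1 • ((2 : ℝ) • p.2.2)) +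
      nem (forceQuot W) (p.1 • (-(2 : ℝ) • p.2.2))))

/-- The scalar factor vanishes at the base point, so only the germ of `g` at `0` matters, however
large the profile `u` is. -/
theorem contDiffAt_nem_smul {E : Type*} [NormedAddCommGroup E] [NormedSpace ℝ E] {g : ℝ → ℝ}
    (hg : AnalyticAt ℝ g 0) {c : E → ℝ} {u : E → C(unitInterval, ℝ)} {p : E}
    (hc : ContDiffAt ℝ ω c p) (hu : ContDiffAt ℝ ω u p) (h0 : c p = 0) :
    ContDiffAt ℝ ω (fun x => nem g (c x • u x)) p := by
  have h1 : ContDiffAt ℝ ω (fun x => c x • u x) p := hc.smul hu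
  have h2 : ContDiffAt ℝ ω (nem g) (c p • u p) := by
    rw [h0, zero_smul]
    exact (exists_analyticAt_nem hg).1.contDiffAt
  exact h2.comp p h1

theorem eventually_nem_smul_apply {E : Type*} [TopologicalSpace E] {g : ℝ → ℝ}
    (hg : AnalyticAt ℝ g 0) {c : E → ℝ} {u : E → C(unitInterval, ℝ)} {p : E}
    (hc : ContinuousAt c p) (hu : ContinuousAt u p) (h0 : c p = 0) :
    ∀ᶠ x in 𝓝 p, ∀ t, nem g (c x • u x) t = g (c x * u x t) := by
  have h1 : ContinuousAt (fun x => c x • u x) p := hc.smul hu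
  have h2 := (exists_analyticAt_nem hg).2
  have h3 : Tendsto (fun x => c x • u x) (𝓝 p) (𝓝 0) := by
    have := h1.tendsto
    rwa [h0, zero_smul] at this
  exact h3.eventually h2

theorem nem_zero (g : ℝ → ℝ) : nem g 0 = g 0 • 1 :=
  nem_eq_of_forall fun t => by simp

theorem contDiffAt_dimerForceZero {V : ℝ → ℝ} (hV : IsPotential V)
    (X : C(unitInterval, ℝ) × C(unitInterval, ℝ)) :
    ContDiffAt ℝ ω (dimerForceZero V) (0, X) := by
  unfold dimerForceZero
  have h1 : ContDiffAt ℝ ω (fun p : ℝ × C(unitInterval, ℝ) × C(unitInterval, ℝ) =>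
      nem (forceQuot V) (p.1 • (p.2.1 + p.2.2))) (0, X) :=
    contDiffAt_nem_smul hV.analyticAt_forceQuot (by fun_prop) (by fun_prop) rfl
  have h2 : ContDiffAt ℝ ω (fun p : ℝ × C(unitInterval, ℝ) × C(unitInterval, ℝ) =>
      nem (forceQuot V) (p.1 • (p.2.1 - p.2.2))) (0, X) :=
    contDiffAt_nem_smul hV.analyticAt_forceQuot (by fun_prop) (by fun_prop) rfl
  fun_prop

theorem contDiffAt_dimerForcePi {V W : ℝ → ℝ} (hV : IsPotential V) (hW : IsPotential W)
    (X : C(unitInterval, ℝ) × C(unitInterval, ℝ)) :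
    ContDiffAt ℝ ω (dimerForcePi V W) (0, X) := by
  unfold dimerForcePi
  have h1 : ContDiffAt ℝ ω (fun p : ℝ × C(unitInterval, ℝ) × C(unitInterval, ℝ) =>
      nem (forceQuot V) (p.1 • (p.2.1 + p.2.2))) (0, X) :=
    contDiffAt_nem_smul hV.analyticAt_forceQuot (by fun_prop) (by fun_prop) rfl
  have h2 : ContDiffAt ℝ ω (fun p : ℝ × C(unitInterval, ℝ) × C(unitInterval, ℝ) =>
      nem (forceQuot V) (p.1 • (p.2.1 - p.2.2))) (0, X) :=
    contDiffAt_nem_smul hV.analyticAt_forceQuot (by fun_prop) (by fun_prop) rfl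
  have h3 : ContDiffAt ℝ ω (fun p : ℝ × C(unitInterval, ℝ) × C(unitInterval, ℝ) =>
      nem (forceQuot W) (p.1 • ((2 : ℝ) • p.2.2))) (0, X) :=
    contDiffAt_nem_smul hW.analyticAt_forceQuot (by fun_prop) (by fun_prop) rfl
  have h4 : ContDiffAt ℝ ω (fun p : ℝ × C(unitInterval, ℝ) × C(unitInterval, ℝ) =>
      nem (forceQuot W) (p.1 • (-(2 : ℝ) • p.2.2))) (0, X) :=
    contDiffAt_nem_smul hW.analyticAt_forceQuot (by fun_prop) (by fun_prop) rfl
  fun_prop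

theorem dimerForceZero_zero {V : ℝ → ℝ} (hV : IsPotential V)
    (X : C(unitInterval, ℝ) × C(unitInterval, ℝ)) :
    dimerForceZero V (0, X) = potentialCoeff V 2 • X.1 := by
  ext t
  simp [dimerForceZero, nem_zero, hV.forceQuot_zero]
  ring

theorem dimerForcePi_zero {V W : ℝ → ℝ} (hV : IsPotential V) (hW : IsPotential W)
    (X : C(unitInterval, ℝ) × C(unitInterval, ℝ)) :
    dimerForcePi V W (0, X) = piFreqSq V W • X.2 := by
  ext t
  simp [dimerForcePi, nem_zero, hV.forceQuot_zero, hW.forceQuot_zero, piFreqSq]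
  ring

theorem piFreqSq_pos {V W : ℝ → ℝ} (hV : IsPotential V) (hW : IsPotential W) :
    0 < piFreqSq V W := by
  have := hV.coeff_two_pos
  have := hW.coeff_two_pos
  rw [piFreqSq]; linarith

/-- The phase advanced by the in-phase linear mode in half a period of the out-of-phase mode. -/
def inPhaseAngle (V W : ℝ → ℝ) : ℝ := √(potentialCoeff V 2 / piFreqSq V W) * Real.pi

theorem inPhaseAngle_pos {V W : ℝ → ℝ} (hV : IsPotential V) (hW : IsPotential W) :
    0 < inPhaseAngle V W :=
  mul_pos (Real.sqrt_pos.2 (div_pos hV.coeff_two_pos (piFreqSq_pos hV hW))) Real.pi_pos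

theorem inPhaseAngle_lt_pi {V W : ℝ → ℝ} (hV : IsPotential V) (hW : IsPotential W) :
    inPhaseAngle V W < Real.pi := by
  have h : √(potentialCoeff V 2 / piFreqSq V W) < 1 := by
    rw [Real.sqrt_lt' one_pos, one_pow, div_lt_one (piFreqSq_pos hV hW), piFreqSq]
    linarith [hW.coeff_two_pos]
  calc _ < 1 * Real.pi := mul_lt_mul_of_pos_right h Real.pi_pos
    _ = _ := one_mul _

/-- This is the nonresonance condition of the Neumann problem. It holds automatically: `φ₂ > 0` puts
the in-phase frequency strictly below the out-of-phase one. -/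
theorem sin_inPhaseAngle_pos {V W : ℝ → ℝ} (hV : IsPotential V) (hW : IsPotential W) :
    0 < Real.sin (inPhaseAngle V W) :=
  Real.sin_pos_of_pos_of_lt_pi (inPhaseAngle_pos hV hW) (inPhaseAngle_lt_pi hV hW)

/-- Branches of out-of-phase modes. -/
abbrev IsModeBranch (V W : ℝ → ℝ) (X₀ Xπ : ℝ → C(unitInterval, ℝ)) (Λ : ℝ → ℝ) : Prop :=
  IsNeumannBranch (dimerForceZero V) (dimerForcePi V W) (piFreqSq V W) X₀ Xπ Λ

theorem exists_isModeBranch {V W : ℝ → ℝ} (hV : IsPotential V) (hW : IsPotential W) :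
    ∃ X₀ Xπ Λ, IsModeBranch V W X₀ Xπ Λ :=
  exists_isNeumannBranch hV.coeff_two_pos (piFreqSq_pos hV hW) (sin_inPhaseAngle_pos hV hW).ne'
    (contDiffAt_dimerForceZero hV _) (contDiffAt_dimerForcePi hV hW _) (dimerForceZero_zero hV)
    (dimerForcePi_zero hV hW)

/-- The rescaled force of a single oscillator. -/
def onsiteForce (V : ℝ → ℝ) (p : ℝ × C(unitInterval, ℝ) × C(unitInterval, ℝ)) :
    C(unitInterval, ℝ) := p.2.2 * nem (forceQuot V) (p.1 • p.2.2)

/-- Branches of oscillations of a single particle. The first component is a decoupled harmonic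
oscillator. -/
abbrev IsOnsiteBranch (V : ℝ → ℝ) (X₀ X : ℝ → C(unitInterval, ℝ)) (Λ : ℝ → ℝ) : Prop :=
  IsNeumannBranch (fun p => (potentialCoeff V 2 / 4) • p.2.1) (onsiteForce V) (potentialCoeff V 2)
    X₀ X Λ

/-- The two-component theory is reused with a decoupled harmonic oscillator of squared frequency `v₂
/ 4`. It advances its phase by `π / 2` in half a period, hence is nonresonant. -/
theorem exists_isOnsiteBranch {V : ℝ → ℝ} (hV : IsPotential V) :
    ∃ X₀ X Λ, IsOnsiteBranch V X₀ X Λ := by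
  have h2 := hV.coeff_two_pos
  refine exists_isNeumannBranch (l₀ := potentialCoeff V 2 / 4) (by positivity) h2 ?_
    (by fun_prop) ?_ (fun X => rfl) ?_
  · have : √(potentialCoeff V 2 / 4 / potentialCoeff V 2) = 1 / 2 := by
      rw [show potentialCoeff V 2 / 4 / potentialCoeff V 2 = (1 / 2) ^ 2 by field_simp; norm_num]
      exact Real.sqrt_sq (by norm_num)
    rw [this, show (1 / 2 : ℝ) * Real.pi = Real.pi / 2 by ring, Real.sin_pi_div_two]
    exact one_ne_zero
  · unfold onsiteForce
    have h1 : ContDiffAt ℝ ω (fun p : ℝ × C(unitInterval, ℝ) × C(unitInterval, ℝ) =>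
        nem (forceQuot V) (p.1 • p.2.2)) (0, 0, cosI Real.pi) :=
      contDiffAt_nem_smul hV.analyticAt_forceQuot (by fun_prop) (by fun_prop) rfl
    fun_prop
  · intro X
    ext t
    simp [onsiteForce, nem_zero, hV.forceQuot_zero]

end Dimer

end

noncomputable section

/-! ### Half periods and periodic solutions -/

section Periodic

theorem foldI_mem (t : ℝ) : Real.arccos (Real.cos (Real.pi * t)) / Real.pi ∈ Set.Icc (0 : ℝ) 1 :=
  ⟨div_nonneg (Real.arccos_nonneg _) Real.pi_pos.le,
    (div_le_one Real.pi_pos).2 (Real.arccos_le_pi _)⟩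

/-- The even `2`-periodic retraction of the line onto the unit interval. -/
def foldI (t : ℝ) : unitInterval := ⟨Real.arccos (Real.cos (Real.pi * t)) / Real.pi, foldI_mem t⟩

theorem continuous_foldI : Continuous foldI := by
  unfold foldI
  fun_prop

theorem foldI_coe (t : unitInterval) : foldI t = t := by
  apply Subtype.ext
  have h : Real.arccos (Real.cos (Real.pi * t)) = Real.pi * t :=
    Real.arccos_cos (mul_nonneg Real.pi_pos.le t.2.1)
      (mul_le_of_le_one_right Real.pi_pos.le t.2.2)
  simp [foldI, h, Real.pi_ne_zero]

theorem foldI_neg (t : ℝ) : foldI (-t) = foldI t := by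
  apply Subtype.ext
  simp [foldI]

theorem foldI_add_two (t : ℝ) : foldI (t + 2) = foldI t := by
  apply Subtype.ext
  simp [foldI, mul_add, mul_comm Real.pi 2]

theorem foldI_zero : foldI 0 = 0 := by
  simpa using foldI_coe 0

theorem eq_of_even_of_periodic {E : Type*} {x y : ℝ → E}
    (hx : Function.Even x) (hy : Function.Even y) (hx2 : Function.Periodic x 2)
    (hy2 : Function.Periodic y 2) (h : ∀ t : unitInterval, x t = y t) : x = y := by
  have hp : Function.Periodic (fun t => (x t, y t)) 2 := fun t => by simp [hx2 t, hy2 t]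
  funext t
  obtain ⟨s, hs, hst⟩ := hp.exists_mem_Ico two_pos t (-1)
  simp only [Prod.mk.injEq] at hst
  rw [hst.1, hst.2]
  rcases le_total 0 s with h0 | h0
  · exact h ⟨s, h0, by linarith [hs.2]⟩
  · rw [← hx s, ← hy s]
    exact h ⟨-s, by linarith, by linarith [hs.1]⟩

theorem deriv_neg_of_even {x : ℝ → ℝ} (hx : Function.Even x) (t : ℝ) :
    deriv x (-t) = -deriv x t := by
  have h : (fun s => x (-s)) = x := funext hx
  have := deriv_comp_neg x t
  rw [h] at this
  rw [this, neg_neg]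

theorem deriv_zero_of_even {x : ℝ → ℝ} (hx : Function.Even x) : deriv x 0 = 0 := by
  have := deriv_neg_of_even hx 0
  rw [neg_zero] at this
  linarith

theorem deriv_half_period {x : ℝ → ℝ} {h : ℝ} (hx : Function.Even x)
    (hp : Function.Periodic x (2 * h)) : deriv x h = 0 := by
  have h1 := deriv_neg_of_even hx h
  have h2 : deriv x (-h + 2 * h) = deriv x (-h) := by
    have : (fun s => x (s + 2 * h)) = x := funext hp
    rw [← deriv_comp_add_const, this]
  rw [show -h + 2 * h = h by ring] at h2
  linarith

/-- Zero velocity at both ends lets the solution be continued by reflections. The primitive `G` of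
the folded acceleration is odd and vanishes at `1`, hence is `2`-periodic. Its own primitive is
therefore even and `2`-periodic, and agrees with `X` on the unit interval. -/
theorem HasAccel.hasSecondDeriv_foldI {X F : C(unitInterval, ℝ)} (hX : HasAccel X 0 F)
    (hF : primitive F 1 = 0) :
    HasSecondDeriv (fun t => X (foldI t)) fun t => F (foldI t) := by
  have hFc : Continuous fun t => F (foldI t) := F.continuous.comp continuous_foldI
  set G : ℝ → ℝ := fun t => ∫ s in (0 : ℝ)..t, F (foldI s) with hG
  have hGd : ∀ t, HasDerivAt G (F (foldI t)) t := fun t =>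
    (hFc.integral_hasStrictDerivAt 0 t).hasDerivAt
  have hGc : Continuous G := continuous_iff_continuousAt.2 fun t => (hGd t).continuousAt
  set y : ℝ → ℝ := fun t => X 0 + ∫ s in (0 : ℝ)..t, G s with hy
  have hyd : ∀ t, HasDerivAt y (G t) t := fun t =>
    (hGc.integral_hasStrictDerivAt 0 t).hasDerivAt.const_add _
  have const_of : ∀ z : ℝ → ℝ, (∀ t, HasDerivAt z 0 t) → ∀ t s, z t = z s := fun z hz t s =>
    is_const_of_deriv_eq_zero (fun t => (hz t).differentiableAt) (fun t => (hz t).deriv) t s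
  have hG0 : G 0 = 0 := by simp [hG]
  have hG1 : G 1 = 0 := by
    rw [← hF, primitive_one, hG]
    refine intervalIntegral.integral_congr fun s hs => ?_
    rw [Set.uIcc_of_le zero_le_one] at hs
    rw [extendI_of_mem F hs]
    exact congrArg F (foldI_coe ⟨s, hs⟩)
  have hGodd : ∀ t, G (-t) = -G t := by
    intro t
    have h := const_of (fun t => G (-t) + G t) (fun t => by
      have h1 := (hGd (-t)).comp t (hasDerivAt_neg t)
      convert! h1.add (hGd t) using 1
      rw [foldI_neg]; ring) t 0
    simp only [neg_zero, hG0] at h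
    linarith
  have hGper : ∀ t, G (t + 2) = G t := by
    intro t
    have h := const_of (fun t => G (t + 2) - G t) (fun t => by
      have h1 := (hGd (t + 2)).comp_add_const t 2
      convert! h1.sub (hGd t) using 1
      rw [foldI_add_two]; ring) t (-1)
    rw [show (-1 : ℝ) + 2 = 1 by norm_num, hGodd, hG1] at h
    linarith
  have hyeven : Function.Even y := by
    intro t
    have h := const_of (fun t => y (-t) - y t) (fun t => by
      have h1 := (hyd (-t)).comp t (hasDerivAt_neg t)
      convert! h1.sub (hyd t) using 1
      rw [hGodd]; ring) t 0
    rw [neg_zero, sub_self] at h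
    linarith
  have hyper : Function.Periodic y 2 := by
    intro t
    have h := const_of (fun t => y (t + 2) - y t) (fun t => by
      have h1 := (hyd (t + 2)).comp_add_const t 2
      convert! h1.sub (hyd t) using 1
      rw [hGper]; ring) t (-1)
    rw [show (-1 : ℝ) + 2 = 1 by norm_num, hyeven, sub_self] at h
    linarith
  have hyX : y = fun t => X (foldI t) := by
    refine eq_of_even_of_periodic hyeven (fun t => by rw [foldI_neg]) hyper
      (fun t => by rw [foldI_add_two]) fun t => ?_
    have h2 := hasAccel_of_hasDerivAt (f := ⟨fun t : unitInterval => y t, by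
      have : Continuous y := continuous_iff_continuousAt.2 fun t => (hyd t).continuousAt
      fun_prop⟩) (F := F) (fun t => hyd t) (fun t => by
        have := hGd t
        rwa [foldI_coe] at this) (fun t => rfl) t
    have hy0 : y 0 = X 0 := by simp [hy]
    simp only [ContinuousMap.coe_mk, hG0, Set.Icc.coe_zero, hy0] at h2
    rw [h2, foldI_coe, hX t]
  rw [← hyX]
  refine ⟨fun t => (hyd t).differentiableAt, fun t => ?_⟩
  have : deriv y = G := funext fun t => (hyd t).deriv
  rw [this]
  exact hGd t

theorem HasSecondDeriv.congr {x f g : ℝ → ℝ} (h : HasSecondDeriv x f) (hfg : ∀ t, f t = g t) :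
    HasSecondDeriv x g := ⟨h.1, fun t => hfg t ▸ h.2 t⟩

theorem HasSecondDeriv.add {x y f g : ℝ → ℝ} (hx : HasSecondDeriv x f) (hy : HasSecondDeriv y g) :
    HasSecondDeriv (fun t => x t + y t) fun t => f t + g t := by
  refine ⟨hx.1.add hy.1, fun t => ?_⟩
  have : deriv (fun t => x t + y t) = fun t => deriv x t + deriv y t :=
    funext fun t => deriv_add (hx.1 t) (hy.1 t)
  rw [this]
  exact (hx.2 t).add (hy.2 t)

theorem HasSecondDeriv.const_mul {x f : ℝ → ℝ} (hx : HasSecondDeriv x f) (c : ℝ) :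
    HasSecondDeriv (fun t => c * x t) fun t => c * f t := by
  refine ⟨hx.1.const_mul c, fun t => ?_⟩
  have : deriv (fun t => c * x t) = fun t => c * deriv x t :=
    funext fun t => deriv_const_mul c (hx.1 t)
  rw [this]
  exact (hx.2 t).const_mul c

theorem HasSecondDeriv.comp_mul {x f : ℝ → ℝ} (hx : HasSecondDeriv x f) (c : ℝ) :
    HasSecondDeriv (fun t => x (c * t)) fun t => c ^ 2 * f (c * t) := by
  have h1 : ∀ t, HasDerivAt (fun t => x (c * t)) (c * deriv x (c * t)) t := fun t => by
    have := (hx.1 (c * t)).hasDerivAt.comp t ((hasDerivAt_id t).const_mul c)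
    convert! this using 1
    simp; ring
  refine ⟨fun t => (h1 t).differentiableAt, fun t => ?_⟩
  rw [funext fun t => (h1 t).deriv]
  have := ((hx.2 (c * t)).comp t ((hasDerivAt_id t).const_mul c)).const_mul c
  convert! this using 1
  simp; ring

/-- Restriction of a second order equation to half a period. -/
theorem HasSecondDeriv.hasAccel {x f : ℝ → ℝ} (hx : HasSecondDeriv x f) {X F : C(unitInterval, ℝ)}
    (hX : ∀ t : unitInterval, X t = x t) (hF : ∀ t : unitInterval, F t = f t) :
    HasAccel X (deriv x 0) F ∧ primitive F 1 = deriv x 1 - deriv x 0 := by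
  have h : ∀ t : unitInterval, HasDerivAt (deriv x) (F t) t := fun t => hF t ▸ hx.2 t
  refine ⟨hasAccel_of_hasDerivAt (fun t => (hx.1 t).hasDerivAt) h hX, ?_⟩
  simpa using primitive_eq_of_hasDerivAt h 1

/-- The energy per site of the configuration `Q₀ + (-1)^n Q_π`. -/
def dimerEnergy (V W : ℝ → ℝ) (Q₀ Qπ : ℝ → ℝ) (t : ℝ) : ℝ :=
  (deriv Q₀ t ^ 2 + deriv Qπ t ^ 2) / 2 + (V (Q₀ t + Qπ t) + V (Q₀ t - Qπ t)) / 2 +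
    (W (2 * Qπ t) + W (-(2 * Qπ t))) / 2

theorem latticeEnergy_dimer {V W : ℝ → ℝ} {Q₀ Qπ : ℝ → ℝ} (h₀ : Differentiable ℝ Q₀)
    (hπ : Differentiable ℝ Qπ) {N : ℕ} (hN : Even N) (t : ℝ) :
    latticeEnergy V W N (dimer Q₀ Qπ) t = N * dimerEnergy V W Q₀ Qπ t := by
  obtain ⟨m, rfl⟩ := hN
  have hd : ∀ n : ℤ, deriv (dimer Q₀ Qπ n) t = deriv Q₀ t + (-1) ^ n * deriv Qπ t := fun n =>
    ((h₀ t).hasDerivAt.add ((hπ t).hasDerivAt.const_mul _)).deriv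
  induction m with
  | zero => simp [latticeEnergy]
  | succ m ih =>
    rw [latticeEnergy] at ih ⊢
    rw [show m + 1 + (m + 1) = (m + m) + 1 + 1 by ring, Finset.sum_range_succ,
      Finset.sum_range_succ, ih]
    have e1 : ((-1 : ℝ)) ^ ((m + m : ℕ) : ℤ) = 1 := by
      rw [zpow_natCast]; exact Even.neg_one_pow ⟨m, rfl⟩
    have e2 : ((-1 : ℝ)) ^ (((m + m : ℕ) : ℤ) + 1) = -1 := by
      rw [zpow_add_one₀ (by norm_num), e1]; norm_num
    have e3 : ((-1 : ℝ)) ^ (((m + m : ℕ) : ℤ) + 1 + 1) = 1 := by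
      rw [zpow_add_one₀ (by norm_num), e2]; norm_num
    rw [show ((m + m + 1 : ℕ) : ℤ) = ((m + m : ℕ) : ℤ) + 1 by push_cast; rfl, hd, hd]
    simp only [dimer, e1, e2, e3, dimerEnergy]
    rw [show Q₀ t + -1 * Qπ t - (Q₀ t + 1 * Qπ t) = -(2 * Qπ t) by ring,
      show Q₀ t + 1 * Qπ t - (Q₀ t + -1 * Qπ t) = 2 * Qπ t by ring,
      show Q₀ t + -1 * Qπ t = Q₀ t - Qπ t by ring, show Q₀ t + 1 * Qπ t = Q₀ t + Qπ t by ring]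
    push_cast
    ring

/-- Equations of motion of the configuration `Q₀ + (-1)^n Q_π`. -/
theorem isLatticeSolution_dimer_iff {V W : ℝ → ℝ} {Q₀ Qπ : ℝ → ℝ} :
    IsLatticeSolution V W (dimer Q₀ Qπ) ↔
      (HasSecondDeriv Q₀ fun t =>
        -((1 / 2) * (deriv V (Q₀ t + Qπ t) + deriv V (Q₀ t - Qπ t)))) ∧
      HasSecondDeriv Qπ fun t =>
        -((1 / 2) * (deriv V (Q₀ t + Qπ t) - deriv V (Q₀ t - Qπ t)) +
          (deriv W (2 * Qπ t) - deriv W (-(2 * Qπ t)))) := by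
  constructor
  · intro h
    have ha := h 0
    have hb := h 1
    simp only [dimer, zero_sub, zero_add, sub_self, zpow_zero, zpow_one, zpow_neg,
      show (1 : ℤ) + 1 = 2 by norm_num, show ((-1 : ℝ)) ^ (2 : ℤ) = 1 by norm_num,
      show ((-1 : ℝ))⁻¹ = -1 by norm_num, one_mul, neg_one_mul] at ha hb
    have e1 : ∀ t, Q₀ t + Qπ t - (Q₀ t + -Qπ t) = 2 * Qπ t := fun t => by ring
    have e2 : ∀ t, Q₀ t + -Qπ t - (Q₀ t + Qπ t) = -(2 * Qπ t) := fun t => by ring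
    simp only [e1, e2] at ha hb
    simp only [← sub_eq_add_neg] at ha hb
    constructor
    · have := (ha.add hb).const_mul (1 / 2)
      have hx : (fun t => 1 / 2 * (dimer Q₀ Qπ 0 t + dimer Q₀ Qπ 1 t)) = Q₀ := by
        funext t; simp [dimer]; ring
      rw [hx] at this
      exact this.congr fun t => by ring
    · have := (ha.add (hb.const_mul (-1))).const_mul (1 / 2)
      have hx : (fun t => 1 / 2 * (dimer Q₀ Qπ 0 t + -1 * dimer Q₀ Qπ 1 t)) = Qπ := by
        funext t; simp [dimer]; ring
      rw [hx] at this
      exact this.congr fun t => by ring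
  · rintro ⟨h₀, hπ⟩ n
    rcases Int.even_or_odd n with hn | hn
    · have e0 : ((-1 : ℝ)) ^ n = 1 := hn.neg_one_zpow
      have e1 : ((-1 : ℝ)) ^ (n + 1) = -1 := by rw [zpow_add_one₀ (by norm_num), e0]; norm_num
      have e2 : ((-1 : ℝ)) ^ (n - 1) = -1 := by rw [zpow_sub_one₀ (by norm_num), e0]; norm_num
      simp only [dimer, e0, e1, e2]
      have := h₀.add (hπ.const_mul 1)
      rw [show dimer Q₀ Qπ n = fun t => Q₀ t + 1 * Qπ t from funext fun t => by simp [dimer, e0]]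
      refine this.congr fun t => ?_
      rw [show Q₀ t + 1 * Qπ t - (Q₀ t + -1 * Qπ t) = 2 * Qπ t by ring,
        show Q₀ t + -1 * Qπ t - (Q₀ t + 1 * Qπ t) = -(2 * Qπ t) by ring,
        show Q₀ t + 1 * Qπ t = Q₀ t + Qπ t by ring]
      ring
    · have e0 : ((-1 : ℝ)) ^ n = -1 := hn.neg_one_zpow
      have e1 : ((-1 : ℝ)) ^ (n + 1) = 1 := by rw [zpow_add_one₀ (by norm_num), e0]; norm_num
      have e2 : ((-1 : ℝ)) ^ (n - 1) = 1 := by rw [zpow_sub_one₀ (by norm_num), e0]; norm_num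
      simp only [dimer, e0, e1, e2]
      have := h₀.add (hπ.const_mul (-1))
      rw [show dimer Q₀ Qπ n = fun t => Q₀ t + -1 * Qπ t from funext fun t => by simp [dimer, e0]]
      refine this.congr fun t => ?_
      rw [show Q₀ t + 1 * Qπ t - (Q₀ t + -1 * Qπ t) = 2 * Qπ t by ring,
        show Q₀ t + -1 * Qπ t - (Q₀ t + 1 * Qπ t) = -(2 * Qπ t) by ring,
        show Q₀ t + -1 * Qπ t = Q₀ t - Qπ t by ring]
      ring

end Periodic

end

noncomputable section

/-! ### The out-of-phase mode -/

section Mode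

open scoped ContDiff

/-- Uniformity in `t` comes from the supremum norm of `c • u`, which tends to `0`. -/
theorem eventually_forall_mul_apply {E : Type*} [TopologicalSpace E] {P : ℝ → Prop}
    (hP : ∀ᶠ x in 𝓝 0, P x) {c : E → ℝ} {u : E → C(unitInterval, ℝ)} {p : E}
    (hc : ContinuousAt c p) (hu : ContinuousAt u p) (h0 : c p = 0) :
    ∀ᶠ x in 𝓝 p, ∀ t, P (c x * u x t) := by
  obtain ⟨δ, hδ, h⟩ := Metric.eventually_nhds_iff.1 hP
  have h1 : Tendsto (fun x => c x • u x) (𝓝 p) (𝓝 0) := by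
    have := (hc.smul hu).tendsto
    rw [show (c • u) p = c p • u p from rfl, h0, zero_smul] at this
    exact this
  filter_upwards [(tendsto_zero_iff_norm_tendsto_zero.1 h1).eventually (gt_mem_nhds hδ)] with x hx t
  apply h
  rw [Real.dist_0_eq_abs]
  exact lt_of_le_of_lt ((c x • u x).norm_coe_le_norm t) hx

/-- The rescaled force is the true force divided by the amplitude, in a form that stays analytic at
amplitude `0`. -/
theorem mul_dimerForceZero_apply {V : ℝ → ℝ} (hV : IsPotential V)
    (X : C(unitInterval, ℝ) × C(unitInterval, ℝ)) :
    ∀ᶠ p in 𝓝 ((0 : ℝ), X), ∀ t, p.1 * dimerForceZero V p t =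
      1 / 2 * (deriv V (p.1 * p.2.1 t + p.1 * p.2.2 t) +
        deriv V (p.1 * p.2.1 t - p.1 * p.2.2 t)) := by
  have h1 := eventually_nem_smul_apply hV.analyticAt_forceQuot (p := ((0 : ℝ), X))
    (c := fun p => p.1) (u := fun p => p.2.1 + p.2.2) (by fun_prop) (by fun_prop) rfl
  have h2 := eventually_nem_smul_apply hV.analyticAt_forceQuot (p := ((0 : ℝ), X))
    (c := fun p => p.1) (u := fun p => p.2.1 - p.2.2) (by fun_prop) (by fun_prop) rfl
  filter_upwards [h1, h2] with p h1 h2 t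
  rw [hV.deriv_eq, hV.deriv_eq]
  simp only [dimerForceZero, ContinuousMap.smul_apply, ContinuousMap.add_apply,
    ContinuousMap.mul_apply, h1, h2, ContinuousMap.sub_apply, smul_eq_mul, mul_add, mul_sub]
  ring

theorem mul_dimerForcePi_apply {V W : ℝ → ℝ} (hV : IsPotential V) (hW : IsPotential W)
    (X : C(unitInterval, ℝ) × C(unitInterval, ℝ)) :
    ∀ᶠ p in 𝓝 ((0 : ℝ), X), ∀ t, p.1 * dimerForcePi V W p t =
      1 / 2 * (deriv V (p.1 * p.2.1 t + p.1 * p.2.2 t) -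
        deriv V (p.1 * p.2.1 t - p.1 * p.2.2 t)) +
      (deriv W (2 * (p.1 * p.2.2 t)) - deriv W (-(2 * (p.1 * p.2.2 t)))) := by
  have h1 := eventually_nem_smul_apply hV.analyticAt_forceQuot (p := ((0 : ℝ), X))
    (c := fun p => p.1) (u := fun p => p.2.1 + p.2.2) (by fun_prop) (by fun_prop) rfl
  have h2 := eventually_nem_smul_apply hV.analyticAt_forceQuot (p := ((0 : ℝ), X))
    (c := fun p => p.1) (u := fun p => p.2.1 - p.2.2) (by fun_prop) (by fun_prop) rfl
  have h3 := eventually_nem_smul_apply hW.analyticAt_forceQuot (p := ((0 : ℝ), X))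
    (c := fun p => p.1) (u := fun p => (2 : ℝ) • p.2.2) (by fun_prop) (by fun_prop) rfl
  have h4 := eventually_nem_smul_apply hW.analyticAt_forceQuot (p := ((0 : ℝ), X))
    (c := fun p => p.1) (u := fun p => -(2 : ℝ) • p.2.2) (by fun_prop) (by fun_prop) rfl
  filter_upwards [h1, h2, h3, h4] with p h1 h2 h3 h4 t
  rw [hV.deriv_eq, hV.deriv_eq, hW.deriv_eq, hW.deriv_eq]
  simp only [dimerForcePi, ContinuousMap.smul_apply, ContinuousMap.add_apply,
    ContinuousMap.mul_apply, h1, h2, h3, h4, ContinuousMap.sub_apply, smul_eq_mul, mul_add,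
    mul_sub]
  rw [show p.1 * (2 * p.2.2 t) = 2 * (p.1 * p.2.2 t) by ring,
    show p.1 * (-2 * p.2.2 t) = -(2 * (p.1 * p.2.2 t)) by ring]
  ring

/-- The oscillation with half period `√(Λ r)` and profile `r X(r)`. -/
def branchOsc (X : ℝ → C(unitInterval, ℝ)) (Λ : ℝ → ℝ) (r t : ℝ) : ℝ :=
  r * X r (foldI (t / √(Λ r)))

/-- The energy per site of the out-of-phase mode of amplitude `r`. -/
def branchEnergy (V W : ℝ → ℝ) (X₀ Xπ : ℝ → C(unitInterval, ℝ)) (r : ℝ) : ℝ :=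
  (V (r * X₀ r 0 + r * Xπ r 0) + V (r * X₀ r 0 - r * Xπ r 0)) / 2 +
    (W (2 * (r * Xπ r 0)) + W (-(2 * (r * Xπ r 0)))) / 2

theorem IsPotential.exists_eq_sq_mul {V : ℝ → ℝ} (hV : IsPotential V) :
    ∃ k : ℝ → ℝ, AnalyticAt ℝ k 0 ∧ k 0 = potentialCoeff V 2 / 2 ∧ ∀ x, V x = x ^ 2 * k x := by
  have h1 : dslope V 0 0 = 0 := by rw [dslope_same, hV.deriv_zero]
  refine ⟨dslope (dslope V 0) 0, analyticAt_dslope (analyticAt_dslope hV.analytic), ?_,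
    fun x => ?_⟩
  · have := iterate_dslope_apply_zero hV.analytic 2
    rw [potentialCoeff]
    simpa using this
  · rw [eq_add_mul_dslope V x, hV.zero, eq_add_mul_dslope (dslope V 0) x, h1]
    ring

variable {V W : ℝ → ℝ} {X₀ Xπ : ℝ → C(unitInterval, ℝ)} {Λ : ℝ → ℝ}

/-- The energy is read off at `t = 0`, where the velocities vanish and all of it is potential.
Factoring the squares out of `V` and `W` leaves an analytic function of the amplitude. -/
theorem IsModeBranch.exists_energy_eq (hV : IsPotential V) (hW : IsPotential W)
    (hb : IsModeBranch V W X₀ Xπ Λ) :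
    ∃ κ : ℝ → ℝ, ContDiffAt ℝ ω κ 0 ∧ κ 0 = piFreqSq V W / 2 ∧
      ∀ r, branchEnergy V W X₀ Xπ r = r ^ 2 * κ r := by
  obtain ⟨k, hk, hk0, hkV⟩ := hV.exists_eq_sq_mul
  obtain ⟨m, hm, hm0, hmW⟩ := hW.exists_eq_sq_mul
  have h0 : ContDiffAt ℝ ω (fun r => X₀ r 0) 0 :=
    (contDiff_eval 0).contDiffAt.comp (0 : ℝ) hb.contDiffAt_zero
  have hπ : ContDiffAt ℝ ω (fun r => Xπ r 0) 0 :=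
    (contDiff_eval 0).contDiffAt.comp (0 : ℝ) hb.contDiffAt_pi
  have comp : ∀ {g u : ℝ → ℝ}, AnalyticAt ℝ g 0 → ContDiffAt ℝ ω u 0 → u 0 = 0 →
      ContDiffAt ℝ ω (fun r => g (u r)) 0 := fun {g u} hg hu hu0 => by
    have : ContDiffAt ℝ ω g (u 0) := by rw [hu0]; exact hg.contDiffAt
    exact this.comp 0 hu
  have c1 : ContDiffAt ℝ ω (fun r => k (r * X₀ r 0 + r * Xπ r 0)) 0 :=
    comp hk (by fun_prop) (by simp)
  have c2 : ContDiffAt ℝ ω (fun r => k (r * X₀ r 0 - r * Xπ r 0)) 0 :=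
    comp hk (by fun_prop) (by simp)
  have c3 : ContDiffAt ℝ ω (fun r => m (2 * (r * Xπ r 0))) 0 := comp hm (by fun_prop) (by simp)
  have c4 : ContDiffAt ℝ ω (fun r => m (-(2 * (r * Xπ r 0)))) 0 :=
    comp hm (by fun_prop) (by simp)
  refine ⟨fun r => 1 / 2 * ((X₀ r 0 + Xπ r 0) ^ 2 * k (r * X₀ r 0 + r * Xπ r 0) +
    (X₀ r 0 - Xπ r 0) ^ 2 * k (r * X₀ r 0 - r * Xπ r 0)) +
    2 * (Xπ r 0) ^ 2 * (m (2 * (r * Xπ r 0)) + m (-(2 * (r * Xπ r 0)))),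
    (contDiffAt_const.mul ((((h0.add hπ).pow 2).mul c1).add (((h0.sub hπ).pow 2).mul c2))).add
      ((contDiffAt_const.mul (hπ.pow 2)).mul (c3.add c4)), ?_, ?_⟩
  · simp [hb.zero_zero, hb.pi_zero, hk0, hm0, piFreqSq]
    ring
  · intro r
    rw [branchEnergy, hkV, hkV, hmW, hmW]
    ring

/-- Inversion of an energy `e(r) = Ω r² / 2 + o(r²)`. -/
theorem exists_amplitude {e κ : ℝ → ℝ} {Ω : ℝ} (hΩ : 0 < Ω) (hκ : ContDiffAt ℝ ω κ 0)
    (hκ0 : κ 0 = Ω / 2) (he : ∀ r, e r = r ^ 2 * κ r) :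
    ∃ ρ : ℝ → ℝ, Tendsto ρ (𝓝[>] 0) (𝓝[>] 0) ∧ (∀ᶠ ε in 𝓝[>] 0, e (ρ ε) = ε) ∧
      Tendsto (fun ε => ρ ε / √(2 * ε / Ω)) (𝓝[>] 0) (𝓝 1) ∧
      (∀ᶠ r in 𝓝[>] 0, ρ (e r) = r) := by
  have hκpos : 0 < κ 0 := by rw [hκ0]; positivity
  -- The energy is the square of `m` for small amplitudes, and `m` is a local diffeomorphism at `0`;
  -- the amplitude is its local inverse at `√ε`.
  set m : ℝ → ℝ := fun r => r * √(κ r) with hm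
  have hmd : ContDiffAt ℝ ω m 0 := contDiffAt_id.mul (hκ.sqrt hκpos.ne')
  have hs0 : 0 < √(κ 0) := Real.sqrt_pos.2 hκpos
  have hm' : HasStrictDerivAt m (√(κ 0)) 0 := by
    have h1 := hmd.hasStrictDerivAt (by simp)
    have h2 : HasDerivAt m (√(κ 0)) 0 := by
      have hk : HasDerivAt (fun r => √(κ r)) _ 0 :=
        ((hκ.sqrt hκpos.ne').differentiableAt (by simp)).hasDerivAt
      have := (hasDerivAt_id (0 : ℝ)).mul hk
      convert! this using 1
      simp
    rwa [h2.deriv] at h1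
  set inv := hm'.localInverse m _ 0 hs0.ne' with hinv
  have hm0 : m 0 = 0 := by simp [hm]
  have hinv0 : inv 0 = 0 := by
    have := (hm'.hasStrictFDerivAt_equiv hs0.ne').localInverse_apply_image
    rwa [hm0] at this
  have hinvd : HasStrictDerivAt inv (√(κ 0))⁻¹ 0 := by
    have := hm'.to_localInverse hs0.ne'
    rwa [hm0] at this
  have hr : ∀ᶠ x in 𝓝 0, m (inv x) = x := by
    have := (hm'.hasStrictFDerivAt_equiv hs0.ne').eventually_right_inverse
    rwa [hm0] at this
  have hl : ∀ᶠ x in 𝓝 0, inv (m x) = x :=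
    (hm'.hasStrictFDerivAt_equiv hs0.ne').eventually_left_inverse
  have hsqrt : Tendsto (fun ε : ℝ => √ε) (𝓝[>] 0) (𝓝[>] 0) := by
    refine tendsto_nhdsWithin_iff.2 ⟨?_, ?_⟩
    · have : Tendsto (fun ε : ℝ => √ε) (𝓝 0) (𝓝 (√0)) := Real.continuous_sqrt.tendsto 0
      rw [Real.sqrt_zero] at this
      exact this.mono_left nhdsWithin_le_nhds
    · filter_upwards [self_mem_nhdsWithin] with ε hε
      exact Real.sqrt_pos.2 hε
  have hsqrt' := tendsto_nhds_of_tendsto_nhdsWithin hsqrt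
  have hslope : Tendsto (fun x => inv x / x) (𝓝[>] 0) (𝓝 (√(κ 0))⁻¹) := by
    have h1 := hasDerivAt_iff_tendsto_slope_zero.1 hinvd.hasDerivAt
    simp only [zero_add, hinv0, sub_zero, smul_eq_mul] at h1
    refine (h1.mono_left (nhdsWithin_mono _ fun x hx => ne_of_gt hx)).congr fun x => ?_
    rw [div_eq_inv_mul]
  have hpos : ∀ᶠ x in 𝓝[>] 0, 0 < inv x := by
    filter_upwards [hslope.eventually (lt_mem_nhds (inv_pos.2 hs0)), self_mem_nhdsWithin] with x h1 h2
    exact (div_pos_iff_of_pos_right h2).1 h1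
  have hinvt : Tendsto inv (𝓝 0) (𝓝 0) := by
    have := hinvd.hasDerivAt.continuousAt.tendsto
    rwa [hinv0] at this
  have hκev : ∀ᶠ r in 𝓝 0, 0 < κ r := hκ.continuousAt.eventually (lt_mem_nhds hκpos)
  refine ⟨fun ε => inv √ε, ?_, ?_, ?_, ?_⟩
  · exact tendsto_nhdsWithin_iff.2 ⟨hinvt.comp hsqrt', hsqrt.eventually hpos⟩
  · filter_upwards [hsqrt'.eventually hr, (hinvt.comp hsqrt').eventually hκev,
      self_mem_nhdsWithin] with ε h1 h2 h3
    have h2' : 0 < κ (inv √ε) := h2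
    have h4 : m (inv √ε) ^ 2 = inv √ε ^ 2 * κ (inv √ε) := by
      rw [hm, mul_pow, Real.sq_sqrt h2'.le]
    rw [he, ← h4, h1, Real.sq_sqrt (le_of_lt h3)]
  · have h1 := (hslope.comp hsqrt).mul_const (√(κ 0))
    rw [inv_mul_cancel₀ hs0.ne'] at h1
    refine h1.congr' ?_
    filter_upwards [self_mem_nhdsWithin] with ε hε
    have : √(2 * ε / Ω) = √ε / √(κ 0) := by
      rw [← Real.sqrt_div (le_of_lt hε), hκ0]
      congr 1
      field_simp
    rw [this, Function.comp_apply, div_div_eq_mul_div, div_mul_eq_mul_div]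
  · filter_upwards [nhdsWithin_le_nhds hl, nhdsWithin_le_nhds hκev, self_mem_nhdsWithin]
      with r h1 h2 h3
    rw [he, Real.sqrt_mul (sq_nonneg r), Real.sqrt_sq (le_of_lt h3)]
    exact h1

/-- The amplitude of the mode as a function of its energy per site. -/
theorem IsModeBranch.exists_amplitude (hV : IsPotential V) (hW : IsPotential W)
    (hb : IsModeBranch V W X₀ Xπ Λ) :
    ∃ ρ : ℝ → ℝ, Tendsto ρ (𝓝[>] 0) (𝓝[>] 0) ∧
      (∀ᶠ ε in 𝓝[>] 0, branchEnergy V W X₀ Xπ (ρ ε) = ε) ∧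
      Tendsto (fun ε => ρ ε / √(2 * ε / piFreqSq V W)) (𝓝[>] 0) (𝓝 1) ∧
      (∀ᶠ r in 𝓝[>] 0, ρ (branchEnergy V W X₀ Xπ r) = r) := by
  obtain ⟨κ, hκ, hκ0, he⟩ := hb.exists_energy_eq hV hW
  exact _root_.exists_amplitude (piFreqSq_pos hV hW) hκ hκ0 he

theorem IsModeBranch.eventually_time_pos (hV : IsPotential V) (hW : IsPotential W)
    (hb : IsModeBranch V W X₀ Xπ Λ) : ∀ᶠ r in 𝓝 0, 0 < Λ r := by
  have : 0 < Λ 0 := by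
    rw [hb.time_zero]
    have := piFreqSq_pos hV hW
    positivity
  exact hb.contDiffAt_time.continuousAt.eventually (lt_mem_nhds this)

theorem tendsto_branch {l : ℝ} {f₀ fπ : ℝ × C(unitInterval, ℝ) × C(unitInterval, ℝ) → C(unitInterval, ℝ)}
    (hb : IsNeumannBranch f₀ fπ l X₀ Xπ Λ) :
    Tendsto (fun r => (r, X₀ r, Xπ r)) (𝓝 0) (𝓝 (0, 0, cosI Real.pi)) := by
  have h0 := hb.contDiffAt_zero.continuousAt
  have hπ := hb.contDiffAt_pi.continuousAt
  have : ContinuousAt (fun r => (r, X₀ r, Xπ r)) 0 := by fun_prop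
  have := this.tendsto
  rwa [hb.zero_zero, hb.pi_zero] at this

theorem hasSecondDeriv_branchOsc {X : ℝ → C(unitInterval, ℝ)} {r : ℝ} {F : C(unitInterval, ℝ)}
    (hΛ : 0 < Λ r) (hX : HasAccel (X r) 0 (-Λ r • F)) (hF : primitive F 1 = 0) :
    HasSecondDeriv (branchOsc X Λ r) fun t => -(r * F (foldI (t / √(Λ r)))) := by
  have h1 := (hX.hasSecondDeriv_foldI (by simp [hF])).comp_mul (√(Λ r))⁻¹
  have h2 := h1.const_mul r
  have hx : (fun t => r * X r (foldI ((√(Λ r))⁻¹ * t))) = branchOsc X Λ r := by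
    funext t; rw [branchOsc, div_eq_inv_mul]
  rw [hx] at h2
  refine h2.congr fun t => ?_
  rw [div_eq_inv_mul, inv_pow, Real.sq_sqrt hΛ.le]
  simp only [ContinuousMap.smul_apply, smul_eq_mul]
  field_simp

theorem even_branchOsc (X : ℝ → C(unitInterval, ℝ)) (Λ : ℝ → ℝ) (r : ℝ) :
    Function.Even (branchOsc X Λ r) := fun t => by
  rw [branchOsc, branchOsc, neg_div, foldI_neg]

theorem periodic_branchOsc (X : ℝ → C(unitInterval, ℝ)) {r : ℝ} (hΛ : 0 < Λ r) :
    Function.Periodic (branchOsc X Λ r) (2 * √(Λ r)) := fun t => by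
  have : √(Λ r) ≠ 0 := (Real.sqrt_pos.2 hΛ).ne'
  rw [branchOsc, branchOsc, add_div, mul_div_cancel_right₀ _ this, foldI_add_two]

theorem branchOsc_zero (X : ℝ → C(unitInterval, ℝ)) (Λ : ℝ → ℝ) (r : ℝ) :
    branchOsc X Λ r 0 = r * X r 0 := by
  rw [branchOsc, zero_div, foldI_zero]

/-- The potentials are regular only near `0`, so differentiability is required just at the points
visited by the orbit. -/
theorem dimerEnergy_const {Q₀ Qπ : ℝ → ℝ}
    (h₀ : HasSecondDeriv Q₀ fun t =>
        -((1 / 2) * (deriv V (Q₀ t + Qπ t) + deriv V (Q₀ t - Qπ t))))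
    (hπ : HasSecondDeriv Qπ fun t =>
        -((1 / 2) * (deriv V (Q₀ t + Qπ t) - deriv V (Q₀ t - Qπ t)) +
          (deriv W (2 * Qπ t) - deriv W (-(2 * Qπ t)))))
    (ha : ∀ t, HasDerivAt V (deriv V (Q₀ t + Qπ t)) (Q₀ t + Qπ t))
    (hb : ∀ t, HasDerivAt V (deriv V (Q₀ t - Qπ t)) (Q₀ t - Qπ t))
    (hc : ∀ t, HasDerivAt W (deriv W (2 * Qπ t)) (2 * Qπ t))
    (hd : ∀ t, HasDerivAt W (deriv W (-(2 * Qπ t))) (-(2 * Qπ t))) (t : ℝ) :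
    dimerEnergy V W Q₀ Qπ t = dimerEnergy V W Q₀ Qπ 0 := by
  have h : ∀ t, HasDerivAt (dimerEnergy V W Q₀ Qπ) 0 t := by
    intro t
    have d0 := (h₀.1 t).hasDerivAt
    have dπ := (hπ.1 t).hasDerivAt
    have e1 := (((h₀.2 t).pow 2).add ((hπ.2 t).pow 2)).div_const 2
    have e2 := (((ha t).comp t (d0.add dπ)).add ((hb t).comp t (d0.sub dπ))).div_const 2
    have e3 := (((hc t).comp t (dπ.const_mul 2)).add
      ((hd t).comp t ((dπ.const_mul 2).neg))).div_const 2
    convert! (e1.add e2).add e3 using 1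
    simp
    ring
  exact is_const_of_deriv_eq_zero (fun t => (h t).differentiableAt) (fun t => (h t).deriv) t 0

/-- Every point of the branch is an even periodic solution. -/
theorem IsModeBranch.eventually_solution (hV : IsPotential V) (hW : IsPotential W)
    (hb : IsModeBranch V W X₀ Xπ Λ) :
    ∀ᶠ r in 𝓝 0, IsLatticeSolution V W (dimer (branchOsc X₀ Λ r) (branchOsc Xπ Λ r)) ∧
      ∀ N : ℕ, Even N → ∀ t, latticeEnergy V W N (dimer (branchOsc X₀ Λ r) (branchOsc Xπ Λ r)) t =
        N * branchEnergy V W X₀ Xπ r := by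
  have c0 := hb.contDiffAt_zero.continuousAt
  have cπ := hb.contDiffAt_pi.continuousAt
  have s1 := eventually_forall_mul_apply hV.hasDerivAt (p := (0 : ℝ)) (c := fun r => r)
    (u := fun r => X₀ r + Xπ r) (by fun_prop) (by fun_prop) rfl
  have s2 := eventually_forall_mul_apply hV.hasDerivAt (p := (0 : ℝ)) (c := fun r => r)
    (u := fun r => X₀ r - Xπ r) (by fun_prop) (by fun_prop) rfl
  have s3 := eventually_forall_mul_apply hW.hasDerivAt (p := (0 : ℝ)) (c := fun r => 2 * r)
    (u := fun r => Xπ r) (by fun_prop) (by fun_prop) (by simp)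
  have s4 := eventually_forall_mul_apply hW.hasDerivAt (p := (0 : ℝ)) (c := fun r => -(2 * r))
    (u := fun r => Xπ r) (by fun_prop) (by fun_prop) (by simp)
  filter_upwards [hb.sol, hb.eventually_time_pos hV hW,
    (tendsto_branch hb).eventually (mul_dimerForceZero_apply hV _),
    (tendsto_branch hb).eventually (mul_dimerForcePi_apply hV hW _), s1, s2, s3, s4]
    with r hs hΛ f0 fπ s1 s2 s3 s4
  have h0 := (hasSecondDeriv_branchOsc hΛ hs.accel_zero hs.velocity_zero).congr
    (g := fun t => -((1 / 2) * (deriv V (branchOsc X₀ Λ r t + branchOsc Xπ Λ r t) +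
      deriv V (branchOsc X₀ Λ r t - branchOsc Xπ Λ r t)))) fun t => by rw [f0]; rfl
  have hπ := (hasSecondDeriv_branchOsc hΛ hs.accel_pi hs.velocity_pi).congr
    (g := fun t => -((1 / 2) * (deriv V (branchOsc X₀ Λ r t + branchOsc Xπ Λ r t) -
      deriv V (branchOsc X₀ Λ r t - branchOsc Xπ Λ r t)) +
      (deriv W (2 * branchOsc Xπ Λ r t) - deriv W (-(2 * branchOsc Xπ Λ r t)))))
    fun t => by rw [fπ]; rfl
  refine ⟨isLatticeSolution_dimer_iff.2 ⟨h0, hπ⟩, fun N hN t => ?_⟩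
  rw [latticeEnergy_dimer h0.1 hπ.1 hN, dimerEnergy_const h0 hπ
    (fun t => by
      have := s1 (foldI (t / √(Λ r)))
      rwa [ContinuousMap.add_apply, mul_add] at this)
    (fun t => by
      have := s2 (foldI (t / √(Λ r)))
      rwa [ContinuousMap.sub_apply, mul_sub] at this)
    (fun t => by
      have := s3 (foldI (t / √(Λ r)))
      rwa [mul_assoc] at this)
    (fun t => by
      have := s4 (foldI (t / √(Λ r)))
      rwa [neg_mul, mul_assoc] at this),
    dimerEnergy, deriv_zero_of_even (even_branchOsc _ _ _),
    deriv_zero_of_even (even_branchOsc _ _ _), branchOsc_zero, branchOsc_zero, branchEnergy]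
  ring

/-- Convergence of profiles in supremum norm on half a period becomes uniform convergence on the
whole line through the folding map. -/
theorem tendstoUniformly_branchOsc {X : ℝ → C(unitInterval, ℝ)} {x : C(unitInterval, ℝ)}
    {ρ A : ℝ → ℝ} {l : Filter ℝ} (hX : Tendsto (fun ε => X (ρ ε)) l (𝓝 x))
    (hA : Tendsto (fun ε => ρ ε / A ε) l (𝓝 1)) (hΛ : ∀ᶠ ε in l, 0 < Λ (ρ ε)) :
    TendstoUniformly (fun ε τ => branchOsc X Λ (ρ ε) (τ / (Real.pi / √(Λ (ρ ε)))) / A ε)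
      (fun τ => x (foldI (τ / Real.pi))) l := by
  have h1 : Tendsto (fun ε => (ρ ε / A ε) • X (ρ ε)) l (𝓝 x) := by
    simpa using hA.smul hX
  have h2 : TendstoUniformly (fun ε τ => ((ρ ε / A ε) • X (ρ ε)) (foldI (τ / Real.pi)))
      (fun τ => x (foldI (τ / Real.pi))) l :=
    (ContinuousMap.tendsto_iff_tendstoUniformly.1 h1).comp fun τ => foldI (τ / Real.pi)
  intro u hu
  filter_upwards [h2 u hu, hΛ] with ε h hε τ
  have : √(Λ (ρ ε)) ≠ 0 := (Real.sqrt_pos.2 hε).ne'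
  have e : τ / (Real.pi / √(Λ (ρ ε))) / √(Λ (ρ ε)) = τ / Real.pi := by
    field_simp
  convert! h τ using 2
  simp [branchOsc, e]
  ring

theorem cosI_pi_foldI (τ : ℝ) : cosI Real.pi (foldI (τ / Real.pi)) = Real.cos τ := by
  simp only [cosI_apply, foldI]
  rw [mul_div_cancel₀ _ Real.pi_ne_zero, mul_div_cancel₀ _ Real.pi_ne_zero,
    Real.cos_arccos (Real.neg_one_le_cos _) (Real.cos_le_one _)]

/-- The out-of-phase mode exists. -/
theorem exists_isOutOfPhaseMode (hV : IsPotential V) (hW : IsPotential W) :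
    ∃ Q₀ Qπ w, IsOutOfPhaseMode V W Q₀ Qπ w := by
  obtain ⟨X₀, Xπ, Λ, hb⟩ := exists_isModeBranch hV hW
  obtain ⟨ρ, hρ, hρe, hρA, -⟩ := hb.exists_amplitude hV hW
  have hρ0 := tendsto_nhds_of_tendsto_nhdsWithin hρ
  have hΛ := hρ0.eventually (hb.eventually_time_pos hV hW)
  have hsol := hρ0.eventually (hb.eventually_solution hV hW)
  have hX0 : Tendsto (fun ε => X₀ (ρ ε)) (𝓝[>] 0) (𝓝 0) := by
    have := hb.contDiffAt_zero.continuousAt.tendsto.comp hρ0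
    rwa [hb.zero_zero] at this
  have hXπ : Tendsto (fun ε => Xπ (ρ ε)) (𝓝[>] 0) (𝓝 (cosI Real.pi)) := by
    have := hb.contDiffAt_pi.continuousAt.tendsto.comp hρ0
    rwa [hb.pi_zero] at this
  refine ⟨fun ε => branchOsc X₀ Λ (ρ ε), fun ε => branchOsc Xπ Λ (ρ ε),
    fun ε => Real.pi / √(Λ (ρ ε)), ?_, hsol.mono fun ε h => h.1, ?_, ?_, ?_, ?_, ?_, ?_⟩
  · filter_upwards [hΛ] with ε h
    have := Real.sqrt_pos.2 h
    positivity
  · filter_upwards [hsol, hρe] with ε h1 h2 N hN t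
    rw [h1.2 N hN t, h2]
  · filter_upwards [hΛ] with ε h
    have h1 : 2 * Real.pi / (Real.pi / √(Λ (ρ ε))) = 2 * √(Λ (ρ ε)) := by
      have := (Real.sqrt_pos.2 h).ne'
      field_simp
    rw [h1]
    exact ⟨periodic_branchOsc _ h, periodic_branchOsc _ h⟩
  · exact Eventually.of_forall fun ε => ⟨even_branchOsc _ _ _, even_branchOsc _ _ _⟩
  · have h1 : Tendsto (fun ε => Real.pi ^ 2 / Λ (ρ ε)) (𝓝[>] 0) (𝓝 (Real.pi ^ 2 / Λ 0)) := by
      have hpos : Λ 0 ≠ 0 := (hb.eventually_time_pos hV hW).self_of_nhds.ne'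
      exact tendsto_const_nhds.div (hb.contDiffAt_time.continuousAt.tendsto.comp hρ0) hpos
    have h2 : Real.pi ^ 2 / Λ 0 = piFreqSq V W := by
      rw [hb.time_zero]
      have := (piFreqSq_pos hV hW).ne'
      have := Real.pi_ne_zero
      field_simp
    rw [h2] at h1
    refine h1.congr' ?_
    filter_upwards [hΛ] with ε h
    rw [div_pow, Real.sq_sqrt h.le]
  · exact tendstoUniformly_branchOsc hX0 hρA hΛ
  · have := tendstoUniformly_branchOsc hXπ hρA hΛ
    simp only [cosI_pi_foldI] at this
    exact this

end Mode

end

noncomputable section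

/-! ### Uniqueness of the modes -/

section Uniqueness

open scoped ContDiff

open Classical in
/-- The restriction of a continuous function to the unit interval. -/
def restrictI (f : ℝ → ℝ) : C(unitInterval, ℝ) :=
  if h : Continuous f then ⟨fun t => f t, h.comp continuous_subtype_val⟩ else 0

theorem restrictI_apply {f : ℝ → ℝ} (h : Continuous f) (t : unitInterval) :
    restrictI f t = f t := by
  simp [restrictI, h]

/-- A half period of an oscillation of frequency `w`, with the amplitude `r` scaled out. -/
def profile (q : ℝ → ℝ) (w r : ℝ) : C(unitInterval, ℝ) :=
  restrictI fun t => q (Real.pi / w * t) / r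

theorem profile_apply {q : ℝ → ℝ} (h : Continuous q) (w r : ℝ) (t : unitInterval) :
    profile q w r t = q (Real.pi / w * t) / r :=
  restrictI_apply (by fun_prop) t

/-- Uniform convergence on the line restricts to norm convergence on half a period. It survives the
change from the scale `A` to the scale `r`, since their ratio tends to `1`. -/
theorem tendsto_profile {q : ℝ → ℝ → ℝ} {w A r : ℝ → ℝ} {l : Filter ℝ} {g : ℝ → ℝ}
    {x : C(unitInterval, ℝ)} (hq : ∀ᶠ ε in l, Continuous (q ε))
    (h : TendstoUniformly (fun ε τ => q ε (τ / w ε) / A ε) g l) (hA : ∀ᶠ ε in l, A ε ≠ 0)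
    (hr : Tendsto (fun ε => A ε / r ε) l (𝓝 1)) (hx : ∀ t : unitInterval, x t = g (Real.pi * t)) :
    Tendsto (fun ε => profile (q ε) (w ε) (r ε)) l (𝓝 x) := by
  have h1 : Tendsto (fun ε => profile (q ε) (w ε) (A ε)) l (𝓝 x) := by
    rw [ContinuousMap.tendsto_iff_tendstoUniformly]
    have h2 := h.comp fun t : unitInterval => Real.pi * (t : ℝ)
    intro u hu
    filter_upwards [h2 u hu, hq] with ε h hq t
    convert! h t using 2
    · rw [hx]; rfl
    · rw [profile_apply hq, Function.comp_apply, mul_div_right_comm]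
  have h2 := hr.smul h1
  rw [one_smul] at h2
  refine h2.congr' ?_
  filter_upwards [hq, hA] with ε hq hA
  ext t
  rw [ContinuousMap.smul_apply, profile_apply hq, profile_apply hq, smul_eq_mul,
    div_mul_div_cancel₀' hA]

theorem HasSecondDeriv.continuous {x f : ℝ → ℝ} (h : HasSecondDeriv x f) : Continuous x :=
  h.1.continuous

/-- Evenness and periodicity force the velocity to vanish at `0` and at half a period. These are
exactly the Neumann conditions. -/
theorem HasSecondDeriv.hasAccel_profile {q f : ℝ → ℝ} {w r : ℝ} (hq : HasSecondDeriv q f)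
    (he : Function.Even q) (hp : Function.Periodic q (2 * Real.pi / w)) (hr : r ≠ 0) (hw : w ≠ 0)
    {F : C(unitInterval, ℝ)} (hF : ∀ t : unitInterval, f (Real.pi / w * t) = -(r * F t)) :
    HasAccel (profile q w r) 0 (-(Real.pi / w) ^ 2 • F) ∧ primitive F 1 = 0 := by
  have h1 := (hq.comp_mul (Real.pi / w)).const_mul r⁻¹
  have h2 := h1.hasAccel (X := profile q w r) (F := -(Real.pi / w) ^ 2 • F)
    (fun t => by rw [profile_apply hq.continuous, div_eq_inv_mul])
    (fun t => by
      rw [hF, ContinuousMap.smul_apply, smul_eq_mul]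
      field_simp)
  have he' : Function.Even fun t => r⁻¹ * q (Real.pi / w * t) := fun t => by
    simp only [mul_neg, he (Real.pi / w * t)]
  have hp' : Function.Periodic (fun t => r⁻¹ * q (Real.pi / w * t)) (2 * 1) := fun t => by
    have : Real.pi / w * (t + 2 * 1) = Real.pi / w * t + 2 * Real.pi / w := by ring
    simp only [this, hp (Real.pi / w * t)]
  rw [deriv_zero_of_even he', deriv_half_period he' hp', sub_zero] at h2
  refine ⟨h2.1, ?_⟩
  have h3 := h2.2
  rw [map_smul, ContinuousMap.smul_apply, smul_eq_mul] at h3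
  have : -(Real.pi / w) ^ 2 ≠ 0 := neg_ne_zero.2 (pow_ne_zero _ (div_ne_zero Real.pi_ne_zero hw))
  exact (mul_eq_zero.1 h3).resolve_left this

theorem eq_branchOsc {q : ℝ → ℝ} {w r : ℝ} {X : ℝ → C(unitInterval, ℝ)} {Λ : ℝ → ℝ}
    (hq : Continuous q) (he : Function.Even q) (hp : Function.Periodic q (2 * Real.pi / w))
    (hr : r ≠ 0) (hw : 0 < w) (hX : profile q w r = X r) (hΛ : (Real.pi / w) ^ 2 = Λ r) :
    q = branchOsc X Λ r := by
  have hs : √(Λ r) = Real.pi / w := by rw [← hΛ, Real.sqrt_sq (by positivity)]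
  have h0 : Real.pi / w ≠ 0 := (div_pos Real.pi_pos hw).ne'
  have h : (fun t => q (Real.pi / w * t)) = fun t => r * X r (foldI t) := by
    refine eq_of_even_of_periodic (fun t => by simp only [mul_neg, he (Real.pi / w * t)])
      (fun t => by simp only [foldI_neg]) (fun t => ?_) (fun t => by simp only [foldI_add_two])
      fun t => ?_
    · have : Real.pi / w * (t + 2) = Real.pi / w * t + 2 * Real.pi / w := by ring
      simp only [this, hp (Real.pi / w * t)]
    · rw [foldI_coe, ← hX, profile_apply hq, mul_div_cancel₀ _ hr]
  funext t
  have := congrFun h (t / (Real.pi / w))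
  simp only [mul_div_cancel₀ _ h0] at this
  rw [this, branchOsc, hs]

/-- Amplitudes of a family of small oscillations. -/
theorem tendsto_amplitude {q : ℝ → ℝ → ℝ} {w : ℝ → ℝ} {Ω : ℝ} (hΩ : 0 < Ω)
    (h : TendstoUniformly (fun ε τ => q ε (τ / w ε) / √(2 * ε / Ω)) Real.cos (𝓝[>] 0)) :
    Tendsto (fun ε => √(2 * ε / Ω) / q ε 0) (𝓝[>] 0) (𝓝 1) ∧
      Tendsto (fun ε => q ε 0) (𝓝[>] 0) (𝓝[>] 0) := by
  have h1 : Tendsto (fun ε => q ε 0 / √(2 * ε / Ω)) (𝓝[>] 0) (𝓝 1) := by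
    simpa using h.tendsto_at 0
  have hA : ∀ᶠ ε : ℝ in 𝓝[>] 0, 0 < √(2 * ε / Ω) := by
    filter_upwards [self_mem_nhdsWithin] with ε hε
    have : (0 : ℝ) < ε := hε
    positivity
  have hA0 : Tendsto (fun ε : ℝ => √(2 * ε / Ω)) (𝓝[>] 0) (𝓝 0) := by
    have : ContinuousAt (fun ε : ℝ => √(2 * ε / Ω)) 0 := by fun_prop
    have h := this.tendsto
    simp only [mul_zero, zero_div, Real.sqrt_zero] at h
    exact h.mono_left nhdsWithin_le_nhds
  refine ⟨?_, tendsto_nhdsWithin_iff.2 ⟨?_, ?_⟩⟩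
  · have := h1.inv₀ one_ne_zero
    simpa using this
  · have := h1.mul hA0
    rw [mul_zero] at this
    refine this.congr' ?_
    filter_upwards [hA] with ε h
    exact div_mul_cancel₀ _ h.ne'
  · filter_upwards [h1.eventually (lt_mem_nhds one_pos), hA] with ε h1 h2
    exact (div_pos_iff_of_pos_right h2).1 h1

theorem tendsto_sq_pi_div {w : ℝ → ℝ} {Ω : ℝ} (hΩ : 0 < Ω) {l : Filter ℝ}
    (h : Tendsto (fun ε => w ε ^ 2) l (𝓝 Ω)) :
    Tendsto (fun ε => (Real.pi / w ε) ^ 2) l (𝓝 (Real.pi ^ 2 / Ω)) := by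
  simp only [div_pow]
  exact tendsto_const_nhds.div h hΩ.ne'

variable {V W : ℝ → ℝ} {X₀ Xπ : ℝ → C(unitInterval, ℝ)} {Λ : ℝ → ℝ}

/-- The out-of-phase mode of energy `ε` is the point of the branch of amplitude `Q_π(0)`. -/
theorem IsOutOfPhaseMode.eventually_eq_branch (hV : IsPotential V) (hW : IsPotential W)
    (hb : IsModeBranch V W X₀ Xπ Λ) {Q₀ Qπ : ℝ → ℝ → ℝ} {w : ℝ → ℝ}
    (hm : IsOutOfPhaseMode V W Q₀ Qπ w) :
    Tendsto (fun ε => Qπ ε 0) (𝓝[>] 0) (𝓝[>] 0) ∧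
    ∀ᶠ ε in 𝓝[>] 0, branchEnergy V W X₀ Xπ (Qπ ε 0) = ε ∧
      Q₀ ε = branchOsc X₀ Λ (Qπ ε 0) ∧ Qπ ε = branchOsc Xπ Λ (Qπ ε 0) ∧
      0 < w ε ∧ (Real.pi / w ε) ^ 2 = Λ (Qπ ε 0) := by
  have hΩ := piFreqSq_pos hV hW
  obtain ⟨hA, hr⟩ := tendsto_amplitude hΩ hm.tendsto_pi
  have hr0 := tendsto_nhds_of_tendsto_nhdsWithin hr
  have hApos : ∀ᶠ ε : ℝ in 𝓝[>] 0, √(2 * ε / piFreqSq V W) ≠ 0 := by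
    filter_upwards [self_mem_nhdsWithin] with ε hε
    have : (0 : ℝ) < ε := hε
    positivity
  have hsol := hm.solution.mono fun ε h => isLatticeSolution_dimer_iff.1 h
  have t0 := tendsto_profile (x := 0) (hsol.mono fun ε h => h.1.continuous) hm.tendsto_zero hApos
    hA (fun t => rfl)
  have tπ := tendsto_profile (x := cosI Real.pi) (hsol.mono fun ε h => h.2.continuous)
    hm.tendsto_pi hApos hA (fun t => rfl)
  have tΛ := tendsto_sq_pi_div hΩ hm.freq_tendsto
  refine ⟨hr, ?_⟩
  -- Dividing by the actual amplitude `Q_π(0)` gives profiles with `X_π(0) = 1` that converge to the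
  -- base point of the Neumann problem. They thus enter the neighbourhood where the branch is
  -- unique.
  have hp3 := hr0.prodMk_nhds (t0.prodMk_nhds tπ)
  have hp4 := hr0.prodMk_nhds ((t0.prodMk_nhds tπ).prodMk_nhds tΛ)
  filter_upwards [hsol, hm.freq_pos, hm.periodic, hm.symmetric, hm.energy, hr.eventually
    self_mem_nhdsWithin, hp3.eventually (mul_dimerForceZero_apply hV _),
    hp3.eventually (mul_dimerForcePi_apply hV hW _), hp4.eventually hb.unique,
    hr0.eventually (hb.eventually_solution hV hW)]
    with ε hsol hw hper hev hen hrpos f0 fπ huniq hbs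
  have hrne : Qπ ε 0 ≠ 0 := ne_of_gt hrpos
  have e0 : ∀ t : unitInterval, Qπ ε 0 * profile (Q₀ ε) (w ε) (Qπ ε 0) t =
      Q₀ ε (Real.pi / w ε * t) := fun t => by
    rw [profile_apply hsol.1.continuous, mul_div_cancel₀ _ hrne]
  have eπ : ∀ t : unitInterval, Qπ ε 0 * profile (Qπ ε) (w ε) (Qπ ε 0) t =
      Qπ ε (Real.pi / w ε * t) := fun t => by
    rw [profile_apply hsol.2.continuous, mul_div_cancel₀ _ hrne]
  obtain ⟨a0, v0⟩ := hsol.1.hasAccel_profile hev.1 hper.1 hrne hw.ne'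
    (F := dimerForceZero V (Qπ ε 0, profile (Q₀ ε) (w ε) (Qπ ε 0), profile (Qπ ε) (w ε) (Qπ ε 0)))
    (fun t => by rw [f0]; simp only [e0, eπ])
  obtain ⟨aπ, vπ⟩ := hsol.2.hasAccel_profile hev.2 hper.2 hrne hw.ne'
    (F := dimerForcePi V W (Qπ ε 0, profile (Q₀ ε) (w ε) (Qπ ε 0), profile (Qπ ε) (w ε) (Qπ ε 0)))
    (fun t => by rw [fπ]; simp only [e0, eπ])
  obtain ⟨u0, uπ, uΛ⟩ := huniq ⟨by
    rw [profile_apply hsol.2.continuous]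
    simp [hrne], a0, aπ, v0, vπ⟩
  have q0 := eq_branchOsc hsol.1.continuous hev.1 hper.1 hrne hw u0 uΛ
  have qπ := eq_branchOsc hsol.2.continuous hev.2 hper.2 hrne hw uπ uΛ
  refine ⟨?_, q0, qπ, hw, uΛ⟩
  -- The two-site lattice at time `0` suffices to identify the prescribed energy with that of the
  -- branch.
  have h1 := hen 2 even_two 0
  have h2 := hbs.2 2 even_two 0
  rw [← q0, ← qπ, h1] at h2
  simpa using h2.symm

/-! #### Oscillations of a single particle -/

theorem mul_onsiteForce_apply (hV : IsPotential V)
    (X : C(unitInterval, ℝ) × C(unitInterval, ℝ)) :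
    ∀ᶠ p in 𝓝 ((0 : ℝ), X), ∀ t, p.1 * onsiteForce V p t = deriv V (p.1 * p.2.2 t) := by
  have h1 := eventually_nem_smul_apply hV.analyticAt_forceQuot (p := ((0 : ℝ), X))
    (c := fun p => p.1) (u := fun p => p.2.2) (by fun_prop) (by fun_prop) rfl
  filter_upwards [h1] with p h1 t
  rw [hV.deriv_eq]
  simp only [onsiteForce, ContinuousMap.mul_apply, h1]
  ring

theorem IsOnsiteBranch.eventually_time_pos (hV : IsPotential V) (hb : IsOnsiteBranch V X₀ Xπ Λ) :
    ∀ᶠ r in 𝓝 0, 0 < Λ r := by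
  have : 0 < Λ 0 := by
    rw [hb.time_zero]
    have := hV.coeff_two_pos
    positivity
  exact hb.contDiffAt_time.continuousAt.eventually (lt_mem_nhds this)

theorem onsiteEnergy_const {q : ℝ → ℝ} (h : HasSecondDeriv q fun t => -deriv V (q t))
    (ha : ∀ t, HasDerivAt V (deriv V (q t)) (q t)) (t : ℝ) :
    deriv q t ^ 2 / 2 + V (q t) = deriv q 0 ^ 2 / 2 + V (q 0) := by
  have hd : ∀ t, HasDerivAt (fun t => deriv q t ^ 2 / 2 + V (q t)) 0 t := fun t => by
    have e1 := ((h.2 t).pow 2).div_const 2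
    have e2 := (ha t).comp t (h.1 t).hasDerivAt
    convert! e1.add e2 using 1
    simp
    ring
  exact is_const_of_deriv_eq_zero (fun t => (hd t).differentiableAt) (fun t => (hd t).deriv) t 0

theorem IsOnsiteBranch.eventually_solution (hV : IsPotential V)
    (hb : IsOnsiteBranch V X₀ Xπ Λ) :
    ∀ᶠ r in 𝓝 0, (HasSecondDeriv (branchOsc Xπ Λ r) fun t => -deriv V (branchOsc Xπ Λ r t)) ∧
      ∀ t, deriv (branchOsc Xπ Λ r) t ^ 2 / 2 + V (branchOsc Xπ Λ r t) = V r := by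
  have cπ := hb.contDiffAt_pi.continuousAt
  have s1 := eventually_forall_mul_apply hV.hasDerivAt (p := (0 : ℝ)) (c := fun r => r)
    (u := fun r => Xπ r) (by fun_prop) (by fun_prop) rfl
  filter_upwards [hb.sol, hb.eventually_time_pos hV,
    (tendsto_branch hb).eventually (mul_onsiteForce_apply hV _), s1] with r hs hΛ f s1
  have hq := (hasSecondDeriv_branchOsc hΛ hs.accel_pi hs.velocity_pi).congr
    (g := fun t => -deriv V (branchOsc Xπ Λ r t)) fun t => by rw [f]; rfl
  refine ⟨hq, fun t => ?_⟩
  rw [onsiteEnergy_const hq (fun t => s1 (foldI (t / √(Λ r)))) t,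
    deriv_zero_of_even (even_branchOsc _ _ _), branchOsc_zero, hs.normalized]
  simp

theorem IsPotential.exists_amplitude (hV : IsPotential V) :
    ∃ ρ : ℝ → ℝ, Tendsto ρ (𝓝[>] 0) (𝓝[>] 0) ∧ (∀ᶠ ε in 𝓝[>] 0, V (ρ ε) = ε) ∧
      Tendsto (fun ε => ρ ε / √(2 * ε / potentialCoeff V 2)) (𝓝[>] 0) (𝓝 1) ∧
      (∀ᶠ r in 𝓝[>] 0, ρ (V r) = r) := by
  obtain ⟨k, hk, hk0, hkV⟩ := hV.exists_eq_sq_mul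
  exact _root_.exists_amplitude hV.coeff_two_pos hk.contDiffAt hk0 hkV

/-- The small oscillations of a single particle exist. -/
theorem exists_isOnsiteMode (hV : IsPotential V) : ∃ q w, IsOnsiteMode V q w := by
  obtain ⟨X₀, Xπ, Λ, hb⟩ := exists_isOnsiteBranch hV
  obtain ⟨ρ, hρ, hρe, hρA, -⟩ := hV.exists_amplitude
  have hρ0 := tendsto_nhds_of_tendsto_nhdsWithin hρ
  have hΛ := hρ0.eventually (hb.eventually_time_pos hV)
  have hsol := hρ0.eventually (hb.eventually_solution hV)
  have hXπ : Tendsto (fun ε => Xπ (ρ ε)) (𝓝[>] 0) (𝓝 (cosI Real.pi)) := by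
    have := hb.contDiffAt_pi.continuousAt.tendsto.comp hρ0
    rwa [hb.pi_zero] at this
  refine ⟨fun ε => branchOsc Xπ Λ (ρ ε), fun ε => Real.pi / √(Λ (ρ ε)), ?_,
    hsol.mono fun ε h => h.1, ?_, ?_, ?_, ?_, ?_⟩
  · filter_upwards [hΛ] with ε h
    have := Real.sqrt_pos.2 h
    positivity
  · filter_upwards [hsol, hρe] with ε h1 h2 t
    rw [h1.2 t, h2]
  · filter_upwards [hΛ] with ε h
    have h1 : 2 * Real.pi / (Real.pi / √(Λ (ρ ε))) = 2 * √(Λ (ρ ε)) := by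
      have := (Real.sqrt_pos.2 h).ne'
      field_simp
    rw [h1]
    exact periodic_branchOsc _ h
  · exact Eventually.of_forall fun ε => even_branchOsc _ _ _
  · have h1 : Tendsto (fun ε => Real.pi ^ 2 / Λ (ρ ε)) (𝓝[>] 0) (𝓝 (Real.pi ^ 2 / Λ 0)) := by
      have hpos : Λ 0 ≠ 0 := (hb.eventually_time_pos hV).self_of_nhds.ne'
      exact tendsto_const_nhds.div (hb.contDiffAt_time.continuousAt.tendsto.comp hρ0) hpos
    have h2 : Real.pi ^ 2 / Λ 0 = potentialCoeff V 2 := by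
      rw [hb.time_zero]
      have := hV.coeff_two_pos.ne'
      have := Real.pi_ne_zero
      field_simp
    rw [h2] at h1
    refine h1.congr' ?_
    filter_upwards [hΛ] with ε h
    rw [div_pow, Real.sq_sqrt h.le]
  · have := tendstoUniformly_branchOsc hXπ hρA hΛ
    simp only [cosI_pi_foldI] at this
    exact this

/-- The oscillation of energy `ε` is the point of the branch of amplitude `q(0)`. -/
theorem IsOnsiteMode.eventually_eq_branch (hV : IsPotential V)
    (hb : IsOnsiteBranch V X₀ Xπ Λ) {q : ℝ → ℝ → ℝ} {w : ℝ → ℝ} (hm : IsOnsiteMode V q w) :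
    Tendsto (fun ε => q ε 0) (𝓝[>] 0) (𝓝[>] 0) ∧
    ∀ᶠ ε in 𝓝[>] 0, V (q ε 0) = ε ∧ 0 < w ε ∧ (Real.pi / w ε) ^ 2 = Λ (q ε 0) := by
  have hΩ := hV.coeff_two_pos
  obtain ⟨hA, hr⟩ := tendsto_amplitude hΩ hm.tendsto_cos
  have hr0 := tendsto_nhds_of_tendsto_nhdsWithin hr
  have hApos : ∀ᶠ ε : ℝ in 𝓝[>] 0, √(2 * ε / potentialCoeff V 2) ≠ 0 := by
    filter_upwards [self_mem_nhdsWithin] with ε hε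
    have : (0 : ℝ) < ε := hε
    positivity
  have tπ := tendsto_profile (x := cosI Real.pi) (hm.solution.mono fun ε h => h.continuous)
    hm.tendsto_cos hApos hA (fun t => rfl)
  have tΛ := tendsto_sq_pi_div hΩ hm.freq_tendsto
  have t0 : Tendsto (fun _ : ℝ => (0 : C(unitInterval, ℝ))) (𝓝[>] 0) (𝓝 0) := tendsto_const_nhds
  refine ⟨hr, ?_⟩
  have hp3 := hr0.prodMk_nhds (t0.prodMk_nhds tπ)
  have hp4 := hr0.prodMk_nhds ((t0.prodMk_nhds tπ).prodMk_nhds tΛ)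
  filter_upwards [hm.solution, hm.freq_pos, hm.periodic, hm.symmetric, hm.energy, hr.eventually
    self_mem_nhdsWithin, hp3.eventually (mul_onsiteForce_apply hV _), hp4.eventually hb.unique]
    with ε hsol hw hper hev hen hrpos f huniq
  have hrne : q ε 0 ≠ 0 := ne_of_gt hrpos
  obtain ⟨aπ, vπ⟩ := hsol.hasAccel_profile hev hper hrne hw.ne'
    (F := onsiteForce V (q ε 0, 0, profile (q ε) (w ε) (q ε 0)))
    (fun t => by
      rw [f, profile_apply hsol.continuous, mul_div_cancel₀ _ hrne])
  obtain ⟨-, -, uΛ⟩ := huniq ⟨by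
    rw [profile_apply hsol.continuous]
    simp [hrne], fun t => by simp, aπ, by simp, vπ⟩
  refine ⟨?_, hw, uΛ⟩
  have h1 := hen 0
  rw [deriv_zero_of_even hev] at h1
  simpa using h1

end Uniqueness

end

noncomputable section

/-! ### The amplitude dependence of the frequency -/

section Frequency

open scoped ContDiff

/-! ### Integrals of powers of the cosine over half a period. -/

theorem primitive_one_one : primitive (1 : C(unitInterval, ℝ)) 1 = 1 := by
  simp [primitive_one, extendI]

theorem primitive_cosI_nat (n : ℕ) (hn : n ≠ 0) : primitive (cosI (n * Real.pi)) 1 = 0 := by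
  rw [primitive_cosI_one (by positivity), Real.sin_nat_mul_pi, zero_div]

theorem cosI_two_apply (t : unitInterval) :
    Real.cos (2 * Real.pi * t) = 2 * Real.cos (Real.pi * t) ^ 2 - 1 := by
  rw [mul_assoc, Real.cos_two_mul]

theorem cosI_three_apply (t : unitInterval) :
    Real.cos (3 * Real.pi * t) = 4 * Real.cos (Real.pi * t) ^ 3 - 3 * Real.cos (Real.pi * t) := by
  rw [mul_assoc, Real.cos_three_mul]

theorem cosI_four_apply (t : unitInterval) :
    Real.cos (4 * Real.pi * t) = 2 * (2 * Real.cos (Real.pi * t) ^ 2 - 1) ^ 2 - 1 := by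
  rw [show 4 * Real.pi * (t : ℝ) = 2 * (2 * Real.pi * t) by ring, Real.cos_two_mul, cosI_two_apply]

theorem cosI_pi_sq : cosI Real.pi ^ 2 = (1 / 2 : ℝ) • (1 + cosI (2 * Real.pi)) := by
  ext t
  simp [cosI_two_apply]
  ring

theorem primitive_cosI_pi_sq : primitive (cosI Real.pi ^ 2) 1 = 1 / 2 := by
  have h := primitive_cosI_nat 2 two_ne_zero
  push_cast at h
  simp [cosI_pi_sq, primitive_one_one, h]

theorem primitive_cosI_pi_cube : primitive (cosI Real.pi ^ 3) 1 = 0 := by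
  have h1 := primitive_cosI_nat 1 one_ne_zero
  have h3 := primitive_cosI_nat 3 three_ne_zero
  push_cast at h1 h3
  rw [one_mul] at h1
  have : cosI Real.pi ^ 3 = (3 / 4 : ℝ) • cosI Real.pi + (1 / 4 : ℝ) • cosI (3 * Real.pi) := by
    ext t
    simp [cosI_three_apply]
    ring
  simp [this, h1, h3]

theorem primitive_cosI_pi_four : primitive (cosI Real.pi ^ 4) 1 = 3 / 8 := by
  have h2 := primitive_cosI_nat 2 two_ne_zero
  have h4 := primitive_cosI_nat 4 four_ne_zero
  push_cast at h2 h4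
  have : cosI Real.pi ^ 4 = (3 / 8 : ℝ) • 1 + (1 / 2 : ℝ) • cosI (2 * Real.pi) +
      (1 / 8 : ℝ) • cosI (4 * Real.pi) := by
    ext t
    simp [cosI_two_apply, cosI_four_apply]
    ring
  simp [this, h2, h4, primitive_one_one]

theorem primitive_cosI_pi_sq_mul : primitive (cosI Real.pi ^ 2 * cosI (2 * Real.pi)) 1 = 1 / 4 := by
  have h2 := primitive_cosI_nat 2 two_ne_zero
  have h4 := primitive_cosI_nat 4 four_ne_zero
  push_cast at h2 h4
  have : cosI Real.pi ^ 2 * cosI (2 * Real.pi) = (1 / 4 : ℝ) • 1 + (1 / 2 : ℝ) • cosI (2 * Real.pi) +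
      (1 / 4 : ℝ) • cosI (4 * Real.pi) := by
    ext t
    simp [cosI_two_apply, cosI_four_apply]
    ring
  simp [this, h2, h4, primitive_one_one]

/-- Fourier coefficients of solutions of a Neumann problem. -/
theorem HasAccel.mul_cosI {X F : C(unitInterval, ℝ)} {Λ : ℝ} (h : HasAccel X 0 (-Λ • F))
    (hF : primitive F 1 = 0) (n : ℕ) (hn : n ≠ 0) :
    (n * Real.pi) ^ 2 * primitive (X * cosI (n * Real.pi)) 1 =
      Λ * primitive (F * cosI (n * Real.pi)) 1 := by
  have h1 := h.green (hasAccel_cosI (n * Real.pi))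
  have e : X * (-((n * Real.pi) ^ 2) • cosI (n * Real.pi)) - -Λ • F * cosI (n * Real.pi) =
      -((n * Real.pi) ^ 2) • (X * cosI (n * Real.pi)) + Λ • (F * cosI (n * Real.pi)) := by
    ext t
    simp
  rw [e, map_add, map_smul, map_smul, map_smul, map_smul] at h1
  simp only [ContinuousMap.add_apply, ContinuousMap.smul_apply, hF, primitive_cosI_nat n hn] at h1
  simp only [smul_eq_mul] at h1
  linarith

/-- The second harmonics generated by a quadratic nonlinearity. -/
theorem primitive_mul_cosI_pi_sq {ψ : C(unitInterval, ℝ)} {l c d : ℝ} (hl : 0 < l) (hc : 0 < c)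
    (hcl : c < 4 * l) (h : HasAccel ψ 0 (-(Real.pi ^ 2 / l) • (c • ψ + d • cosI Real.pi ^ 2)))
    (h1 : primitive (c • ψ + d • cosI Real.pi ^ 2) 1 = 0) :
    primitive (ψ * cosI Real.pi ^ 2) 1 = -d / (4 * c) + d / (8 * (4 * l - c)) := by
  -- Since `cos² = (1 + cos 2πt) / 2`, only the mean and the second Fourier coefficient of `ψ` are
  -- needed. The mean follows from `h1`; the second coefficient involves `4l - c > 0`, the detuning
  -- from the second harmonic.
  have h2 := h.mul_cosI h1 2 two_ne_zero
  push_cast at h2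
  rw [add_mul, smul_mul_assoc, smul_mul_assoc, map_add, map_smul, map_smul] at h2
  simp only [ContinuousMap.add_apply, ContinuousMap.smul_apply, primitive_cosI_pi_sq_mul,
    smul_eq_mul] at h2
  rw [map_add, map_smul, map_smul] at h1
  simp only [ContinuousMap.add_apply, ContinuousMap.smul_apply, primitive_cosI_pi_sq,
    smul_eq_mul] at h1
  have e1 : primitive ψ 1 = -d / (2 * c) := by
    rw [eq_div_iff (by positivity)]
    linarith
  have e2 : primitive (ψ * cosI (2 * Real.pi)) 1 = d / (4 * (4 * l - c)) := by
    have : 0 < 4 * l - c := by linarith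
    rw [eq_div_iff (by positivity)]
    have hπ := Real.pi_pos
    field_simp at h2
    linarith
  rw [cosI_pi_sq, mul_smul_comm, mul_add, mul_one, map_smul, map_add]
  simp only [ContinuousMap.add_apply, ContinuousMap.smul_apply, e1, e2, smul_eq_mul]
  have : (4 * l - c) ≠ 0 := by linarith
  field_simp
  ring

/-- The integral form of the equation is closed under uniform limits. This yields the equations for
the first-order corrections of the branches from difference quotients. -/
theorem HasAccel.of_tendsto {α E : Type*} [NormedAddCommGroup E] [NormedSpace ℝ E] {l : Filter α}
    [l.NeBot] {f F : α → C(unitInterval, E)} {v : α → E} {f₀ F₀ : C(unitInterval, E)} {v₀ : E}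
    (hf : Tendsto f l (𝓝 f₀)) (hv : Tendsto v l (𝓝 v₀)) (hF : Tendsto F l (𝓝 F₀))
    (h : ∀ᶠ a in l, HasAccel (f a) (v a) (F a)) : HasAccel f₀ v₀ F₀ := by
  intro t
  have ev : ∀ (s : unitInterval) {g : α → C(unitInterval, E)} {g₀ : C(unitInterval, E)},
      Tendsto g l (𝓝 g₀) → Tendsto (fun a => g a s) l (𝓝 (g₀ s)) := fun s g g₀ hg =>
    ((by fun_prop : Continuous fun f : C(unitInterval, E) => f s).tendsto _).comp hg
  have hPP : Tendsto (fun a => primitive (primitive (F a))) l (𝓝 (primitive (primitive F₀))) :=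
    ((primitive.continuous.comp primitive.continuous).tendsto F₀).comp hF
  have h1 := ((ev 0 hf).add (hv.const_smul (t : ℝ))).add (ev t hPP)
  refine tendsto_nhds_unique_of_eventuallyEq (ev t hf) h1 (h.mono fun a ha => ha t)

theorem tendsto_primitive_apply {α : Type*} {l : Filter α} {f : α → C(unitInterval, ℝ)}
    {f₀ : C(unitInterval, ℝ)} (hf : Tendsto f l (𝓝 f₀)) (t : unitInterval) :
    Tendsto (fun a => primitive (f a) t) l (𝓝 (primitive f₀ t)) :=
  (((by fun_prop : Continuous fun f : C(unitInterval, ℝ) => f t).comp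
    primitive.continuous).tendsto f₀).comp hf

theorem IsPotential.forceQuot_eq {V : ℝ → ℝ} (hV : IsPotential V) (x : ℝ) :
    forceQuot V x = potentialCoeff V 2 + potentialCoeff V 3 * x + x ^ 2 * forceRem V x := by
  rcases eq_or_ne x 0 with rfl | hx
  · simp [hV.forceQuot_zero]
  · have h1 := hV.deriv_eq_cubic x
    rw [hV.deriv_eq] at h1
    apply mul_left_cancel₀ hx
    rw [h1]
    ring

theorem eventually_nem_forceQuot {V : ℝ → ℝ} (hV : IsPotential V) {E : Type*} [TopologicalSpace E]
    {c : E → ℝ} {u : E → C(unitInterval, ℝ)} {p : E} (hc : ContinuousAt c p)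
    (hu : ContinuousAt u p) (h0 : c p = 0) :
    ∀ᶠ x in 𝓝 p, ∀ t, nem (forceQuot V) (c x • u x) t = potentialCoeff V 2 +
      potentialCoeff V 3 * (c x * u x t) +
        (c x * u x t) ^ 2 * nem (forceRem V) (c x • u x) t := by
  filter_upwards [eventually_nem_smul_apply hV.analyticAt_forceQuot hc hu h0,
    eventually_nem_smul_apply hV.analyticAt_forceRem hc hu h0] with x h1 h2 t
  rw [h1, h2, hV.forceQuot_eq]

theorem tendsto_nem_forceRem {V : ℝ → ℝ} (hV : IsPotential V) {u : ℝ → C(unitInterval, ℝ)}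
    (hu : ContDiffAt ℝ ω u 0) (c : ℝ) :
    Tendsto (fun r => nem (forceRem V) ((c * r) • u r)) (𝓝[≠] 0)
      (𝓝 (potentialCoeff V 4 • 1)) := by
  have h1 := (contDiffAt_nem_smul hV.analyticAt_forceRem (c := fun r : ℝ => c * r) (u := u)
    (p := (0 : ℝ)) (by fun_prop) hu (by simp)).continuousAt.tendsto
  simp only [mul_zero, zero_smul, nem_zero, hV.forceRem_zero] at h1
  exact h1.mono_left nhdsWithin_le_nhds

theorem tendsto_inv_smul_sub {E : Type*} [NormedAddCommGroup E] [NormedSpace ℝ E] {X : ℝ → E}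
    (h : ContDiffAt ℝ ω X 0) :
    Tendsto (fun r => r⁻¹ • (X r - X 0)) (𝓝[≠] 0) (𝓝 (deriv X 0)) := by
  have := hasDerivAt_iff_tendsto_slope_zero.1 (h.differentiableAt (by simp)).hasDerivAt
  simpa using this

theorem HasAccel.smul {E : Type*} [NormedAddCommGroup E] [NormedSpace ℝ E]
    {f F : C(unitInterval, E)} {v : E} (h : HasAccel f v F) (c : ℝ) :
    HasAccel (c • f) (c • v) (c • F) := fun t => by
  rw [map_smul, map_smul]
  simp only [ContinuousMap.smul_apply]
  rw [h t, smul_add, smul_add, smul_comm]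

theorem HasAccel.sub {E : Type*} [NormedAddCommGroup E] [NormedSpace ℝ E]
    {f F g G : C(unitInterval, E)} {v w : E} (h : HasAccel f v F) (h' : HasAccel g w G) :
    HasAccel (f - g) (v - w) (F - G) := fun t => by
  rw [map_sub, map_sub]
  simp only [ContinuousMap.sub_apply]
  rw [h t, h' t, smul_sub]
  abel

variable {V W : ℝ → ℝ} {X₀ Xπ : ℝ → C(unitInterval, ℝ)} {Λ : ℝ → ℝ}

theorem tendsto_of_contDiffAt {E : Type*} [NormedAddCommGroup E] [NormedSpace ℝ E] {X : ℝ → E}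
    (h : ContDiffAt ℝ ω X 0) : Tendsto X (𝓝[≠] 0) (𝓝 (X 0)) :=
  h.continuousAt.tendsto.mono_left nhdsWithin_le_nhds

/-- Testing the out-of-phase equation with `cos πt` isolates the frequency: if the force is `Ω X_π +
r² G_π`, then `(π²/Λ - Ω)/r²` is the quotient of the integrals of `G_π cos πt` and `X_π cos πt`.
Quartic terms contribute through the integral `3/8` of `cos⁴`. The cubic coefficient of `V` acts
only through the in-phase response `X₀ ≈ rψ`, where `ψ` is driven by `v₃ cos²`. -/
theorem IsModeBranch.tendsto_frequency (hV : IsPotential V) (hW : IsPotential W)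
    (hb : IsModeBranch V W X₀ Xπ Λ) :
    Tendsto (fun r => (Real.pi ^ 2 / Λ r - piFreqSq V W) / r ^ 2) (𝓝[≠] 0)
      (𝓝 ((3 * (potentialCoeff V 4 + 16 * potentialCoeff W 4) +
        2 * potentialCoeff V 3 ^ 2 / (3 * potentialCoeff V 2 + 16 * potentialCoeff W 2) -
        4 * potentialCoeff V 3 ^ 2 / potentialCoeff V 2) / 4)) := by
  have hΩ := piFreqSq_pos hV hW
  have hv := hV.coeff_two_pos
  have hw := hW.coeff_two_pos
  have c0 := hb.contDiffAt_zero.continuousAt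
  have cπ := hb.contDiffAt_pi.continuousAt
  have lt : (𝓝[≠] (0 : ℝ)) ≤ 𝓝 0 := nhdsWithin_le_nhds
  have t0 : Tendsto X₀ (𝓝[≠] 0) (𝓝 0) := by
    have := tendsto_of_contDiffAt hb.contDiffAt_zero
    rwa [hb.zero_zero] at this
  have tπ : Tendsto Xπ (𝓝[≠] 0) (𝓝 (cosI Real.pi)) := by
    have := tendsto_of_contDiffAt hb.contDiffAt_pi
    rwa [hb.pi_zero] at this
  have tΛ : Tendsto Λ (𝓝[≠] 0) (𝓝 (Real.pi ^ 2 / piFreqSq V W)) := by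
    have := tendsto_of_contDiffAt hb.contDiffAt_time
    rwa [hb.time_zero] at this
  have tr : Tendsto (fun r : ℝ => r) (𝓝[≠] 0) (𝓝 0) := lt
  set ψ := deriv X₀ 0 with hψ
  have tψ : Tendsto (fun r => r⁻¹ • X₀ r) (𝓝[≠] 0) (𝓝 ψ) := by
    simpa [hb.zero_zero] using tendsto_inv_smul_sub hb.contDiffAt_zero
  have q1 := eventually_nem_forceQuot hV (p := (0 : ℝ)) (c := fun r => r)
    (u := fun r => X₀ r + Xπ r) (by fun_prop) (by fun_prop) rfl
  have q2 := eventually_nem_forceQuot hV (p := (0 : ℝ)) (c := fun r => r)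
    (u := fun r => X₀ r - Xπ r) (by fun_prop) (by fun_prop) rfl
  have q3 := eventually_nem_forceQuot hW (p := (0 : ℝ)) (c := fun r => r)
    (u := fun r => (2 : ℝ) • Xπ r) (by fun_prop) (by fun_prop) rfl
  have q4 := eventually_nem_forceQuot hW (p := (0 : ℝ)) (c := fun r => r)
    (u := fun r => (-2 : ℝ) • Xπ r) (by fun_prop) (by fun_prop) rfl
  have R1 := tendsto_nem_forceRem hV (hb.contDiffAt_zero.add hb.contDiffAt_pi) 1
  have R2 := tendsto_nem_forceRem hV (hb.contDiffAt_zero.sub hb.contDiffAt_pi) 1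
  have R3 := tendsto_nem_forceRem hW (hb.contDiffAt_pi.const_smul (2 : ℝ)) 1
  have R4 := tendsto_nem_forceRem hW (hb.contDiffAt_pi.const_smul (-2 : ℝ)) 1
  simp only [one_mul] at R1 R2 R3 R4
  set S1 := fun r => nem (forceRem V) (r • (X₀ + Xπ) r)
  set S2 := fun r => nem (forceRem V) (r • (X₀ - Xπ) r)
  set S3 := fun r => nem (forceRem W) (r • ((2 : ℝ) • Xπ) r)
  set S4 := fun r => nem (forceRem W) (r • ((-2 : ℝ) • Xπ) r)
  -- By parity, the quadratic part of `V'` contributes `X₀² + X_π²` in phase but only `2 X₀ X_π` out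
  -- of phase, and the quadratic part of `W'` cancels. As `X₀ = O(r)`, the in-phase force is `r G₀`
  -- and the out-of-phase force is `Ω X_π + r² G_π`, with convergent `G₀` and `G_π`.
  set G0 : ℝ → C(unitInterval, ℝ) := fun r => potentialCoeff V 2 • (r⁻¹ • X₀ r) +
    potentialCoeff V 3 • (X₀ r ^ 2 + Xπ r ^ 2) +
    r • ((1 / 2 : ℝ) • ((X₀ r + Xπ r) ^ 3 * S1 r + (X₀ r - Xπ r) ^ 3 * S2 r)) with hG0
  set Gπ : ℝ → C(unitInterval, ℝ) := fun r =>
    (2 * potentialCoeff V 3) • ((r⁻¹ • X₀ r) * Xπ r) +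
    (1 / 2 : ℝ) • ((X₀ r + Xπ r) ^ 3 * S1 r - (X₀ r - Xπ r) ^ 3 * S2 r) +
    (8 : ℝ) • (Xπ r ^ 3 * (S3 r + S4 r)) with hGπ
  have tG0 : Tendsto G0 (𝓝[≠] 0) (𝓝 (potentialCoeff V 2 • ψ +
      potentialCoeff V 3 • cosI Real.pi ^ 2)) := by
    have := ((tψ.const_smul (potentialCoeff V 2)).add
      (((t0.pow 2).add (tπ.pow 2)).const_smul (potentialCoeff V 3))).add
      (tr.smul (((((t0.add tπ).pow 3).mul R1).add (((t0.sub tπ).pow 3).mul R2)).const_smul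
        (1 / 2 : ℝ)))
    convert! this using 2
    simp
  have tGπ : Tendsto Gπ (𝓝[≠] 0) (𝓝 ((2 * potentialCoeff V 3) • (ψ * cosI Real.pi) +
      (potentialCoeff V 4 + 16 * potentialCoeff W 4) • cosI Real.pi ^ 3)) := by
    have := (((tψ.mul tπ).const_smul (2 * potentialCoeff V 3)).add
      (((((t0.add tπ).pow 3).mul R1).sub (((t0.sub tπ).pow 3).mul R2)).const_smul
        (1 / 2 : ℝ))).add (((tπ.pow 3).mul (R3.add R4)).const_smul (8 : ℝ))
    convert! this using 2
    ext t
    simp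
    ring
  have hf0 : ∀ᶠ r in 𝓝[≠] 0, dimerForceZero V (r, X₀ r, Xπ r) = r • G0 r := by
    filter_upwards [lt q1, lt q2, self_mem_nhdsWithin] with r q1 q2 hr
    have hr : r ≠ 0 := hr
    ext t
    have q1 := q1 t
    have q2 := q2 t
    simp only [dimerForceZero, hG0, S1, S2, ContinuousMap.smul_apply, ContinuousMap.add_apply,
      ContinuousMap.sub_apply, ContinuousMap.mul_apply, ContinuousMap.pow_apply, smul_eq_mul,
      Pi.add_apply, Pi.sub_apply] at q1 q2 ⊢
    rw [q1, q2]
    field_simp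
    ring
  have hfπ : ∀ᶠ r in 𝓝[≠] 0, dimerForcePi V W (r, X₀ r, Xπ r) =
      piFreqSq V W • Xπ r + r ^ 2 • Gπ r := by
    filter_upwards [lt q1, lt q2, lt q3, lt q4, self_mem_nhdsWithin] with r q1 q2 q3 q4 hr
    have hr : r ≠ 0 := hr
    ext t
    have q1 := q1 t
    have q2 := q2 t
    have q3 := q3 t
    have q4 := q4 t
    simp only [dimerForcePi, hGπ, S1, S2, S3, S4, ContinuousMap.smul_apply,
      ContinuousMap.add_apply,
      ContinuousMap.sub_apply, ContinuousMap.mul_apply, ContinuousMap.pow_apply, smul_eq_mul,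
      Pi.add_apply, Pi.sub_apply, Pi.smul_apply, piFreqSq] at q1 q2 q3 q4 ⊢
    rw [q1, q2, q3, q4]
    field_simp
    ring
  -- This is the in-phase equation divided by `r`, in the limit `r → 0`.
  have hψ1 : HasAccel ψ 0 (-(Real.pi ^ 2 / piFreqSq V W) • (potentialCoeff V 2 • ψ +
      potentialCoeff V 3 • cosI Real.pi ^ 2)) := by
    refine HasAccel.of_tendsto (v := fun _ => 0) tψ tendsto_const_nhds (tΛ.neg.smul tG0) ?_
    filter_upwards [hf0, lt hb.sol, self_mem_nhdsWithin] with r h1 h2 hr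
    have hr : r ≠ 0 := hr
    have := h2.accel_zero.smul r⁻¹
    rw [h1, smul_zero] at this
    convert! this using 1
    ext t
    simp
    field_simp
  have hψ2 : primitive (potentialCoeff V 2 • ψ + potentialCoeff V 3 • cosI Real.pi ^ 2) 1 = 0 := by
    refine tendsto_nhds_unique (tendsto_primitive_apply tG0 1) (tendsto_const_nhds.congr' ?_)
    filter_upwards [hf0, lt hb.sol, self_mem_nhdsWithin] with r h1 h2 hr
    have h3 := h2.velocity_zero
    rw [h1, map_smul, ContinuousMap.smul_apply, smul_eq_mul] at h3
    exact ((mul_eq_zero.1 h3).resolve_left hr).symm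
  have key := primitive_mul_cosI_pi_sq hΩ hv (by rw [piFreqSq]; linarith) hψ1 hψ2
  have t1 := tendsto_primitive_apply (tπ.mul (tendsto_const_nhds (x := cosI Real.pi))) 1
  have t2 := tendsto_primitive_apply (tGπ.mul (tendsto_const_nhds (x := cosI Real.pi))) 1
  rw [← sq, primitive_cosI_pi_sq] at t1
  have e2 : primitive (((2 * potentialCoeff V 3) • (ψ * cosI Real.pi) +
      (potentialCoeff V 4 + 16 * potentialCoeff W 4) • cosI Real.pi ^ 3) * cosI Real.pi) 1 =
      2 * potentialCoeff V 3 * (-potentialCoeff V 3 / (4 * potentialCoeff V 2) +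
        potentialCoeff V 3 / (8 * (4 * piFreqSq V W - potentialCoeff V 2))) +
      (potentialCoeff V 4 + 16 * potentialCoeff W 4) * (3 / 8) := by
    rw [← key, ← primitive_cosI_pi_four, add_mul, smul_mul_assoc, smul_mul_assoc, map_add,
      map_smul, map_smul, mul_assoc, ← sq, ← pow_succ]
    rfl
  rw [e2] at t2
  have t3 := t2.div t1 (by norm_num)
  have e3 : 4 * piFreqSq V W - potentialCoeff V 2 =
      3 * potentialCoeff V 2 + 16 * potentialCoeff W 2 := by rw [piFreqSq]; ring
  rw [e3] at t3
  refine Tendsto.congr' ?_ (t3.trans_eq ?_)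
  · filter_upwards [hfπ, lt hb.sol, lt (hb.eventually_time_pos hV hW), self_mem_nhdsWithin,
      t1.eventually (lt_mem_nhds (by norm_num : (0 : ℝ) < 1 / 2))] with r h1 h2 h3 hr h4
    have hr : r ≠ 0 := hr
    have h5 := h2.accel_pi.mul_cosI h2.velocity_pi 1 one_ne_zero
    simp only [Nat.cast_one, one_mul] at h5
    rw [h1, add_mul, smul_mul_assoc, smul_mul_assoc, map_add, map_smul, map_smul] at h5
    simp only [ContinuousMap.add_apply, ContinuousMap.smul_apply, smul_eq_mul] at h5
    rw [Pi.div_apply, div_eq_div_iff h4.ne' (pow_ne_zero _ hr)]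
    field_simp
    linarith
  · congr 1
    field_simp
    ring

/-- Here the quadratic term of the force already acts at first order in the amplitude, but it does
not shift the frequency at that order because `cos³` has zero integral. Its effect appears at second
order, through the first-order correction `ψ` of the profile. -/
theorem IsOnsiteBranch.tendsto_frequency (hV : IsPotential V) (hb : IsOnsiteBranch V X₀ Xπ Λ) :
    Tendsto (fun r => (Real.pi ^ 2 / Λ r - potentialCoeff V 2) / r ^ 2) (𝓝[≠] 0)
      (𝓝 ((9 * potentialCoeff V 2 * potentialCoeff V 4 - 10 * potentialCoeff V 3 ^ 2) /
        (12 * potentialCoeff V 2))) := by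
  have hv := hV.coeff_two_pos
  have cπ := hb.contDiffAt_pi.continuousAt
  have lt : (𝓝[≠] (0 : ℝ)) ≤ 𝓝 0 := nhdsWithin_le_nhds
  have tπ : Tendsto Xπ (𝓝[≠] 0) (𝓝 (cosI Real.pi)) := by
    have := tendsto_of_contDiffAt hb.contDiffAt_pi
    rwa [hb.pi_zero] at this
  have tΛ : Tendsto Λ (𝓝[≠] 0) (𝓝 (Real.pi ^ 2 / potentialCoeff V 2)) := by
    have := tendsto_of_contDiffAt hb.contDiffAt_time
    rwa [hb.time_zero] at this
  have tr : Tendsto (fun r : ℝ => r) (𝓝[≠] 0) (𝓝 0) := lt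
  set ψ := deriv Xπ 0 with hψ
  have tψ : Tendsto (fun r => r⁻¹ • (Xπ r - cosI Real.pi)) (𝓝[≠] 0) (𝓝 ψ) := by
    simpa [hb.pi_zero] using tendsto_inv_smul_sub hb.contDiffAt_pi
  have q1 := eventually_nem_forceQuot hV (p := (0 : ℝ)) (c := fun r => r)
    (u := fun r => Xπ r) (by fun_prop) (by fun_prop) rfl
  have R1 := tendsto_nem_forceRem hV hb.contDiffAt_pi 1
  simp only [one_mul] at R1
  set S1 := fun r => nem (forceRem V) (r • Xπ r)
  set G : ℝ → C(unitInterval, ℝ) := fun r => potentialCoeff V 3 • Xπ r ^ 2 +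
    r • (Xπ r ^ 3 * S1 r) with hG
  have tG : Tendsto G (𝓝[≠] 0) (𝓝 (potentialCoeff V 3 • cosI Real.pi ^ 2)) := by
    have := ((tπ.pow 2).const_smul (potentialCoeff V 3)).add (tr.smul ((tπ.pow 3).mul R1))
    convert! this using 2
    simp
  have hf : ∀ᶠ r in 𝓝[≠] 0, onsiteForce V (r, X₀ r, Xπ r) =
      potentialCoeff V 2 • Xπ r + r • G r := by
    filter_upwards [lt q1] with r q1
    ext t
    simp only [onsiteForce, hG, S1, ContinuousMap.smul_apply, ContinuousMap.add_apply,
      ContinuousMap.mul_apply, ContinuousMap.pow_apply, smul_eq_mul, q1]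
    ring
  have t1 := tendsto_primitive_apply (tπ.mul (tendsto_const_nhds (x := cosI Real.pi))) 1
  rw [← sq, primitive_cosI_pi_sq] at t1
  have hpos := t1.eventually (lt_mem_nhds (by norm_num : (0 : ℝ) < 1 / 2))
  have fund : ∀ᶠ r in 𝓝[≠] 0, (Real.pi ^ 2 / Λ r - potentialCoeff V 2) =
      r * (primitive (G r * cosI Real.pi) 1 / primitive (Xπ r * cosI Real.pi) 1) := by
    filter_upwards [hf, lt hb.sol, lt (hb.eventually_time_pos hV), hpos] with r h1 h2 h3 h4
    have h5 := h2.accel_pi.mul_cosI h2.velocity_pi 1 one_ne_zero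
    simp only [Nat.cast_one, one_mul] at h5
    rw [h1, add_mul, smul_mul_assoc, smul_mul_assoc, map_add, map_smul, map_smul] at h5
    simp only [ContinuousMap.add_apply, ContinuousMap.smul_apply, smul_eq_mul] at h5
    field_simp
    linarith
  have tg := (tendsto_primitive_apply (tG.mul (tendsto_const_nhds (x := cosI Real.pi))) 1).div t1
    (by norm_num)
  rw [smul_mul_assoc, ← pow_succ, map_smul, ContinuousMap.smul_apply, primitive_cosI_pi_cube,
    smul_zero, zero_div] at tg
  -- The vanishing integral of `cos³` gives `π² - v₂ Λ = o(r)`, so the variation of the period drops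
  -- out of the equation for `ψ`.
  have hΛ0 : Tendsto (fun r => r⁻¹ * (Real.pi ^ 2 - potentialCoeff V 2 * Λ r)) (𝓝[≠] 0) (𝓝 0) := by
    have := tg.mul tΛ
    rw [zero_mul] at this
    refine this.congr' ?_
    filter_upwards [fund, lt (hb.eventually_time_pos hV), self_mem_nhdsWithin] with r h1 h2 hr
    have hr : r ≠ 0 := hr
    simp only [Pi.div_apply]
    field_simp at h1 ⊢
    linarith
  have hψ1 : HasAccel ψ 0 (-(Real.pi ^ 2 / potentialCoeff V 2) • (potentialCoeff V 2 • ψ +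
      potentialCoeff V 3 • cosI Real.pi ^ 2)) := by
    have tF := (tΛ.neg.smul ((tψ.const_smul (potentialCoeff V 2)).add tG)).add
      (hΛ0.smul_const (cosI Real.pi))
    rw [zero_smul, add_zero] at tF
    refine HasAccel.of_tendsto (v := fun _ => 0) tψ tendsto_const_nhds tF ?_
    filter_upwards [hf, lt hb.sol, self_mem_nhdsWithin] with r h1 h2 hr
    have hr : r ≠ 0 := hr
    have := (h2.accel_pi.sub (hasAccel_cosI Real.pi)).smul r⁻¹
    rw [h1, sub_zero, smul_zero] at this
    convert! this using 1
    ext t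
    simp
    field_simp
    ring
  have hψ2 : primitive (potentialCoeff V 2 • ψ + potentialCoeff V 3 • cosI Real.pi ^ 2) 1 = 0 := by
    refine tendsto_nhds_unique (tendsto_primitive_apply
      ((tψ.const_smul (potentialCoeff V 2)).add tG) 1) (tendsto_const_nhds.congr' ?_)
    filter_upwards [hf, lt hb.sol, self_mem_nhdsWithin] with r h1 h2 hr
    have hr : r ≠ 0 := hr
    have h3 := h2.velocity_pi
    have h4 := primitive_cosI_nat 1 one_ne_zero
    simp only [Nat.cast_one, one_mul] at h4
    rw [h1] at h3
    simp only [map_add, map_smul, map_sub, ContinuousMap.add_apply, ContinuousMap.smul_apply,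
      ContinuousMap.sub_apply, smul_eq_mul, h4, sub_zero] at h3 ⊢
    apply mul_left_cancel₀ hr
    rw [mul_zero]
    rw [← h3]
    field_simp
  have key := primitive_mul_cosI_pi_sq hv hv (by linarith) hψ1 hψ2
  -- After subtraction of `v₃ cos²`, whose product with the cosine integrates to zero, `G` is
  -- divisible by `r`; `K` is the quotient, written with `X² - cos² = (X - cos)(X + cos)`.
  set K : ℝ → C(unitInterval, ℝ) := fun r =>
    potentialCoeff V 3 • ((r⁻¹ • (Xπ r - cosI Real.pi)) * (Xπ r + cosI Real.pi)) +
      Xπ r ^ 3 * S1 r with hK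
  have tK : Tendsto K (𝓝[≠] 0) (𝓝 (potentialCoeff V 3 • (ψ * (cosI Real.pi + cosI Real.pi)) +
      cosI Real.pi ^ 3 * (potentialCoeff V 4 • 1))) :=
    ((tψ.mul (tπ.add tendsto_const_nhds)).const_smul _).add ((tπ.pow 3).mul R1)
  have t2 := (tendsto_primitive_apply (tK.mul (tendsto_const_nhds (x := cosI Real.pi))) 1).div t1
    (by norm_num)
  have e2 : primitive ((potentialCoeff V 3 • (ψ * (cosI Real.pi + cosI Real.pi)) +
      cosI Real.pi ^ 3 * (potentialCoeff V 4 • 1)) * cosI Real.pi) 1 =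
      2 * potentialCoeff V 3 * (-potentialCoeff V 3 / (4 * potentialCoeff V 2) +
        potentialCoeff V 3 / (8 * (4 * potentialCoeff V 2 - potentialCoeff V 2))) +
      potentialCoeff V 4 * (3 / 8) := by
    rw [← key, ← primitive_cosI_pi_four]
    have : (potentialCoeff V 3 • (ψ * (cosI Real.pi + cosI Real.pi)) +
      cosI Real.pi ^ 3 * (potentialCoeff V 4 • 1)) * cosI Real.pi =
      (2 * potentialCoeff V 3) • (ψ * cosI Real.pi ^ 2) +
        potentialCoeff V 4 • cosI Real.pi ^ 4 := by
      ext t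
      simp
      ring
    rw [this, map_add, map_smul, map_smul]
    rfl
  rw [e2] at t2
  refine Tendsto.congr' ?_ (t2.trans_eq ?_)
  · filter_upwards [fund, self_mem_nhdsWithin, hpos] with r h1 hr h4
    have hr : r ≠ 0 := hr
    have e : G r * cosI Real.pi = potentialCoeff V 3 • cosI Real.pi ^ 3 +
        r • (K r * cosI Real.pi) := by
      ext t
      simp [hG, hK]
      field_simp
      ring
    rw [h1, e, map_add, map_smul, map_smul]
    simp only [ContinuousMap.add_apply, ContinuousMap.smul_apply, primitive_cosI_pi_cube,
      smul_eq_mul, Pi.div_apply]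
    field_simp
    ring
  · congr 1
    field_simp
    ring

end Frequency

end

noncomputable section

/-! ### Isochronism -/

section Isochronism

/-- The first-order coefficient is unique: it can only be the limit of the difference quotient. -/
theorem isochronousUpToOrder_one_iff {w : ℝ → ℝ} {Ω g : ℝ}
    (h : Tendsto (fun ε => (w ε ^ 2 - Ω) / ε) (𝓝[>] 0) (𝓝 g)) :
    IsochronousUpToOrder w Ω 1 ↔ g ≠ 0 := by
  have key : ∀ γ : ℝ, (fun ε => w ε ^ 2 - Ω - γ * ε ^ 1) =o[𝓝[>] 0] (fun ε => ε ^ 1) ↔ γ = g := by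
    intro γ
    rw [isLittleO_iff_tendsto' (by
      filter_upwards [self_mem_nhdsWithin] with ε hε h0
      have : (0 : ℝ) < ε := hε
      simp only [pow_one] at h0
      linarith)]
    have h1 : Tendsto (fun ε => (w ε ^ 2 - Ω - γ * ε ^ 1) / ε ^ 1) (𝓝[>] 0) (𝓝 (g - γ)) := by
      refine (h.sub_const γ).congr' ?_
      filter_upwards [self_mem_nhdsWithin] with ε hε
      have : (0 : ℝ) < ε := hε
      field_simp
    refine ⟨fun h2 => ?_, fun h2 => ?_⟩
    · have := tendsto_nhds_unique h1 h2
      linarith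
    · simpa [h2] using h1
  constructor
  · rintro ⟨γ, h0, h1⟩
    rwa [← (key γ).1 h1]
  · exact fun h0 => ⟨g, h0, (key g).2 rfl⟩

/-- A shift of order `ε ^ n` with `n ≥ 2`, divided by `ε`, tends to `0`. -/
theorem PartiallyIsochronous.eq_zero {w : ℝ → ℝ} {Ω g : ℝ} (hp : PartiallyIsochronous w Ω)
    (h : Tendsto (fun ε => (w ε ^ 2 - Ω) / ε) (𝓝[>] 0) (𝓝 g)) : g = 0 := by
  rcases hp with ⟨n, hn, γ, -, h1⟩ | hp
  · have ht : Tendsto (fun ε : ℝ => ε ^ (n - 1)) (𝓝[>] 0) (𝓝 0) := by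
      have : Tendsto (fun ε : ℝ => ε ^ (n - 1)) (𝓝 0) (𝓝 (0 ^ (n - 1))) :=
        (continuous_pow (n - 1)).tendsto 0
      rw [zero_pow (by omega)] at this
      exact this.mono_left nhdsWithin_le_nhds
    have h2 := (h1.tendsto_div_nhds_zero.add_const γ).mul ht
    rw [mul_zero] at h2
    refine tendsto_nhds_unique h (h2.congr' ?_)
    filter_upwards [self_mem_nhdsWithin] with ε hε
    have : (0 : ℝ) < ε := hε
    have e : ε ^ n = ε ^ (n - 1) * ε := by rw [← pow_succ]; congr 1; omega
    rw [e]
    field_simp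
    ring
  · refine tendsto_nhds_unique h (tendsto_const_nhds.congr' ?_)
    filter_upwards [hp] with ε h
    simp [h]

/-- The energy dependence of the frequency, from its amplitude dependence. -/
theorem tendsto_frequency_energy {Λ e κ w r : ℝ → ℝ} {Ω b : ℝ} (hΩ : 0 < Ω)
    (hκ : ContinuousAt κ 0) (hκ0 : κ 0 = Ω / 2) (he : ∀ r, e r = r ^ 2 * κ r)
    (hb : Tendsto (fun r => (Real.pi ^ 2 / Λ r - Ω) / r ^ 2) (𝓝[≠] 0) (𝓝 b))
    (hr : Tendsto r (𝓝[>] 0) (𝓝[>] 0))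
    (h : ∀ᶠ ε in 𝓝[>] 0, e (r ε) = ε ∧ 0 < w ε ∧ (Real.pi / w ε) ^ 2 = Λ (r ε)) :
    Tendsto (fun ε => (w ε ^ 2 - Ω) / ε) (𝓝[>] 0) (𝓝 (2 * b / Ω)) := by
  have hr' : Tendsto r (𝓝[>] 0) (𝓝[≠] 0) :=
    hr.mono_right (nhdsWithin_mono _ fun x hx => ne_of_gt hx)
  have h1 : Tendsto (fun ε => κ (r ε)) (𝓝[>] 0) (𝓝 (Ω / 2)) := by
    rw [← hκ0]
    exact hκ.tendsto.comp (tendsto_nhds_of_tendsto_nhdsWithin hr)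
  have h2 := (hb.comp hr').div h1 (by positivity)
  have e1 : b / (Ω / 2) = 2 * b / Ω := by field_simp
  rw [e1] at h2
  refine h2.congr' ?_
  filter_upwards [h, hr.eventually self_mem_nhdsWithin] with ε ⟨h3, h4, h5⟩ hr
  have hr : 0 < r ε := hr
  have hπ := Real.pi_pos
  rw [he] at h3
  simp only [Pi.div_apply, Function.comp_apply]
  rw [← h5, div_div, h3]
  congr 2
  field_simp

variable {V W : ℝ → ℝ}

theorem IsOutOfPhaseMode.isochronousUpToOrder_one_iff (hV : IsPotential V) (hW : IsPotential W)
    {Q₀ Qπ : ℝ → ℝ → ℝ} {w : ℝ → ℝ} (hm : IsOutOfPhaseMode V W Q₀ Qπ w) :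
    IsochronousUpToOrder w (piFreqSq V W) 1 ↔
      3 * (potentialCoeff V 4 + 16 * potentialCoeff W 4) +
        2 * potentialCoeff V 3 ^ 2 / (3 * potentialCoeff V 2 + 16 * potentialCoeff W 2) -
        4 * potentialCoeff V 3 ^ 2 / potentialCoeff V 2 ≠ 0 := by
  obtain ⟨X₀, Xπ, Λ, hb⟩ := exists_isModeBranch hV hW
  obtain ⟨κ, hκ, hκ0, he⟩ := hb.exists_energy_eq hV hW
  obtain ⟨hr, h⟩ := hm.eventually_eq_branch hV hW hb
  have hΩ := piFreqSq_pos hV hW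
  rw [_root_.isochronousUpToOrder_one_iff (tendsto_frequency_energy hΩ hκ.continuousAt hκ0 he
    (hb.tendsto_frequency hV hW) hr (h.mono fun ε h => ⟨h.1, h.2.2.2⟩))]
  simp [hΩ.ne']

theorem IsOnsiteMode.coeff_eq_of_partiallyIsochronous (hV : IsPotential V) {q : ℝ → ℝ → ℝ}
    {w : ℝ → ℝ} (hm : IsOnsiteMode V q w) (hp : PartiallyIsochronous w (potentialCoeff V 2)) :
    10 * potentialCoeff V 3 ^ 2 = 9 * potentialCoeff V 2 * potentialCoeff V 4 := by
  obtain ⟨X₀, X, Λ, hb⟩ := exists_isOnsiteBranch hV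
  obtain ⟨κ, hκ, hκ0, he⟩ := hV.exists_eq_sq_mul
  obtain ⟨hr, h⟩ := hm.eventually_eq_branch hV hb
  have hv := hV.coeff_two_pos
  have h1 := hp.eq_zero (tendsto_frequency_energy hv hκ.continuousAt hκ0 he
    (hb.tendsto_frequency hV) hr h)
  field_simp at h1
  linarith

end Isochronism

end

noncomputable section

/-! ### Fundamental solutions of linear second order equations -/

section Fundamental

open scoped ContDiff

variable {R : Type*} [NormedRing R] [NormedAlgebra ℝ R]

/-- The Volterra operator of `f'' = -A f`. -/
def volterra (A : C(unitInterval, R)) : C(unitInterval, R) →L[ℝ] C(unitInterval, R) :=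
  1 + primitive * primitive * ContinuousLinearMap.mul ℝ C(unitInterval, R) A

theorem volterra_apply (A f : C(unitInterval, R)) :
    volterra A f = f + primitive (primitive (A * f)) := rfl

theorem contDiff_primitive_mul {n : WithTop ℕ∞} {f : C(unitInterval, R) → C(unitInterval, R)}
    (hf : ContDiff ℝ n f) : ContDiff ℝ n fun A => primitive (A * f A) 1 := by
  have h : ContDiff ℝ n fun A => ContinuousLinearMap.mul ℝ C(unitInterval, R) A (f A) :=
    (ContinuousLinearMap.mul ℝ C(unitInterval, R)).contDiff.clm_apply hf
  exact ((ContinuousMap.evalCLM ℝ 1 : C(unitInterval, R) →L[ℝ] R).comp primitive).contDiff.comp h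

variable [CompleteSpace R]

theorem isUnit_volterra (A : C(unitInterval, R)) : IsUnit (volterra A) := by
  refine isUnit_one_add_primitive_primitive _ (M := ‖A‖) fun f t => ?_
  calc ‖(A * f) t‖ ≤ ‖A t‖ * ‖f t‖ := norm_mul_le _ _
    _ ≤ ‖A‖ * ‖f t‖ := by gcongr; exact A.norm_coe_le_norm t

theorem volterra_inverse (A f : C(unitInterval, R)) :
    volterra A (Ring.inverse (volterra A) f) = f := by
  have := Ring.mul_inverse_cancel _ (isUnit_volterra A)
  exact DFunLike.congr_fun this f

theorem volterra_injective (A : C(unitInterval, R)) : Function.Injective (volterra A) := by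
  intro f g h
  have := Ring.inverse_mul_cancel _ (isUnit_volterra A)
  have h' := congrArg (fun u => Ring.inverse (volterra A) u) h
  have e : ∀ f, Ring.inverse (volterra A) (volterra A f) = f := fun f => DFunLike.congr_fun this f
  simpa only [e] using h'

/-- The solution of `f'' = -A f`, `f(0) = 1`, `f'(0) = 0`. -/
def fundCos (A : C(unitInterval, R)) : C(unitInterval, R) := Ring.inverse (volterra A) 1

/-- The solution of `f'' = -A f`, `f(0) = 0`, `f'(0) = 1`. -/
def fundSin (A : C(unitInterval, R)) : C(unitInterval, R) :=
  Ring.inverse (volterra A) ⟨fun t => (t : ℝ) • (1 : R), by fun_prop⟩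

theorem fundCos_zero (A : C(unitInterval, R)) : fundCos A 0 = 1 := by
  have h := congrArg (fun f => f 0) (volterra_inverse A 1)
  rw [fundCos]
  simpa [volterra_apply, primitive_zero] using h

theorem fundSin_zero (A : C(unitInterval, R)) : fundSin A 0 = 0 := by
  have h := congrArg (fun f => f 0) (volterra_inverse A ⟨fun t => (t : ℝ) • (1 : R), by fun_prop⟩)
  rw [fundSin]
  simpa [volterra_apply, primitive_zero] using h

theorem hasAccel_fundCos (A : C(unitInterval, R)) :
    HasAccel (fundCos A) 0 (-(A * fundCos A)) := fun t => by
  have h := congrArg (fun f => f t) (volterra_inverse A 1)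
  simp only [volterra_apply, ContinuousMap.add_apply, ContinuousMap.one_apply] at h
  rw [fundCos_zero, map_neg, map_neg, ContinuousMap.neg_apply, fundCos, smul_zero, add_zero,
    eq_add_neg_iff_add_eq]
  exact h

theorem hasAccel_fundSin (A : C(unitInterval, R)) :
    HasAccel (fundSin A) 1 (-(A * fundSin A)) := fun t => by
  have h := congrArg (fun f => f t)
    (volterra_inverse A ⟨fun t => (t : ℝ) • (1 : R), by fun_prop⟩)
  simp only [volterra_apply, ContinuousMap.add_apply, ContinuousMap.coe_mk] at h
  rw [fundSin_zero, map_neg, map_neg, ContinuousMap.neg_apply, fundSin, zero_add,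
    eq_add_neg_iff_add_eq]
  exact h

theorem HasAccel.eq_of_eq {A f g : C(unitInterval, R)} {v : R} (hf : HasAccel f v (-(A * f)))
    (hg : HasAccel g v (-(A * g))) (h : f 0 = g 0) : f = g := by
  apply volterra_injective A
  ext t
  have h1 := hf t
  have h2 := hg t
  simp only [map_neg, ContinuousMap.neg_apply, eq_add_neg_iff_add_eq] at h1 h2
  simp only [volterra_apply, ContinuousMap.add_apply, h1, h2, h]

theorem primitive_map {E F : Type*} [NormedAddCommGroup E] [NormedSpace ℝ E] [CompleteSpace E]
    [NormedAddCommGroup F] [NormedSpace ℝ F] [CompleteSpace F] {f : C(unitInterval, E)}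
    {g : C(unitInterval, F)} (L : E →L[ℝ] F) (h : ∀ t, g t = L (f t)) (t : unitInterval) :
    primitive g t = L (primitive f t) := by
  rw [primitive_apply, primitive_apply, ← L.intervalIntegral_comp_comm
    ((continuous_extendI f).intervalIntegrable _ _)]
  exact intervalIntegral.integral_congr fun s _ => h _

theorem HasAccel.map {E F : Type*} [NormedAddCommGroup E] [NormedSpace ℝ E] [CompleteSpace E]
    [NormedAddCommGroup F] [NormedSpace ℝ F] [CompleteSpace F] {f G : C(unitInterval, E)} {v : E}
    (h : HasAccel f v G) (L : E →L[ℝ] F) {f' G' : C(unitInterval, F)} (hf : ∀ t, f' t = L (f t))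
    (hG : ∀ t, G' t = L (G t)) : HasAccel f' (L v) G' := fun t => by
  rw [hf, hf, primitive_map L (primitive_map L hG), h t, map_add, map_add, map_smul]

/-- The value of the cosine-like solution at the end of the interval. -/
def endCos (A : C(unitInterval, R)) : R := fundCos A 1

/-- The value of the sine-like solution at the end of the interval. -/
def endSin (A : C(unitInterval, R)) : R := fundSin A 1

/-- The derivative of the cosine-like solution at the end of the interval. -/
def endCosDeriv (A : C(unitInterval, R)) : R := -primitive (A * fundCos A) 1

/-- The derivative of the sine-like solution at the end of the interval. -/
def endSinDeriv (A : C(unitInterval, R)) : R := 1 - primitive (A * fundSin A) 1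

theorem HasAccel.mul_const {f F : C(unitInterval, R)} {v : R} (h : HasAccel f v F) (c : R) :
    HasAccel (f * ContinuousMap.const _ c) (v * c) (F * ContinuousMap.const _ c) :=
  h.map ((ContinuousLinearMap.mul ℝ R).flip c) (fun _ => rfl) fun _ => rfl

theorem HasAccel.add {E : Type*} [NormedAddCommGroup E] [NormedSpace ℝ E]
    {f F g G : C(unitInterval, E)} {v w : E} (h : HasAccel f v F) (h' : HasAccel g w G) :
    HasAccel (f + g) (v + w) (F + G) := fun t => by
  rw [map_add, map_add]
  simp only [ContinuousMap.add_apply]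
  rw [h t, h' t, smul_add]
  abel

/-- Every solution of `f'' = -A f` in terms of the fundamental solutions. -/
theorem HasAccel.eq_fund {A f : C(unitInterval, R)} {v : R} (hf : HasAccel f v (-(A * f))) :
    f = fundCos A * ContinuousMap.const _ (f 0) + fundSin A * ContinuousMap.const _ v := by
  refine hf.eq_of_eq ?_ (by simp [fundCos_zero, fundSin_zero])
  have := ((hasAccel_fundCos A).mul_const (f 0)).add ((hasAccel_fundSin A).mul_const v)
  rw [zero_mul, zero_add, one_mul] at this
  convert! this using 1
  ext t
  simp [mul_add, mul_assoc]
  abel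

theorem HasAccel.end_eq {A f : C(unitInterval, R)} {v : R} (hf : HasAccel f v (-(A * f))) :
    f 1 = endCos A * f 0 + endSin A * v ∧
      v - primitive (A * f) 1 = endCosDeriv A * f 0 + endSinDeriv A * v := by
  have h := hf.eq_fund
  have hp : ∀ (g : C(unitInterval, R)) (c : R), primitive (g * ContinuousMap.const _ c) =
      primitive g * ContinuousMap.const _ c := fun g c => by
    ext t
    exact primitive_map ((ContinuousLinearMap.mul ℝ R).flip c) (fun _ => rfl) t
  constructor
  · exact congrArg (fun f => f 1) h
  · have h1 : primitive (A * f) 1 = primitive (A * fundCos A) 1 * f 0 +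
        primitive (A * fundSin A) 1 * v := by
      conv_lhs => rw [h]
      rw [mul_add, ← mul_assoc, ← mul_assoc, map_add, hp, hp]
      rfl
    rw [h1, endCosDeriv, endSinDeriv]
    noncomm_ring

/-- Solutions depend analytically on the coefficient, since the Volterra operator is affine in `A`
and inversion is analytic on units. -/
theorem contDiff_inverse_volterra_apply (u : C(unitInterval, R)) {n : WithTop ℕ∞} :
    ContDiff ℝ n fun A : C(unitInterval, R) => Ring.inverse (volterra A) u := by
  rw [contDiff_iff_contDiffAt]
  intro A
  have h1 : ContDiffAt ℝ n (Ring.inverse : (C(unitInterval, R) →L[ℝ] C(unitInterval, R)) → _)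
      (volterra A) := by
    obtain ⟨U, hU⟩ := isUnit_volterra A
    rw [← hU]
    exact contDiffAt_ringInverse (R := C(unitInterval, R) →L[ℝ] C(unitInterval, R)) ℝ U
  have h2 : ContDiff ℝ n (volterra : C(unitInterval, R) → _) := by
    have h3 : ContDiff ℝ n ((ContinuousLinearMap.compL ℝ C(unitInterval, R) C(unitInterval, R)
        C(unitInterval, R) (primitive * primitive)).comp
          (ContinuousLinearMap.mul ℝ C(unitInterval, R))) := ContinuousLinearMap.contDiff _
    exact contDiff_const.add h3
  exact ((ContinuousLinearMap.apply ℝ C(unitInterval, R) u).contDiff.contDiffAt).comp A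
    (h1.comp A h2.contDiffAt)

theorem contDiff_fundCos {n : WithTop ℕ∞} : ContDiff ℝ n (fundCos : C(unitInterval, R) → _) :=
  contDiff_inverse_volterra_apply _

theorem contDiff_fundSin {n : WithTop ℕ∞} : ContDiff ℝ n (fundSin : C(unitInterval, R) → _) :=
  contDiff_inverse_volterra_apply _

theorem contDiff_apply_continuousMap {E : Type*} [NormedAddCommGroup E] [NormedSpace ℝ E]
    {n : WithTop ℕ∞} (t : unitInterval) :
    ContDiff ℝ n fun f : C(unitInterval, E) => f t :=
  (ContinuousMap.evalCLM ℝ t : C(unitInterval, E) →L[ℝ] E).contDiff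

theorem contDiff_endCos {n : WithTop ℕ∞} : ContDiff ℝ n (endCos : C(unitInterval, R) → R) :=
  (contDiff_apply_continuousMap 1).comp contDiff_fundCos

theorem contDiff_endSin {n : WithTop ℕ∞} : ContDiff ℝ n (endSin : C(unitInterval, R) → R) :=
  (contDiff_apply_continuousMap 1).comp contDiff_fundSin

theorem contDiff_endCosDeriv {n : WithTop ℕ∞} :
    ContDiff ℝ n (endCosDeriv : C(unitInterval, R) → R) :=
  (contDiff_primitive_mul contDiff_fundCos).neg

theorem contDiff_endSinDeriv {n : WithTop ℕ∞} :
    ContDiff ℝ n (endSinDeriv : C(unitInterval, R) → R) :=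
  contDiff_const.sub (contDiff_primitive_mul contDiff_fundSin)

/-- Conservation of the Wronskian of a solution and a solution of the adjoint equation. -/
theorem HasAccel.wronskian {A f g : C(unitInterval, R)} {v w : R}
    (hf : HasAccel f v (-(f * A))) (hg : HasAccel g w (-(A * g))) :
    f 1 * (w - primitive (A * g) 1) - (v - primitive (f * A) 1) * g 1 = f 0 * w - v * g 0 := by
  have h := hf.green hg
  have e : f * -(A * g) - -(f * A) * g = 0 := by
    ext t
    simp [mul_assoc]
  rw [e, map_zero, map_neg, map_neg, ContinuousMap.zero_apply, ContinuousMap.neg_apply,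
    ContinuousMap.neg_apply, ← sub_eq_add_neg, ← sub_eq_add_neg] at h
  exact (sub_eq_zero.1 h.symm)

end Fundamental

end

noncomputable section

/-! ### Half-period maps of self-adjoint equations -/

section HalfPeriod

open scoped ContDiff Matrix Matrix.Norms.L2Operator

/-- Complex two by two matrices. -/
abbrev CMat := Matrix (Fin 2) (Fin 2) ℂ

/-- A real-linear map on matrices, as a continuous linear map. -/
abbrev cmatMap {F : Type*} [NormedAddCommGroup F] [NormedSpace ℝ F] (L : CMat →ₗ[ℝ] F) :
    CMat →L[ℝ] F := LinearMap.toContinuousLinearMap L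

/-- The conjugate transpose as a real-linear map. -/
def starLin : CMat →ₗ[ℝ] CMat where
  toFun m := mᴴ
  map_add' := Matrix.conjTranspose_add
  map_smul' c m := by simp [Matrix.conjTranspose_smul]

theorem HasAccel.star {f F : C(unitInterval, CMat)} {v : CMat} (h : HasAccel f v F) :
    HasAccel (star f) vᴴ (star F) :=
  h.map (cmatMap starLin) (fun _ => rfl) fun _ => rfl

theorem primitive_star (f : C(unitInterval, CMat)) (t : unitInterval) :
    primitive (star f) t = (primitive f t)ᴴ :=
  primitive_map (cmatMap starLin) (fun _ => rfl) t

/-- For self-adjoint `A` the adjoint of the cosine-like solution solves the adjoint equation. Its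
Wronskian with the solution itself is constant, and it vanishes at `0`. -/
theorem endCos_wronskian {A : C(unitInterval, CMat)} (hA : star A = A) :
    (endCos A)ᴴ * endCosDeriv A = (endCosDeriv A)ᴴ * endCos A := by
  have h := (hasAccel_fundCos A).star
  rw [star_neg, star_mul, hA] at h
  have h1 := h.wronskian (hasAccel_fundCos A)
  have e : star (fundCos A) * A = star (A * fundCos A) := by rw [star_mul, hA]
  rw [e, primitive_star] at h1
  simp only [Matrix.conjTranspose_zero, zero_sub, mul_zero, zero_mul, sub_zero] at h1
  rw [sub_eq_zero] at h1
  rw [endCosDeriv, endCos, Matrix.conjTranspose_neg]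
  exact h1

theorem endSin_wronskian {A : C(unitInterval, CMat)} (hA : star A = A) :
    (endSin A)ᴴ * endSinDeriv A = (endSinDeriv A)ᴴ * endSin A := by
  have h := (hasAccel_fundSin A).star
  rw [star_neg, star_mul, hA] at h
  have h1 := h.wronskian (hasAccel_fundSin A)
  have e : star (fundSin A) * A = star (A * fundSin A) := by rw [star_mul, hA]
  have e0 : (star (fundSin A)) 0 = 0 := by
    rw [ContinuousMap.star_apply, fundSin_zero, star_zero]
  rw [e, primitive_star, e0, fundSin_zero, mul_zero, zero_mul, sub_zero, sub_eq_zero] at h1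
  rw [endSinDeriv, endSin, Matrix.conjTranspose_sub, Matrix.conjTranspose_one]
  rw [Matrix.conjTranspose_one] at h1
  exact h1

/-! #### Two by two matching problems -/

/-- The symmetry of the pair `(C, D)` persists when `C` is replaced by `X = C + l D`. Multiplication
by the inverses of `Xᴴ` and `X` then turns it into self-adjointness of `D X⁻¹`. The shift by `l` is
needed because `C` alone may be singular. -/
theorem isHermitian_mul_inv {C D : CMat} {l : ℝ} (h : Cᴴ * D = Dᴴ * C)
    (hX : (C + l • D).det ≠ 0) : (D * (C + l • D)⁻¹)ᴴ = D * (C + l • D)⁻¹ := by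
  set X := C + l • D with hXdef
  have hu : IsUnit X.det := isUnit_iff_ne_zero.2 hX
  have h1 : Xᴴ * D = Dᴴ * X := by
    rw [hXdef, Matrix.conjTranspose_add, Matrix.conjTranspose_smul, add_mul, mul_add, h]
    simp
  have hu' : IsUnit Xᴴ.det := by rw [Matrix.det_conjTranspose]; exact hu.star
  rw [Matrix.conjTranspose_mul, Matrix.conjTranspose_nonsing_inv]
  calc Xᴴ⁻¹ * Dᴴ = Xᴴ⁻¹ * (Dᴴ * X) * X⁻¹ := by
        rw [mul_assoc, mul_assoc, Matrix.mul_nonsing_inv _ hu, mul_one]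
    _ = D * X⁻¹ := by
        rw [← h1, ← mul_assoc, Matrix.nonsing_inv_mul _ hu', one_mul]

/-- The matrix whose determinant detects the solutions of a matching problem. -/
def matchMat (G B : CMat) (l m k : ℝ) : CMat :=
  G * B - (k ^ 2) • ((1 - l • G) * (1 - m • B))

/-- The vector `e` is eliminated by applying `G`, which commutes with `1 - l G`, to the first
equation. For `k = 0` the two equations decouple, and the determinant factors accordingly. -/
theorem exists_match_iff {G B : CMat} {l m k : ℝ} :
    (∃ e o : Fin 2 → ℂ, (e ≠ 0 ∨ o ≠ 0) ∧ k • ((1 - l • G) *ᵥ e) = B *ᵥ o ∧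
      G *ᵥ e = k • ((1 - m • B) *ᵥ o)) ↔ (matchMat G B l m k).det = 0 := by
  have hA : G * (1 - l • G) = (1 - l • G) * G := by
    rw [mul_sub, sub_mul, mul_one, one_mul, mul_smul_comm, smul_mul_assoc]
  constructor
  · rintro ⟨e, o, h0, h1, h2⟩
    by_cases ho : o = 0
    · have he : e ≠ 0 := h0.resolve_right (by simp [ho])
      rw [ho, Matrix.mulVec_zero] at h1 h2
      rw [smul_zero] at h2
      have hk : k = 0 := by
        by_contra hk
        rw [Matrix.sub_mulVec, Matrix.one_mulVec, Matrix.smul_mulVec, h2, smul_zero,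
          sub_zero] at h1
        exact he ((smul_eq_zero.1 h1).resolve_left hk)
      have : G.det = 0 := Matrix.exists_mulVec_eq_zero_iff.1 ⟨e, he, h2⟩
      rw [matchMat, hk]
      simp [this]
    · refine Matrix.exists_mulVec_eq_zero_iff.1 ⟨o, ho, ?_⟩
      rw [matchMat, Matrix.sub_mulVec, ← Matrix.mulVec_mulVec, ← h1, Matrix.mulVec_smul,
        Matrix.mulVec_mulVec, hA, ← Matrix.mulVec_mulVec, h2, Matrix.mulVec_smul,
        Matrix.mulVec_mulVec, smul_smul, ← sq, Matrix.smul_mulVec, sub_self]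
  · intro h
    by_cases hk : k = 0
    · rw [matchMat, hk] at h
      simp only [ne_eq, OfNat.ofNat_ne_zero, not_false_eq_true, zero_pow, zero_smul, sub_zero,
        Matrix.det_mul] at h
      rcases mul_eq_zero.1 h with h | h
      · obtain ⟨e, he, h1⟩ := Matrix.exists_mulVec_eq_zero_iff.2 h
        exact ⟨e, 0, Or.inl he, by simp [hk], by simp [h1]⟩
      · obtain ⟨o, ho, h1⟩ := Matrix.exists_mulVec_eq_zero_iff.2 h
        exact ⟨0, o, Or.inr ho, by simp [h1], by simp [hk]⟩
    · obtain ⟨o, ho, h1⟩ := Matrix.exists_mulVec_eq_zero_iff.2 h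
      rw [matchMat, Matrix.sub_mulVec, sub_eq_zero, Matrix.smul_mulVec] at h1
      set E := 1 - m • B with hE
      have h1' : G *ᵥ (B *ᵥ o) = (k ^ 2) • (((1 - l • G) * E) *ᵥ o) := by
        rw [Matrix.mulVec_mulVec, h1]
      -- The vector in parentheses is the only candidate for `e`: solve the first equation for `e`,
      -- and replace `G e` by `k (1 - m B) o` from the second.
      have h2 : G *ᵥ ((k⁻¹ : ℝ) • (B *ᵥ o) + (l * k) • (E *ᵥ o)) = k • (E *ᵥ o) := by
        rw [Matrix.mulVec_add, Matrix.mulVec_smul, Matrix.mulVec_smul, h1', sub_mul, one_mul,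
          Matrix.sub_mulVec, smul_mul_assoc, Matrix.smul_mulVec, Matrix.mulVec_mulVec, smul_smul,
          show k⁻¹ * k ^ 2 = k by field_simp, smul_sub, smul_smul, mul_comm l k]
        abel
      refine ⟨_, o, Or.inr ho, ?_, h2⟩
      rw [Matrix.sub_mulVec, Matrix.one_mulVec, Matrix.smul_mulVec, h2, smul_smul,
        add_sub_cancel_right, smul_smul, mul_inv_cancel₀ hk, one_smul]

/-- A half-period solution `C x ± S p` whose values and velocities at both ends match up to the
factor `(1 + k) / (1 - k)`. -/
def HasMatch (A : C(unitInterval, CMat)) (k : ℝ) : Prop :=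
  ∃ x p : Fin 2 → ℂ, (x ≠ 0 ∨ p ≠ 0) ∧ k • (endCos A *ᵥ x) = endSin A *ᵥ p ∧
    endCosDeriv A *ᵥ x = k • (endSinDeriv A *ᵥ p)

/-- The normalized even boundary matrix. -/
def evenMat (l : ℝ) (A : C(unitInterval, CMat)) : CMat :=
  endCosDeriv A * (endCos A + l • endCosDeriv A)⁻¹

/-- The normalized odd boundary matrix. -/
def oddMat (m : ℝ) (A : C(unitInterval, CMat)) : CMat :=
  endSin A * (endSinDeriv A + m • endSin A)⁻¹

/-- The substitutions `e = X x` and `o = Y p` with the invertible normalizing matrices turn the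
boundary data into polynomials in the Hermitian matrices `G` and `B`. -/
theorem hasMatch_iff {A : C(unitInterval, CMat)} {l m k : ℝ}
    (hX : (endCos A + l • endCosDeriv A).det ≠ 0)
    (hY : (endSinDeriv A + m • endSin A).det ≠ 0) :
    HasMatch A k ↔ (matchMat (evenMat l A) (oddMat m A) l m k).det = 0 := by
  rw [← exists_match_iff]
  set X := endCos A + l • endCosDeriv A with hXd
  set Y := endSinDeriv A + m • endSin A with hYd
  have huX : IsUnit X.det := isUnit_iff_ne_zero.2 hX
  have huY : IsUnit Y.det := isUnit_iff_ne_zero.2 hY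
  have hG : evenMat l A * X = endCosDeriv A := by
    rw [evenMat, mul_assoc, Matrix.nonsing_inv_mul _ huX, mul_one]
  have hB : oddMat m A * Y = endSin A := by
    rw [oddMat, mul_assoc, Matrix.nonsing_inv_mul _ huY, mul_one]
  have hC : (1 - l • evenMat l A) * X = endCos A := by
    rw [sub_mul, one_mul, smul_mul_assoc, hG, hXd, add_sub_cancel_right]
  have hE : (1 - m • oddMat m A) * Y = endSinDeriv A := by
    rw [sub_mul, one_mul, smul_mul_assoc, hB, hYd, add_sub_cancel_right]
  constructor
  · rintro ⟨x, p, h0, h1, h2⟩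
    refine ⟨X *ᵥ x, Y *ᵥ p, ?_, ?_, ?_⟩
    · refine h0.imp (fun h h' => h ?_) fun h h' => h ?_
      · by_contra hx
        exact hX (Matrix.exists_mulVec_eq_zero_iff.1 ⟨x, hx, h'⟩)
      · by_contra hx
        exact hY (Matrix.exists_mulVec_eq_zero_iff.1 ⟨p, hx, h'⟩)
    · rw [Matrix.mulVec_mulVec, Matrix.mulVec_mulVec, hC, hB, h1]
    · rw [Matrix.mulVec_mulVec, Matrix.mulVec_mulVec, hG, hE, h2]
  · rintro ⟨e, o, h0, h1, h2⟩
    have he : X *ᵥ (X⁻¹ *ᵥ e) = e := by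
      rw [Matrix.mulVec_mulVec, Matrix.mul_nonsing_inv _ huX, Matrix.one_mulVec]
    have ho : Y *ᵥ (Y⁻¹ *ᵥ o) = o := by
      rw [Matrix.mulVec_mulVec, Matrix.mul_nonsing_inv _ huY, Matrix.one_mulVec]
    refine ⟨X⁻¹ *ᵥ e, Y⁻¹ *ᵥ o, ?_, ?_, ?_⟩
    · refine h0.imp (fun h h' => h ?_) fun h h' => h ?_
      · rw [← he, h', Matrix.mulVec_zero]
      · rw [← ho, h', Matrix.mulVec_zero]
    · rw [← hC, ← hB, ← Matrix.mulVec_mulVec, ← Matrix.mulVec_mulVec, he, ho, h1]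
    · rw [← hG, ← hE, ← Matrix.mulVec_mulVec, ← Matrix.mulVec_mulVec, he, ho, h2]

theorem im_det_eq_zero {G : CMat} (hG : Gᴴ = G) : G.det.im = 0 := by
  have h := Matrix.det_conjTranspose G
  rw [hG] at h
  exact Complex.conj_eq_iff_im.1 h.symm

/-- Taking adjoints reverses the order of both products, which for two by two matrices does not
change the determinant. The complex characteristic equation is therefore a single real one. -/
theorem im_det_matchMat {G B : CMat} (hG : Gᴴ = G) (hB : Bᴴ = B) (l m k : ℝ) :
    (matchMat G B l m k).det.im = 0 := by
  have h1 : (matchMat G B l m k)ᴴ = B * G - (k ^ 2) • ((1 - m • B) * (1 - l • G)) := by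
    simp [matchMat, Matrix.conjTranspose_smul, hG, hB]
  have h2 : (matchMat G B l m k)ᴴ.det = (matchMat G B l m k).det := by
    rw [h1, matchMat]
    simp only [Matrix.det_fin_two, Matrix.sub_apply, Matrix.smul_apply, Matrix.mul_apply,
      Fin.sum_univ_two, Matrix.one_apply, Complex.real_smul]
    simp
    ring
  rw [Matrix.det_conjTranspose] at h2
  exact Complex.conj_eq_iff_im.1 h2

/-- The polarization of the determinant. -/
def mixedDet (P Q : CMat) : ℂ := P 0 0 * Q 1 1 + Q 0 0 * P 1 1 - P 0 1 * Q 1 0 - Q 0 1 * P 1 0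

/-- The equation is quadratic in `k²`, and its constant term is the product of the even and the odd
determinant. -/
theorem det_matchMat (G B : CMat) (l m k : ℝ) :
    (matchMat G B l m k).det = G.det * B.det +
      (k ^ 2 : ℝ) * (-mixedDet (G * B) ((1 - l • G) * (1 - m • B)) +
        (k ^ 2 : ℝ) * ((1 - l • G) * (1 - m • B)).det) := by
  rw [← Matrix.det_mul, matchMat, mixedDet]
  simp only [Matrix.det_fin_two, Matrix.sub_apply, Matrix.smul_apply, Complex.real_smul]
  ring

end HalfPeriod

end

noncomputable section

/-! ### Variational equations in Bloch form -/

section Bloch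

open scoped ContDiff Matrix Matrix.Norms.L2Operator

/-- A scalar function times a fixed matrix. -/
def matI (m : CMat) : C(unitInterval, ℝ) →L[ℝ] C(unitInterval, CMat) :=
  (ContinuousLinearMap.toSpanSingleton ℝ m).compLeftContinuous ℝ unitInterval

theorem matI_apply (m : CMat) (u : C(unitInterval, ℝ)) (t : unitInterval) :
    matI m u t = u t • m := rfl

/-- The first Pauli matrix. -/
def sigX : CMat := !![0, 1; 1, 0]

/-- The second Pauli matrix. -/
def sigY : CMat := !![0, -Complex.I; Complex.I, 0]

/-- The third Pauli matrix. -/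
def sigZ : CMat := !![1, 0; 0, -1]

/-- The matrix of the variational equations with quasimomentum `q`, in units of the half period
and in the basis of in-phase and out-of-phase perturbations. -/
def blochOp (V W : ℝ → ℝ) (X₀ Xπ : C(unitInterval, ℝ)) (Λ r q : ℝ) : C(unitInterval, CMat) :=
  Λ • (matI 1 ((1 / 2 : ℝ) • (nem (deriv (deriv V)) (r • (X₀ + Xπ)) +
        nem (deriv (deriv V)) (r • (X₀ - Xπ))) +
      (nem (deriv (deriv W)) (r • ((2 : ℝ) • Xπ)) + nem (deriv (deriv W)) (r • (-(2 : ℝ) • Xπ)))) -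
    Real.cos q • matI sigZ (nem (deriv (deriv W)) (r • ((2 : ℝ) • Xπ)) +
      nem (deriv (deriv W)) (r • (-(2 : ℝ) • Xπ))) +
    matI sigX ((1 / 2 : ℝ) • (nem (deriv (deriv V)) (r • (X₀ + Xπ)) -
        nem (deriv (deriv V)) (r • (X₀ - Xπ)))) +
    Real.sin q • matI sigY (nem (deriv (deriv W)) (r • ((2 : ℝ) • Xπ)) -
      nem (deriv (deriv W)) (r • (-(2 : ℝ) • Xπ))))

theorem star_matI {m : CMat} (hm : mᴴ = m) (u : C(unitInterval, ℝ)) :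
    star (matI m u) = matI m u := by
  ext1 t
  rw [ContinuousMap.star_apply, matI_apply, Matrix.star_eq_conjTranspose,
    Matrix.conjTranspose_smul, hm, star_trivial]

theorem conjTranspose_sigX : sigXᴴ = sigX := by
  ext i j
  fin_cases i <;> fin_cases j <;> simp [sigX]

theorem conjTranspose_sigY : sigYᴴ = sigY := by
  ext i j
  fin_cases i <;> fin_cases j <;> simp [sigY]

theorem conjTranspose_sigZ : sigZᴴ = sigZ := by
  ext i j
  fin_cases i <;> fin_cases j <;> simp [sigZ]

theorem star_smul_eq {f : C(unitInterval, CMat)} (h : star f = f) (c : ℝ) :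
    star (c • f) = c • f := by
  ext1 t
  have h1 : (f t)ᴴ = f t := DFunLike.congr_fun h t
  rw [ContinuousMap.star_apply, ContinuousMap.smul_apply, Matrix.star_eq_conjTranspose,
    Matrix.conjTranspose_smul, h1, star_trivial]

theorem star_blochOp (V W : ℝ → ℝ) (X₀ Xπ : C(unitInterval, ℝ)) (Λ r q : ℝ) :
    star (blochOp V W X₀ Xπ Λ r q) = blochOp V W X₀ Xπ Λ r q := by
  rw [blochOp]
  refine star_smul_eq ?_ _
  rw [star_add, star_add, star_sub, star_matI Matrix.conjTranspose_one,
    star_matI conjTranspose_sigX, star_smul_eq (star_matI conjTranspose_sigZ _),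
    star_smul_eq (star_matI conjTranspose_sigY _)]

/-! #### Symmetries -/

/-- A real algebra endomorphism carries solutions for `A` to solutions for `L A` with the same
normalization, and these are unique. This transports symmetries of the coefficient to the boundary
matrices. -/
theorem end_map (L : CMat →ₐ[ℝ] CMat) {A A' : C(unitInterval, CMat)} (h : ∀ t, A' t = L (A t)) :
    endCos A' = L (endCos A) ∧ endSin A' = L (endSin A) ∧
      endCosDeriv A' = L (endCosDeriv A) ∧ endSinDeriv A' = L (endSinDeriv A) := by
  set T : CMat →L[ℝ] CMat := cmatMap L.toLinearMap with hT
  have hTL : ∀ m, T m = L m := fun m => rfl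
  have key : ∀ f : C(unitInterval, CMat), ∃ g : C(unitInterval, CMat), ∀ t, g t = T (f t) :=
    fun f => ⟨⟨fun t => T (f t), by fun_prop⟩, fun t => rfl⟩
  obtain ⟨c, hc⟩ := key (fundCos A)
  obtain ⟨s, hs⟩ := key (fundSin A)
  have hc1 : fundCos A' = c := by
    refine (hasAccel_fundCos A').eq_of_eq ?_ ?_
    · have := (hasAccel_fundCos A).map T (f' := c) (G' := -(A' * c)) hc fun t => by
        simp only [ContinuousMap.neg_apply, ContinuousMap.mul_apply, h, hc, hTL, map_neg, map_mul]
      rwa [map_zero] at this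
    · rw [fundCos_zero, hc, fundCos_zero, hTL, map_one]
  have hs1 : fundSin A' = s := by
    refine (hasAccel_fundSin A').eq_of_eq ?_ ?_
    · have := (hasAccel_fundSin A).map T (f' := s) (G' := -(A' * s)) hs fun t => by
        simp only [ContinuousMap.neg_apply, ContinuousMap.mul_apply, h, hs, hTL, map_neg, map_mul]
      rwa [hTL, map_one] at this
    · rw [fundSin_zero, hs, fundSin_zero, map_zero]
  refine ⟨?_, ?_, ?_, ?_⟩
  · rw [endCos, hc1, hc]; rfl
  · rw [endSin, hs1, hs]; rfl
  · rw [endCosDeriv, hc1, primitive_map T (f := A * fundCos A)]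
    · exact (map_neg L _).symm
    · intro t
      simp only [ContinuousMap.mul_apply, h, hc, hTL, map_mul]
  · rw [endSinDeriv, hs1, primitive_map T (f := A * fundSin A)]
    · have h1 := map_sub L 1 (primitive (A * fundSin A) 1)
      rw [map_one L] at h1
      exact h1.symm
    · intro t
      simp only [ContinuousMap.mul_apply, h, hs, hTL, map_mul]

/-- The determinant of the even boundary conditions, normalized. -/
def evenDet (l : ℝ) (A : C(unitInterval, CMat)) : ℝ :=
  ((endCosDeriv A).det / (endCos A + l • endCosDeriv A).det).re

/-- The determinant of the odd boundary conditions, normalized. -/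
def oddDet (m : ℝ) (A : C(unitInterval, CMat)) : ℝ :=
  ((endSin A).det / (endSinDeriv A + m • endSin A).det).re

/-- Conjugation by `σ_z`. -/
def flipHom : CMat →ₐ[ℝ] CMat :=
  AlgHom.ofLinearMap
    { toFun := fun a => !![a 0 0, -a 0 1; -a 1 0, a 1 1]
      map_add' := fun a b => by
        ext i j
        fin_cases i <;> fin_cases j <;> simp [add_comm]
      map_smul' := fun c a => by
        ext i j
        fin_cases i <;> fin_cases j <;> simp }
    (by
      ext i j
      fin_cases i <;> fin_cases j <;> simp)
    (fun a b => by
      ext i j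
      fin_cases i <;> fin_cases j <;> simp [Matrix.mul_apply, Fin.sum_univ_two] <;> ring)

theorem flipHom_apply (a : CMat) : flipHom a = !![a 0 0, -a 0 1; -a 1 0, a 1 1] := rfl

theorem det_flipHom (a : CMat) : (flipHom a).det = a.det := by
  simp [flipHom_apply, Matrix.det_fin_two]

/-- Entrywise complex conjugation. -/
def conjHom : CMat →ₐ[ℝ] CMat := (Complex.conjAe : ℂ →ₐ[ℝ] ℂ).mapMatrix

theorem conjHom_apply (a : CMat) (i j : Fin 2) : conjHom a i j = star (a i j) := rfl

theorem det_conjHom (a : CMat) : (conjHom a).det = star a.det := by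
  simp [conjHom_apply, Matrix.det_fin_two]

theorem evenDet_flip {A A' : C(unitInterval, CMat)} (h : ∀ t, A' t = flipHom (A t)) (l : ℝ) :
    evenDet l A' = evenDet l A := by
  obtain ⟨h1, -, h3, -⟩ := end_map flipHom h
  rw [evenDet, h1, h3, ← map_smul, ← map_add, det_flipHom, det_flipHom, evenDet]

theorem oddDet_flip {A A' : C(unitInterval, CMat)} (h : ∀ t, A' t = flipHom (A t)) (l : ℝ) :
    oddDet l A' = oddDet l A := by
  obtain ⟨-, h2, -, h4⟩ := end_map flipHom h
  rw [oddDet, h2, h4, ← map_smul, ← map_add, det_flipHom, det_flipHom, oddDet]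

theorem evenDet_conj {A A' : C(unitInterval, CMat)} (h : ∀ t, A' t = conjHom (A t)) (l : ℝ) :
    evenDet l A' = evenDet l A := by
  obtain ⟨h1, -, h3, -⟩ := end_map conjHom h
  rw [evenDet, h1, h3, ← map_smul, ← map_add, det_conjHom, det_conjHom, evenDet, ← star_div₀]
  rfl

theorem oddDet_conj {A A' : C(unitInterval, CMat)} (h : ∀ t, A' t = conjHom (A t)) (l : ℝ) :
    oddDet l A' = oddDet l A := by
  obtain ⟨-, h2, -, h4⟩ := end_map conjHom h
  rw [oddDet, h2, h4, ← map_smul, ← map_add, det_conjHom, det_conjHom, oddDet, ← star_div₀]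
  rfl

theorem blochOp_apply (V W : ℝ → ℝ) (X₀ Xπ : C(unitInterval, ℝ)) (Λ r q : ℝ) (t : unitInterval) :
    blochOp V W X₀ Xπ Λ r q t =
      Λ • (((1 / 2) * (nem (deriv (deriv V)) (r • (X₀ + Xπ)) t +
        nem (deriv (deriv V)) (r • (X₀ - Xπ)) t) +
      (nem (deriv (deriv W)) (r • ((2 : ℝ) • Xπ)) t +
        nem (deriv (deriv W)) (r • (-(2 : ℝ) • Xπ)) t)) • (1 : CMat) -
    Real.cos q • (nem (deriv (deriv W)) (r • ((2 : ℝ) • Xπ)) t +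
      nem (deriv (deriv W)) (r • (-(2 : ℝ) • Xπ)) t) • sigZ +
    ((1 / 2) * (nem (deriv (deriv V)) (r • (X₀ + Xπ)) t -
        nem (deriv (deriv V)) (r • (X₀ - Xπ)) t)) • sigX +
    Real.sin q • (nem (deriv (deriv W)) (r • ((2 : ℝ) • Xπ)) t -
      nem (deriv (deriv W)) (r • (-(2 : ℝ) • Xπ)) t) • sigY) := rfl

/-- Complex conjugation changes the sign of `σ_y` only, which is the same as changing the sign of
`sin q`. -/
theorem blochOp_neg_momentum (V W : ℝ → ℝ) (X₀ Xπ : C(unitInterval, ℝ)) (Λ r q : ℝ)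
    (t : unitInterval) :
    blochOp V W X₀ Xπ Λ r (-q) t = conjHom (blochOp V W X₀ Xπ Λ r q t) := by
  have h1 : conjHom sigX = sigX := by
    ext i j; fin_cases i <;> fin_cases j <;> simp [conjHom_apply, sigX]
  have h2 : conjHom sigY = -sigY := by
    ext i j; fin_cases i <;> fin_cases j <;> simp [conjHom_apply, sigY]
  have h3 : conjHom sigZ = sigZ := by
    ext i j; fin_cases i <;> fin_cases j <;> simp [conjHom_apply, sigZ]
  simp only [blochOp_apply, map_smul, map_add, map_sub, map_one, h1, h2, h3, Real.cos_neg,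
    Real.sin_neg, smul_neg, neg_smul]

/-- Changing the signs of `r` and `X₀` exchanges the two sublattices. On the Bloch matrix this is
conjugation by `σ_z`, which changes the signs of `σ_x` and `σ_y`. -/
theorem blochOp_neg_amplitude (V W : ℝ → ℝ) (X₀ Xπ : C(unitInterval, ℝ)) (Λ r q : ℝ)
    (t : unitInterval) :
    blochOp V W (-X₀) Xπ Λ (-r) q t = flipHom (blochOp V W X₀ Xπ Λ r q t) := by
  have h1 : flipHom sigX = -sigX := by
    ext i j; fin_cases i <;> fin_cases j <;> simp [flipHom_apply, sigX]
  have h2 : flipHom sigY = -sigY := by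
    ext i j; fin_cases i <;> fin_cases j <;> simp [flipHom_apply, sigY]
  have h3 : flipHom sigZ = sigZ := by
    ext i j; fin_cases i <;> fin_cases j <;> simp [flipHom_apply, sigZ]
  have e1 : -r • (-X₀ + Xπ) = r • (X₀ - Xπ) := by
    rw [neg_smul, ← smul_neg]; congr 1; abel
  have e2 : -r • (-X₀ - Xπ) = r • (X₀ + Xπ) := by
    rw [neg_smul, ← smul_neg]; congr 1; abel
  have e3 : -r • ((2 : ℝ) • Xπ) = r • (-(2 : ℝ) • Xπ) := by
    rw [neg_smul, neg_smul, smul_neg]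
  have e4 : -r • (-(2 : ℝ) • Xπ) = r • ((2 : ℝ) • Xπ) := by
    rw [neg_smul, neg_smul, smul_neg, neg_neg]
  simp only [blochOp_apply, map_smul, map_add, map_sub, map_one, h1, h2, h3, e1, e2, e3, e4]
  congr 1
  module

variable {V W : ℝ → ℝ} {X₀ Xπ : ℝ → C(unitInterval, ℝ)} {Λ : ℝ → ℝ}

theorem dimerForceZero_neg (V : ℝ → ℝ) (r : ℝ) (X₀ Xπ : C(unitInterval, ℝ)) :
    dimerForceZero V (r, -X₀, Xπ) = -dimerForceZero V (-r, X₀, Xπ) := by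
  have e1 : -r • (X₀ + Xπ) = r • (-X₀ - Xπ) := by
    rw [neg_smul, ← smul_neg]; congr 1; abel
  have e2 : -r • (X₀ - Xπ) = r • (-X₀ + Xπ) := by
    rw [neg_smul, ← smul_neg]; congr 1; abel
  ext t
  simp only [dimerForceZero, e1, e2]
  simp
  ring

theorem dimerForcePi_neg (V W : ℝ → ℝ) (r : ℝ) (X₀ Xπ : C(unitInterval, ℝ)) :
    dimerForcePi V W (r, -X₀, Xπ) = dimerForcePi V W (-r, X₀, Xπ) := by
  have e1 : -r • (X₀ + Xπ) = r • (-X₀ - Xπ) := by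
    rw [neg_smul, ← smul_neg]; congr 1; abel
  have e2 : -r • (X₀ - Xπ) = r • (-X₀ + Xπ) := by
    rw [neg_smul, ← smul_neg]; congr 1; abel
  have e3 : -r • ((2 : ℝ) • Xπ) = r • (-(2 : ℝ) • Xπ) := by
    rw [neg_smul, neg_smul, smul_neg]
  have e4 : -r • (-(2 : ℝ) • Xπ) = r • ((2 : ℝ) • Xπ) := by
    rw [neg_smul, neg_smul, smul_neg, neg_neg]
  ext t
  simp only [dimerForcePi, e1, e2, e3, e4]
  simp
  ring

/-- Translation by one site turns the amplitude `r` into `-r` and `X₀` into `-X₀`; local uniqueness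
makes the branch invariant under it. Consequently the boundary determinants are even in `r` and
expand in powers of `r²`. -/
theorem IsModeBranch.eventually_neg (hb : IsModeBranch V W X₀ Xπ Λ) :
    ∀ᶠ r in 𝓝 0, X₀ (-r) = -X₀ r ∧ Xπ (-r) = Xπ r ∧ Λ (-r) = Λ r := by
  have hneg : Tendsto (fun r : ℝ => -r) (𝓝 0) (𝓝 0) := by
    have := (continuous_neg (G := ℝ)).tendsto 0
    rwa [neg_zero] at this
  have c0 : Tendsto (fun r => -X₀ (-r)) (𝓝 0) (𝓝 0) := by
    have := (hb.contDiffAt_zero.continuousAt.tendsto.comp hneg).neg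
    rwa [hb.zero_zero, neg_zero] at this
  have cπ : Tendsto (fun r => Xπ (-r)) (𝓝 0) (𝓝 (cosI Real.pi)) := by
    have := hb.contDiffAt_pi.continuousAt.tendsto.comp hneg
    rwa [hb.pi_zero] at this
  have cΛ : Tendsto (fun r => Λ (-r)) (𝓝 0) (𝓝 (Real.pi ^ 2 / piFreqSq V W)) := by
    have := hb.contDiffAt_time.continuousAt.tendsto.comp hneg
    rwa [hb.time_zero] at this
  have hp : Tendsto (fun r => (r, (-X₀ (-r), Xπ (-r)), Λ (-r))) (𝓝 (0 : ℝ))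
      (𝓝 ((0 : ℝ), ((0, cosI Real.pi) : C(unitInterval, ℝ) × C(unitInterval, ℝ)),
        Real.pi ^ 2 / piFreqSq V W)) :=
    tendsto_id.prodMk_nhds ((c0.prodMk_nhds cπ).prodMk_nhds cΛ)
  filter_upwards [hp.eventually hb.unique, hneg.eventually hb.sol] with r h1 h2
  obtain ⟨a, b, c⟩ := h1 ⟨h2.normalized, by
    have := h2.accel_zero.smul (-1)
    rw [dimerForceZero_neg]
    convert! this using 1
    · ext t; simp
    · simp
    · ext t; simp, by
    rw [dimerForcePi_neg]; exact h2.accel_pi, by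
    rw [dimerForceZero_neg, map_neg, ContinuousMap.neg_apply, h2.velocity_zero, neg_zero], by
    rw [dimerForcePi_neg]; exact h2.velocity_pi⟩
  exact ⟨by rw [← a, neg_neg], b, c⟩

/-- The Bloch matrix along the branch, as a function of amplitude and quasimomentum. -/
def modeOp (V W : ℝ → ℝ) (X₀ Xπ : ℝ → C(unitInterval, ℝ)) (Λ : ℝ → ℝ) (p : ℝ × ℝ) :
    C(unitInterval, CMat) := blochOp V W (X₀ p.1) (Xπ p.1) (Λ p.1) p.1 p.2

theorem IsModeBranch.contDiffAt_modeOp (hV : IsPotential V) (hW : IsPotential W)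
    (hb : IsModeBranch V W X₀ Xπ Λ) (q : ℝ) :
    ContDiffAt ℝ ω (modeOp V W X₀ Xπ Λ) (0, q) := by
  have f1 : ContDiffAt ℝ ω (fun p : ℝ × ℝ => p.1) (0, q) := contDiffAt_fst
  have f2 : ContDiffAt ℝ ω (fun p : ℝ × ℝ => p.2) (0, q) := contDiffAt_snd
  have b0 : ContDiffAt ℝ ω (fun p : ℝ × ℝ => X₀ p.1) (0, q) :=
    ContDiffAt.comp (0, q) (g := X₀) hb.contDiffAt_zero f1
  have bπ : ContDiffAt ℝ ω (fun p : ℝ × ℝ => Xπ p.1) (0, q) :=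
    ContDiffAt.comp (0, q) (g := Xπ) hb.contDiffAt_pi f1
  have bΛ : ContDiffAt ℝ ω (fun p : ℝ × ℝ => Λ p.1) (0, q) :=
    ContDiffAt.comp (0, q) (g := Λ) hb.contDiffAt_time f1
  have n1 := contDiffAt_nem_smul hV.analyticAt_deriv_deriv f1 (b0.add bπ) rfl
  have n2 := contDiffAt_nem_smul hV.analyticAt_deriv_deriv f1 (b0.sub bπ) rfl
  have n3 := contDiffAt_nem_smul hW.analyticAt_deriv_deriv f1 (bπ.const_smul (2 : ℝ)) rfl
  have n4 := contDiffAt_nem_smul hW.analyticAt_deriv_deriv f1 (bπ.const_smul (-(2 : ℝ))) rfl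
  have m : ∀ (c : CMat) {u : ℝ × ℝ → C(unitInterval, ℝ)}, ContDiffAt ℝ ω u (0, q) →
      ContDiffAt ℝ ω (fun p => matI c (u p)) (0, q) := fun c u hu =>
    (matI c).contDiff.contDiffAt.comp (0, q) hu
  have hc : ContDiffAt ℝ ω (fun p : ℝ × ℝ => Real.cos p.2) (0, q) :=
    Real.contDiff_cos.contDiffAt.comp (0, q) f2
  have hs : ContDiffAt ℝ ω (fun p : ℝ × ℝ => Real.sin p.2) (0, q) :=
    Real.contDiff_sin.contDiffAt.comp (0, q) f2
  exact bΛ.smul ((((m 1 (((n1.add n2).const_smul (1 / 2 : ℝ)).add (n3.add n4))).sub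
    (hc.smul (m sigZ (n3.add n4)))).add (m sigX ((n1.sub n2).const_smul (1 / 2 : ℝ)))).add
    (hs.smul (m sigY (n3.sub n4))))

theorem IsModeBranch.eventually_evenDet_neg (hb : IsModeBranch V W X₀ Xπ Λ) (l m : ℝ) :
    ∀ᶠ r in 𝓝 0, ∀ q, evenDet l (modeOp V W X₀ Xπ Λ (-r, q)) = evenDet l (modeOp V W X₀ Xπ Λ (r, q)) ∧
      oddDet m (modeOp V W X₀ Xπ Λ (-r, q)) = oddDet m (modeOp V W X₀ Xπ Λ (r, q)) := by
  filter_upwards [hb.eventually_neg] with r h q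
  have : ∀ t, modeOp V W X₀ Xπ Λ (-r, q) t = flipHom (modeOp V W X₀ Xπ Λ (r, q) t) := fun t => by
    simp only [modeOp, h.1, h.2.1, h.2.2]
    exact blochOp_neg_amplitude _ _ _ _ _ _ _ _
  exact ⟨evenDet_flip this l, oddDet_flip this m⟩

theorem evenDet_modeOp_neg (l r q : ℝ) :
    evenDet l (modeOp V W X₀ Xπ Λ (r, -q)) = evenDet l (modeOp V W X₀ Xπ Λ (r, q)) :=
  evenDet_conj (fun _ => blochOp_neg_momentum _ _ _ _ _ _ _ _) l

theorem oddDet_modeOp_neg (m r q : ℝ) :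
    oddDet m (modeOp V W X₀ Xπ Λ (r, -q)) = oddDet m (modeOp V W X₀ Xπ Λ (r, q)) :=
  oddDet_conj (fun _ => blochOp_neg_momentum _ _ _ _ _ _ _ _) m

end Bloch

end

noncomputable section

/-! ### The linear limit -/

section LinearLimit

open scoped ContDiff Matrix Matrix.Norms.L2Operator

/-- `sin (θ t) / θ` on the unit interval. -/
def sinI (θ : ℝ) : C(unitInterval, ℝ) := ⟨fun t => Real.sin (θ * t) / θ, by fun_prop⟩

theorem hasAccel_sinI {θ : ℝ} (hθ : θ ≠ 0) : HasAccel (sinI θ) 1 (-(θ ^ 2) • sinI θ) ∧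
    1 + primitive (-(θ ^ 2) • sinI θ) 1 = Real.cos θ := by
  have h1 : ∀ t : ℝ, HasDerivAt (fun t : ℝ => Real.sin (θ * t) / θ) (Real.cos (θ * t)) t := fun t => by
    have h := (((hasDerivAt_id t).const_mul θ).sin).div_const θ
    convert! h using 1
    simp [hθ]
  have h2 : ∀ t : unitInterval, HasDerivAt (fun t : ℝ => Real.cos (θ * t))
      ((-(θ ^ 2) • sinI θ) t) t := fun t => by
    have h := ((hasDerivAt_id (t : ℝ)).const_mul θ).cos
    convert! h using 1
    simp [sinI]
    field_simp
  have h3 := hasAccel_of_hasDerivAt (f := sinI θ) (fun t => h1 t) h2 fun t => rfl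
  rw [mul_zero, Real.cos_zero] at h3
  refine ⟨h3, ?_⟩
  rw [primitive_eq_of_hasDerivAt h2]
  simp

/-- Real diagonal matrices. -/
def diagC (a b : ℝ) : CMat := !![(a : ℂ), 0; 0, (b : ℂ)]

theorem diagC_eq (a b : ℝ) : diagC a b = a • !![1, 0; 0, 0] + b • !![0, 0; 0, 1] := by
  ext i j
  fin_cases i <;> fin_cases j <;> simp [diagC]

theorem HasAccel.combine {u F w G : C(unitInterval, ℝ)} {v v' : ℝ} (hu : HasAccel u v F)
    (hw : HasAccel w v' G) (m n : CMat) {f H : C(unitInterval, CMat)}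
    (hf : ∀ t, f t = u t • m + w t • n) (hH : ∀ t, H t = F t • m + G t • n) :
    HasAccel f (v • m + v' • n) H ∧ primitive H 1 = primitive F 1 • m + primitive G 1 • n := by
  have ef : f = matI m u + matI n w := ContinuousMap.ext hf
  have eH : H = matI m F + matI n G := ContinuousMap.ext hH
  have h1 : ∀ (m : CMat) {u F : C(unitInterval, ℝ)} {v : ℝ}, HasAccel u v F →
      HasAccel (matI m u) (v • m) (matI m F) := fun m u F v h =>
    h.map (ContinuousLinearMap.toSpanSingleton ℝ m) (fun _ => rfl) fun _ => rfl
  have h2 : ∀ (m : CMat) (F : C(unitInterval, ℝ)), primitive (matI m F) 1 = primitive F 1 • m :=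
    fun m F => primitive_map (ContinuousLinearMap.toSpanSingleton ℝ m) (fun _ => rfl) 1
  constructor
  · rw [ef, eH]
    exact (h1 _ hu).add (h1 _ hw)
  · rw [eH, map_add, ContinuousMap.add_apply, h2, h2]

theorem HasAccel.diagC {u F w G : C(unitInterval, ℝ)} {v v' : ℝ} (hu : HasAccel u v F)
    (hw : HasAccel w v' G) {f H : C(unitInterval, CMat)} (hf : ∀ t, f t = diagC (u t) (w t))
    (hH : ∀ t, H t = _root_.diagC (F t) (G t)) :
    HasAccel f (_root_.diagC v v') H ∧
      primitive H 1 = _root_.diagC (primitive F 1) (primitive G 1) := by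
  simp only [diagC_eq] at hf hH ⊢
  exact hu.combine hw _ _ hf hH

theorem diagC_mul (a b c d : ℝ) : diagC a b * diagC c d = diagC (a * c) (b * d) := by
  ext i j
  fin_cases i <;> fin_cases j <;> simp [diagC, Matrix.mul_apply, Fin.sum_univ_two]

theorem diagC_neg (a b : ℝ) : -diagC a b = diagC (-a) (-b) := by
  ext i j
  fin_cases i <;> fin_cases j <;> simp [diagC]

theorem diagC_one : diagC 1 1 = 1 := by
  ext i j
  fin_cases i <;> fin_cases j <;> simp [diagC]

theorem diagC_add (a b c d : ℝ) : diagC a b + diagC c d = diagC (a + c) (b + d) := by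
  ext i j
  fin_cases i <;> fin_cases j <;> simp [diagC]

theorem diagC_smul (c a b : ℝ) : c • diagC a b = diagC (c * a) (c * b) := by
  ext i j
  fin_cases i <;> fin_cases j <;> simp [diagC]

theorem det_diagC (a b : ℝ) : (diagC a b).det = ((a * b : ℝ) : ℂ) := by
  simp [diagC, Matrix.det_fin_two]

theorem diagC_mulVec (a b : ℝ) (x : Fin 2 → ℂ) : diagC a b *ᵥ x = ![a * x 0, b * x 1] := by
  ext i
  fin_cases i <;> simp [diagC, Matrix.mulVec, dotProduct, Fin.sum_univ_two]

/-- The fundamental solutions for two uncoupled harmonic oscillators. -/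
theorem end_diagC {A : C(unitInterval, CMat)} {θ η : ℝ} (hθ : θ ≠ 0) (hη : η ≠ 0)
    (hA : ∀ t, A t = diagC (θ ^ 2) (η ^ 2)) :
    endCos A = diagC (Real.cos θ) (Real.cos η) ∧
      endSin A = diagC (Real.sin θ / θ) (Real.sin η / η) ∧
      endCosDeriv A = diagC (-(θ * Real.sin θ)) (-(η * Real.sin η)) ∧
      endSinDeriv A = diagC (Real.cos θ) (Real.cos η) ∧
      ∀ t, fundCos A t = diagC (cosI θ t) (cosI η t) := by
  have key : ∀ u w : C(unitInterval, ℝ), ∃ f : C(unitInterval, CMat),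
      ∀ t, f t = diagC (u t) (w t) := fun u w =>
    ⟨matI !![1, 0; 0, 0] u + matI !![0, 0; 0, 1] w, fun t => by rw [diagC_eq]; rfl⟩
  obtain ⟨c, hc⟩ := key (cosI θ) (cosI η)
  obtain ⟨s, hs⟩ := key (sinI θ) (sinI η)
  have hAc : ∀ t, (-(A * c)) t = diagC ((-(θ ^ 2) • cosI θ) t) ((-(η ^ 2) • cosI η) t) := fun t => by
    rw [ContinuousMap.neg_apply, ContinuousMap.mul_apply, hA, hc, diagC_mul, diagC_neg]
    simp
  have hAs : ∀ t, (-(A * s)) t = diagC ((-(θ ^ 2) • sinI θ) t) ((-(η ^ 2) • sinI η) t) := fun t => by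
    rw [ContinuousMap.neg_apply, ContinuousMap.mul_apply, hA, hs, diagC_mul, diagC_neg]
    simp
  obtain ⟨c1, c2⟩ := (hasAccel_cosI θ).diagC (hasAccel_cosI η) hc hAc
  obtain ⟨s1, s2⟩ := (hasAccel_sinI hθ).1.diagC (hasAccel_sinI hη).1 hs hAs
  have z : diagC 0 0 = 0 := by
    ext i j
    fin_cases i <;> fin_cases j <;> simp [diagC]
  rw [z] at c1
  rw [diagC_one] at s1
  have ec : fundCos A = c := (hasAccel_fundCos A).eq_of_eq c1 (by
    rw [fundCos_zero, hc, ← diagC_one]; simp)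
  have es : fundSin A = s := (hasAccel_fundSin A).eq_of_eq s1 (by
    rw [fundSin_zero, hs, ← z]; simp [sinI])
  refine ⟨?_, ?_, ?_, ?_, fun t => by rw [ec, hc]⟩
  · rw [endCos, ec, hc]; simp
  · rw [endSin, es, hs]; simp [sinI]
  · rw [endCosDeriv, ec, ← ContinuousMap.neg_apply, ← map_neg, c2, map_smul, map_smul]
    simp only [ContinuousMap.smul_apply, primitive_cosI_one hθ, primitive_cosI_one hη, smul_eq_mul]
    congr 1 <;> field_simp
  · rw [endSinDeriv, es, sub_eq_add_neg, ← ContinuousMap.neg_apply, ← map_neg, s2, ← diagC_one,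
      diagC_add, (hasAccel_sinI hθ).2, (hasAccel_sinI hη).2]

/-! #### Matching is a closed condition -/

/-- Written as a four by four determinant, matching is visibly a closed condition in `A` and `k`. -/
theorem hasMatch_iff_det {A : C(unitInterval, CMat)} {k : ℝ} : HasMatch A k ↔
    (Matrix.fromBlocks (k • endCos A) (-endSin A) (endCosDeriv A) (-(k • endSinDeriv A))).det = 0 := by
  rw [← Matrix.exists_mulVec_eq_zero_iff]
  constructor
  · rintro ⟨x, p, h0, h1, h2⟩
    refine ⟨Sum.elim x p, fun h => ?_, ?_⟩
    · rcases h0 with h0 | h0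
      · exact h0 (funext fun i => congrFun h (Sum.inl i))
      · exact h0 (funext fun i => congrFun h (Sum.inr i))
    · rw [Matrix.fromBlocks_mulVec]
      simp only [Sum.elim_comp_inl, Sum.elim_comp_inr, Matrix.neg_mulVec, Matrix.smul_mulVec, h1, h2]
      ext i
      rcases i with i | i <;> simp <;> fin_cases i <;> rfl
  · rintro ⟨v, hv, h⟩
    rw [Matrix.fromBlocks_mulVec] at h
    refine ⟨v ∘ Sum.inl, v ∘ Sum.inr, ?_, ?_, ?_⟩
    · by_contra h0
      push Not at h0
      refine hv (funext fun i => ?_)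
      rcases i with i | i
      · exact congrFun h0.1 i
      · exact congrFun h0.2 i
    · have := fun i => congrFun h (Sum.inl i)
      simp only [Sum.elim_inl, Pi.add_apply, Pi.zero_apply, Matrix.neg_mulVec, Pi.neg_apply] at this
      rw [← Matrix.smul_mulVec]
      exact funext fun i => add_neg_eq_zero.1 (this i)
    · have := fun i => congrFun h (Sum.inr i)
      simp only [Sum.elim_inr, Pi.add_apply, Pi.zero_apply, Matrix.neg_mulVec, Pi.neg_apply] at this
      rw [← Matrix.smul_mulVec]
      exact funext fun i => add_neg_eq_zero.1 (this i)

theorem eventually_not_hasMatch {E : Type*} [TopologicalSpace E] {A : E → C(unitInterval, CMat)}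
    {k : E → ℝ} {x : E} (hA : ContinuousAt A x) (hk : ContinuousAt k x)
    (h : ¬HasMatch (A x) (k x)) : ∀ᶠ y in 𝓝 x, ¬HasMatch (A y) (k y) := by
  simp only [hasMatch_iff_det] at h ⊢
  have c : ∀ {f : C(unitInterval, CMat) → CMat}, ContDiff ℝ ω f →
      ContinuousAt (fun y => f (A y)) x := fun hf => hf.continuous.continuousAt.comp hA
  have c1 := hk.smul (c contDiff_endCos)
  have c2 := (c contDiff_endSin).neg
  have c3 := c contDiff_endCosDeriv
  have c4 := (hk.smul (c contDiff_endSinDeriv)).neg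
  have e : Continuous fun z : (CMat × CMat) × (CMat × CMat) =>
      (Matrix.fromBlocks z.1.1 z.1.2 z.2.1 z.2.2).det :=
    Continuous.matrix_det (Continuous.matrix_fromBlocks (by fun_prop) (by fun_prop) (by fun_prop)
      (by fun_prop))
  have := e.continuousAt.comp ((c1.prodMk c2).prodMk (c3.prodMk c4))
  exact this.eventually_ne h

/-! #### The two phases of the linear problem -/

/-- The squared phase advanced by the first linear mode in half a period. -/
def phaseSqZero (V W : ℝ → ℝ) (q : ℝ) : ℝ := Real.pi ^ 2 / piFreqSq V W *
  (potentialCoeff V 2 + 2 * potentialCoeff W 2 * (1 - Real.cos q))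

/-- The squared phase advanced by the second linear mode in half a period. -/
def phaseSqPi (V W : ℝ → ℝ) (q : ℝ) : ℝ := Real.pi ^ 2 / piFreqSq V W *
  (potentialCoeff V 2 + 2 * potentialCoeff W 2 * (1 + Real.cos q))

variable {V W : ℝ → ℝ} {X₀ Xπ : ℝ → C(unitInterval, ℝ)} {Λ : ℝ → ℝ}

theorem phaseSqZero_pos (hV : IsPotential V) (hW : IsPotential W) (q : ℝ) :
    0 < phaseSqZero V W q := by
  have := piFreqSq_pos hV hW
  have := hV.coeff_two_pos
  have := mul_nonneg hW.coeff_two_pos.le (sub_nonneg.2 (Real.cos_le_one q))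
  unfold phaseSqZero
  have h : 0 < potentialCoeff V 2 + 2 * potentialCoeff W 2 * (1 - Real.cos q) := by linarith
  positivity

theorem phaseSqPi_pos (hV : IsPotential V) (hW : IsPotential W) (q : ℝ) :
    0 < phaseSqPi V W q := by
  have := piFreqSq_pos hV hW
  have := hV.coeff_two_pos
  have := mul_nonneg hW.coeff_two_pos.le (neg_le_iff_add_nonneg'.1 (Real.neg_one_le_cos q))
  unfold phaseSqPi
  have h : 0 < potentialCoeff V 2 + 2 * potentialCoeff W 2 * (1 + Real.cos q) := by linarith
  positivity

theorem modeOp_zero_apply (hb : IsModeBranch V W X₀ Xπ Λ) (q : ℝ) (t : unitInterval) :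
    modeOp V W X₀ Xπ Λ (0, q) t = diagC (phaseSqZero V W q) (phaseSqPi V W q) := by
  simp only [modeOp, blochOp_apply, zero_smul, nem_zero, deriv_deriv_zero, hb.time_zero]
  ext i j
  fin_cases i <;> fin_cases j <;> simp [sigX, sigZ, diagC, phaseSqZero, phaseSqPi] <;>
    first | ring1 | (left; ring1)

theorem end_modeOp_zero (hV : IsPotential V) (hW : IsPotential W)
    (hb : IsModeBranch V W X₀ Xπ Λ) (q : ℝ) :
    endCos (modeOp V W X₀ Xπ Λ (0, q)) =
        diagC (Real.cos √(phaseSqZero V W q)) (Real.cos √(phaseSqPi V W q)) ∧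
      endSin (modeOp V W X₀ Xπ Λ (0, q)) =
        diagC (Real.sin √(phaseSqZero V W q) / √(phaseSqZero V W q))
          (Real.sin √(phaseSqPi V W q) / √(phaseSqPi V W q)) ∧
      endCosDeriv (modeOp V W X₀ Xπ Λ (0, q)) =
        diagC (-(√(phaseSqZero V W q) * Real.sin √(phaseSqZero V W q)))
          (-(√(phaseSqPi V W q) * Real.sin √(phaseSqPi V W q))) ∧
      endSinDeriv (modeOp V W X₀ Xπ Λ (0, q)) =
        diagC (Real.cos √(phaseSqZero V W q)) (Real.cos √(phaseSqPi V W q)) ∧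
      ∀ t, fundCos (modeOp V W X₀ Xπ Λ (0, q)) t =
        diagC (cosI √(phaseSqZero V W q) t) (cosI √(phaseSqPi V W q) t) := by
  refine end_diagC (Real.sqrt_pos.2 (phaseSqZero_pos hV hW q)).ne'
    (Real.sqrt_pos.2 (phaseSqPi_pos hV hW q)).ne' fun t => ?_
  rw [modeOp_zero_apply hb, Real.sq_sqrt (phaseSqZero_pos hV hW q).le,
    Real.sq_sqrt (phaseSqPi_pos hV hW q).le]

theorem sqrt_phaseSqZero_zero (V W : ℝ → ℝ) : √(phaseSqZero V W 0) = inPhaseAngle V W := by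
  rw [phaseSqZero, inPhaseAngle]
  rw [Real.cos_zero, sub_self, mul_zero, add_zero, div_mul_eq_mul_div, mul_div_assoc,
    Real.sqrt_mul (sq_nonneg _), Real.sqrt_sq Real.pi_pos.le, mul_comm]

theorem phaseSqPi_eq (hV : IsPotential V) (hW : IsPotential W) (q : ℝ) : phaseSqPi V W q =
    Real.pi ^ 2 * (1 - 2 * potentialCoeff W 2 / piFreqSq V W * (1 - Real.cos q)) := by
  have := (piFreqSq_pos hV hW).ne'
  rw [phaseSqPi]
  field_simp
  rw [piFreqSq]
  ring

theorem sqrt_phaseSqPi_zero (hV : IsPotential V) (hW : IsPotential W) :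
    √(phaseSqPi V W 0) = Real.pi := by
  rw [phaseSqPi_eq hV hW]
  simp [Real.sqrt_sq Real.pi_pos.le]

theorem sin_sqrt_pos {a : ℝ} (h0 : 0 < a) (h1 : a < Real.pi ^ 2) : 0 < Real.sin √a :=
  Real.sin_pos_of_pos_of_lt_pi (Real.sqrt_pos.2 h0) ((Real.sqrt_lt' Real.pi_pos).2 h1)

/-- For `cos q ≥ 0` the first linear mode stays strictly slower than the out-of-phase mode. This is
why momenta are reduced to `|q| ≤ π / 2`. -/
theorem sin_phaseZero_pos (hV : IsPotential V) (hW : IsPotential W) {q : ℝ}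
    (hq : 0 ≤ Real.cos q) : 0 < Real.sin √(phaseSqZero V W q) := by
  refine sin_sqrt_pos (phaseSqZero_pos hV hW q) ?_
  have hΩ := piFreqSq_pos hV hW
  have h1 := mul_nonneg hW.coeff_two_pos.le hq
  have h2 := hW.coeff_two_pos
  have hπ := Real.pi_pos
  rw [phaseSqZero, div_mul_eq_mul_div, div_lt_iff₀ hΩ]
  refine mul_lt_mul_of_pos_left ?_ (by positivity)
  rw [piFreqSq]
  linarith

theorem sin_phasePi_pos (hV : IsPotential V) (hW : IsPotential W) {q : ℝ}
    (hq : Real.cos q < 1) : 0 < Real.sin √(phaseSqPi V W q) := by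
  refine sin_sqrt_pos (phaseSqPi_pos hV hW q) ?_
  have hΩ := piFreqSq_pos hV hW
  have h1 := mul_pos hW.coeff_two_pos (sub_pos.2 hq)
  have hπ := Real.pi_pos
  rw [phaseSqPi, div_mul_eq_mul_div, div_lt_iff₀ hΩ]
  refine mul_lt_mul_of_pos_left ?_ (by positivity)
  rw [piFreqSq]
  linarith

/-- Eliminating `p` leaves `(s² + (k c)²) x = 0`. A harmonic oscillator that is not resonant at half
a period has no real multiplier `≥ 1`. -/
theorem eq_zero_of_match {c s θ k : ℝ} (hθ : 0 < θ) (hs : 0 < s) {x p : ℂ}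
    (h1 : (k : ℂ) * (c * x) = (s / θ : ℝ) * p) (h2 : ((-(θ * s) : ℝ) : ℂ) * x = k * (c * p)) :
    x = 0 ∧ p = 0 := by
  have hθ' : (θ : ℂ) ≠ 0 := by exact_mod_cast hθ.ne'
  have hs' : (s : ℂ) ≠ 0 := by exact_mod_cast hs.ne'
  push_cast at h1 h2
  have hp : p = θ * (k * (c * x)) / s := by
    field_simp at h1 ⊢
    linear_combination -h1
  have h3 : ((s ^ 2 + (k * c) ^ 2 : ℝ) : ℂ) * x = 0 := by
    rw [hp] at h2
    push_cast
    field_simp at h2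
    have h4 : (θ : ℂ) * (((s : ℂ) ^ 2 + (k * c) ^ 2) * x) = 0 := by linear_combination (-θ : ℂ) * h2
    exact (mul_eq_zero.1 h4).resolve_left hθ'
  have h5 : (s ^ 2 + (k * c) ^ 2 : ℝ) ≠ 0 := by positivity
  have hx : x = 0 := (mul_eq_zero.1 h3).resolve_left (by exact_mod_cast h5)
  exact ⟨hx, by rw [hp, hx]; simp⟩

/-- In the linear limit there are no matching solutions except for `k = q = 0`. -/
theorem not_hasMatch_modeOp_zero (hV : IsPotential V) (hW : IsPotential W)
    (hb : IsModeBranch V W X₀ Xπ Λ) {q k : ℝ} (hq : |q| ≤ Real.pi / 2) (h : q ≠ 0 ∨ k ≠ 0) :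
    ¬HasMatch (modeOp V W X₀ Xπ Λ (0, q)) k := by
  rintro ⟨x, p, h0, h1, h2⟩
  obtain ⟨e1, e2, e3, e4, -⟩ := end_modeOp_zero hV hW hb q
  rw [e1, e2, diagC_mulVec, diagC_mulVec] at h1
  rw [e3, e4, diagC_mulVec, diagC_mulVec] at h2
  have a0 := congrFun h1 0
  have a1 := congrFun h1 1
  have b0 := congrFun h2 0
  have b1 := congrFun h2 1
  simp only [Pi.smul_apply, Matrix.cons_val_zero, Matrix.cons_val_one, Complex.real_smul] at a0 a1 b0 b1
  have hcos : 0 ≤ Real.cos q := Real.cos_nonneg_of_mem_Icc (abs_le.1 hq)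
  obtain ⟨x0, p0⟩ := eq_zero_of_match (Real.sqrt_pos.2 (phaseSqZero_pos hV hW q))
    (sin_phaseZero_pos hV hW hcos) a0 b0
  have h1 : x 1 = 0 ∧ p 1 = 0 := by
    -- At `q = 0` the second oscillator is the mode itself, with phase `π`: its sine vanishes, its
    -- cosine is `-1`, and the equations force a zero solution only when `k ≠ 0`.
    by_cases hq0 : q = 0
    · have hk : (k : ℂ) ≠ 0 := by exact_mod_cast h.resolve_left (by simp [hq0])
      rw [hq0, sqrt_phaseSqPi_zero hV hW] at a1 b1
      simp [hk] at a1 b1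
      exact ⟨a1, b1⟩
    · have hcos1 : Real.cos q < 1 := by
        refine lt_of_le_of_ne (Real.cos_le_one q) fun hc => hq0 ?_
        have hπ := Real.pi_pos
        have := abs_le.1 hq
        exact (Real.cos_eq_one_iff_of_lt_of_lt (by linarith) (by linarith)).1 hc
      exact eq_zero_of_match (Real.sqrt_pos.2 (phaseSqPi_pos hV hW q))
        (sin_phasePi_pos hV hW hcos1) a1 b1
  have hx : x = 0 := by
    ext i; fin_cases i
    · exact x0
    · exact h1.1
  have hp : p = 0 := by
    ext i; fin_cases i
    · exact p0
    · exact h1.2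
  simp [hx, hp] at h0

/-- Away from `k = q = 0`, there are no matching solutions for small amplitudes. -/
theorem eventually_not_hasMatch_modeOp (hV : IsPotential V) (hW : IsPotential W)
    (hb : IsModeBranch V W X₀ Xπ Λ) {δ κ : ℝ} (hδ : 0 < δ) (hκ : 0 < κ) :
    ∀ᶠ r in 𝓝 0, ∀ q k : ℝ, |q| ≤ Real.pi / 2 → 0 ≤ k → k ≤ 1 → (δ ≤ |q| ∨ κ ≤ k) →
      ¬HasMatch (modeOp V W X₀ Xπ Λ (r, q)) k := by
  -- With `k = 1` included, although it is the limit of infinite multipliers, the parameter set is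
  -- compact. Nonexistence at `r = 0` then extends to a uniform neighbourhood.
  set K : Set (ℝ × ℝ) := (Set.Icc (-(Real.pi / 2)) (Real.pi / 2) ×ˢ Set.Icc 0 1) ∩
    {z | δ ≤ |z.1| ∨ κ ≤ z.2} with hK
  have hKc : IsCompact K := by
    refine (isCompact_Icc.prod isCompact_Icc).inter_right ?_
    exact (isClosed_le continuous_const continuous_fst.abs).union
      (isClosed_le continuous_const continuous_snd)
  have h := hKc.eventually_forall_of_forall_eventually (x₀ := (0 : ℝ))
    (P := fun r z => ¬HasMatch (modeOp V W X₀ Xπ Λ (r, z.1)) z.2) fun z hz => by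
      have hne : z.1 ≠ 0 ∨ z.2 ≠ 0 := hz.2.imp (fun h h0 => by
        rw [h0, abs_zero] at h; linarith) fun h h0 => by linarith
      have hc := (hb.contDiffAt_modeOp hV hW z.1).continuousAt
      have hc' : ContinuousAt (fun y : ℝ × ℝ × ℝ => modeOp V W X₀ Xπ Λ (y.1, y.2.1)) (0, z) :=
        ContinuousAt.comp (g := modeOp V W X₀ Xπ Λ) (f := fun y : ℝ × ℝ × ℝ => (y.1, y.2.1)) hc
          (by fun_prop)
      exact eventually_not_hasMatch (x := ((0 : ℝ), z)) hc' (k := fun y => y.2.2) (by fun_prop)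
        (not_hasMatch_modeOp_zero hV hW hb (abs_le.2 hz.1.1) hne)
  filter_upwards [h] with r hr q k h1 h2 h3 h4
  exact hr (q, k) ⟨⟨abs_le.1 h1, h2, h3⟩, h4⟩

end LinearLimit

end

noncomputable section

/-! ### Perturbations which preserve the mode -/

section Tangent

open scoped ContDiff Matrix Matrix.Norms.L2Operator

/-- A real vector, as the first column of a matrix. -/
def colC (a b : ℝ) : CMat := !![(a : ℂ), 0; (b : ℂ), 0]

theorem colC_eq (a b : ℝ) : colC a b = a • !![1, 0; 0, 0] + b • !![0, 0; 1, 0] := by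
  ext i j
  fin_cases i <;> fin_cases j <;> simp [colC]

theorem HasAccel.colC {u F w G : C(unitInterval, ℝ)} {v v' : ℝ} (hu : HasAccel u v F)
    (hw : HasAccel w v' G) {f H : C(unitInterval, CMat)} (hf : ∀ t, f t = colC (u t) (w t))
    (hH : ∀ t, H t = _root_.colC (F t) (G t)) :
    HasAccel f (_root_.colC v v') H ∧
      primitive H 1 = _root_.colC (primitive F 1) (primitive G 1) := by
  simp only [colC_eq] at hf hH ⊢
  exact hu.combine hw _ _ hf hH

/-- The function with values in the first column. -/
def colI (u w : C(unitInterval, ℝ)) : C(unitInterval, CMat) :=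
  matI !![1, 0; 0, 0] u + matI !![0, 0; 1, 0] w

theorem colI_apply (u w : C(unitInterval, ℝ)) (t : unitInterval) :
    colI u w t = colC (u t) (w t) := by
  rw [colC_eq]; rfl

/-- Derivative of the in-phase force on the mode in the direction `(x', y')`. -/
def forceDerivZero (V : ℝ → ℝ) (x y x' y' : ℝ) : ℝ :=
  1 / 2 * (deriv (deriv V) (x + y) * (x' + y') + deriv (deriv V) (x - y) * (x' - y'))

/-- Derivative of the out-of-phase force on the mode in the direction `(x', y')`. -/
def forceDerivPi (V W : ℝ → ℝ) (x y x' y' : ℝ) : ℝ :=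
  1 / 2 * (deriv (deriv V) (x + y) * (x' + y') - deriv (deriv V) (x - y) * (x' - y')) +
    2 * (deriv (deriv W) (2 * y) + deriv (deriv W) (-(2 * y))) * y'

theorem hasDerivAt_forceZero {V x y : ℝ → ℝ} {x' y' s : ℝ} (hx : HasDerivAt x x' s)
    (hy : HasDerivAt y y' s)
    (h1 : HasDerivAt (deriv V) (deriv (deriv V) (x s + y s)) (x s + y s))
    (h2 : HasDerivAt (deriv V) (deriv (deriv V) (x s - y s)) (x s - y s)) :
    HasDerivAt (fun s => 1 / 2 * (deriv V (x s + y s) + deriv V (x s - y s)))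
      (forceDerivZero V (x s) (y s) x' y') s :=
  ((h1.comp s (hx.add hy)).add (h2.comp s (hx.sub hy))).const_mul (1 / 2)

theorem hasDerivAt_forcePi {V W x y : ℝ → ℝ} {x' y' s : ℝ} (hx : HasDerivAt x x' s)
    (hy : HasDerivAt y y' s)
    (h1 : HasDerivAt (deriv V) (deriv (deriv V) (x s + y s)) (x s + y s))
    (h2 : HasDerivAt (deriv V) (deriv (deriv V) (x s - y s)) (x s - y s))
    (h3 : HasDerivAt (deriv W) (deriv (deriv W) (2 * y s)) (2 * y s))
    (h4 : HasDerivAt (deriv W) (deriv (deriv W) (-(2 * y s))) (-(2 * y s))) :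
    HasDerivAt (fun s => 1 / 2 * (deriv V (x s + y s) - deriv V (x s - y s)) +
        (deriv W (2 * y s) - deriv W (-(2 * y s))))
      (forceDerivPi V W (x s) (y s) x' y') s := by
  have := (((h1.comp s (hx.add hy)).sub (h2.comp s (hx.sub hy))).const_mul (1 / 2)).add
    ((h3.comp s (hy.const_mul 2)).sub (h4.comp s (hy.const_mul 2).neg))
  convert! this using 1
  rw [forceDerivPi]
  ring

variable {V W : ℝ → ℝ} {X₀ Xπ : ℝ → C(unitInterval, ℝ)} {Λ : ℝ → ℝ}

/-- Smoothness of the forces at all points visited by the mode. -/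
theorem IsModeBranch.eventually_hasDerivAt_deriv (hV : IsPotential V) (hW : IsPotential W)
    (hb : IsModeBranch V W X₀ Xπ Λ) : ∀ᶠ r in 𝓝 0, ∀ t,
      HasDerivAt (deriv V) (deriv (deriv V) (r * X₀ r t + r * Xπ r t)) (r * X₀ r t + r * Xπ r t) ∧
      HasDerivAt (deriv V) (deriv (deriv V) (r * X₀ r t - r * Xπ r t)) (r * X₀ r t - r * Xπ r t) ∧
      HasDerivAt (deriv W) (deriv (deriv W) (2 * (r * Xπ r t))) (2 * (r * Xπ r t)) ∧
      HasDerivAt (deriv W) (deriv (deriv W) (-(2 * (r * Xπ r t)))) (-(2 * (r * Xπ r t))) := by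
  have c0 := hb.contDiffAt_zero.continuousAt
  have cπ := hb.contDiffAt_pi.continuousAt
  have s1 := eventually_forall_mul_apply hV.hasDerivAt_deriv (p := (0 : ℝ)) (c := fun r => r)
    (u := fun r => X₀ r + Xπ r) (by fun_prop) (by fun_prop) rfl
  have s2 := eventually_forall_mul_apply hV.hasDerivAt_deriv (p := (0 : ℝ)) (c := fun r => r)
    (u := fun r => X₀ r - Xπ r) (by fun_prop) (by fun_prop) rfl
  have s3 := eventually_forall_mul_apply hW.hasDerivAt_deriv (p := (0 : ℝ)) (c := fun r => 2 * r)
    (u := fun r => Xπ r) (by fun_prop) (by fun_prop) (by simp)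
  have s4 := eventually_forall_mul_apply hW.hasDerivAt_deriv (p := (0 : ℝ)) (c := fun r => -(2 * r))
    (u := fun r => Xπ r) (by fun_prop) (by fun_prop) (by simp)
  filter_upwards [s1, s2, s3, s4] with r s1 s2 s3 s4 t
  have s1 := s1 t
  have s2 := s2 t
  have s3 := s3 t
  have s4 := s4 t
  rw [ContinuousMap.add_apply, mul_add] at s1
  rw [ContinuousMap.sub_apply, mul_sub] at s2
  rw [mul_assoc] at s3
  rw [neg_mul, mul_assoc] at s4
  exact ⟨s1, s2, s3, s4⟩

/-- The Bloch matrix in terms of second derivatives of the potentials. -/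
theorem IsModeBranch.eventually_modeOp_apply (hV : IsPotential V) (hW : IsPotential W)
    (hb : IsModeBranch V W X₀ Xπ Λ) : ∀ᶠ r in 𝓝 0, ∀ q t, modeOp V W X₀ Xπ Λ (r, q) t =
      Λ r • ((1 / 2 * (deriv (deriv V) (r * X₀ r t + r * Xπ r t) +
          deriv (deriv V) (r * X₀ r t - r * Xπ r t)) +
        (deriv (deriv W) (2 * (r * Xπ r t)) + deriv (deriv W) (-(2 * (r * Xπ r t))))) • (1 : CMat) -
      Real.cos q • (deriv (deriv W) (2 * (r * Xπ r t)) +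
        deriv (deriv W) (-(2 * (r * Xπ r t)))) • sigZ +
      (1 / 2 * (deriv (deriv V) (r * X₀ r t + r * Xπ r t) -
          deriv (deriv V) (r * X₀ r t - r * Xπ r t))) • sigX +
      Real.sin q • (deriv (deriv W) (2 * (r * Xπ r t)) -
        deriv (deriv W) (-(2 * (r * Xπ r t)))) • sigY) := by
  have c0 := hb.contDiffAt_zero.continuousAt
  have cπ := hb.contDiffAt_pi.continuousAt
  have h1 := eventually_nem_smul_apply hV.analyticAt_deriv_deriv (p := (0 : ℝ))
    (c := fun r => r) (u := fun r => X₀ r + Xπ r) (by fun_prop) (by fun_prop) rfl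
  have h2 := eventually_nem_smul_apply hV.analyticAt_deriv_deriv (p := (0 : ℝ))
    (c := fun r => r) (u := fun r => X₀ r - Xπ r) (by fun_prop) (by fun_prop) rfl
  have h3 := eventually_nem_smul_apply hW.analyticAt_deriv_deriv (p := (0 : ℝ))
    (c := fun r => r) (u := fun r => (2 : ℝ) • Xπ r) (by fun_prop) (by fun_prop) rfl
  have h4 := eventually_nem_smul_apply hW.analyticAt_deriv_deriv (p := (0 : ℝ))
    (c := fun r => r) (u := fun r => -(2 : ℝ) • Xπ r) (by fun_prop) (by fun_prop) rfl
  filter_upwards [h1, h2, h3, h4] with r h1 h2 h3 h4 q t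
  simp only [modeOp, blochOp_apply, h1, h2, h3, h4, ContinuousMap.add_apply,
    ContinuousMap.sub_apply, ContinuousMap.smul_apply, smul_eq_mul]
  rw [show r * (2 * Xπ r t) = 2 * (r * Xπ r t) by ring,
    show r * (-2 * Xπ r t) = -(2 * (r * Xπ r t)) by ring, mul_add r (X₀ r t) (Xπ r t),
    mul_sub r (X₀ r t) (Xπ r t)]

/-- The Bloch matrix with `q = 0` is the derivative of the forces on the mode. -/
theorem IsModeBranch.eventually_modeOp_mul_colC (hV : IsPotential V) (hW : IsPotential W)
    (hb : IsModeBranch V W X₀ Xπ Λ) : ∀ᶠ r in 𝓝 0, ∀ t a b,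
      modeOp V W X₀ Xπ Λ (r, 0) t * colC a b =
        colC (Λ r * forceDerivZero V (r * X₀ r t) (r * Xπ r t) a b)
          (Λ r * forceDerivPi V W (r * X₀ r t) (r * Xπ r t) a b) := by
  filter_upwards [hb.eventually_modeOp_apply hV hW] with r h t a b
  rw [h]
  ext i j
  fin_cases i <;> fin_cases j <;>
    simp [sigX, sigZ, colC, forceDerivZero, forceDerivPi, Matrix.mul_apply, Fin.sum_univ_two,
      Matrix.one_apply] <;> ring

theorem det_eq_zero_of_mul_colC {S : CMat} {a b : ℝ} (h : S * colC a b = 0) (hb : b ≠ 0) :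
    S.det = 0 := by
  refine Matrix.exists_mulVec_eq_zero_iff.1 ⟨![(a : ℂ), (b : ℂ)], fun h0 => ?_, ?_⟩
  · have := congrFun h0 1
    simp at this
    exact hb this
  · ext i
    have := congrFun (congrFun h i) 0
    fin_cases i <;>
      simpa [colC, Matrix.mul_apply, Fin.sum_univ_two, Matrix.mulVec, dotProduct] using this

/-- The velocity of the mode is an odd perturbation that vanishes at half a period. -/
theorem IsModeBranch.eventually_oddDet_eq_zero (hV : IsPotential V) (hW : IsPotential W)
    (hb : IsModeBranch V W X₀ Xπ Λ) (m : ℝ) :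
    ∀ᶠ r in 𝓝[≠] 0, oddDet m (modeOp V W X₀ Xπ Λ (r, 0)) = 0 := by
  have lt : (𝓝[≠] (0 : ℝ)) ≤ 𝓝 0 := nhdsWithin_le_nhds
  have tf : Tendsto (fun r => dimerForcePi V W (r, X₀ r, Xπ r) 0) (𝓝 0) (𝓝 (piFreqSq V W)) := by
    have h1 := (contDiffAt_dimerForcePi hV hW (0, cosI Real.pi)).continuousAt.tendsto.comp
      (tendsto_branch hb)
    have h2 := ((by fun_prop : Continuous fun f : C(unitInterval, ℝ) => f 0).tendsto _).comp h1
    have e : (piFreqSq V W • cosI Real.pi) 0 = piFreqSq V W := by simp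
    rw [dimerForcePi_zero hV hW, e] at h2
    exact h2
  filter_upwards [lt hb.sol, lt (hb.eventually_time_pos hV hW),
    lt ((tendsto_branch hb).eventually (mul_dimerForceZero_apply hV _)),
    lt ((tendsto_branch hb).eventually (mul_dimerForcePi_apply hV hW _)),
    lt (hb.eventually_hasDerivAt_deriv hV hW), lt (hb.eventually_modeOp_mul_colC hV hW),
    self_mem_nhdsWithin, lt (tf.eventually (lt_mem_nhds (piFreqSq_pos hV hW)))]
    with r hs hΛ f0 fπ hd hA hr hfpos
  have hr : r ≠ 0 := hr
  obtain ⟨x, x', hx, hx', x0, x1, xX⟩ := (hs.accel_zero.smul r).exists_extension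
  obtain ⟨y, y', hy, hy', y0, y1, yY⟩ := (hs.accel_pi.smul r).exists_extension
  have hx1 : ∀ t : unitInterval, x t = r * X₀ r t := xX
  have hy1 : ∀ t : unitInterval, y t = r * Xπ r t := yY
  have hx2 : ∀ t : unitInterval, HasDerivAt x'
      (-Λ r * (1 / 2 * (deriv V (x t + y t) + deriv V (x t - y t)))) t := fun t => by
    have h := hx' t
    rw [extendI_coe] at h
    convert! h using 1
    rw [hx1, hy1, ← f0]
    simp
    ring
  have hy2 : ∀ t : unitInterval, HasDerivAt y'
      (-Λ r * (1 / 2 * (deriv V (x t + y t) - deriv V (x t - y t)) +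
        (deriv W (2 * y t) - deriv W (-(2 * y t))))) t := fun t => by
    have h := hy' t
    rw [extendI_coe] at h
    convert! h using 1
    rw [hx1, hy1, ← fπ]
    simp
    ring
  have cont : ∀ {z : ℝ → ℝ} {z' : ℝ → ℝ}, (∀ t, HasDerivAt z (z' t) t) →
      Continuous fun t : unitInterval => z t := fun h =>
    (continuous_iff_continuousAt.2 fun t => (h t).continuousAt).comp continuous_subtype_val
  -- The velocity `(x', y')` of the mode solves the variational equation with `q = 0`, by
  -- differentiation of the equations of motion in time. The Neumann conditions make it vanish at
  -- both ends.
  set p : C(unitInterval, ℝ) := ⟨fun t => x' t, cont hx'⟩ with hp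
  set s : C(unitInterval, ℝ) := ⟨fun t => y' t, cont hy'⟩ with hs'
  set g := colI p s with hg
  set A := modeOp V W X₀ Xπ Λ (r, 0) with hAdef
  have key : ∀ t, (-(A * g)) t =
      colC (-Λ r * forceDerivZero V (x t) (y t) (x' t) (y' t))
        (-Λ r * forceDerivPi V W (x t) (y t) (x' t) (y' t)) := fun t => by
    rw [ContinuousMap.neg_apply, ContinuousMap.mul_apply, hg, colI_apply, hA, hx1, hy1]
    ext i j
    fin_cases i <;> fin_cases j <;> simp [colC, hp, hs']
  have hre : ∀ i : Fin 2, Continuous fun t => ((-(A * g)) t i 0).re := fun i => by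
    have : Continuous fun m : CMat => (m i 0).re := by fun_prop
    exact this.comp (-(A * g)).continuous
  set F : C(unitInterval, ℝ) := ⟨_, hre 0⟩ with hF
  set G : C(unitInterval, ℝ) := ⟨_, hre 1⟩ with hG
  have eF : ∀ t : unitInterval, F t = -Λ r * forceDerivZero V (x t) (y t) (x' t) (y' t) :=
    fun t => by
      rw [hF, ContinuousMap.coe_mk, key]
      simp [colC]
  have eG : ∀ t : unitInterval, G t = -Λ r * forceDerivPi V W (x t) (y t) (x' t) (y' t) :=
    fun t => by
      rw [hG, ContinuousMap.coe_mk, key]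
      simp [colC]
  have dF := hasAccel_of_hasDerivAt (f := p) (F := F) hx2 (fun t => by
    obtain ⟨d1, d2, d3, d4⟩ := hd t
    rw [← hx1, ← hy1] at d1 d2
    rw [eF]
    exact (hasDerivAt_forceZero (hx t) (hy t) d1 d2).const_mul _) (fun t => rfl)
  have dG := hasAccel_of_hasDerivAt (f := s) (F := G) hy2 (fun t => by
    obtain ⟨d1, d2, d3, d4⟩ := hd t
    rw [← hx1, ← hy1] at d1 d2
    rw [← hy1] at d3 d4
    rw [eG]
    exact (hasDerivAt_forcePi (hx t) (hy t) d1 d2 d3 d4).const_mul _) (fun t => rfl)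
  have hgA := (dF.colC dG (f := g) (H := -(A * g)) (fun t => colI_apply _ _ t) fun t => by
    rw [key, eF, eG]).1
  have hend := hgA.end_eq.1
  have g0 : g 0 = 0 := by
    rw [hg, colI_apply, hp, hs']
    ext i j
    fin_cases i <;> fin_cases j <;> simp [colC, x0, y0]
  have g1 : g 1 = 0 := by
    rw [hg, colI_apply, hp, hs']
    have e1 := hs.velocity_zero
    have e2 := hs.velocity_pi
    ext i j
    fin_cases i <;> fin_cases j <;> simp [colC, x1, y1, e1, e2]
  rw [g0, g1, mul_zero, zero_add] at hend
  -- The initial velocity of this perturbation is the initial acceleration of the mode. Its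
  -- out-of-phase part is nonzero because the rescaled force at `t = 0` is close to `Ω`.
  have hdet := det_eq_zero_of_mul_colC hend.symm (by
    have := fπ 0
    rw [← hx1, ← hy1] at this
    simp only [Set.Icc.coe_zero] at this
    rw [← this]
    exact mul_ne_zero (neg_ne_zero.2 hΛ.ne') (mul_ne_zero hr hfpos.ne'))
  rw [oddDet, hdet, zero_div, Complex.zero_re]

end Tangent

end

noncomputable section

/-! ### The even determinant along the branch -/

section EvenDet

open scoped ContDiff Matrix Matrix.Norms.L2Operator

theorem HasDerivAt.apply_continuousMap {f : ℝ → C(unitInterval, ℝ)} {f' : C(unitInterval, ℝ)} {r : ℝ}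
    (h : HasDerivAt f f' r) (t : unitInterval) : HasDerivAt (fun s => f s t) (f' t) r :=
  (ContinuousMap.evalCLM ℝ t : C(unitInterval, ℝ) →L[ℝ] ℝ).hasFDerivAt.comp_hasDerivAt r h

theorem HasDerivAt.primitive {f : ℝ → C(unitInterval, ℝ)} {f' : C(unitInterval, ℝ)} {r : ℝ}
    (h : HasDerivAt f f' r) : HasDerivAt (fun s => _root_.primitive (f s)) (_root_.primitive f') r :=
  (_root_.primitive : C(unitInterval, ℝ) →L[ℝ] _).hasFDerivAt.comp_hasDerivAt r h

/-- In integral form a second-order equation can be differentiated in a parameter term by term. -/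
theorem HasAccel.hasDerivAt {f F : ℝ → C(unitInterval, ℝ)} {f' F' : C(unitInterval, ℝ)} {r : ℝ}
    (h : ∀ᶠ s in 𝓝 r, HasAccel (f s) 0 (F s)) (hf : HasDerivAt f f' r) (hF : HasDerivAt F F' r) :
    HasAccel f' 0 F' := fun t => by
  have h1 := hf.apply_continuousMap t
  have h2 := ((hf.apply_continuousMap 0).add_const ((t : ℝ) • (0 : ℝ))).add
    (hF.primitive.primitive.apply_continuousMap t)
  rw [smul_zero, add_zero]
  refine h1.unique (h2.congr_of_eventuallyEq ?_)
  filter_upwards [h] with s hs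
  exact hs t

/-- If `(f(r) - f(0)) / r²` converges, so does `f'(r) / r`. -/
theorem tendsto_deriv_div {f : ℝ → ℝ} {c : ℝ} (hf : ContDiffAt ℝ ω f 0)
    (h : Tendsto (fun r => (f r - f 0) / r ^ 2) (𝓝[≠] 0) (𝓝 c)) :
    Tendsto (fun r => deriv f r / r) (𝓝[≠] 0) (𝓝 (2 * c)) := by
  have tr : Tendsto (fun r : ℝ => r) (𝓝[≠] 0) (𝓝 0) := nhdsWithin_le_nhds
  have hne : ∀ᶠ r : ℝ in 𝓝[≠] 0, r ≠ 0 := self_mem_nhdsWithin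
  have hd : ∀ᶠ r in 𝓝 0, DifferentiableAt ℝ f r :=
    (hf.eventually (by simp)).mono fun r h => h.differentiableAt (by simp)
  -- Convergence of the quotient by `r²` forces `f'(0) = 0`. Then `f'(r)/r` tends to `f''(0)`, and
  -- l'Hôpital's rule identifies this limit with `2c`.
  have h1 : deriv f 0 = 0 := by
    have a1 := (hasDerivAt_iff_tendsto_slope.1 (hf.differentiableAt (by simp)).hasDerivAt)
    have a2 : Tendsto (slope f 0) (𝓝[≠] 0) (𝓝 0) := by
      have := h.mul tr
      rw [mul_zero] at this
      refine this.congr' ?_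
      filter_upwards [hne] with r hr
      rw [slope_def_field, sub_zero]
      field_simp
    exact tendsto_nhds_unique a1 a2
  have hdd : DifferentiableAt ℝ (deriv f) 0 :=
    hf.analyticAt.deriv.differentiableAt
  have h2 : Tendsto (fun r => deriv f r / r) (𝓝[≠] 0) (𝓝 (deriv (deriv f) 0)) := by
    refine (hasDerivAt_iff_tendsto_slope.1 hdd.hasDerivAt).congr fun r => ?_
    rw [slope_def_field, h1, sub_zero, sub_zero]
  have h3 : Tendsto (fun r => (f r - f 0) / r ^ 2) (𝓝[≠] 0) (𝓝 (deriv (deriv f) 0 / 2)) := by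
    have lt : (𝓝[≠] (0 : ℝ)) ≤ 𝓝 0 := nhdsWithin_le_nhds
    refine HasDerivAt.lhopital_zero_nhdsNE (f' := deriv f) (g' := fun r => 2 * r) ?_ ?_ ?_ ?_ ?_ ?_
    · filter_upwards [lt hd] with r hr
      exact hr.hasDerivAt.sub_const _
    · filter_upwards with r
      simpa using hasDerivAt_pow 2 r
    · filter_upwards [hne] with r hr
      simpa using hr
    · have := (hf.continuousAt.tendsto.mono_left lt).sub_const (f 0)
      rwa [sub_self] at this
    · have := tr.pow 2
      simpa using this
    · refine (h2.div_const 2).congr fun r => ?_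
      rw [div_div, mul_comm]
  rw [tendsto_nhds_unique h h3, mul_div_cancel₀ _ two_ne_zero]
  exact h2

variable {V W : ℝ → ℝ} {X₀ Xπ : ℝ → C(unitInterval, ℝ)} {Λ : ℝ → ℝ}

/-- The derivative of the mode with respect to its amplitude solves an inhomogeneous variational
equation. -/
theorem IsModeBranch.eventually_endCosDeriv_mul (hV : IsPotential V) (hW : IsPotential W)
    (hb : IsModeBranch V W X₀ Xπ Λ) : ∀ᶠ r in 𝓝 0,
    (endCosDeriv (modeOp V W X₀ Xπ Λ (r, 0)))ᴴ *
        colC (deriv (fun s => s • X₀ s) r 1) (deriv (fun s => s • Xπ s) r 1) =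
      deriv Λ r • primitive (star (fundCos (modeOp V W X₀ Xπ Λ (r, 0))) *
        (r • colI (dimerForceZero V (r, X₀ r, Xπ r)) (dimerForcePi V W (r, X₀ r, Xπ r)))) 1 := by
  have hp : ContDiffAt ℝ ω (fun s => (s, X₀ s, Xπ s)) 0 :=
    contDiffAt_id.prodMk (hb.contDiffAt_zero.prodMk hb.contDiffAt_pi)
  have hp0 : (fun s => (s, X₀ s, Xπ s)) 0 = (0, 0, cosI Real.pi) := by
    simp only [hb.zero_zero, hb.pi_zero]
  have k0 : ContDiffAt ℝ ω (fun s => dimerForceZero V (s, X₀ s, Xπ s)) 0 :=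
    ContDiffAt.comp (0 : ℝ) (g := dimerForceZero V) (by
      rw [show ((0 : ℝ), X₀ 0, Xπ 0) = (0, 0, cosI Real.pi) from hp0]
      exact contDiffAt_dimerForceZero hV (0, cosI Real.pi)) hp
  have kπ : ContDiffAt ℝ ω (fun s => dimerForcePi V W (s, X₀ s, Xπ s)) 0 :=
    ContDiffAt.comp (0 : ℝ) (g := dimerForcePi V W)
      (by
      rw [show ((0 : ℝ), X₀ 0, Xπ 0) = (0, 0, cosI Real.pi) from hp0]
      exact contDiffAt_dimerForcePi hV hW (0, cosI Real.pi)) hp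
  have ev : ∀ {E : Type} [NormedAddCommGroup E] [NormedSpace ℝ E] {f : ℝ → E}, ContDiffAt ℝ ω f 0 →
      ∀ᶠ r in 𝓝 0, DifferentiableAt ℝ f r := fun h =>
    (h.eventually (by simp)).mono fun r h => h.differentiableAt (by simp)
  filter_upwards [hb.sol.eventually_nhds,
    ((tendsto_branch hb).eventually (mul_dimerForceZero_apply hV _)).eventually_nhds,
    ((tendsto_branch hb).eventually (mul_dimerForcePi_apply hV hW _)).eventually_nhds,
    hb.eventually_hasDerivAt_deriv hV hW, hb.eventually_modeOp_mul_colC hV hW,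
    ev (contDiffAt_id.smul hb.contDiffAt_zero), ev (contDiffAt_id.smul hb.contDiffAt_pi),
    ev (contDiffAt_id.smul k0), ev (contDiffAt_id.smul kπ), ev hb.contDiffAt_time]
    with r hs f0 fπ hd hA du dw dF dG dΛ
  have du := du.hasDerivAt
  have dw := dw.hasDerivAt
  have dF := dF.hasDerivAt
  have dG := dG.hasDerivAt
  have dΛ := dΛ.hasDerivAt
  simp only [id, Pi.smul_def'] at du dw dF dG
  set u' := deriv (fun s => s • X₀ s) r with hu'
  set w' := deriv (fun s => s • Xπ s) r with hw'
  set F' := deriv (fun s => s • dimerForceZero V (s, X₀ s, Xπ s)) r with hF'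
  set G' := deriv (fun s => s • dimerForcePi V W (s, X₀ s, Xπ s)) r with hG'
  have hs0 := hs.self_of_nhds
  -- accelerations
  have a1 := HasAccel.hasDerivAt (f := fun s => s • X₀ s)
    (F := fun s => (-Λ s) • (s • dimerForceZero V (s, X₀ s, Xπ s)))
    (hs.mono fun s hs => by
      have := hs.accel_zero.smul s
      rwa [smul_zero, smul_comm] at this) du (dΛ.neg.smul dF)
  have a2 := HasAccel.hasDerivAt (f := fun s => s • Xπ s)
    (F := fun s => (-Λ s) • (s • dimerForcePi V W (s, X₀ s, Xπ s)))
    (hs.mono fun s hs => by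
      have := hs.accel_pi.smul s
      rwa [smul_zero, smul_comm] at this) dw (dΛ.neg.smul dG)
  -- end velocities
  have v1 : primitive F' 1 = 0 := (dF.primitive.apply_continuousMap 1).unique
    ((hasDerivAt_const r (0 : ℝ)).congr_of_eventuallyEq (hs.mono fun s hs => by
      simp [hs.velocity_zero]))
  have v2 : primitive G' 1 = 0 := (dG.primitive.apply_continuousMap 1).unique
    ((hasDerivAt_const r (0 : ℝ)).congr_of_eventuallyEq (hs.mono fun s hs => by
      simp [hs.velocity_pi]))
  -- pointwise values
  have e1 : ∀ t, F' t = forceDerivZero V (r * X₀ r t) (r * Xπ r t) (u' t) (w' t) := fun t => by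
    obtain ⟨d1, d2, d3, d4⟩ := hd t
    refine (dF.apply_continuousMap t).unique ((hasDerivAt_forceZero (du.apply_continuousMap t)
      (dw.apply_continuousMap t) d1 d2).congr_of_eventuallyEq (f0.mono fun s f0 => ?_))
    exact f0 t
  have e2 : ∀ t, G' t = forceDerivPi V W (r * X₀ r t) (r * Xπ r t) (u' t) (w' t) := fun t => by
    obtain ⟨d1, d2, d3, d4⟩ := hd t
    refine (dG.apply_continuousMap t).unique ((hasDerivAt_forcePi (du.apply_continuousMap t)
      (dw.apply_continuousMap t) d1 d2 d3 d4).congr_of_eventuallyEq (fπ.mono fun s f0 => ?_))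
    exact f0 t
  set A := modeOp V W X₀ Xπ Λ (r, 0) with hAdef
  set Φ := r • colI (dimerForceZero V (r, X₀ r, Xπ r)) (dimerForcePi V W (r, X₀ r, Xπ r)) with hΦ
  set g := colI u' w' with hg
  have hAg : ∀ t, (A * g) t = colC ((Λ r • F') t) ((Λ r • G') t) := fun t => by
    rw [ContinuousMap.mul_apply, hg, colI_apply, hA, ContinuousMap.smul_apply,
      ContinuousMap.smul_apply, e1, e2, smul_eq_mul, smul_eq_mul]
  -- The amplitude derivative `g` satisfies `g'' = -A g - Λ' Φ`. The inhomogeneity arises because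
  -- half a period, whose length depends on the amplitude, was scaled to the unit interval.
  obtain ⟨b1, b2⟩ := a1.colC a2 (f := g) (H := -(A * g) - deriv Λ r • Φ)
    (fun t => colI_apply _ _ t) fun t => by
      rw [ContinuousMap.sub_apply, ContinuousMap.neg_apply, hAg, hΦ, ContinuousMap.smul_apply (deriv Λ r),
        ContinuousMap.smul_apply r, colI_apply]
      ext i j
      fin_cases i <;> fin_cases j <;> simp [colC] <;> ring
  have z : colC 0 0 = 0 := by
    ext i j
    fin_cases i <;> fin_cases j <;> simp [colC]
  have b3 : primitive (-(A * g) - deriv Λ r • Φ) 1 = 0 := by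
    rw [b2, ← z]
    congr 1
    · simp [v1, hs0.velocity_zero]
    · simp [v2, hs0.velocity_pi]
  rw [z] at b1
  have c1 := (hasAccel_fundCos A).star
  have hstar : star A = A := star_blochOp _ _ _ _ _ _ _
  rw [star_neg, star_mul, hstar, Matrix.conjTranspose_zero] at c1
  -- Green's identity against the adjoint cosine-like solution: both have zero initial velocity and
  -- `g` has zero final velocity. Only the product of the adjoint of `C'` with `g(1)` survives on
  -- the boundary.
  have hgreen := c1.green b1
  rw [b3, zero_add, zero_add, mul_zero, mul_zero, zero_mul, sub_zero, sub_zero, zero_sub] at hgreen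
  have e3 : star (fundCos A) * (-(A * g) - deriv Λ r • Φ) - -(star (fundCos A) * A) * g =
      -(deriv Λ r • (star (fundCos A) * Φ)) := by
    ext1 t
    simp [mul_sub, mul_assoc]
    abel
  have e4 : star (fundCos A) * A = star (A * fundCos A) := by rw [star_mul, hstar]
  rw [e3, map_neg, map_smul, e4, map_neg, ContinuousMap.neg_apply, ContinuousMap.neg_apply,
    primitive_star, neg_inj, ContinuousMap.smul_apply] at hgreen
  rw [endCosDeriv, Matrix.conjTranspose_neg, hgreen, hg, colI_apply]

theorem conjTranspose_diagC (a b : ℝ) : (diagC a b)ᴴ = diagC a b := by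
  ext i j
  fin_cases i <;> fin_cases j <;> simp [diagC]

theorem tendsto_coe {α : Type*} {l : Filter α} {f : α → ℝ} {c : ℝ} (h : Tendsto f l (𝓝 c)) :
    Tendsto (fun x => (f x : ℂ)) l (𝓝 (c : ℂ)) := (Complex.continuous_ofReal.tendsto c).comp h

/-- The quadratic growth of the even determinant is given by the nonlinear frequency shift. -/
theorem IsModeBranch.tendsto_det_endCosDeriv (hV : IsPotential V) (hW : IsPotential W)
    (hb : IsModeBranch V W X₀ Xπ Λ) {b : ℝ}
    (hf : Tendsto (fun r => (Real.pi ^ 2 / Λ r - piFreqSq V W) / r ^ 2) (𝓝[≠] 0) (𝓝 b)) :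
    Tendsto (fun r => (endCosDeriv (modeOp V W X₀ Xπ Λ (r, 0))).det / ((r ^ 2 : ℝ) : ℂ)) (𝓝[≠] 0)
      (𝓝 ((-(inPhaseAngle V W * Real.sin (inPhaseAngle V W) *
        (Real.pi ^ 2 * b / piFreqSq V W)) : ℝ) : ℂ)) := by
  have hΩ := piFreqSq_pos hV hW
  have lt : (𝓝[≠] (0 : ℝ)) ≤ 𝓝 0 := nhdsWithin_le_nhds
  have hne : ∀ᶠ r : ℝ in 𝓝[≠] 0, r ≠ 0 := self_mem_nhdsWithin
  have hΛ := lt (hb.eventually_time_pos hV hW)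
  -- As `Λ = π²/Ω - (π² b/Ω²) r² + o(r²)`, the quotient `Λ'(r)/r` tends to twice the quadratic
  -- coefficient.
  have tΛ : Tendsto (fun r => deriv Λ r / r) (𝓝[≠] 0)
      (𝓝 (2 * (-(Real.pi ^ 2 / piFreqSq V W / piFreqSq V W * b)))) := by
    refine tendsto_deriv_div hb.contDiffAt_time ?_
    have t1 := (((hb.contDiffAt_time.continuousAt.tendsto.mono_left lt).div_const
      (piFreqSq V W)).mul hf).neg
    rw [hb.time_zero] at t1
    refine t1.congr' ?_
    filter_upwards [hne, hΛ] with r hr hΛ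
    rw [hb.time_zero]
    field_simp
    ring
  set θ := inPhaseAngle V W with hθ
  obtain ⟨e1, e2, e3, e4, e5⟩ := end_modeOp_zero hV hW hb 0
  rw [sqrt_phaseSqZero_zero, sqrt_phaseSqPi_zero hV hW, Real.sin_pi, mul_zero, neg_zero] at e3
  simp only [sqrt_phaseSqZero_zero, sqrt_phaseSqPi_zero hV hW] at e5
  have cA : ContinuousAt (fun r : ℝ => modeOp V W X₀ Xπ Λ (r, 0)) 0 :=
    ContinuousAt.comp (g := modeOp V W X₀ Xπ Λ) (f := fun r : ℝ => (r, (0 : ℝ)))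
      (hb.contDiffAt_modeOp hV hW 0).continuousAt (by fun_prop)
  have tD : Tendsto (fun r => (endCosDeriv (modeOp V W X₀ Xπ Λ (r, 0)))ᴴ) (𝓝[≠] 0)
      (𝓝 (diagC (-(θ * Real.sin θ)) 0)) := by
    have h1 := (contDiff_endCosDeriv (n := 0) (R := CMat)).continuous.continuousAt.comp cA
    have h2 := ((continuous_id.matrix_conjTranspose :
      Continuous fun M : CMat => Mᴴ).tendsto _).comp (h1.tendsto.mono_left lt)
    simp only [Function.comp_def] at h2
    rwa [e3, id, conjTranspose_diagC] at h2
  have tC : Tendsto (fun r => star (fundCos (modeOp V W X₀ Xπ Λ (r, 0)))) (𝓝[≠] 0)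
      (𝓝 (fundCos (modeOp V W X₀ Xπ Λ (0, 0)))) := by
    have h1 := (contDiff_fundCos (n := 0) (R := CMat)).continuous.continuousAt.comp cA
    have h2 := ((continuous_star.tendsto _).comp (h1.tendsto.mono_left lt))
    have e : star (fundCos (modeOp V W X₀ Xπ Λ (0, 0))) = fundCos (modeOp V W X₀ Xπ Λ (0, 0)) := by
      ext1 t
      rw [ContinuousMap.star_apply, e5, Matrix.star_eq_conjTranspose, conjTranspose_diagC]
    simp only [Function.comp_def] at h2
    rwa [e] at h2
  have tB : Tendsto (fun r => (r, X₀ r, Xπ r)) (𝓝[≠] 0) (𝓝 (0, 0, cosI Real.pi)) :=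
    (tendsto_branch hb).mono_left lt
  have tF : Tendsto (fun r => colI (dimerForceZero V (r, X₀ r, Xπ r))
      (dimerForcePi V W (r, X₀ r, Xπ r))) (𝓝[≠] 0)
      (𝓝 (colI 0 (piFreqSq V W • cosI Real.pi))) := by
    have h1 := (contDiffAt_dimerForceZero hV (0, cosI Real.pi)).continuousAt.tendsto.comp tB
    have h2 := (contDiffAt_dimerForcePi hV hW (0, cosI Real.pi)).continuousAt.tendsto.comp tB
    rw [dimerForceZero_zero hV] at h1
    rw [dimerForcePi_zero hV hW] at h2
    rw [smul_zero] at h1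
    exact (((matI _).continuous.tendsto _).comp h1).add (((matI _).continuous.tendsto _).comp h2)
  have tR := ((((contDiff_apply_continuousMap (E := CMat) (n := 0) 1).continuous.comp
    primitive.continuous).tendsto _).comp (tC.mul tF))
  simp only [Function.comp_def] at tR
  have eR : primitive (fundCos (modeOp V W X₀ Xπ Λ (0, 0)) *
      colI 0 (piFreqSq V W • cosI Real.pi)) 1 = colC 0 (piFreqSq V W / 2) := by
    have h : fundCos (modeOp V W X₀ Xπ Λ (0, 0)) * colI 0 (piFreqSq V W • cosI Real.pi) =
        piFreqSq V W • matI !![0, 0; 1, 0] (cosI Real.pi ^ 2) := by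
      ext1 t
      rw [ContinuousMap.mul_apply, e5, colI_apply, ContinuousMap.smul_apply (piFreqSq V W) (matI _ _),
        matI_apply]
      ext i j
      fin_cases i <;> fin_cases j <;> simp [diagC, colC]
      ring
    rw [h, map_smul, ContinuousMap.smul_apply,
      primitive_map (f := cosI Real.pi ^ 2)
        (ContinuousLinearMap.toSpanSingleton ℝ (!![0, 0; 1, 0] : CMat)) (fun _ => rfl),
      primitive_cosI_pi_sq]
    ext i j
    fin_cases i <;> fin_cases j <;> simp [colC]
    ring
  rw [eR] at tR
  have tw : Tendsto (fun r => deriv (fun s => s • Xπ s) r 1) (𝓝[≠] 0) (𝓝 (-1)) := by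
    have h0 : ContDiffAt ℝ ω (fun s : ℝ => s • Xπ s) 0 := contDiffAt_id.smul hb.contDiffAt_pi
    have h1 : ContinuousAt (deriv fun s : ℝ => s • Xπ s) 0 := h0.analyticAt.deriv.continuousAt
    have h2 : deriv (fun s : ℝ => s • Xπ s) 0 = cosI Real.pi := by
      have h3 := (hasDerivAt_id (0 : ℝ)).smul
        (hb.contDiffAt_pi.differentiableAt (by simp)).hasDerivAt
      have h4 := h3.deriv
      simp only [id, zero_smul, zero_add, one_smul, hb.pi_zero] at h4
      exact h4
    have h5 := ((by fun_prop : Continuous fun f : C(unitInterval, ℝ) => f 1).tendsto _).comp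
      (h1.tendsto.mono_left lt)
    have e : (cosI Real.pi) 1 = -1 := by simp
    rw [h2, e] at h5
    exact h5
  have entry : ∀ {f : ℝ → CMat} {M : CMat} (_ : Tendsto f (𝓝[≠] 0) (𝓝 M)) (i j : Fin 2),
      Tendsto (fun r => f r i j) (𝓝[≠] 0) (𝓝 (M i j)) := fun h i j =>
    ((by fun_prop : Continuous fun M : CMat => M i j).tendsto _).comp h
  have lim := ((tendsto_coe tΛ).mul (((entry tD 0 0).mul (entry tR 1 0)).sub
    ((entry tD 1 0).mul (entry tR 0 0)))).div (tendsto_coe tw) (by simp)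
  have e6 : (((2 * (-(Real.pi ^ 2 / piFreqSq V W / piFreqSq V W * b)) : ℝ) : ℂ) *
      (diagC (-(θ * Real.sin θ)) 0 0 0 * colC 0 (piFreqSq V W / 2) 1 0 -
        diagC (-(θ * Real.sin θ)) 0 1 0 * colC 0 (piFreqSq V W / 2) 0 0)) / ((-1 : ℝ) : ℂ) =
        ((-(θ * Real.sin θ * (Real.pi ^ 2 * b / piFreqSq V W)) : ℝ) : ℂ) := by
    have hΩ' : (piFreqSq V W : ℂ) ≠ 0 := by exact_mod_cast hΩ.ne'
    simp [diagC, colC]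
    field_simp
  have lim2 := (Complex.continuous_conj.tendsto _).comp lim
  rw [e6, Complex.conj_ofReal] at lim2
  refine lim2.congr' ?_
  filter_upwards [hne, lt (hb.eventually_endCosDeriv_mul hV hW),
    tw.eventually (gt_mem_nhds (show (-1 : ℝ) < 0 by norm_num))] with r hr hkey hw
  set D := (endCosDeriv (modeOp V W X₀ Xπ Λ (r, 0)))ᴴ with hD
  set P := primitive (star (fundCos (modeOp V W X₀ Xπ Λ (r, 0))) *
    colI (dimerForceZero V (r, X₀ r, Xπ r)) (dimerForcePi V W (r, X₀ r, Xπ r))) 1 with hP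
  have hw' : ((deriv (fun s => s • Xπ s) r 1 : ℝ) : ℂ) ≠ 0 := by exact_mod_cast hw.ne
  have hr' : (r : ℂ) ≠ 0 := by exact_mod_cast hr
  have hsm : star (fundCos (modeOp V W X₀ Xπ Λ (r, 0))) *
      (r • colI (dimerForceZero V (r, X₀ r, Xπ r)) (dimerForcePi V W (r, X₀ r, Xπ r))) =
      r • (star (fundCos (modeOp V W X₀ Xπ Λ (r, 0))) *
      colI (dimerForceZero V (r, X₀ r, Xπ r)) (dimerForcePi V W (r, X₀ r, Xπ r))) := by
    ext1 t
    simp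
  rw [hsm, map_smul, ContinuousMap.smul_apply, ← hP] at hkey
  have k0 := congrFun (congrFun hkey 0) 0
  have k1 := congrFun (congrFun hkey 1) 0
  simp [colC, Matrix.mul_apply, Fin.sum_univ_two] at k0 k1
  -- Cramer's rule for the linear system just obtained: eliminating the in-phase end value expresses
  -- `det D` through the out-of-phase end value, which tends to `-1`.
  have hdet : D.det * (deriv (fun s => s • Xπ s) r 1 : ℝ) =
      ((deriv Λ r : ℝ) : ℂ) * r * (D 0 0 * P 1 0 - D 1 0 * P 0 0) := by
    rw [Matrix.det_fin_two]
    linear_combination D 0 0 * k1 - D 1 0 * k0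
  have hre : (endCosDeriv (modeOp V W X₀ Xπ Λ (r, 0))).det = (starRingEnd ℂ) D.det := by
    rw [hD, Matrix.det_conjTranspose, ← starRingEnd_apply, Complex.conj_conj]
  have : D.det = ((r ^ 2 : ℝ) : ℂ) * (((deriv Λ r / r : ℝ) : ℂ) * (D 0 0 * P 1 0 - D 1 0 * P 0 0) /
      (deriv (fun s => s • Xπ s) r 1 : ℝ)) := by
    push_cast
    field_simp
    linear_combination hdet
  have hr2 : ((r ^ 2 : ℝ) : ℂ) ≠ 0 := by exact_mod_cast pow_ne_zero 2 hr
  rw [hre, this, map_mul, Complex.conj_ofReal, mul_div_cancel_left₀ _ hr2]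
  rfl

end EvenDet

end

noncomputable section

/-! ### Expansions of the boundary determinants -/

section Expansions

open scoped ContDiff Matrix Matrix.Norms.L2Operator

/-- Uniform quadratic expansion of an analytic function which is even in its first variable. -/
theorem exists_even_expansion {g : ℝ × ℝ → ℝ} {b : ℝ} (hg : ContDiffAt ℝ ω g (0, 0))
    (he : ∀ᶠ r in 𝓝 (0 : ℝ), ∀ q, g (-r, q) = g (r, q))
    (hb : Tendsto (fun r => (g (r, 0) - g (0, 0)) / r ^ 2) (𝓝[≠] 0) (𝓝 b)) {ε : ℝ} (hε : 0 < ε) :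
    ∃ δ > 0, ∀ q r₁ r₂, |q| < δ → 0 ≤ r₁ → r₁ ≤ r₂ → r₂ < δ →
      |g (r₂, q) - g (r₁, q) - b * (r₂ ^ 2 - r₁ ^ 2)| ≤ ε * (r₂ ^ 2 - r₁ ^ 2) := by
  set g₁ : ℝ × ℝ → ℝ := fun p => fderiv ℝ g p (1, 0) with hg₁
  set g₂ : ℝ × ℝ → ℝ := fun p => fderiv ℝ g₁ p (1, 0) with hg₂
  have appl : ∀ {h : ℝ × ℝ → ℝ} {p : ℝ × ℝ}, AnalyticAt ℝ h p →
      AnalyticAt ℝ (fun p => fderiv ℝ h p (1, 0)) p := fun hh =>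
    ((ContinuousLinearMap.apply ℝ ℝ ((1 : ℝ), (0 : ℝ))).analyticAt _).comp hh.fderiv
  have a0 := hg.analyticAt
  have a1 : AnalyticAt ℝ g₁ (0, 0) := appl a0
  have a2 : AnalyticAt ℝ g₂ (0, 0) := appl a1
  have hdir : ∀ {h : ℝ × ℝ → ℝ} {r q : ℝ}, AnalyticAt ℝ h (r, q) →
      HasDerivAt (fun s => h (s, q)) (fderiv ℝ h (r, q) (1, 0)) r := fun {h r q} hh =>
    hh.differentiableAt.hasFDerivAt.comp_hasDerivAt r
      ((hasDerivAt_id r).prodMk (hasDerivAt_const r q))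
  -- Evenness in the first variable removes the first derivative at `0`, so the prescribed quadratic
  -- coefficient is half the second derivative.
  have hval : g₂ (0, 0) = 2 * b := by
    have hf : ContDiffAt ℝ ω (fun r : ℝ => g (r, 0)) 0 :=
      ContDiffAt.comp (0 : ℝ) (g := g) hg (contDiffAt_id.prodMk contDiffAt_const)
    have h1 := tendsto_deriv_div hf hb
    have hc : Tendsto (fun r : ℝ => (r, (0 : ℝ))) (𝓝 0) (𝓝 (0, 0)) :=
      (Continuous.prodMk_left (0 : ℝ)).tendsto 0
    have h2 : (deriv fun r : ℝ => g (r, 0)) =ᶠ[𝓝 0] fun r => g₁ (r, 0) := by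
      filter_upwards [hc.eventually a0.eventually_analyticAt] with r hr
      exact (hdir hr).deriv
    have h3 : deriv (fun r : ℝ => g (r, 0)) 0 = 0 := by
      have h4 : HasDerivAt (fun r : ℝ => g (-r, 0)) (deriv (fun r : ℝ => g (r, 0)) 0 * -1) 0 := by
        have h5 := (hf.differentiableAt (by simp)).hasDerivAt
        rw [← neg_zero] at h5
        have := h5.comp (0 : ℝ) (hasDerivAt_neg (0 : ℝ))
        rwa [neg_zero] at this
      have h5 := (h4.congr_of_eventuallyEq (he.mono fun r hr => (hr 0).symm)).deriv
      linarith
    have h6 : Tendsto (fun r => deriv (fun r : ℝ => g (r, 0)) r / r) (𝓝[≠] 0) (𝓝 (g₂ (0, 0))) := by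
      refine (hasDerivAt_iff_tendsto_slope.1 ((hdir a1).congr_of_eventuallyEq h2)).congr fun r => ?_
      rw [slope_def_field, h3, sub_zero, sub_zero]
    exact tendsto_nhds_unique h6 h1
  have hnear : ∀ᶠ p in 𝓝 ((0 : ℝ), (0 : ℝ)), AnalyticAt ℝ g p ∧ AnalyticAt ℝ g₁ p ∧
      |g₂ p - 2 * b| < 2 * ε := by
    have h1 := a2.continuousAt.tendsto.eventually (Metric.ball_mem_nhds _ (by positivity : 0 < 2 * ε))
    filter_upwards [a0.eventually_analyticAt, a1.eventually_analyticAt, h1] with p h2 h3 h1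
    refine ⟨h2, h3, ?_⟩
    rwa [hval] at h1
  obtain ⟨δ₁, hδ₁, h1⟩ := Metric.eventually_nhds_iff.1 hnear
  obtain ⟨δ₂, hδ₂, h2⟩ := Metric.eventually_nhds_iff.1 he
  refine ⟨min δ₁ δ₂, lt_min hδ₁ hδ₂, fun q r₁ r₂ hq h0 h12 hr => ?_⟩
  have hq1 := hq.trans_le (min_le_left _ _)
  have hr1 := hr.trans_le (min_le_left _ _)
  have near : ∀ r : ℝ, |r| < δ₁ → AnalyticAt ℝ g (r, q) ∧ AnalyticAt ℝ g₁ (r, q) ∧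
      |g₂ (r, q) - 2 * b| < 2 * ε := fun r hr => h1 (by
    rw [Prod.dist_eq, Real.dist_0_eq_abs, Real.dist_0_eq_abs]
    exact max_lt hr hq1)
  -- Evenness holds for every `q`. This is what makes the expansion uniform in `q`, without a term
  -- linear in `r`.
  have z : g₁ (0, q) = 0 := by
    have h3 := hdir (near 0 (by simpa using hδ₁)).1
    have h4 : HasDerivAt (fun r : ℝ => g (-r, q)) (g₁ (0, q) * -1) 0 := by
      have h5 := h3
      rw [← neg_zero] at h5
      have := h5.comp (0 : ℝ) (hasDerivAt_neg (0 : ℝ))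
      rwa [neg_zero] at this
    have h5 : (fun r : ℝ => g (-r, q)) =ᶠ[𝓝 0] fun r => g (r, q) := by
      filter_upwards [he] with r hr
      exact hr q
    have := (h4.congr_of_eventuallyEq h5.symm).unique h3
    change g₁ (0, q) * -1 = g₁ (0, q) at this
    linarith
  -- The bound on the second derivative is integrated twice, as monotonicity of an auxiliary
  -- function. The signs `σ = ±1` give the two sides of the estimate.
  have mono : ∀ (σ : ℝ) (_ : |σ| = 1), ∀ r ∈ Set.Icc 0 r₂,
      0 ≤ σ * (g₁ (r, q) - 2 * b * r) + 2 * ε * r := fun σ hσ => by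
    have hd : ∀ r ∈ Set.Icc 0 r₂, HasDerivAt (fun r => σ * (g₁ (r, q) - 2 * b * r) + 2 * ε * r)
        (σ * (g₂ (r, q) - 2 * b) + 2 * ε) r := fun r hr => by
      have h3 := hdir (near r (by rw [abs_of_nonneg hr.1]; linarith [hr.2])).2.1
      have h4 := ((h3.sub ((hasDerivAt_id r).const_mul (2 * b))).const_mul σ).add
        ((hasDerivAt_id r).const_mul (2 * ε))
      convert! h4 using 1
      simp [hg₂]
    have hm : MonotoneOn (fun r => σ * (g₁ (r, q) - 2 * b * r) + 2 * ε * r) (Set.Icc 0 r₂) := by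
      refine monotoneOn_of_deriv_nonneg (convex_Icc _ _)
        (fun r hr => (hd r hr).continuousAt.continuousWithinAt)
        (fun r hr => (hd r (interior_subset hr)).differentiableAt.differentiableWithinAt)
        fun r hr => ?_
      have hr := interior_subset hr
      rw [(hd r hr).deriv]
      have h3 := (near r (by rw [abs_of_nonneg hr.1]; linarith [hr.2])).2.2
      have h4 : |σ * (g₂ (r, q) - 2 * b)| < 2 * ε := by rwa [abs_mul, hσ, one_mul]
      linarith [(abs_lt.1 h4).1]
    intro r hr
    have := hm ⟨le_rfl, hr.1.trans hr.2⟩ hr hr.1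
    simpa [z] using this
  have mono2 : ∀ (σ : ℝ) (_ : |σ| = 1), 0 ≤ σ * (g (r₂, q) - g (r₁, q) - b * (r₂ ^ 2 - r₁ ^ 2)) +
      ε * (r₂ ^ 2 - r₁ ^ 2) := fun σ hσ => by
    have hd : ∀ r ∈ Set.Icc 0 r₂, HasDerivAt (fun r => σ * (g (r, q) - b * r ^ 2) + ε * r ^ 2)
        (σ * (g₁ (r, q) - 2 * b * r) + 2 * ε * r) r := fun r hr => by
      have h3 := hdir (near r (by rw [abs_of_nonneg hr.1]; linarith [hr.2])).1
      have h4 := ((h3.sub ((hasDerivAt_pow 2 r).const_mul b)).const_mul σ).add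
        ((hasDerivAt_pow 2 r).const_mul ε)
      convert! h4 using 1
      simp [hg₁]
      ring
    have hm : MonotoneOn (fun r => σ * (g (r, q) - b * r ^ 2) + ε * r ^ 2) (Set.Icc 0 r₂) := by
      refine monotoneOn_of_deriv_nonneg (convex_Icc _ _)
        (fun r hr => (hd r hr).continuousAt.continuousWithinAt)
        (fun r hr => (hd r (interior_subset hr)).differentiableAt.differentiableWithinAt)
        fun r hr => ?_
      have hr := interior_subset hr
      rw [(hd r hr).deriv]
      exact mono σ hσ r hr
    have := hm ⟨h0, h12⟩ ⟨h0.trans h12, le_rfl⟩ h12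
    simp only at this
    linarith
  rw [abs_le]
  have m1 := mono2 1 (by simp)
  have m2 := mono2 (-1) (by simp)
  constructor <;> linarith

theorem tendsto_one_sub_cos_div_sq :
    Tendsto (fun q => (1 - Real.cos q) / q ^ 2) (𝓝[≠] 0) (𝓝 (1 / 2)) := by
  have h : Tendsto (fun q : ℝ => Real.sinc (q / 2) ^ 2 / 2) (𝓝[≠] 0) (𝓝 (1 / 2)) := by
    have : Continuous fun q : ℝ => Real.sinc (q / 2) ^ 2 / 2 := by
      have := Real.continuous_sinc
      fun_prop
    have := (this.tendsto 0).mono_left (nhdsWithin_le_nhds (s := {0}ᶜ))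
    simpa using this
  refine h.congr' ?_
  filter_upwards [self_mem_nhdsWithin] with q hq
  have hq : q ≠ 0 := hq
  rw [Real.sinc_of_ne_zero (by simpa using hq)]
  have h2 := Real.cos_sq' (q / 2)
  have h3 := Real.cos_two_mul (q / 2)
  rw [mul_div_cancel₀ _ two_ne_zero] at h3
  field_simp
  linarith

variable {V W : ℝ → ℝ} {X₀ Xπ : ℝ → C(unitInterval, ℝ)} {Λ : ℝ → ℝ}

/-- The phase is a smooth function of `1 - cos q ∼ q²/2`. Its sine vanishes at `q = 0`, where the
linear mode is the out-of-phase mode itself, and so grows quadratically in `q`. -/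
theorem tendsto_sin_phasePi (hV : IsPotential V) (hW : IsPotential W) :
    Tendsto (fun q => Real.sin √(phaseSqPi V W q) / q ^ 2) (𝓝[≠] 0)
      (𝓝 (Real.pi * potentialCoeff W 2 / (2 * piFreqSq V W))) := by
  have hΩ := piFreqSq_pos hV hW
  set κ := 2 * potentialCoeff W 2 / piFreqSq V W with hκ
  have hd : HasDerivAt (fun s : ℝ => Real.sin (Real.pi * √(1 - κ * s))) (Real.pi * κ / 2) 0 := by
    have h1 := ((((hasDerivAt_id (0 : ℝ)).const_mul κ).const_sub 1).sqrt (by simp)).const_mul Real.pi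
    convert! h1.sin using 1
    simp
    ring
  have h1 := hasDerivAt_iff_tendsto_slope.1 hd
  have hs : Tendsto (fun q : ℝ => 1 - Real.cos q) (𝓝[≠] 0) (𝓝[≠] 0) := by
    refine tendsto_nhdsWithin_of_tendsto_nhds_of_eventually_within _ ?_ ?_
    · have : Continuous fun q : ℝ => 1 - Real.cos q := by fun_prop
      have := (this.tendsto 0).mono_left (nhdsWithin_le_nhds (s := {0}ᶜ))
      simpa using this
    · have h2 := tendsto_one_sub_cos_div_sq.eventually (lt_mem_nhds (by norm_num : (0 : ℝ) < 1 / 2))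
      filter_upwards [h2] with q hq h
      simp only [Set.mem_singleton_iff] at h
      rw [h, zero_div] at hq
      exact lt_irrefl _ hq
  have h3 := (h1.comp hs).mul tendsto_one_sub_cos_div_sq
  have e : Real.pi * κ / 2 * (1 / 2) = Real.pi * potentialCoeff W 2 / (2 * piFreqSq V W) := by
    rw [hκ]
    field_simp
  rw [e] at h3
  refine h3.congr' ?_
  filter_upwards [hs self_mem_nhdsWithin] with q hq
  have hq : 1 - Real.cos q ≠ 0 := hq
  rw [Function.comp_apply, slope_def_field, phaseSqPi_eq hV hW,
    ← hκ, Real.sqrt_mul (sq_nonneg _), Real.sqrt_sq Real.pi_pos.le]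
  simp only [mul_zero, sub_zero, Real.sqrt_one, mul_one, Real.sin_pi]
  exact div_mul_div_cancel₀ hq

/-- The level which normalizes the even boundary condition of the in-phase oscillator. -/
def levelEven (V W : ℝ → ℝ) : ℝ :=
  (Real.cos (inPhaseAngle V W) - 1) / (inPhaseAngle V W * Real.sin (inPhaseAngle V W))

/-- The level which normalizes the odd boundary condition of the in-phase oscillator. -/
def levelOdd (V W : ℝ → ℝ) : ℝ :=
  (1 - Real.cos (inPhaseAngle V W)) * inPhaseAngle V W / Real.sin (inPhaseAngle V W)

theorem diagC_level (hV : IsPotential V) (hW : IsPotential W)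
    (hb : IsModeBranch V W X₀ Xπ Λ) (q : ℝ) {l : ℝ} :
    endCos (modeOp V W X₀ Xπ Λ (0, q)) + l • endCosDeriv (modeOp V W X₀ Xπ Λ (0, q)) =
        diagC (Real.cos √(phaseSqZero V W q) + l * -(√(phaseSqZero V W q) * Real.sin √(phaseSqZero V W q)))
          (Real.cos √(phaseSqPi V W q) + l * -(√(phaseSqPi V W q) * Real.sin √(phaseSqPi V W q))) ∧
      endSinDeriv (modeOp V W X₀ Xπ Λ (0, q)) + l • endSin (modeOp V W X₀ Xπ Λ (0, q)) =
        diagC (Real.cos √(phaseSqZero V W q) + l * (Real.sin √(phaseSqZero V W q) / √(phaseSqZero V W q)))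
          (Real.cos √(phaseSqPi V W q) + l * (Real.sin √(phaseSqPi V W q) / √(phaseSqPi V W q))) := by
  obtain ⟨e1, e2, e3, e4, -⟩ := end_modeOp_zero hV hW hb q
  rw [e1, e2, e3, e4, diagC_smul, diagC_smul, diagC_add, diagC_add]
  exact ⟨rfl, rfl⟩

/-- The levels are chosen to make both normalizing matrices equal to `diag(1, -1)` in the linear
limit. They are thus invertible nearby, even if `cos θ = 0`. -/
theorem level_zero (hV : IsPotential V) (hW : IsPotential W)
    (hb : IsModeBranch V W X₀ Xπ Λ) :
    endCos (modeOp V W X₀ Xπ Λ (0, 0)) + levelEven V W • endCosDeriv (modeOp V W X₀ Xπ Λ (0, 0)) =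
        diagC 1 (-1) ∧
      endSinDeriv (modeOp V W X₀ Xπ Λ (0, 0)) + levelOdd V W • endSin (modeOp V W X₀ Xπ Λ (0, 0)) =
        diagC 1 (-1) := by
  have h0 := (inPhaseAngle_pos hV hW).ne'
  have h1 := (sin_inPhaseAngle_pos hV hW).ne'
  rw [(diagC_level hV hW hb 0).1, (diagC_level hV hW hb 0).2, sqrt_phaseSqZero_zero,
    sqrt_phaseSqPi_zero hV hW, Real.sin_pi, Real.cos_pi]
  constructor
  · congr 1
    · rw [levelEven]
      field_simp
      ring
    · ring
  · congr 1
    · rw [levelOdd]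
      field_simp
      ring
    · ring

/-- The even determinant along the branch. -/
def modeEven (V W : ℝ → ℝ) (X₀ Xπ : ℝ → C(unitInterval, ℝ)) (Λ : ℝ → ℝ) (p : ℝ × ℝ) : ℝ :=
  evenDet (levelEven V W) (modeOp V W X₀ Xπ Λ p)

/-- The odd determinant along the branch. -/
def modeOdd (V W : ℝ → ℝ) (X₀ Xπ : ℝ → C(unitInterval, ℝ)) (Λ : ℝ → ℝ) (p : ℝ × ℝ) : ℝ :=
  oddDet (levelOdd V W) (modeOp V W X₀ Xπ Λ p)

theorem contDiff_det {n : WithTop ℕ∞} : ContDiff ℝ n (Matrix.det : CMat → ℂ) := by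
  have h : ∀ i j : Fin 2, ContDiff ℝ n fun m : CMat => m i j := fun i j =>
    (cmatMap (Matrix.entryLinearMap ℝ ℂ i j)).contDiff
  have : (Matrix.det : CMat → ℂ) = fun m => m 0 0 * m 1 1 - m 0 1 * m 1 0 :=
    funext Matrix.det_fin_two
  rw [this]
  exact ((h 0 0).mul (h 1 1)).sub ((h 0 1).mul (h 1 0))

theorem IsModeBranch.contDiffAt_modeEven (hV : IsPotential V) (hW : IsPotential W)
    (hb : IsModeBranch V W X₀ Xπ Λ) : ContDiffAt ℝ ω (modeEven V W X₀ Xπ Λ) (0, 0) := by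
  have hA := hb.contDiffAt_modeOp hV hW 0
  have h1 := (contDiff_endCosDeriv (R := CMat)).contDiffAt.comp ((0 : ℝ), (0 : ℝ)) hA
  have h2 := (contDiff_endCos (R := CMat)).contDiffAt.comp ((0 : ℝ), (0 : ℝ)) hA
  have h3 := contDiff_det.contDiffAt.comp ((0 : ℝ), (0 : ℝ)) h1
  have h4 := contDiff_det.contDiffAt.comp ((0 : ℝ), (0 : ℝ)) (h2.add (h1.const_smul (levelEven V W)))
  have h5 := h3.mul (h4.inv (by
    change (endCos (modeOp V W X₀ Xπ Λ (0, 0)) +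
      levelEven V W • endCosDeriv (modeOp V W X₀ Xπ Λ (0, 0))).det ≠ 0
    rw [(level_zero hV hW hb).1, det_diagC]
    norm_num))
  exact Complex.reCLM.contDiff.contDiffAt.comp ((0 : ℝ), (0 : ℝ)) h5

theorem IsModeBranch.contDiffAt_modeOdd (hV : IsPotential V) (hW : IsPotential W)
    (hb : IsModeBranch V W X₀ Xπ Λ) : ContDiffAt ℝ ω (modeOdd V W X₀ Xπ Λ) (0, 0) := by
  have hA := hb.contDiffAt_modeOp hV hW 0
  have h1 := (contDiff_endSin (R := CMat)).contDiffAt.comp ((0 : ℝ), (0 : ℝ)) hA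
  have h2 := (contDiff_endSinDeriv (R := CMat)).contDiffAt.comp ((0 : ℝ), (0 : ℝ)) hA
  have h3 := contDiff_det.contDiffAt.comp ((0 : ℝ), (0 : ℝ)) h1
  have h4 := contDiff_det.contDiffAt.comp ((0 : ℝ), (0 : ℝ)) (h2.add (h1.const_smul (levelOdd V W)))
  have h5 := h3.mul (h4.inv (by
    change (endSinDeriv (modeOp V W X₀ Xπ Λ (0, 0)) +
      levelOdd V W • endSin (modeOp V W X₀ Xπ Λ (0, 0))).det ≠ 0
    rw [(level_zero hV hW hb).2, det_diagC]
    norm_num))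
  exact Complex.reCLM.contDiff.contDiffAt.comp ((0 : ℝ), (0 : ℝ)) h5

theorem IsModeBranch.modeEven_zero (hV : IsPotential V) (hW : IsPotential W)
    (hb : IsModeBranch V W X₀ Xπ Λ) : modeEven V W X₀ Xπ Λ (0, 0) = 0 := by
  rw [modeEven, evenDet, (end_modeOp_zero hV hW hb 0).2.2.1, sqrt_phaseSqPi_zero hV hW, Real.sin_pi,
    det_diagC]
  simp

theorem IsModeBranch.modeOdd_zero (hV : IsPotential V) (hW : IsPotential W)
    (hb : IsModeBranch V W X₀ Xπ Λ) : modeOdd V W X₀ Xπ Λ (0, 0) = 0 := by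
  rw [modeOdd, oddDet, (end_modeOp_zero hV hW hb 0).2.1, sqrt_phaseSqPi_zero hV hW, Real.sin_pi,
    det_diagC]
  simp

/-- The stiffness of the even boundary value problem. -/
def evenStiffness (V W : ℝ → ℝ) : ℝ :=
  inPhaseAngle V W * Real.sin (inPhaseAngle V W) * Real.pi ^ 2 / piFreqSq V W

theorem evenStiffness_pos (hV : IsPotential V) (hW : IsPotential W) : 0 < evenStiffness V W := by
  have h0 := inPhaseAngle_pos hV hW
  have h1 := sin_inPhaseAngle_pos hV hW
  have h2 := piFreqSq_pos hV hW
  have h3 := Real.pi_pos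
  unfold evenStiffness
  positivity

/-- The normalizing determinant tends to `-1`, which reverses the sign of the growth of `det C'`:
the even determinant has the sign of the frequency shift. -/
theorem IsModeBranch.tendsto_modeEven_amplitude (hV : IsPotential V) (hW : IsPotential W)
    (hb : IsModeBranch V W X₀ Xπ Λ) {b : ℝ}
    (hf : Tendsto (fun r => (Real.pi ^ 2 / Λ r - piFreqSq V W) / r ^ 2) (𝓝[≠] 0) (𝓝 b)) :
    Tendsto (fun r => (modeEven V W X₀ Xπ Λ (r, 0) - modeEven V W X₀ Xπ Λ (0, 0)) / r ^ 2) (𝓝[≠] 0)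
      (𝓝 (evenStiffness V W * b)) := by
  have lt : (𝓝[≠] (0 : ℝ)) ≤ 𝓝 0 := nhdsWithin_le_nhds
  have cA : ContinuousAt (fun r : ℝ => modeOp V W X₀ Xπ Λ (r, 0)) 0 :=
    ContinuousAt.comp (g := modeOp V W X₀ Xπ Λ) (f := fun r : ℝ => (r, (0 : ℝ)))
      (hb.contDiffAt_modeOp hV hW 0).continuousAt (by fun_prop)
  have hX := (level_zero hV hW hb).1
  have cX : Tendsto (fun r => (endCos (modeOp V W X₀ Xπ Λ (r, 0)) +
      levelEven V W • endCosDeriv (modeOp V W X₀ Xπ Λ (r, 0))).det) (𝓝[≠] 0) (𝓝 (diagC 1 (-1)).det) := by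
    have h1 := (contDiff_endCosDeriv (n := 0) (R := CMat)).continuous.continuousAt.comp cA
    have h2 := (contDiff_endCos (n := 0) (R := CMat)).continuous.continuousAt.comp cA
    have h3 := (contDiff_det (n := 0)).continuous.continuousAt.comp
      (h2.add (h1.const_smul (levelEven V W)))
    rw [← hX]
    exact h3.tendsto.mono_left lt
  have h := (hb.tendsto_det_endCosDeriv hV hW hf).div cX (by rw [det_diagC]; norm_num)
  have h2 := (Complex.continuous_re.tendsto _).comp h
  rw [det_diagC, ← Complex.ofReal_div, Complex.ofReal_re] at h2
  have e : -(inPhaseAngle V W * Real.sin (inPhaseAngle V W) * (Real.pi ^ 2 * b / piFreqSq V W)) /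
      (1 * -1) = evenStiffness V W * b := by
    rw [evenStiffness]
    ring
  rw [e] at h2
  refine h2.congr fun r => ?_
  rw [hb.modeEven_zero hV hW, sub_zero, modeEven, evenDet, Function.comp_apply, Pi.div_apply,
    div_right_comm, Complex.div_ofReal_re]

theorem tendsto_sqrt_phase (hV : IsPotential V) (hW : IsPotential W) :
    Tendsto (fun q => √(phaseSqZero V W q)) (𝓝[≠] 0) (𝓝 (inPhaseAngle V W)) ∧
      Tendsto (fun q => √(phaseSqPi V W q)) (𝓝[≠] 0) (𝓝 Real.pi) := by
  have c1 : Continuous fun q => √(phaseSqZero V W q) := by unfold phaseSqZero; fun_prop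
  have c2 : Continuous fun q => √(phaseSqPi V W q) := by unfold phaseSqPi; fun_prop
  have t1 := (c1.tendsto 0).mono_left (nhdsWithin_le_nhds (s := {0}ᶜ))
  have t2 := (c2.tendsto 0).mono_left (nhdsWithin_le_nhds (s := {0}ᶜ))
  rw [sqrt_phaseSqZero_zero] at t1
  rw [sqrt_phaseSqPi_zero hV hW] at t2
  exact ⟨t1, t2⟩

/-- At zero amplitude the two linear modes are uncoupled and the determinant is a product. The
factor of the second mode vanishes quadratically in `q`, and normalization by `-1` makes the
quotient negative. -/
theorem IsModeBranch.tendsto_modeEven_momentum (hV : IsPotential V) (hW : IsPotential W)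
    (hb : IsModeBranch V W X₀ Xπ Λ) :
    Tendsto (fun q => (modeEven V W X₀ Xπ Λ (0, q) - modeEven V W X₀ Xπ Λ (0, 0)) / q ^ 2) (𝓝[≠] 0)
      (𝓝 (-(evenStiffness V W * (potentialCoeff W 2 / 2)))) := by
  obtain ⟨t1, t2⟩ := tendsto_sqrt_phase hV hW
  have s1 := (Real.continuous_sin.tendsto _).comp t1
  have s2 := (Real.continuous_sin.tendsto _).comp t2
  have c1 := (Real.continuous_cos.tendsto _).comp t1
  have c2 := (Real.continuous_cos.tendsto _).comp t2
  have hx : Tendsto (fun q => Real.cos √(phaseSqZero V W q) + levelEven V W * -(√(phaseSqZero V W q) *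
      Real.sin √(phaseSqZero V W q))) (𝓝[≠] 0) (𝓝 1) := by
    have h0 := (inPhaseAngle_pos hV hW).ne'
    have h1 := (sin_inPhaseAngle_pos hV hW).ne'
    have := c1.add ((t1.mul s1).neg.const_mul (levelEven V W))
    convert! this using 2
    rw [levelEven]
    field_simp
    ring
  have hy : Tendsto (fun q => Real.cos √(phaseSqPi V W q) + levelEven V W * -(√(phaseSqPi V W q) *
      Real.sin √(phaseSqPi V W q))) (𝓝[≠] 0) (𝓝 (-1)) := by
    have := c2.add ((t2.mul s2).neg.const_mul (levelEven V W))
    simpa using this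
  have t := ((t1.mul s1).mul (t2.mul (tendsto_sin_phasePi hV hW))).div (hx.mul hy) (by norm_num)
  have e : inPhaseAngle V W * Real.sin (inPhaseAngle V W) *
      (Real.pi * (Real.pi * potentialCoeff W 2 / (2 * piFreqSq V W))) / (1 * -1) =
      -(evenStiffness V W * (potentialCoeff W 2 / 2)) := by
    rw [evenStiffness]
    ring
  rw [e] at t
  refine t.congr fun q => ?_
  rw [hb.modeEven_zero hV hW, sub_zero, modeEven, evenDet, (diagC_level hV hW hb q).1,
    (end_modeOp_zero hV hW hb q).2.2.1, det_diagC, det_diagC, ← Complex.ofReal_div, Complex.ofReal_re]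
  simp only [Pi.div_apply, Function.comp_apply]
  ring

/-- The stiffness of the odd boundary value problem. -/
def oddStiffness (V W : ℝ → ℝ) : ℝ :=
  Real.sin (inPhaseAngle V W) / inPhaseAngle V W * potentialCoeff W 2 / (2 * piFreqSq V W)

theorem oddStiffness_pos (hV : IsPotential V) (hW : IsPotential W) : 0 < oddStiffness V W := by
  have h0 := inPhaseAngle_pos hV hW
  have h1 := sin_inPhaseAngle_pos hV hW
  have h2 := piFreqSq_pos hV hW
  have h3 := hW.coeff_two_pos
  unfold oddStiffness
  positivity

theorem IsModeBranch.tendsto_modeOdd_momentum (hV : IsPotential V) (hW : IsPotential W)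
    (hb : IsModeBranch V W X₀ Xπ Λ) :
    Tendsto (fun q => (modeOdd V W X₀ Xπ Λ (0, q) - modeOdd V W X₀ Xπ Λ (0, 0)) / q ^ 2) (𝓝[≠] 0)
      (𝓝 (-oddStiffness V W)) := by
  obtain ⟨t1, t2⟩ := tendsto_sqrt_phase hV hW
  have h0 := (inPhaseAngle_pos hV hW).ne'
  have h1 := (sin_inPhaseAngle_pos hV hW).ne'
  have hπ := Real.pi_ne_zero
  have s1 := ((Real.continuous_sin.tendsto _).comp t1).div t1 h0
  have s2 := ((Real.continuous_sin.tendsto _).comp t2).div t2 hπ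
  have c1 := (Real.continuous_cos.tendsto _).comp t1
  have c2 := (Real.continuous_cos.tendsto _).comp t2
  have hx : Tendsto (fun q => Real.cos √(phaseSqZero V W q) + levelOdd V W *
      (Real.sin √(phaseSqZero V W q) / √(phaseSqZero V W q))) (𝓝[≠] 0) (𝓝 1) := by
    have := c1.add (s1.const_mul (levelOdd V W))
    convert! this using 2
    rw [levelOdd]
    field_simp
    ring
  have hy : Tendsto (fun q => Real.cos √(phaseSqPi V W q) + levelOdd V W *
      (Real.sin √(phaseSqPi V W q) / √(phaseSqPi V W q))) (𝓝[≠] 0) (𝓝 (-1)) := by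
    have := c2.add (s2.const_mul (levelOdd V W))
    simpa using this
  have t := (s1.mul ((tendsto_sin_phasePi hV hW).div t2 hπ)).div (hx.mul hy) (by norm_num)
  have e : Real.sin (inPhaseAngle V W) / inPhaseAngle V W *
      (Real.pi * potentialCoeff W 2 / (2 * piFreqSq V W) / Real.pi) / (1 * -1) =
      -oddStiffness V W := by
    rw [oddStiffness]
    field_simp
  rw [e] at t
  refine t.congr fun q => ?_
  rw [hb.modeOdd_zero hV hW, sub_zero, modeOdd, oddDet, (diagC_level hV hW hb q).2,
    (end_modeOp_zero hV hW hb q).2.1, det_diagC, det_diagC, ← Complex.ofReal_div, Complex.ofReal_re]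
  simp only [Pi.div_apply, Function.comp_apply]
  ring

end Expansions

end

noncomputable section

/-! ### Matching solutions for small amplitude and quasimomentum -/

section Matching

open scoped ContDiff Matrix Matrix.Norms.L2Operator

variable {V W : ℝ → ℝ} {X₀ Xπ : ℝ → C(unitInterval, ℝ)} {Λ : ℝ → ℝ}

/-- Monotonicity and size of the even determinant. -/
theorem IsModeBranch.exists_modeEven_expansion (hV : IsPotential V) (hW : IsPotential W)
    (hb : IsModeBranch V W X₀ Xπ Λ) {b : ℝ}
    (hf : Tendsto (fun r => (Real.pi ^ 2 / Λ r - piFreqSq V W) / r ^ 2) (𝓝[≠] 0) (𝓝 b))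
    {ε : ℝ} (hε : 0 < ε) :
    ∃ δ > 0, (∀ q r₁ r₂, |q| < δ → 0 ≤ r₁ → r₁ ≤ r₂ → r₂ < δ →
      |modeEven V W X₀ Xπ Λ (r₂, q) - modeEven V W X₀ Xπ Λ (r₁, q) -
        evenStiffness V W * b * (r₂ ^ 2 - r₁ ^ 2)| ≤ ε * (r₂ ^ 2 - r₁ ^ 2)) ∧
      ∀ r q₁ q₂, |r| < δ → 0 ≤ q₁ → q₁ ≤ q₂ → q₂ < δ →
      |modeEven V W X₀ Xπ Λ (r, q₂) - modeEven V W X₀ Xπ Λ (r, q₁) +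
        evenStiffness V W * (potentialCoeff W 2 / 2) * (q₂ ^ 2 - q₁ ^ 2)| ≤ ε * (q₂ ^ 2 - q₁ ^ 2) := by
  have hs := hb.contDiffAt_modeEven hV hW
  obtain ⟨δ₁, h1, h2⟩ := exists_even_expansion hs
    ((hb.eventually_evenDet_neg (levelEven V W) 0).mono fun r h q => (h q).1)
    (hb.tendsto_modeEven_amplitude hV hW hf) hε
  have hs' : ContDiffAt ℝ ω (fun p : ℝ × ℝ => modeEven V W X₀ Xπ Λ (p.2, p.1)) (0, 0) :=
    ContDiffAt.comp ((0 : ℝ), (0 : ℝ)) (g := modeEven V W X₀ Xπ Λ) hs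
      (contDiffAt_snd.prodMk contDiffAt_fst)
  obtain ⟨δ₂, h3, h4⟩ := exists_even_expansion hs'
    (Eventually.of_forall fun q r => evenDet_modeOp_neg _ _ _)
    (hb.tendsto_modeEven_momentum hV hW) hε
  refine ⟨min δ₁ δ₂, lt_min h1 h3, fun q r₁ r₂ k0 k1 k2 k3 => h2 q r₁ r₂
    (k0.trans_le (min_le_left _ _)) k1 k2 (k3.trans_le (min_le_left _ _)),
    fun r q₁ q₂ k0 k1 k2 k3 => ?_⟩
  have := h4 r q₁ q₂ (k0.trans_le (min_le_right _ _)) k1 k2 (k3.trans_le (min_le_right _ _))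
  rwa [neg_mul, sub_neg_eq_add] at this

/-- At `q = 0` the determinant vanishes for every amplitude, by invariance under time translation.
The expansion in `q` is uniform in `r` and controls increments, so the strict sign of the linear
limit persists for every small `q ≠ 0`. -/
theorem IsModeBranch.exists_modeOdd_neg (hV : IsPotential V) (hW : IsPotential W)
    (hb : IsModeBranch V W X₀ Xπ Λ) :
    ∃ δ > 0, ∀ r q, |r| < δ → |q| < δ →
      modeOdd V W X₀ Xπ Λ (r, 0) = 0 ∧ (q ≠ 0 → modeOdd V W X₀ Xπ Λ (r, q) < 0) := by
  have hs := hb.contDiffAt_modeOdd hV hW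
  have hs' : ContDiffAt ℝ ω (fun p : ℝ × ℝ => modeOdd V W X₀ Xπ Λ (p.2, p.1)) (0, 0) :=
    ContDiffAt.comp ((0 : ℝ), (0 : ℝ)) (g := modeOdd V W X₀ Xπ Λ) hs
      (contDiffAt_snd.prodMk contDiffAt_fst)
  have hK := oddStiffness_pos hV hW
  obtain ⟨δ₂, h3, h4⟩ := exists_even_expansion hs'
    (Eventually.of_forall fun q r => oddDet_modeOp_neg _ _ _)
    (hb.tendsto_modeOdd_momentum hV hW) (half_pos hK)
  obtain ⟨δ₁, h1, h2⟩ := Metric.eventually_nhds_iff.1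
    (eventually_nhdsWithin_iff.1 (hb.eventually_oddDet_eq_zero hV hW (levelOdd V W)))
  refine ⟨min δ₁ δ₂, lt_min h1 h3, fun r q hr hq => ?_⟩
  have h0 : modeOdd V W X₀ Xπ Λ (r, 0) = 0 := by
    by_cases hr0 : r = 0
    · rw [hr0, hb.modeOdd_zero hV hW]
    · exact h2 (by rw [Real.dist_0_eq_abs]; exact hr.trans_le (min_le_left _ _)) hr0
  refine ⟨h0, fun hq0 => ?_⟩
  have h5 := h4 r 0 |q| (hr.trans_le (min_le_right _ _)) le_rfl (abs_nonneg q)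
    (hq.trans_le (min_le_right _ _))
  have h6 : modeOdd V W X₀ Xπ Λ (r, |q|) = modeOdd V W X₀ Xπ Λ (r, q) := by
    rcases abs_choice q with h | h
    · rw [h]
    · rw [h]; exact oddDet_modeOp_neg _ _ _
  simp only [h0, h6, sub_zero, sq_abs, zero_pow two_ne_zero] at h5
  have h7 := (abs_le.1 h5).2
  have h8 := mul_pos hK (pow_pos (abs_pos.2 hq0) 2)
  rw [sq_abs] at h8
  linarith

theorem continuousAt_mul_inv {E : Type*} [TopologicalSpace E] {M N : E → CMat} {x : E}
    (hM : ContinuousAt M x) (hN : ContinuousAt N x) (h : (N x).det ≠ 0) :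
    ContinuousAt (fun y => M y * (N y)⁻¹) x := by
  simp only [Matrix.inv_def, Ring.inverse_eq_inv']
  have h1 : ContinuousAt (fun y => (N y).det) x :=
    (contDiff_det (n := 0)).continuous.continuousAt.comp hN
  have h2 : ContinuousAt (fun y => (N y).adjugate) x :=
    (Continuous.matrix_adjugate continuous_id).continuousAt.comp hN
  exact hM.mul ((h1.inv₀ h).smul h2)

/-- The characteristic equation for matching solutions. -/
theorem IsModeBranch.exists_char (hV : IsPotential V) (hW : IsPotential W)
    (hb : IsModeBranch V W X₀ Xπ Λ) :
    ∃ c d : ℝ × ℝ → ℝ, ContinuousAt c (0, 0) ∧ ContinuousAt d (0, 0) ∧ 0 < c (0, 0) ∧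
      ∀ᶠ p in 𝓝 ((0 : ℝ), (0 : ℝ)), ∀ k, HasMatch (modeOp V W X₀ Xπ Λ p) k ↔
        modeEven V W X₀ Xπ Λ p * modeOdd V W X₀ Xπ Λ p + k ^ 2 * (c p + k ^ 2 * d p) = 0 := by
  set A := modeOp V W X₀ Xπ Λ with hA
  set l := levelEven V W with hl
  set m := levelOdd V W with hm
  set G := fun p => evenMat l (A p) with hG
  set B := fun p => oddMat m (A p) with hB
  have cA : ContinuousAt A (0, 0) := (hb.contDiffAt_modeOp hV hW 0).continuousAt
  have c1 := (contDiff_endCos (n := 0) (R := CMat)).continuous.continuousAt.comp cA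
  have c2 := (contDiff_endSin (n := 0) (R := CMat)).continuous.continuousAt.comp cA
  have c3 := (contDiff_endCosDeriv (n := 0) (R := CMat)).continuous.continuousAt.comp cA
  have c4 := (contDiff_endSinDeriv (n := 0) (R := CMat)).continuous.continuousAt.comp cA
  have cX := c1.add (c3.const_smul l)
  have cY := c4.add (c2.const_smul m)
  obtain ⟨hX, hY⟩ := level_zero hV hW hb
  have hX0 : (endCos (A (0, 0)) + l • endCosDeriv (A (0, 0))).det ≠ 0 := by
    rw [hX, det_diagC]; norm_num
  have hY0 : (endSinDeriv (A (0, 0)) + m • endSin (A (0, 0))).det ≠ 0 := by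
    rw [hY, det_diagC]; norm_num
  have cG : ContinuousAt G (0, 0) := continuousAt_mul_inv c3 cX hX0
  have cB : ContinuousAt B (0, 0) := continuousAt_mul_inv c2 cY hY0
  obtain ⟨-, e2, e3, -, -⟩ := end_modeOp_zero hV hW hb 0
  rw [sqrt_phaseSqZero_zero, sqrt_phaseSqPi_zero hV hW, Real.sin_pi] at e2 e3
  set θ := inPhaseAngle V W with hθ
  have hinv : (diagC 1 (-1))⁻¹ = diagC 1 (-1) := Matrix.inv_eq_right_inv (by
    rw [diagC_mul, ← diagC_one]; norm_num)
  have hG0 : G (0, 0) = diagC (-(θ * Real.sin θ)) 0 := by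
    rw [hG]
    simp only [evenMat]
    rw [hX, e3, hinv, diagC_mul]
    simp
  have hB0 : B (0, 0) = diagC (Real.sin θ / θ) 0 := by
    rw [hB]
    simp only [oddMat]
    rw [hY, e2, hinv, diagC_mul]
    simp
  have entry : ∀ {M : ℝ × ℝ → CMat} (_ : ContinuousAt M (0, 0)) (i j : Fin 2),
      ContinuousAt (fun p => M p i j) (0, 0) := fun h i j =>
    (by fun_prop : Continuous fun M : CMat => M i j).continuousAt.comp h
  have cP := cG.mul cB
  have cQ := ((continuousAt_const (y := (1 : CMat))).sub (cG.const_smul l)).mul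
    ((continuousAt_const (y := (1 : CMat))).sub (cB.const_smul m))
  have cmix := (((((entry cP 0 0).mul (entry cQ 1 1)).add ((entry cQ 0 0).mul (entry cP 1 1))).sub
    ((entry cP 0 1).mul (entry cQ 1 0))).sub ((entry cQ 0 1).mul (entry cP 1 0))).neg
  refine ⟨fun p => (-mixedDet (G p * B p) ((1 - l • G p) * (1 - m • B p))).re,
    fun p => ((1 - l • G p) * (1 - m • B p)).det.re, ?_, ?_, ?_, ?_⟩
  · exact Complex.continuous_re.continuousAt.comp cmix
  · exact Complex.continuous_re.continuousAt.comp
      ((contDiff_det (n := 0)).continuous.continuousAt.comp cQ)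
  · simp only [hG0, hB0]
    have e : ∀ a b c : ℝ, 1 - c • diagC a b = diagC (1 - c * a) (1 - c * b) := fun a b c => by
      rw [← diagC_one, diagC_smul, sub_eq_add_neg, diagC_neg, diagC_add]
      rfl
    rw [e, e, diagC_mul, diagC_mul]
    have hθ0 := (inPhaseAngle_pos hV hW).ne'
    have hs := sin_inPhaseAngle_pos hV hW
    -- In the linear limit `G B` is `diag(-sin² θ, 0)` and the second diagonal entry of the other
    -- factor is `1`, so the coefficient of `k²` is `sin² θ > 0`.
    have : (-mixedDet (diagC (-(θ * Real.sin θ) * (Real.sin θ / θ)) (0 * 0))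
      (diagC ((1 - l * -(θ * Real.sin θ)) * (1 - m * (Real.sin θ / θ))) ((1 - l * 0) * (1 - m * 0)))) =
        ((Real.sin θ ^ 2 : ℝ) : ℂ) := by
      have hθ1 : (θ : ℂ) ≠ 0 := by exact_mod_cast hθ0
      simp [mixedDet, diagC]
      field_simp
    rw [this, Complex.ofReal_re]
    positivity
  · have k1 := ((contDiff_det (n := 0)).continuous.continuousAt.comp cX).eventually_ne hX0
    have k2 := ((contDiff_det (n := 0)).continuous.continuousAt.comp cY).eventually_ne hY0
    filter_upwards [k1, k2] with p k1 k2 k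
    have hst : star (A p) = A p := star_blochOp _ _ _ _ _ _ _
    have gH : (G p)ᴴ = G p := isHermitian_mul_inv (endCos_wronskian hst) k1
    have bH : (B p)ᴴ = B p := isHermitian_mul_inv (endSin_wronskian hst).symm k2
    have hE : (G p).det.re = modeEven V W X₀ Xπ Λ p := by
      simp only [hG, evenMat, modeEven, evenDet, Matrix.det_mul, Matrix.det_nonsing_inv,
        Ring.inverse_eq_inv', div_eq_mul_inv, hA, hl]
    have hO : (B p).det.re = modeOdd V W X₀ Xπ Λ p := by
      simp only [hB, oddMat, modeOdd, oddDet, Matrix.det_mul, Matrix.det_nonsing_inv,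
        Ring.inverse_eq_inv', div_eq_mul_inv, hA, hm]
    rw [hasMatch_iff k1 k2]
    -- Since the determinant is real, only its real part has to be computed.
    have him := im_det_matchMat gH bH l m k
    have hre : (matchMat (G p) (B p) l m k).det.re = modeEven V W X₀ Xπ Λ p * modeOdd V W X₀ Xπ Λ p +
        k ^ 2 * ((-mixedDet (G p * B p) ((1 - l • G p) * (1 - m • B p))).re +
          k ^ 2 * ((1 - l • G p) * (1 - m • B p)).det.re) := by
      rw [det_matchMat, Complex.add_re, Complex.mul_re, hE, hO, im_det_eq_zero gH, zero_mul, sub_zero,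
        Complex.re_ofReal_mul, Complex.add_re, Complex.re_ofReal_mul]
    rw [← hre]
    exact ⟨fun h => congrArg Complex.re h, fun h => Complex.ext h him⟩

/-- Matching solutions for small amplitude are governed by the sign of the even determinant. -/
theorem IsModeBranch.exists_match_threshold (hV : IsPotential V) (hW : IsPotential W)
    (hb : IsModeBranch V W X₀ Xπ Λ) {δ₀ : ℝ} (hδ₀ : 0 < δ₀) : ∃ δ ρ, 0 < ρ ∧ ρ ≤ δ ∧ δ ≤ δ₀ ∧
      (∀ r q k, |r| < ρ → |q| ≤ Real.pi / 2 → q ≠ 0 → (|q| < δ → modeEven V W X₀ Xπ Λ (r, q) < 0) →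
        0 ≤ k → k ≤ 1 → ¬HasMatch (modeOp V W X₀ Xπ Λ (r, q)) k) ∧
      (∀ r k, |r| < ρ → 0 < k → k ≤ 1 → ¬HasMatch (modeOp V W X₀ Xπ Λ (r, 0)) k) ∧
      (∀ r q, |r| < ρ → |q| < δ → modeEven V W X₀ Xπ Λ (r, q) = 0 →
        HasMatch (modeOp V W X₀ Xπ Λ (r, q)) 0) ∧
      ∀ κ > 0, ∃ η > 0, ∀ r q, |r| < ρ → |q| < δ → q ≠ 0 → 0 < modeEven V W X₀ Xπ Λ (r, q) →
        modeEven V W X₀ Xπ Λ (r, q) < η → ∃ k, 0 < k ∧ k < κ ∧ HasMatch (modeOp V W X₀ Xπ Λ (r, q)) k := by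
  obtain ⟨c, d, hc, hd, hc0, hchar⟩ := hb.exists_char hV hW
  set s := c (0, 0) with hs
  have hO := (hb.contDiffAt_modeOdd hV hW).continuousAt
  have ev : ∀ᶠ p in 𝓝 ((0 : ℝ), (0 : ℝ)), s / 2 < c p ∧ |d p| < |d (0, 0)| + 1 ∧
      |modeOdd V W X₀ Xπ Λ p| < 1 := by
    filter_upwards [hc.eventually (lt_mem_nhds (half_lt_self hc0)),
      hd.abs.eventually (gt_mem_nhds (lt_add_one _)),
      hO.abs.eventually (gt_mem_nhds (show |modeOdd V W X₀ Xπ Λ (0, 0)| < 1 by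
        rw [hb.modeOdd_zero hV hW, abs_zero]; exact one_pos))]
      with p h1 h2 h3
    exact ⟨h1, h2, h3⟩
  obtain ⟨δ₁, hδ₁, h1⟩ := Metric.eventually_nhds_iff.1 (ev.and hchar)
  obtain ⟨δ₂, hδ₂, h2⟩ := hb.exists_modeOdd_neg hV hW
  set M := |d (0, 0)| + 1 with hM
  have hMpos : 0 < M := by positivity
  -- For `k ≤ κ₀` the quartic coefficient satisfies `k² |d| ≤ s/4`, while `c > s/2`, so the bracket
  -- `c + k² d` stays above `s/4`.
  set κ₀ := √(s / (4 * M)) with hκ₀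
  have hκ₀pos : 0 < κ₀ := Real.sqrt_pos.2 (by positivity)
  have hκ₀sq : κ₀ ^ 2 * M = s / 4 := by
    rw [hκ₀, Real.sq_sqrt (by positivity)]
    field_simp
  set δ₃ := min δ₀ (min δ₁ δ₂) with hδ₃
  have hδ₃pos : 0 < δ₃ := lt_min hδ₀ (lt_min hδ₁ hδ₂)
  have le₁ : δ₃ ≤ δ₁ := (min_le_right _ _).trans (min_le_left _ _)
  have le₂ : δ₃ ≤ δ₂ := (min_le_right _ _).trans (min_le_right _ _)
  -- The compactness argument disposes of `|q| ≥ δ₃` and of `k ≥ κ₀`; the characteristic equation is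
  -- needed only in the remaining region.
  obtain ⟨δ₄, hδ₄, h4⟩ := Metric.eventually_nhds_iff.1
    (eventually_not_hasMatch_modeOp hV hW hb hδ₃pos hκ₀pos)
  have near : ∀ r q, |r| < δ₃ → |q| < δ₃ → ((s / 2 < c (r, q) ∧ |d (r, q)| < M ∧
      |modeOdd V W X₀ Xπ Λ (r, q)| < 1) ∧ ∀ k, HasMatch (modeOp V W X₀ Xπ Λ (r, q)) k ↔
        modeEven V W X₀ Xπ Λ (r, q) * modeOdd V W X₀ Xπ Λ (r, q) +
          k ^ 2 * (c (r, q) + k ^ 2 * d (r, q)) = 0) := fun r q hr hq => h1 (by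
    rw [Prod.dist_eq, Real.dist_0_eq_abs, Real.dist_0_eq_abs]
    exact max_lt (hr.trans_le le₁) (hq.trans_le le₁))
  have pos : ∀ r q k, |r| < δ₃ → |q| < δ₃ → 0 ≤ k → k ≤ κ₀ →
      s / 4 ≤ c (r, q) + k ^ 2 * d (r, q) := fun r q k hr hq h0 hk => by
    obtain ⟨⟨a1, a2, -⟩, -⟩ := near r q hr hq
    have b1 : k ^ 2 ≤ κ₀ ^ 2 := pow_le_pow_left₀ h0 hk 2
    have b2 : |k ^ 2 * d (r, q)| ≤ κ₀ ^ 2 * M := by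
      rw [abs_mul, abs_of_nonneg (sq_nonneg k)]
      exact mul_le_mul b1 a2.le (abs_nonneg _) (sq_nonneg _)
    have := (abs_le.1 b2).1
    rw [hκ₀sq] at this
    linarith
  have hlt3 : ∀ {x : ℝ}, x < min δ₃ δ₄ → x < δ₃ := fun h => h.trans_le (min_le_left _ _)
  have hlt4 : ∀ {x : ℝ}, x < min δ₃ δ₄ → x < δ₄ := fun h => h.trans_le (min_le_right _ _)
  refine ⟨δ₃, min δ₃ δ₄, lt_min hδ₃pos hδ₄, min_le_left _ _, min_le_left _ _, fun r q k hr hq hq0 hE h0 hk1 => ?_,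
    fun r k hr h0 hk1 => ?_, fun r q hr hq hE => ?_, fun κ hκ => ?_⟩
  · by_cases hk : κ₀ ≤ k
    · exact h4 (by rw [Real.dist_0_eq_abs]; exact hlt4 hr) q k hq h0 hk1 (Or.inr hk)
    by_cases hq3 : δ₃ ≤ |q|
    · exact h4 (by rw [Real.dist_0_eq_abs]; exact hlt4 hr) q k hq h0 hk1 (Or.inl hq3)
    push Not at hk hq3
    rw [(near r q (hlt3 hr) hq3).2]
    have b1 := pos r q k (hlt3 hr) hq3 h0 hk.le
    have b2 := mul_nonneg (sq_nonneg k) (by linarith : 0 ≤ c (r, q) + k ^ 2 * d (r, q))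
    -- Both determinants are negative, so their product is positive, while the other term of the
    -- characteristic equation is nonnegative.
    have b3 := (h2 r q ((hlt3 hr).trans_le le₂) (hq3.trans_le le₂)).2 hq0
    have b4 := mul_pos_of_neg_of_neg (hE hq3) b3
    linarith
  · by_cases hk : κ₀ ≤ k
    · exact h4 (by rw [Real.dist_0_eq_abs]; exact hlt4 hr) 0 k
        (by rw [abs_zero]; positivity) h0.le hk1 (Or.inr hk)
    push Not at hk
    have hz : |(0 : ℝ)| < δ₃ := by rwa [abs_zero]
    rw [(near r 0 (hlt3 hr) hz).2,
      (h2 r 0 ((hlt3 hr).trans_le le₂) (hz.trans_le le₂)).1,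
      mul_zero, zero_add]
    have := pos r 0 k (hlt3 hr) hz h0.le hk.le
    have : 0 < c (r, 0) + k ^ 2 * d (r, 0) := by linarith
    positivity
  · rw [(near r q (hlt3 hr) hq).2, hE]
    ring
  · set κ' := min κ κ₀ / 2 with hκ'
    have hmin : 0 < min κ κ₀ := lt_min hκ hκ₀pos
    have hκ'pos : 0 < κ' := half_pos hmin
    have hκ'κ : κ' < κ := (half_lt_self hmin).trans_le (min_le_left _ _)
    have hκ'κ₀ : κ' < κ₀ := (half_lt_self hmin).trans_le (min_le_right _ _)
    refine ⟨κ' ^ 2 * (s / 4), by positivity, fun r q hr hq hq0 hE0 hE1 => ?_⟩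
    obtain ⟨⟨-, -, a3⟩, a4⟩ := near r q (hlt3 hr) hq
    have hOneg := (h2 r q ((hlt3 hr).trans_le le₂)
      (hq.trans_le le₂)).2 hq0
    set f : ℝ → ℝ := fun k => modeEven V W X₀ Xπ Λ (r, q) * modeOdd V W X₀ Xπ Λ (r, q) +
          k ^ 2 * (c (r, q) + k ^ 2 * d (r, q)) with hf
    have hfc : Continuous f := by fun_prop
    -- The determinants have opposite signs, so the characteristic function is negative at `k = 0`.
    -- At `κ'` it is positive, because the even determinant is small and the odd one is bounded by
    -- `1`; a root lies in between.
    have f0 : f 0 < 0 := by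
      have := mul_neg_of_pos_of_neg hE0 hOneg
      simpa [hf] using this
    have f1 : 0 < f κ' := by
      have b1 := pos r q κ' (hlt3 hr) hq hκ'pos.le hκ'κ₀.le
      have b2 := mul_le_mul_of_nonneg_left b1 (sq_nonneg κ')
      have b3 : |modeEven V W X₀ Xπ Λ (r, q) * modeOdd V W X₀ Xπ Λ (r, q)| < κ' ^ 2 * (s / 4) := by
        rw [abs_mul, abs_of_pos hE0]
        calc _ ≤ modeEven V W X₀ Xπ Λ (r, q) * 1 := by gcongr
          _ < _ := by rwa [mul_one]
      have := (abs_lt.1 b3).1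
      simp only [hf]
      linarith
    obtain ⟨k, hk, hk0⟩ := intermediate_value_Ioo hκ'pos.le hfc.continuousOn ⟨f0, f1⟩
    exact ⟨k, hk.1, hk.2.trans hκ'κ, (a4 k).2 hk0⟩

end Matching

end

noncomputable section

/-! ### Floquet solutions -/

section Floquet

variable {R : Type*} [NormedRing R] [NormedAlgebra ℝ R] [CompleteSpace R]

theorem fund_of_hasDerivAt {A : C(unitInterval, R)} {Z Z' : ℝ → R}
    (hZ : ∀ t : unitInterval, HasDerivAt Z (Z' t) t)
    (hZ' : ∀ t : unitInterval, HasDerivAt Z' (-(A t * Z t)) t) :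
    (∀ t : unitInterval, Z t = fundCos A t * Z 0 + fundSin A t * Z' 0) ∧
      Z 1 = endCos A * Z 0 + endSin A * Z' 0 ∧
      Z' 1 = endCosDeriv A * Z 0 + endSinDeriv A * Z' 0 := by
  have hc : Continuous fun t : unitInterval => Z t := continuous_iff_continuousAt.2 fun t =>
    (hZ t).continuousAt.comp continuous_subtype_val.continuousAt
  set f : C(unitInterval, R) := ⟨fun t => Z t, hc⟩ with hf
  have h1 : ∀ t : unitInterval, HasDerivAt Z' ((-(A * f)) t) t := hZ'
  have h2 : HasAccel f (Z' 0) (-(A * f)) := hasAccel_of_hasDerivAt hZ h1 fun t => rfl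
  have h3 := primitive_eq_of_hasDerivAt h1 1
  rw [map_neg, ContinuousMap.neg_apply] at h3
  obtain ⟨e1, e2⟩ := h2.end_eq
  refine ⟨fun t => ?_, ?_, ?_⟩
  · have := congrArg (fun f => f t) h2.eq_fund
    simpa [hf] using this
  · simpa [hf] using e1
  · have : Z' 1 = Z' 0 - primitive (A * f) 1 := by
      rw [sub_eq_add_neg, h3]
      simp
    rw [this, e2]
    simp [hf]

theorem hasDerivAt_comp_neg {E : Type*} [NormedAddCommGroup E] [NormedSpace ℝ E] {Z : ℝ → E} {z : E}
    {t : ℝ} (h : HasDerivAt Z z (-t)) : HasDerivAt (fun t => Z (-t)) (-z) t := by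
  simpa using! h.scomp t (hasDerivAt_neg t)

/-- Quasiperiodic solutions satisfy the matching conditions. -/
theorem exists_match_of_floquet {A : C(unitInterval, R)} {Z Z' : ℝ → R} {μ : ℝ} (hμ : μ ≠ 0)
    (hZ : ∀ t, HasDerivAt Z (Z' t) t) (hZ' : ∀ t, HasDerivAt Z' (-(A (foldI t) * Z t)) t)
    (hper : ∀ t, Z (t + 2) = μ • Z t) (hne : ∃ t, Z t ≠ 0) :
    (Z 0 ≠ 0 ∨ Z' 0 ≠ 0) ∧ (μ - 1) • (endCos A * Z 0) = (μ + 1) • (endSin A * Z' 0) ∧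
      (μ + 1) • (endCosDeriv A * Z 0) = (μ - 1) • (endSinDeriv A * Z' 0) := by
  obtain ⟨f1, f2, f3⟩ := fund_of_hasDerivAt (A := A) (fun t => hZ t) fun t => by
    have := hZ' t
    rwa [foldI_coe] at this
  -- The coefficient is even in time, so `Z(-t)` solves the same equation with reversed initial
  -- velocity. Comparing `t = 1` with `t = -1` gives `C X + S P = μ (C X - S P)`, and similarly for
  -- the velocities.
  obtain ⟨g1, g2, g3⟩ := fund_of_hasDerivAt (A := A) (Z := fun t => Z (-t)) (Z' := fun t => -Z' (-t))
    (fun t => hasDerivAt_comp_neg (hZ (-t))) fun t => by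
      have := (hasDerivAt_comp_neg (hZ' (-t))).neg
      rw [foldI_neg, foldI_coe] at this
      simpa using! this
  simp only [neg_zero] at g1 g2 g3
  have hper' : ∀ t, Z' (t + 2) = μ • Z' t := fun t => by
    have h1 := (hZ (t + 2)).comp_add_const t 2
    have h2 := (hZ t).const_smul μ
    exact h1.unique (h2.congr_of_eventuallyEq (Eventually.of_forall hper))
  have p1 := hper (-1)
  have p2 := hper' (-1)
  rw [show (-1 : ℝ) + 2 = 1 by norm_num] at p1 p2
  have g3' : Z' (-1) = -(endCosDeriv A * Z 0) + endSinDeriv A * Z' 0 := by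
    rw [← neg_neg (Z' (-1)), g3]
    noncomm_ring
  rw [g2, f2] at p1
  rw [g3', f3] at p2
  refine ⟨?_, ?_, ?_⟩
  -- With zero initial data the solution vanishes on `[-1, 1]`, hence everywhere by
  -- quasiperiodicity.
  · by_contra h
    push Not at h
    obtain ⟨t, ht⟩ := hne
    have z : ∀ t ∈ Set.Icc (-1 : ℝ) 1, Z t = 0 := fun t ht => by
      by_cases h0 : 0 ≤ t
      · have := f1 ⟨t, h0, ht.2⟩
        rw [h.1, h.2, mul_zero, mul_zero, add_zero] at this
        exact this
      · push Not at h0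
        have := g1 ⟨-t, by linarith, by linarith [ht.1]⟩
        simp only [h.1, h.2, mul_zero, neg_zero, add_zero, neg_neg] at this
        exact this
    have hz2 : Function.Periodic (fun t => Z t = 0) 2 := fun t => by
      simp [hper, hμ]
    obtain ⟨s, hs, hst⟩ := hz2.exists_mem_Ico two_pos t (-1)
    have := z s ⟨hs.1, by linarith [hs.2]⟩
    rw [← hst] at this
    exact ht this
  · rw [mul_neg] at p1
    refine sub_eq_zero.1 (Eq.trans ?_ (sub_eq_zero.2 p1.symm))
    module
  · refine sub_eq_zero.1 (Eq.trans ?_ (sub_eq_zero.2 p2))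
    module

theorem hasDerivAt_integral {E : Type*} [NormedAddCommGroup E] [NormedSpace ℝ E] [CompleteSpace E]
    {φ : ℝ → E} (hφ : Continuous φ) (t : ℝ) :
    HasDerivAt (fun t => ∫ s in (0 : ℝ)..t, φ s) (φ t) t :=
  (hφ.integral_hasStrictDerivAt 0 t).hasDerivAt

theorem eq_of_hasDerivAt_eq {E : Type*} [NormedAddCommGroup E] [NormedSpace ℝ E]
    {f g f' : ℝ → E} (hf : ∀ t, HasDerivAt f (f' t) t) (hg : ∀ t, HasDerivAt g (f' t) t) {a : ℝ}
    (h : f a = g a) : f = g := by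
  funext t
  have h1 : ∀ t, HasDerivAt (fun t => f t - g t) 0 t := fun t => by
    simpa using! (hf t).sub (hg t)
  have h2 := is_const_of_deriv_eq_zero (f := fun t => f t - g t)
    (fun t => (h1 t).differentiableAt) (fun t => (h1 t).deriv) t a
  simp only [h, sub_self] at h2
  exact sub_eq_zero.1 h2

/-- A continuous quasiperiodic extension from one period. -/
theorem exists_quasiperiodic {E : Type*} [NormedAddCommGroup E] [NormedSpace ℝ E] {h : ℝ → E}
    (hc : Continuous h) {μ : ℝ} (hμ : 0 < μ) (h1 : h 1 = μ • h (-1)) :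
    ∃ g : ℝ → E, Continuous g ∧ (∀ t, g (t + 2) = μ • g t) ∧ ∀ t ∈ Set.Icc (-1 : ℝ) 1, g t = h t := by
  -- The factor `exp (κ t)` carries the multiplier over a period of length `2`. What remains is
  -- periodic and is built from the fractional part, which is continuous because the two end values
  -- agree.
  set κ := Real.log μ / 2 with hκ
  have e2 : Real.exp (κ * 2) = μ := by
    rw [hκ, div_mul_cancel₀ _ two_ne_zero, Real.exp_log hμ]
  set w : ℝ → E := fun u => Real.exp (-(κ * (2 * u - 1))) • h (2 * u - 1) with hw
  have hwc : Continuous w := by fun_prop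
  have hw01 : w 0 = w 1 := by
    simp only [hw]
    rw [show (2 : ℝ) * 1 - 1 = 1 by norm_num, show (2 : ℝ) * 0 - 1 = -1 by norm_num, h1, smul_smul]
    congr 1
    rw [← e2, ← Real.exp_add]
    congr 1
    ring
  set W := w ∘ Int.fract with hW
  have hWc : Continuous W := hwc.continuousOn.comp_fract'' hw01
  have hg2 : ∀ t, Real.exp (κ * (t + 2)) • W ((t + 2 + 1) / 2) =
      μ • Real.exp (κ * t) • W ((t + 1) / 2) := fun t => by
    have h1 : W ((t + 2 + 1) / 2) = W ((t + 1) / 2) := by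
      simp only [hW, Function.comp_apply]
      rw [show (t + 2 + 1) / 2 = (t + 1) / 2 + 1 by ring, Int.fract_add_one]
    rw [h1, smul_smul]
    congr 1
    rw [← e2, ← Real.exp_add]
    congr 1
    ring
  have hlt : ∀ t ∈ Set.Ico (-1 : ℝ) 1, Real.exp (κ * t) • W ((t + 1) / 2) = h t := fun t ht => by
    simp only [hW, Function.comp_apply, hw]
    rw [Int.fract_eq_self.2 ⟨by linarith [ht.1], by linarith [ht.2]⟩,
      show 2 * ((t + 1) / 2) - 1 = t by ring, smul_smul, ← Real.exp_add, add_neg_cancel,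
      Real.exp_zero, one_smul]
  refine ⟨fun t => Real.exp (κ * t) • W ((t + 1) / 2), by fun_prop, hg2, fun t ht => ?_⟩
  rcases ht.2.lt_or_eq with h2 | h2
  · exact hlt t ⟨ht.1, h2⟩
  · have h3 := hg2 (-1)
    rw [hlt (-1) ⟨le_rfl, by norm_num⟩, ← h1] at h3
    rw [h2, ← h3]
    norm_num

/-- Solutions of the matching conditions extend to quasiperiodic solutions. -/
theorem exists_floquet_of_match {A : C(unitInterval, R)} {X P : R} {μ : ℝ} (hμ : 0 < μ)
    (h1 : (μ - 1) • (endCos A * X) = (μ + 1) • (endSin A * P))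
    (h2 : (μ + 1) • (endCosDeriv A * X) = (μ - 1) • (endSinDeriv A * P)) :
    ∃ Z Z' : ℝ → R, (∀ t, HasDerivAt Z (Z' t) t) ∧
      (∀ t, HasDerivAt Z' (-(A (foldI t) * Z t)) t) ∧ (∀ t, Z (t + 2) = μ • Z t) ∧
      Z 0 = X ∧ Z' 0 = P := by
  -- Since `extendI` is constant outside the unit interval, this one formula gives `C(|t|) X ±
  -- S(|t|) P` on `[-1, 1]`, with the sign of `t`.
  set h : ℝ → R := fun t => (extendI (fundCos A) t + extendI (fundCos A) (-t) - 1) * X +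
    (extendI (fundSin A) t - extendI (fundSin A) (-t)) * P with hh
  have cC := continuous_extendI (fundCos A)
  have cS := continuous_extendI (fundSin A)
  have hc : Continuous h := by fun_prop
  have clamp : ∀ (f : C(unitInterval, R)) (t : unitInterval), extendI f (-t) = f 0 := fun f t => by
    rw [extendI, Set.projIcc_of_le_left zero_le_one (neg_nonpos.2 t.2.1)]
    rfl
  have hpos : ∀ t : unitInterval, h t = fundCos A t * X + fundSin A t * P := fun t => by
    simp only [hh]
    rw [clamp, clamp, extendI_coe, extendI_coe, fundCos_zero, fundSin_zero, add_sub_cancel_right,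
      sub_zero]
  have hneg : ∀ t : unitInterval, h (-t) = fundCos A t * X - fundSin A t * P := fun t => by
    simp only [hh]
    rw [clamp, clamp, neg_neg, extendI_coe, extendI_coe, fundCos_zero, fundSin_zero,
      add_sub_cancel_left, zero_sub, neg_mul, sub_eq_add_neg]
  have hend : h 1 = μ • h (-1) := by
    have e1 := hpos 1
    have e2 := hneg 1
    simp only [Set.Icc.coe_one] at e1 e2
    rw [e1, e2]
    change endCos A * X + endSin A * P = μ • (endCos A * X - endSin A * P)
    refine sub_eq_zero.1 (Eq.trans ?_ (sub_eq_zero.2 h1.symm))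
    module
  -- The function `g` is only a continuous candidate. The solution `Z` is obtained by integrating
  -- `-A g` twice and is afterwards shown to equal `g`, which avoids checking differentiability at
  -- the points where the pieces are joined.
  obtain ⟨g, hg, hg2, hgh⟩ := exists_quasiperiodic hc hμ hend
  set φ : ℝ → R := fun t => -(A (foldI t) * g t) with hφ
  have cφ : Continuous φ := ((A.continuous.comp continuous_foldI).mul hg).neg
  have hφ2 : ∀ t, φ (t + 2) = μ • φ t := fun t => by
    simp only [hφ]
    rw [foldI_add_two, hg2, mul_smul_comm, smul_neg]
  set Z' : ℝ → R := fun t => P + ∫ s in (0 : ℝ)..t, φ s with hZ'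
  have dZ' : ∀ t, HasDerivAt Z' (φ t) t := fun t => (hasDerivAt_integral cφ t).const_add P
  have cZ' : Continuous Z' := continuous_iff_continuousAt.2 fun t => (dZ' t).continuousAt
  set Z : ℝ → R := fun t => X + ∫ s in (0 : ℝ)..t, Z' s with hZ
  have dZ : ∀ t, HasDerivAt Z (Z' t) t := fun t => (hasDerivAt_integral cZ' t).const_add X
  have Z0 : Z 0 = X := by simp [hZ]
  have Z'0 : Z' 0 = P := by simp [hZ']
  -- comparison on one period
  have comp : ∀ (f : C(unitInterval, R)) {v : R}, HasAccel f v (-(A * f)) → ∀ {Y Y' : ℝ → R},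
      (∀ t, HasDerivAt Y (Y' t) t) → (∀ t : unitInterval, HasDerivAt Y' ((-(A * f)) t) t) →
      Y 0 = f 0 → Y' 0 = v → (∀ t : unitInterval, Y t = f t) ∧
        Y' 1 = endCosDeriv A * f 0 + endSinDeriv A * v := fun f v hf Y Y' hY hY' h0 h0' => by
    have cY : Continuous Y := continuous_iff_continuousAt.2 fun t => (hY t).continuousAt
    have hA := hasAccel_of_hasDerivAt (f := ⟨fun t : unitInterval => Y t, by fun_prop⟩)
      (fun t => hY t) hY' fun t => rfl
    constructor
    · intro t
      have e1 := hA.eq t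
      have e2 := hf.eq t
      simp only [ContinuousMap.coe_mk, Set.Icc.coe_zero] at e1
      rw [e1, e2, h0, h0']
    · have e1 := primitive_eq_of_hasDerivAt hY' 1
      rw [map_neg, ContinuousMap.neg_apply] at e1
      rw [← hf.end_eq.2, sub_eq_add_neg, e1, h0']
      simp
  have combo : ∀ x p : R, ∃ f : C(unitInterval, R), (∀ t, f t = fundCos A t * x + fundSin A t * p) ∧
      HasAccel f p (-(A * f)) := fun x p => by
    refine ⟨fundCos A * ContinuousMap.const _ x + fundSin A * ContinuousMap.const _ p,
      fun t => rfl, ?_⟩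
    have := ((hasAccel_fundCos A).mul_const x).add ((hasAccel_fundSin A).mul_const p)
    rw [zero_mul, zero_add, one_mul] at this
    convert! this using 1
    ext t
    simp [mul_add, mul_assoc]
    abel
  obtain ⟨f, hf, fA⟩ := combo X P
  obtain ⟨f', hf', fA'⟩ := combo X (-P)
  have f0 : f 0 = X := by simp [hf, fundCos_zero, fundSin_zero]
  have f0' : f' 0 = X := by simp [hf', fundCos_zero, fundSin_zero]
  obtain ⟨a1, a2⟩ := comp f fA dZ (fun t => by
    have := dZ' t
    simp only [hφ] at this
    rwa [foldI_coe, hgh t ⟨by linarith [t.2.1], t.2.2⟩, hpos, ← hf] at this)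
    (by rw [Z0, f0]) Z'0
  obtain ⟨b1, b2⟩ := comp f' fA' (Y := fun t => Z (-t)) (Y' := fun t => -Z' (-t))
    (fun t => hasDerivAt_comp_neg (dZ (-t))) (fun t => by
      have := (hasDerivAt_comp_neg (dZ' (-t))).neg
      simp only [hφ] at this
      rw [foldI_neg, foldI_coe, hgh (-t) ⟨by linarith [t.2.2], by linarith [t.2.1]⟩, hneg,
        neg_neg] at this
      rw [ContinuousMap.neg_apply, ContinuousMap.mul_apply, hf', mul_neg, ← sub_eq_add_neg]
      exact this) (by rw [neg_zero, Z0, f0']) (by rw [neg_zero, Z'0])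
  rw [f0] at a2
  rw [f0'] at b2
  -- quasiperiodicity
  have q1 : (fun t => Z' (t + 2)) = fun t => μ • Z' t :=
    eq_of_hasDerivAt_eq (a := -1) (f' := fun t => μ • φ t) (fun t => by
      have := (dZ' (t + 2)).comp_add_const t 2
      rwa [hφ2] at this) (fun t => (dZ' t).const_smul μ) (by
      rw [show (-1 : ℝ) + 2 = 1 by norm_num, a2, ← neg_neg (Z' (-1)), b2]
      rw [mul_neg, smul_neg, smul_add, smul_neg]
      refine sub_eq_zero.1 (Eq.trans ?_ (sub_eq_zero.2 h2))
      module)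
  have zh : ∀ t ∈ Set.Icc (-1 : ℝ) 1, Z t = h t := fun t ht => by
    by_cases h0 : 0 ≤ t
    · have := a1 ⟨t, h0, ht.2⟩
      rw [hf, ← hpos] at this
      exact this
    · push Not at h0
      have := b1 ⟨-t, by linarith, by linarith [ht.1]⟩
      rw [hf', mul_neg, ← sub_eq_add_neg, ← hneg] at this
      simpa using this
  have q2 : (fun t => Z (t + 2)) = fun t => μ • Z t :=
    eq_of_hasDerivAt_eq (a := -1) (f' := fun t => μ • Z' t) (fun t => by
      have := (dZ (t + 2)).comp_add_const t 2
      rwa [congrFun q1 t] at this) (fun t => (dZ t).const_smul μ) (by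
      rw [show (-1 : ℝ) + 2 = 1 by norm_num, zh 1 (by norm_num), zh (-1) (by norm_num), hend])
  have zg : Z = g := by
    have hp : Function.Periodic (fun t => Z t = g t) 2 := fun t => by
      have := congrFun q2 t
      simp only [this, hg2, smul_right_inj hμ.ne']
    funext t
    obtain ⟨s, hs, hst⟩ := hp.exists_mem_Ico two_pos t (-1)
    have hs' : s ∈ Set.Icc (-1 : ℝ) 1 := ⟨hs.1, by linarith [hs.2]⟩
    rw [hst, zh s hs', hgh s hs']
  refine ⟨Z, Z', dZ, fun t => ?_, congrFun q2, Z0, Z'0⟩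
  rw [zg]
  exact dZ' t

end Floquet

end

noncomputable section

/-! ### Bloch waves on the lattice -/

section BlochWaves

open scoped Matrix Matrix.Norms.L2Operator

variable {V W : ℝ → ℝ} {Q₀ Qπ : ℝ → ℝ}

/-- The variational equations on even and odd sites. -/
theorem isVariation_dimer_iff {N : ℕ} {ξ : ℤ → ℝ → ℝ} :
    IsVariation V W N (dimer Q₀ Qπ) ξ ↔ (∀ n, ξ (n + N) = ξ n) ∧ ∀ l : ℤ,
      (HasSecondDeriv (ξ (2 * l)) fun t =>
        -(deriv (deriv V) (Q₀ t + Qπ t) + deriv (deriv W) (2 * Qπ t) +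
          deriv (deriv W) (-(2 * Qπ t))) * ξ (2 * l) t +
        deriv (deriv W) (2 * Qπ t) * ξ (2 * l - 1) t +
        deriv (deriv W) (-(2 * Qπ t)) * ξ (2 * l + 1) t) ∧
      HasSecondDeriv (ξ (2 * l + 1)) fun t =>
        -(deriv (deriv V) (Q₀ t - Qπ t) + deriv (deriv W) (2 * Qπ t) +
          deriv (deriv W) (-(2 * Qπ t))) * ξ (2 * l + 1) t +
        deriv (deriv W) (-(2 * Qπ t)) * ξ (2 * l) t +
        deriv (deriv W) (2 * Qπ t) * ξ (2 * l + 2) t := by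
  have pe : ∀ l : ℤ, (-1 : ℝ) ^ (2 * l) = 1 := fun l => by simp [zpow_mul]
  have ne : (-1 : ℝ) ≠ 0 := by norm_num
  have e1 : ∀ (l : ℤ) t, dimer Q₀ Qπ (2 * l) t = Q₀ t + Qπ t := fun l t => by
    simp [dimer, pe]
  have e2 : ∀ (l : ℤ) t, dimer Q₀ Qπ (2 * l + 1) t = Q₀ t - Qπ t := fun l t => by
    simp [dimer, pe, zpow_add₀ ne, sub_eq_add_neg]
  have e3 : ∀ (l : ℤ) t, dimer Q₀ Qπ (2 * l - 1) t = Q₀ t - Qπ t := fun l t => by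
    rw [show 2 * l - 1 = 2 * (l - 1) + 1 by ring, e2]
  have e4 : ∀ (l : ℤ) t, dimer Q₀ Qπ (2 * l + 1 + 1) t = Q₀ t + Qπ t := fun l t => by
    rw [show 2 * l + 1 + 1 = 2 * (l + 1) by ring, e1]
  have d1 : ∀ t, Q₀ t + Qπ t - (Q₀ t - Qπ t) = 2 * Qπ t := fun t => by ring
  have d2 : ∀ t, Q₀ t - Qπ t - (Q₀ t + Qπ t) = -(2 * Qπ t) := fun t => by ring
  refine and_congr_right fun _ => ⟨fun h l => ⟨(h (2 * l)).congr fun t => ?_,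
    (h (2 * l + 1)).congr fun t => ?_⟩, fun h n => ?_⟩
  · rw [e1, e2, e3, d1, d2]
    ring
  · rw [e2, add_sub_cancel_right, e1, e4, d1, d2, add_assoc (2 * l) 1 1, one_add_one_eq_two]
    ring
  · obtain ⟨l, rfl | rfl⟩ := Int.even_or_odd' n
    · refine (h l).1.congr fun t => ?_
      rw [e1, e2, e3, d1, d2]
      ring
    · refine (h l).2.congr fun t => ?_
      rw [e2, add_sub_cancel_right, e1, e4, d1, d2, add_assoc (2 * l) 1 1, one_add_one_eq_two]
      ring

/-- Amplitudes of a Bloch wave `z⁻ⁿ a` on even sites and `z⁻ⁿ b` on odd sites. -/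
structure IsBlochPair (V W Q₀ Qπ : ℝ → ℝ) (z : ℂ) (a b a' b' : ℝ → ℂ) : Prop where
  even : ∀ t, HasDerivAt a (a' t) t
  odd : ∀ t, HasDerivAt b (b' t) t
  even' : ∀ t, HasDerivAt a' (-((deriv (deriv V) (Q₀ t + Qπ t) + deriv (deriv W) (2 * Qπ t) +
      deriv (deriv W) (-(2 * Qπ t)) : ℝ) : ℂ) * a t + ((deriv (deriv W) (2 * Qπ t) : ℝ) * z +
      (deriv (deriv W) (-(2 * Qπ t)) : ℝ) * z⁻¹) * b t) t
  odd' : ∀ t, HasDerivAt b' (-((deriv (deriv V) (Q₀ t - Qπ t) + deriv (deriv W) (2 * Qπ t) +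
      deriv (deriv W) (-(2 * Qπ t)) : ℝ) : ℂ) * b t + ((deriv (deriv W) (-(2 * Qπ t)) : ℝ) * z +
      (deriv (deriv W) (2 * Qπ t) : ℝ) * z⁻¹) * a t) t

theorem sum_range_shift {E : Type*} [AddCommGroup E] {M : ℕ} {g : ℕ → E} (h : g M = g 0) :
    ∑ l ∈ Finset.range M, g l = ∑ l ∈ Finset.range M, g (l + 1) := by
  have h1 := Finset.sum_range_succ g M
  have h2 := Finset.sum_range_succ' g M
  rw [h1, h] at h2
  exact add_right_cancel h2

/-- Fourier components of variations are amplitudes of Bloch waves. -/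
theorem IsVariation.isBlochPair {M : ℕ} {ξ : ℤ → ℝ → ℝ}
    (h : IsVariation V W (M + M) (dimer Q₀ Qπ) ξ) {z : ℂ} (hz : z ^ (M + M) = 1) :
    IsBlochPair V W Q₀ Qπ z (fun t => ∑ l ∈ Finset.range M, z ^ (2 * l) * ξ (2 * l) t)
      (fun t => ∑ l ∈ Finset.range M, z ^ (2 * l + 1) * ξ (2 * l + 1) t)
      (fun t => ∑ l ∈ Finset.range M, z ^ (2 * l) * (deriv (ξ (2 * l)) t : ℝ))
      (fun t => ∑ l ∈ Finset.range M, z ^ (2 * l + 1) * (deriv (ξ (2 * l + 1)) t : ℝ)) := by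
  obtain ⟨hper, h⟩ := isVariation_dimer_iff.1 h
  have hz0 : z ≠ 0 ∨ M = 0 := by
    by_cases hM : M = 0
    · exact Or.inr hM
    · refine Or.inl fun h0 => ?_
      rw [h0, zero_pow (by omega)] at hz
      exact zero_ne_one hz
  -- Shifting by one cell multiplies a Fourier sum by a power of `z`. The boundary terms cancel
  -- because `ξ` is periodic over the lattice and `z` is a root of unity of that order.
  have s1 : ∀ t, ∑ l ∈ Finset.range M, z ^ (2 * l) * (ξ (2 * l - 1) t : ℂ) =
      z * ∑ l ∈ Finset.range M, z ^ (2 * l + 1) * (ξ (2 * l + 1) t : ℂ) := fun t => by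
    rw [sum_range_shift (g := fun l : ℕ => z ^ (2 * l) * (ξ (2 * l - 1) t : ℂ)), Finset.mul_sum]
    · refine Finset.sum_congr rfl fun l _ => ?_
      rw [show (2 : ℤ) * (l + 1 : ℕ) - 1 = 2 * l + 1 by push_cast; ring]
      ring
    · have := hper (-1)
      rw [← two_mul] at hz
      rw [hz, show (2 : ℤ) * M - 1 = -1 + (M + M : ℕ) by push_cast; ring, this]
      simp
  have s2 : ∀ t, z * ∑ l ∈ Finset.range M, z ^ (2 * l + 1) * (ξ (2 * l + 2) t : ℂ) =
      ∑ l ∈ Finset.range M, z ^ (2 * l) * (ξ (2 * l) t : ℂ) := fun t => by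
    rw [sum_range_shift (g := fun l : ℕ => z ^ (2 * l) * (ξ (2 * l) t : ℂ)), Finset.mul_sum]
    · refine Finset.sum_congr rfl fun l _ => ?_
      rw [show (2 : ℤ) * (l + 1 : ℕ) = 2 * l + 2 by push_cast; ring]
      ring
    · have := hper 0
      rw [← two_mul] at hz
      rw [hz, show (2 : ℤ) * M = 0 + (M + M : ℕ) by push_cast; ring, this]
      simp
  have s3 : ∀ t, z * ∑ l ∈ Finset.range M, z ^ (2 * l) * (ξ (2 * l + 1) t : ℂ) =
      ∑ l ∈ Finset.range M, z ^ (2 * l + 1) * (ξ (2 * l + 1) t : ℂ) := fun t => by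
    rw [Finset.mul_sum]
    exact Finset.sum_congr rfl fun l _ => by ring
  have s4 : ∀ t, z * ∑ l ∈ Finset.range M, z ^ (2 * l) * (ξ (2 * l) t : ℂ) =
      ∑ l ∈ Finset.range M, z ^ (2 * l + 1) * (ξ (2 * l) t : ℂ) := fun t => by
    rw [Finset.mul_sum]
    exact Finset.sum_congr rfl fun l _ => by ring
  rcases hz0 with hz0 | rfl
  swap
  · exact ⟨fun t => by simpa using hasDerivAt_const t (0 : ℂ), fun t => by
      simpa using hasDerivAt_const t (0 : ℂ), fun t => by simpa using hasDerivAt_const t (0 : ℂ),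
      fun t => by simpa using hasDerivAt_const t (0 : ℂ)⟩
  refine ⟨fun t => ?_, fun t => ?_, fun t => ?_, fun t => ?_⟩
  · exact HasDerivAt.fun_sum fun l _ => ((h l).1.1 t).hasDerivAt.ofReal_comp.const_mul _
  · exact HasDerivAt.fun_sum fun l _ => ((h l).2.1 t).hasDerivAt.ofReal_comp.const_mul _
  · have := HasDerivAt.fun_sum (u := Finset.range M) fun l _ =>
      ((h l).1.2 t).ofReal_comp.const_mul (z ^ (2 * l))
    convert! this using 1
    have t1 := s1 t
    have t3 := s3 t
    simp only [Complex.ofReal_add, Complex.ofReal_mul, Complex.ofReal_neg, mul_add,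
      Finset.sum_add_distrib, mul_left_comm (z ^ _), ← Finset.mul_sum, t1]
    rw [← t3]
    field_simp
    ring
  · have := HasDerivAt.fun_sum (u := Finset.range M) fun l _ =>
      ((h l).2.2 t).ofReal_comp.const_mul (z ^ (2 * l + 1))
    convert! this using 1
    have t2 := s2 t
    have t4 := s4 t
    simp only [Complex.ofReal_add, Complex.ofReal_mul, Complex.ofReal_neg, mul_add,
      Finset.sum_add_distrib, mul_left_comm (z ^ _), ← Finset.mul_sum, ← t4]
    rw [← t2]
    field_simp
    ring

/-- Real parts of Bloch waves are variations. -/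
theorem IsBlochPair.isVariation {z : ℂ} {a b a' b' : ℝ → ℂ} (h : IsBlochPair V W Q₀ Qπ z a b a' b')
    {N : ℕ} (hN : Even N) (hN0 : N ≠ 0) (hz : z ^ N = 1) (c : ℂ) :
    IsVariation V W N (dimer Q₀ Qπ) fun n t =>
      (c * z⁻¹ ^ n * if Even n then a t else b t).re := by
  have hz0 : z ≠ 0 := fun h0 => by
    rw [h0, zero_pow hN0] at hz
    exact zero_ne_one hz
  have hzi : z⁻¹ ≠ 0 := inv_ne_zero hz0
  have re : ∀ {f : ℝ → ℂ} {f' : ℂ} {t : ℝ} (m : ℂ), HasDerivAt f f' t →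
      HasDerivAt (fun t => (m * f t).re) (m * f').re t := fun m h =>
    Complex.reCLM.hasFDerivAt.comp_hasDerivAt _ (h.const_mul m)
  have sec : ∀ {f f' : ℝ → ℂ} {f'' : ℝ → ℂ} (m : ℂ), (∀ t, HasDerivAt f (f' t) t) →
      (∀ t, HasDerivAt f' (f'' t) t) →
      HasSecondDeriv (fun t => (m * f t).re) fun t => (m * f'' t).re := fun m h1 h2 => by
    refine ⟨fun t => (re m (h1 t)).differentiableAt, fun t => ?_⟩
    rw [funext fun t => (re m (h1 t)).deriv]
    exact re m (h2 t)
  have o1 : ∀ l : ℤ, ¬Even (2 * l + 1) := fun l => by simp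
  have o2 : ∀ l : ℤ, ¬Even (2 * l - 1) := fun l => by simp
  have o3 : ∀ l : ℤ, Even (2 * l + 2) := fun l => by simp
  refine isVariation_dimer_iff.2 ⟨fun n => ?_, fun l => ⟨?_, ?_⟩⟩
  · have h1 : z⁻¹ ^ (n + N) = z⁻¹ ^ n := by
      rw [zpow_add₀ hzi, zpow_natCast, inv_pow, hz, inv_one, mul_one]
    have h2 : Even (n + N) ↔ Even n := by simp [Int.even_add, hN]
    simp only [h1, h2]
  · simp only [even_two_mul, if_true, o1, o2, if_false]
    refine (sec (c * z⁻¹ ^ (2 * l)) h.even h.even').congr fun t => ?_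
    rw [zpow_sub_one₀ hzi, zpow_add_one₀ hzi, inv_inv]
    generalize z⁻¹ ^ (2 * l) = y
    simp only [← Complex.re_ofReal_mul, ← Complex.add_re]
    congr 1
    push_cast
    ring
  · simp only [even_two_mul, if_true, o1, o3, if_false]
    refine (sec (c * z⁻¹ ^ (2 * l + 1)) h.odd h.odd').congr fun t => ?_
    rw [show (2 : ℤ) * l + 2 = 2 * l + 1 + 1 by ring, zpow_add_one₀ hzi (2 * l + 1),
      zpow_add_one₀ hzi (2 * l)]
    generalize z⁻¹ ^ (2 * l) = y
    simp only [← Complex.re_ofReal_mul, ← Complex.add_re]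
    congr 1
    push_cast
    field_simp
    ring

end BlochWaves

end

noncomputable section

/-! ### Multipliers of the mode and matching solutions -/

section Multipliers

open scoped Matrix Matrix.Norms.L2Operator

/-- Solutions are carried in the matrix algebra, where the fundamental solutions live; a nonzero
column of the initial data then provides the vectors. -/
theorem hasMatch_of_mul {A : C(unitInterval, CMat)} {X P : CMat} {k : ℝ} (h0 : X ≠ 0 ∨ P ≠ 0)
    (h1 : k • (endCos A * X) = endSin A * P) (h2 : endCosDeriv A * X = k • (endSinDeriv A * P)) :
    HasMatch A k := by
  have : ∃ j, (fun i => X i j) ≠ 0 ∨ (fun i => P i j) ≠ 0 := by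
    by_contra! h
    rcases h0 with h0 | h0
    · exact h0 (Matrix.ext fun i j => congrFun (h j).1 i)
    · exact h0 (Matrix.ext fun i j => congrFun (h j).2 i)
  obtain ⟨j, hj⟩ := this
  exact ⟨_, _, hj, funext fun i => congrFun (congrFun h1 i) j,
    funext fun i => congrFun (congrFun h2 i) j⟩

/-- Complex multiples of a matrix, as a real-linear map. -/
def spanC (m : CMat) : ℂ →L[ℝ] CMat :=
  LinearMap.toContinuousLinearMap ((LinearMap.toSpanSingleton ℂ CMat m).restrictScalars ℝ)

theorem spanC_apply (m : CMat) (c : ℂ) : spanC m c = c • m := rfl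

/-- An entry of a matrix, as a real-linear map. -/
def entryC (i j : Fin 2) : CMat →L[ℝ] ℂ := cmatMap (Matrix.entryLinearMap ℝ ℂ i j)

variable {V W : ℝ → ℝ} {X₀ Xπ : ℝ → C(unitInterval, ℝ)} {Λ : ℝ → ℝ}

/-- The branch at amplitude `r` is a mode whose variational equations are given by `modeOp`. -/
structure IsRegularAmplitude (V W : ℝ → ℝ) (X₀ Xπ : ℝ → C(unitInterval, ℝ)) (Λ : ℝ → ℝ)
    (r : ℝ) : Prop where
  time_pos : 0 < Λ r
  modeOp_apply : ∀ q t, modeOp V W X₀ Xπ Λ (r, q) (foldI (t / √(Λ r))) =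
    Λ r • ((1 / 2 * (deriv (deriv V) (branchOsc X₀ Λ r t + branchOsc Xπ Λ r t) +
          deriv (deriv V) (branchOsc X₀ Λ r t - branchOsc Xπ Λ r t)) +
        (deriv (deriv W) (2 * branchOsc Xπ Λ r t) +
          deriv (deriv W) (-(2 * branchOsc Xπ Λ r t)))) • (1 : CMat) -
      Real.cos q • (deriv (deriv W) (2 * branchOsc Xπ Λ r t) +
        deriv (deriv W) (-(2 * branchOsc Xπ Λ r t))) • sigZ +
      (1 / 2 * (deriv (deriv V) (branchOsc X₀ Λ r t + branchOsc Xπ Λ r t) -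
          deriv (deriv V) (branchOsc X₀ Λ r t - branchOsc Xπ Λ r t))) • sigX +
      Real.sin q • (deriv (deriv W) (2 * branchOsc Xπ Λ r t) -
        deriv (deriv W) (-(2 * branchOsc Xπ Λ r t))) • sigY)

theorem IsModeBranch.eventually_isRegularAmplitude (hV : IsPotential V) (hW : IsPotential W)
    (hb : IsModeBranch V W X₀ Xπ Λ) : ∀ᶠ r in 𝓝 0, IsRegularAmplitude V W X₀ Xπ Λ r := by
  filter_upwards [hb.eventually_time_pos hV hW, hb.eventually_modeOp_apply hV hW] with r h1 h2
  exact ⟨h1, fun q t => h2 q _⟩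

theorem exp_neg_mul_I (q : ℝ) :
    Complex.exp (-(q * Complex.I)) = Real.cos q - Real.sin q * Complex.I := by
  rw [← neg_mul, ← Complex.ofReal_neg, Complex.exp_mul_I, ← Complex.ofReal_cos,
    ← Complex.ofReal_sin, Real.cos_neg, Real.sin_neg]
  push_cast
  ring

theorem exp_neg_mul_I_inv (q : ℝ) :
    (Complex.exp (-(q * Complex.I)))⁻¹ = Real.cos q + Real.sin q * Complex.I := by
  rw [← Complex.exp_neg, neg_neg, Complex.exp_mul_I, ← Complex.ofReal_cos, ← Complex.ofReal_sin]

theorem hasDerivAt_comp_mul {E : Type*} [NormedAddCommGroup E] [NormedSpace ℝ E] {f : ℝ → E} {f' : E}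
    {c s : ℝ} (h : HasDerivAt f f' (c * s)) : HasDerivAt (fun s => f (c * s)) (c • f') s := by
  simpa using! h.scomp s ((hasDerivAt_id s).const_mul c)

/-- Bloch amplitudes with a multiplier give matching solutions. -/
theorem IsRegularAmplitude.hasMatch {r : ℝ} (hr : IsRegularAmplitude V W X₀ Xπ Λ r) {q : ℝ}
    {a b a' b' : ℝ → ℂ} (h : IsBlochPair V W (branchOsc X₀ Λ r) (branchOsc Xπ Λ r)
      (Complex.exp (-(q * Complex.I))) a b a' b') {μ : ℝ} (hμ : 0 < μ)
    (ha : ∀ t, a (t + 2 * √(Λ r)) = μ * a t) (hb : ∀ t, b (t + 2 * √(Λ r)) = μ * b t)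
    (hne : ∃ t, a t ≠ 0 ∨ b t ≠ 0) : HasMatch (modeOp V W X₀ Xπ Λ (r, q)) ((μ - 1) / (μ + 1)) := by
  set T := √(Λ r) with hT
  have hT0 : 0 < T := Real.sqrt_pos.2 hr.time_pos
  have hT2 : T * T = Λ r := Real.mul_self_sqrt hr.time_pos.le
  -- The first column of `Z` contains `(a + b)/2` and `(a - b)/2`, the in-phase and out-of-phase
  -- components of the Bloch amplitudes.
  set E : CMat := !![1 / 2, 0; 1 / 2, 0] with hE
  set F : CMat := !![1 / 2, 0; -1 / 2, 0] with hF
  set Z : ℝ → CMat := fun s => spanC E (a (T * s)) + spanC F (b (T * s)) with hZ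
  set Z' : ℝ → CMat := fun s => spanC E (T • a' (T * s)) + spanC F (T • b' (T * s)) with hZ'
  have d : ∀ (m : CMat) {f : ℝ → ℂ} {f' : ℂ} {s : ℝ}, HasDerivAt f f' s →
      HasDerivAt (fun s => spanC m (f s)) (spanC m f') s := fun m _ _ _ h =>
    (spanC m).hasFDerivAt.comp_hasDerivAt _ h
  have dZ : ∀ s, HasDerivAt Z (Z' s) s := fun s =>
    (d E (hasDerivAt_comp_mul (h.even (T * s)))).add (d F (hasDerivAt_comp_mul (h.odd (T * s))))
  have dZ' : ∀ s, HasDerivAt Z' (-(modeOp V W X₀ Xπ Λ (r, q) (foldI s) * Z s)) s := fun s => by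
    have h1 := (d E ((hasDerivAt_comp_mul (h.even' (T * s))).const_smul T)).add
      (d F ((hasDerivAt_comp_mul (h.odd' (T * s))).const_smul T))
    convert! h1 using 1
    have e := hr.modeOp_apply q (T * s)
    rw [← hT, mul_div_cancel_left₀ _ hT0.ne'] at e
    rw [e, hZ]
    rw [exp_neg_mul_I_inv, exp_neg_mul_I]
    simp only [smul_smul, hT2, spanC_apply]
    ext i j
    fin_cases i <;> fin_cases j <;>
      simp [hE, hF, sigX, sigY, sigZ, Matrix.mul_apply, Fin.sum_univ_two, -Complex.ofReal_cos,
        -Complex.ofReal_sin] <;> ring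
  have hper : ∀ s, Z (s + 2) = μ • Z s := fun s => by
    simp only [hZ]
    rw [show T * (s + 2) = T * s + 2 * T by ring, ha, hb, spanC_apply, spanC_apply, spanC_apply,
      spanC_apply, smul_add, mul_smul, mul_smul]
    rfl
  have hZne : ∃ s, Z s ≠ 0 := by
    obtain ⟨t, ht⟩ := hne
    refine ⟨t / T, fun h0 => ?_⟩
    simp only [hZ, mul_div_cancel₀ _ hT0.ne', spanC_apply] at h0
    have h1 := congrFun (congrFun h0 0) 0
    have h2 := congrFun (congrFun h0 1) 0
    simp [hE, hF] at h1 h2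
    rcases ht with ht | ht
    · exact ht (by linear_combination h1 + h2)
    · exact ht (by linear_combination h1 - h2)
  obtain ⟨k0, k1, k2⟩ := exists_match_of_floquet hμ.ne' dZ dZ' hper hZne
  have hμ1 : μ + 1 ≠ 0 := by positivity
  refine hasMatch_of_mul k0 ?_ ?_
  · rw [div_eq_inv_mul, mul_smul, k1, smul_smul, inv_mul_cancel₀ hμ1, one_smul]
  · rw [div_eq_inv_mul, mul_smul, ← k2, smul_smul, inv_mul_cancel₀ hμ1, one_smul]

/-- Matching solutions give Bloch amplitudes with a multiplier. -/
theorem IsRegularAmplitude.exists_isBlochPair {r : ℝ} (hr : IsRegularAmplitude V W X₀ Xπ Λ r)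
    {q k : ℝ} (hk0 : 0 ≤ k) (hk1 : k < 1) (h : HasMatch (modeOp V W X₀ Xπ Λ (r, q)) k) :
    ∃ a b a' b' : ℝ → ℂ, IsBlochPair V W (branchOsc X₀ Λ r) (branchOsc Xπ Λ r)
      (Complex.exp (-(q * Complex.I))) a b a' b' ∧
      (∀ t, a (t + 2 * √(Λ r)) = ((1 + k) / (1 - k) : ℝ) * a t) ∧
      (∀ t, b (t + 2 * √(Λ r)) = ((1 + k) / (1 - k) : ℝ) * b t) ∧ ∃ t, a t ≠ 0 ∨ b t ≠ 0 := by
  set T := √(Λ r) with hT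
  have hT0 : 0 < T := Real.sqrt_pos.2 hr.time_pos
  have hT2 : T * T = Λ r := Real.mul_self_sqrt hr.time_pos.le
  have hk : 0 < 1 - k := sub_pos.2 hk1
  set μ := (1 + k) / (1 - k) with hμ
  have hμ0 : 0 < μ := by positivity
  obtain ⟨x, p, h0, h1, h2⟩ := h
  set A := modeOp V W X₀ Xπ Λ (r, q) with hA
  have col : ∀ (m : CMat) (v : Fin 2 → ℂ), m * Matrix.replicateCol (Fin 2) v =
      Matrix.replicateCol (Fin 2) (m *ᵥ v) := fun m v => (Matrix.replicateCol_mulVec m v).symm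
  -- For `μ = (1 + k)/(1 - k)` both coefficients in the Floquet condition carry the common factor
  -- `2/(1 - k)`, and their ratio is `k`.
  have e1 : μ - 1 = 2 / (1 - k) * k := by rw [hμ, div_sub_one hk.ne', div_mul_eq_mul_div]; ring
  have e2 : μ + 1 = 2 / (1 - k) := by rw [hμ, div_add_one hk.ne']; ring
  obtain ⟨Z, Z', dZ, dZ', hper, Z0, Z'0⟩ := exists_floquet_of_match (A := A)
    (X := Matrix.replicateCol (Fin 2) x) (P := Matrix.replicateCol (Fin 2) p) hμ0
    (by rw [e1, e2, col, col, ← h1, mul_smul, Matrix.replicateCol_smul])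
    (by rw [e1, e2, col, col, h2, mul_smul, Matrix.replicateCol_smul])
  have d : ∀ (i : Fin 2) {f : ℝ → CMat} {f' : CMat} {s : ℝ}, HasDerivAt f f' s →
      HasDerivAt (fun s => f s i 0) (f' i 0) s := fun i _ _ _ h =>
    (entryC i 0).hasFDerivAt.comp_hasDerivAt _ h
  have dd : ∀ {f : ℝ → CMat} {f' : CMat} {t : ℝ}, HasDerivAt f f' (T⁻¹ * t) →
      HasDerivAt (fun t => f (T⁻¹ * t)) (T⁻¹ • f') t := fun h => hasDerivAt_comp_mul h
  refine ⟨fun t => Z (T⁻¹ * t) 0 0 + Z (T⁻¹ * t) 1 0, fun t => Z (T⁻¹ * t) 0 0 - Z (T⁻¹ * t) 1 0,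
    fun t => (T⁻¹ • Z' (T⁻¹ * t)) 0 0 + (T⁻¹ • Z' (T⁻¹ * t)) 1 0,
    fun t => (T⁻¹ • Z' (T⁻¹ * t)) 0 0 - (T⁻¹ • Z' (T⁻¹ * t)) 1 0, ⟨fun t => ?_, fun t => ?_,
      fun t => ?_, fun t => ?_⟩, fun t => ?_, fun t => ?_, ?_⟩
  · exact (d 0 (dd (dZ _))).add (d 1 (dd (dZ _)))
  · exact (d 0 (dd (dZ _))).sub (d 1 (dd (dZ _)))
  · have := (d 0 ((dd (dZ' _)).const_smul T⁻¹)).add (d 1 ((dd (dZ' (T⁻¹ * t))).const_smul T⁻¹))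
    convert! this using 1
    have e := hr.modeOp_apply q t
    rw [div_eq_inv_mul, ← hT, ← hA] at e
    rw [e, exp_neg_mul_I_inv, exp_neg_mul_I, smul_mul_assoc, ← smul_neg, smul_smul, smul_smul,
      ← mul_inv, hT2, inv_mul_cancel₀ hr.time_pos.ne', one_smul]
    simp [sigX, sigY, sigZ, Matrix.mul_apply, Fin.sum_univ_two, -Complex.ofReal_cos,
        -Complex.ofReal_sin]
    ring
  · have := (d 0 ((dd (dZ' _)).const_smul T⁻¹)).sub (d 1 ((dd (dZ' (T⁻¹ * t))).const_smul T⁻¹))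
    convert! this using 1
    have e := hr.modeOp_apply q t
    rw [div_eq_inv_mul, ← hT, ← hA] at e
    rw [e, exp_neg_mul_I_inv, exp_neg_mul_I, smul_mul_assoc, ← smul_neg, smul_smul, smul_smul,
      ← mul_inv, hT2, inv_mul_cancel₀ hr.time_pos.ne', one_smul]
    simp [sigX, sigY, sigZ, Matrix.mul_apply, Fin.sum_univ_two, -Complex.ofReal_cos,
        -Complex.ofReal_sin]
    ring
  · simp only
    rw [show T⁻¹ * (t + 2 * T) = T⁻¹ * t + 2 by field_simp, hper]
    simp
    ring
  · simp only
    rw [show T⁻¹ * (t + 2 * T) = T⁻¹ * t + 2 by field_simp, hper]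
    simp
    ring
  · by_contra! hz
    -- If both amplitudes vanished, so would the first column of `Z` at all times, and with it the
    -- initial value `x` and the initial velocity `p`.
    have z0 : ∀ s i, Z s i 0 = 0 := fun s => by
      obtain ⟨y0, y1⟩ := hz (T * s)
      rw [inv_mul_cancel_left₀ hT0.ne'] at y0 y1
      intro i
      fin_cases i
      · change Z s 0 0 = 0
        linear_combination (y0 + y1) / 2
      · change Z s 1 0 = 0
        linear_combination (y0 - y1) / 2
    have z1 : ∀ i, Z' 0 i 0 = 0 := fun i => by
      refine (d i (dZ 0)).unique ?_
      simp only [z0]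
      exact hasDerivAt_const _ _
    rcases h0 with h0 | h0
    · exact h0 (funext fun i => by simpa [Z0] using z0 0 i)
    · exact h0 (funext fun i => by simpa [Z'0] using z1 i)

end Multipliers

end

noncomputable section

/-! ### Variations of the mode and matching solutions -/

section LatticeVariations

variable {V W : ℝ → ℝ} {X₀ Xπ : ℝ → C(unitInterval, ℝ)} {Λ : ℝ → ℝ} {M : ℕ}

/-- The Vandermonde matrix of the `N` distinct roots of unity is invertible, so not all Fourier
components of a nonzero vector vanish. -/
theorem exists_fourier_ne_zero {N : ℕ} (hN : N ≠ 0) {u : ℕ → ℂ} (hu : ∃ n < N, u n ≠ 0) :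
    ∃ z : ℂ, z ^ N = 1 ∧ ∑ n ∈ Finset.range N, z ^ n * u n ≠ 0 := by
  by_contra! h
  obtain ⟨n, hn, hne⟩ := hu
  have hp := Complex.isPrimitiveRoot_exp N hN
  have h0 := Matrix.eq_zero_of_forall_index_sum_pow_mul_eq_zero (n := N)
    (f := fun j : Fin N => Complex.exp (2 * Real.pi * Complex.I / N) ^ (j : ℕ))
    (v := fun i : Fin N => u i) (fun i j hij => Fin.ext (hp.pow_inj i.2 j.2 hij)) fun j => by
      have := h (Complex.exp (2 * Real.pi * Complex.I / N) ^ (j : ℕ)) (by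
        rw [pow_right_comm, hp.pow_eq_one, one_pow])
      rwa [Finset.sum_range] at this
  exact hne (congrFun h0 ⟨n, hn⟩)

theorem sum_range_add_self (g : ℕ → ℂ) : ∑ n ∈ Finset.range (M + M), g n =
    ∑ l ∈ Finset.range M, g (2 * l) + ∑ l ∈ Finset.range M, g (2 * l + 1) := by
  induction M with
  | zero => simp
  | succ m ih =>
    rw [show m + 1 + (m + 1) = m + m + 1 + 1 by ring, Finset.sum_range_succ, Finset.sum_range_succ,
      ih, Finset.sum_range_succ _ m, Finset.sum_range_succ _ m, ← two_mul]
    ring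

/-- Roots of unity, up to sign, have angles in `[-π/2, π/2]`, separated from zero. -/
theorem exists_angle {z : ℂ} (hM : 0 < M) (hz : z ^ (M + M) = 1) :
    ∃ q : ℝ, |q| ≤ Real.pi / 2 ∧ (q ≠ 0 → Real.pi / M ≤ |q|) ∧
      (Complex.exp (-(q * Complex.I)) = z ∨ Complex.exp (-(q * Complex.I)) = -z) := by
  -- One of `z` and `-z` has nonnegative real part, hence an argument in `[-π/2, π/2]`; both are
  -- roots of unity of the same even order.
  obtain ⟨w, hw, hwz, hre⟩ : ∃ w : ℂ, w ^ (M + M) = 1 ∧ (w = z ∨ w = -z) ∧ 0 ≤ w.re := by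
    rcases le_total 0 z.re with h | h
    · exact ⟨z, hz, Or.inl rfl, h⟩
    · exact ⟨-z, by rw [Even.neg_pow ⟨M, rfl⟩, hz], Or.inr rfl, by simpa using h⟩
  have hexp : Complex.exp (-((-w.arg : ℝ) * Complex.I)) = w := by
    have := Complex.norm_mul_exp_arg_mul_I w
    rw [Complex.norm_eq_one_of_pow_eq_one hw (by omega), Complex.ofReal_one, one_mul] at this
    rw [Complex.ofReal_neg, neg_mul, neg_neg, this]
  refine ⟨-w.arg, by rw [abs_neg]; exact Complex.abs_arg_le_pi_div_two_iff.2 hre, fun h0 => ?_,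
    by rwa [hexp]⟩
  rw [← hexp, ← Complex.exp_nat_mul, Complex.exp_eq_one_iff] at hw
  obtain ⟨m, hm⟩ := hw
  have hm' : (M : ℝ) * w.arg = m * Real.pi := by
    have h1 : ((M + M : ℕ) : ℂ) * w.arg * Complex.I = m * (2 * Real.pi) * Complex.I := by
      rw [Complex.ofReal_neg] at hm
      linear_combination hm
    have h2 := mul_right_cancel₀ Complex.I_ne_zero h1
    have h3 : ((M + M : ℕ) : ℝ) * w.arg = m * (2 * Real.pi) := by exact_mod_cast h2
    push_cast at h3
    linarith
  have hM0 : (0 : ℝ) < M := by exact_mod_cast hM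
  have hm0 : m ≠ 0 := fun h => by
    rw [h, Int.cast_zero, zero_mul, mul_eq_zero] at hm'
    exact h0 (neg_eq_zero.2 (hm'.resolve_left hM0.ne'))
  have h1 : (1 : ℝ) ≤ |(m : ℝ)| := by exact_mod_cast Int.one_le_abs hm0
  have h2 := congrArg abs hm'
  rw [abs_mul, abs_mul, abs_of_pos hM0, abs_of_pos Real.pi_pos] at h2
  rw [abs_neg, div_le_iff₀ hM0, mul_comm, h2]
  nlinarith [Real.pi_pos]

/-- Describing odd sites by `-b` instead of `b` replaces `z` by `-z`. Momenta are therefore needed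
only modulo `π`. -/
theorem IsBlochPair.neg {Q₀ Qπ : ℝ → ℝ} {z : ℂ} {a b a' b' : ℝ → ℂ}
    (h : IsBlochPair V W Q₀ Qπ z a b a' b') : IsBlochPair V W Q₀ Qπ (-z) a (-b) a' (-b') where
  even := h.even
  odd t := (h.odd t).neg
  even' t := by
    convert! h.even' t using 1
    simp only [Pi.neg_apply, inv_neg]
    ring
  odd' t := by
    convert! (h.odd' t).neg using 1
    simp only [Pi.neg_apply, inv_neg]
    ring

/-- Nonzero Fourier components of variations with a multiplier give matching solutions. -/
theorem IsRegularAmplitude.exists_hasMatch {r : ℝ} (hr : IsRegularAmplitude V W X₀ Xπ Λ r)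
    (hM : 0 < M) {ξ : ℤ → ℝ → ℝ}
    (h : IsVariation V W (M + M) (dimer (branchOsc X₀ Λ r) (branchOsc Xπ Λ r)) ξ) {μ : ℝ}
    (hμ : 0 < μ) (hper : ∀ n t, ξ n (t + 2 * √(Λ r)) = μ * ξ n t) {z : ℂ} (hz : z ^ (M + M) = 1)
    {t : ℝ} (hne : ∑ n ∈ Finset.range (M + M), z ^ n * (ξ n t : ℂ) ≠ 0) :
    ∃ q : ℝ, |q| ≤ Real.pi / 2 ∧ (q ≠ 0 → Real.pi / M ≤ |q|) ∧ (z ^ 2 ≠ 1 → q ≠ 0) ∧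
      HasMatch (modeOp V W X₀ Xπ Λ (r, q)) ((μ - 1) / (μ + 1)) := by
  have hB := h.isBlochPair hz
  have hpa : ∀ (f : ℕ → ℂ) (g : ℕ → ℤ) (t : ℝ),
      ∑ l ∈ Finset.range M, f l * (ξ (g l) (t + 2 * √(Λ r)) : ℂ) =
        μ * ∑ l ∈ Finset.range M, f l * (ξ (g l) t : ℂ) := fun f g t => by
    rw [Finset.mul_sum]
    refine Finset.sum_congr rfl fun l _ => ?_
    rw [hper]
    push_cast
    ring
  rw [sum_range_add_self] at hne
  obtain ⟨q, hq1, hq2, hq3⟩ := exists_angle hM hz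
  refine ⟨q, hq1, hq2, fun h2 h0 => h2 ?_, ?_⟩
  · rw [h0] at hq3
    rcases hq3 with h | h
    · simp [← h]
    · rw [← neg_sq, ← h]
      simp
  · have hs : ∀ {x y : ℂ}, x + y ≠ 0 → x ≠ 0 ∨ y ≠ 0 := fun {x y} hxy => by
      by_contra! h0
      exact hxy (by rw [h0.1, h0.2, add_zero])
    push_cast at hne
    rcases hq3 with rfl | h
    · exact hr.hasMatch hB hμ (hpa _ _) (hpa _ _) ⟨t, hs hne⟩
    · have hB' := hB.neg
      rw [← h] at hB'
      refine hr.hasMatch hB' hμ (hpa _ _) (fun s => ?_) ⟨t, ?_⟩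
      · simp only [Pi.neg_apply]
        rw [hpa, mul_neg]
      · exact (hs hne).imp_right neg_ne_zero.2

theorem exists_lt_of_periodic {N : ℕ} (hN : N ≠ 0) {ξ : ℤ → ℝ → ℝ} (hξ : ∀ n, ξ (n + N) = ξ n)
    {n : ℤ} : ∃ m < N, ξ n = ξ (m : ℕ) := by
  have hN' : (0 : ℤ) < N := by exact_mod_cast Nat.pos_of_ne_zero hN
  have hz : ∀ k : ℤ, ∀ n, ξ (n + k * N) = ξ n := fun k => by
    induction k using Int.induction_on with
    | zero => simp
    | succ i ih => exact fun n => by rw [add_one_mul, ← add_assoc, hξ, ih]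
    | pred i ih => exact fun n => by rw [← hξ, sub_one_mul, add_assoc, sub_add_cancel, ih]
  refine ⟨(n % N).toNat, ?_, ?_⟩
  · have := Int.emod_lt_of_pos n hN'
    omega
  · rw [Int.toNat_of_nonneg (Int.emod_nonneg n hN'.ne'), ← hz (n / N) (n % N), mul_comm,
      Int.emod_add_mul_ediv]

/-- A multiplier `μ > 1` corresponds to `k = (μ - 1)/(μ + 1)` in `(0, 1]`. The momentum may be zero
here, since the perturbation need not break the symmetry. -/
theorem IsRegularAmplitude.exists_hasMatch_of_multiplier {r : ℝ}
    (hr : IsRegularAmplitude V W X₀ Xπ Λ r) (hM : 0 < M) {μ : ℝ} (hμ : 1 < μ)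
    (h : IsRealMultiplier V W (M + M) (dimer (branchOsc X₀ Λ r) (branchOsc Xπ Λ r))
      (2 * √(Λ r)) μ) :
    ∃ q k : ℝ, |q| ≤ Real.pi / 2 ∧ (q ≠ 0 → Real.pi / M ≤ |q|) ∧ 0 < k ∧ k ≤ 1 ∧
      HasMatch (modeOp V W X₀ Xπ Λ (r, q)) k := by
  obtain ⟨ξ, hξ, ⟨n, t, hne⟩, hper⟩ := h
  obtain ⟨m, hm, hnm⟩ := exists_lt_of_periodic (N := M + M) (by omega) (by exact_mod_cast hξ.1) (n := n)
  obtain ⟨z, hz, hsum⟩ := exists_fourier_ne_zero (N := M + M) (by omega)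
    (u := fun n => (ξ n t : ℂ)) ⟨m, hm, by rw [← hnm]; exact_mod_cast hne⟩
  obtain ⟨q, h1, h2, -, h3⟩ := hr.exists_hasMatch hM hξ (by linarith) hper hz hsum
  have : 0 < μ + 1 := by linarith
  exact ⟨q, _, h1, h2, div_pos (sub_pos.2 hμ) this, (div_le_one this).2 (by linarith), h3⟩

/-- The Fourier transform is applied to `ξ (n + 2) - ξ n`. Multiplied by `z²` it is `(1 - z²)` times
the transform of `ξ`, so a nonzero component has `z² ≠ 1`, that is `q ≠ 0`, and is also present in
`ξ`. -/
theorem IsRegularAmplitude.exists_hasMatch_of_breaking {r : ℝ}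
    (hr : IsRegularAmplitude V W X₀ Xπ Λ r) (hM : 0 < M)
    (h : HasBreakingPeriodicVariation V W (M + M) (dimer (branchOsc X₀ Λ r) (branchOsc Xπ Λ r))
      (2 * √(Λ r))) :
    ∃ q : ℝ, |q| ≤ Real.pi / 2 ∧ q ≠ 0 ∧ Real.pi / M ≤ |q| ∧
      HasMatch (modeOp V W X₀ Xπ Λ (r, q)) 0 := by
  obtain ⟨ξ, hξ, ⟨n, t, hne⟩, hper⟩ := h
  have hξN : ∀ n, ξ (n + (M + M : ℕ)) = ξ n := by exact_mod_cast hξ.1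
  obtain ⟨m, hm, hnm⟩ := exists_lt_of_periodic (N := M + M) (by omega)
    (ξ := fun n t => ξ (n + 2) t - ξ n t) (fun n => by
      rw [add_right_comm, hξN, hξN]) (n := n)
  have hnm' := congrFun hnm t
  obtain ⟨z, hz, hsum⟩ := exists_fourier_ne_zero (N := M + M) (by omega)
    (u := fun n => ((ξ (n + 2) t - ξ n t : ℝ) : ℂ)) ⟨m, hm, by
      rw [← hnm']
      exact_mod_cast sub_ne_zero.2 hne⟩
  have hz0 : z ≠ 0 := fun h0 => by
    rw [h0, zero_pow (by omega)] at hz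
    exact zero_ne_one hz
  have h0 : ξ (M + M : ℕ) = ξ 0 := by simpa using hξN 0
  have hshift : ∀ f : ℤ → ℂ, (f (M + M : ℕ) = f 0) →
      ∑ n ∈ Finset.range (M + M), z ^ n * f n =
        z * ∑ n ∈ Finset.range (M + M), z ^ n * f ((n + 1 : ℕ) : ℤ) := fun f hf => by
    rw [sum_range_shift (g := fun n : ℕ => z ^ n * f n) (by simp [hz, ← hf]), Finset.mul_sum]
    exact Finset.sum_congr rfl fun l _ => by rw [pow_succ]; ring
  have e1 := hshift (fun n => (ξ n t : ℂ)) (by rw [h0])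
  have e2 := hshift (fun n => (ξ (n + 1) t : ℂ)) (by
    have := hξN 1
    rw [add_comm] at this
    rw [this, zero_add])
  have e3 : ∑ n ∈ Finset.range (M + M), z ^ n * ((ξ (n + 2) t - ξ n t : ℝ) : ℂ) =
      (∑ n ∈ Finset.range (M + M), z ^ n * (ξ (((n + 1 : ℕ) : ℤ) + 1) t : ℂ)) -
        ∑ n ∈ Finset.range (M + M), z ^ n * (ξ n t : ℂ) := by
    rw [← Finset.sum_sub_distrib]
    refine Finset.sum_congr rfl fun l _ => ?_
    rw [Nat.cast_add, Nat.cast_one, add_assoc, one_add_one_eq_two]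
    push_cast
    ring
  rw [e3] at hsum
  push_cast at e1 e2 hsum
  have hz2 : z ^ 2 ≠ 1 := fun h2 => hsum (by
    refine (mul_eq_zero.1 (?_ : z ^ 2 * _ = 0)).resolve_left (pow_ne_zero 2 hz0)
    linear_combination -e1 - z * e2 -
      (∑ n ∈ Finset.range (M + M), z ^ n * (ξ n t : ℂ)) * h2)
  have hs : ∑ n ∈ Finset.range (M + M), z ^ n * (ξ n t : ℂ) ≠ 0 := fun hs => hsum (by
    refine (mul_eq_zero.1 (?_ : z ^ 2 * _ = 0)).resolve_left (pow_ne_zero 2 hz0)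
    linear_combination -e1 - z * e2 + (1 - z ^ 2) * hs)
  obtain ⟨q, h1, h2, h3, h4⟩ := hr.exists_hasMatch hM hξ one_pos (by simpa using hper) hz hs
  rw [sub_self, zero_div] at h4
  exact ⟨q, h1, h3 hz2, h2 (h3 hz2), h4⟩

/-- Matching solutions give variations with a multiplier which break the symmetry. -/
theorem IsRegularAmplitude.exists_variation {r : ℝ} (hr : IsRegularAmplitude V W X₀ Xπ Λ r)
    {q k : ℝ} (hk0 : 0 ≤ k) (hk1 : k < 1) (h : HasMatch (modeOp V W X₀ Xπ Λ (r, q)) k) {N : ℕ}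
    (hN : Even N) (hN0 : N ≠ 0) (hz : Complex.exp (-(q * Complex.I)) ^ N = 1)
    (hz2 : Complex.exp (-(q * Complex.I)) ^ 2 ≠ 1) :
    ∃ ξ, IsVariation V W N (dimer (branchOsc X₀ Λ r) (branchOsc Xπ Λ r)) ξ ∧
      (∃ n t, ξ (n + 2) t ≠ ξ n t) ∧
      ∀ n t, ξ n (t + 2 * √(Λ r)) = (1 + k) / (1 - k) * ξ n t := by
  obtain ⟨a, b, a', b', hB, ha, hb, t, hne⟩ := hr.exists_isBlochPair hk0 hk1 h
  set z := Complex.exp (-(q * Complex.I)) with hzd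
  have hz0 : z⁻¹ ≠ 0 := inv_ne_zero (Complex.exp_ne_zero _)
  have hzi : z⁻¹ ^ 2 - 1 ≠ 0 := fun h0 => hz2 (by
    rw [inv_pow] at h0
    exact inv_eq_one.1 (sub_eq_zero.1 h0))
  set u : ℤ → ℝ → ℂ := fun n t => if Even n then a t else b t with hu
  have hper : ∀ (c : ℂ) (n : ℤ) (t : ℝ), (c * z⁻¹ ^ n * u n (t + 2 * √(Λ r))).re =
      (1 + k) / (1 - k) * (c * z⁻¹ ^ n * u n t).re := fun c n t => by
    have : u n (t + 2 * √(Λ r)) = ((1 + k) / (1 - k) : ℝ) * u n t := by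
      simp only [hu]
      split_ifs
      · exact ha t
      · exact hb t
    rw [this, mul_left_comm, Complex.re_ofReal_mul]
  -- If the real part were invariant under `n ↦ n + 2` for both `c = 1` and `c = i`, then `z⁻² - 1`
  -- times the complex amplitude would vanish at every site.
  obtain ⟨c, hc⟩ : ∃ c : ℂ, ∃ n : ℤ, (c * z⁻¹ ^ (n + 2) * u (n + 2) t).re ≠
      (c * z⁻¹ ^ n * u n t).re := by
    by_contra! hcon
    have hu2 : ∀ n, u (n + 2) t = u n t := fun n => by simp [hu]
    have hu0 : ∀ n, u n t = 0 := fun n => by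
      have h1 := hcon 1 n
      have h2 := hcon Complex.I n
      rw [hu2, zpow_add₀ hz0, ← sub_eq_zero, ← Complex.sub_re] at h1 h2
      have e : z⁻¹ ^ n * (z⁻¹ ^ 2 - 1) * u n t = 0 := by
        refine Complex.ext ?_ ?_
        · rw [Complex.zero_re, ← h1]
          congr 1
          norm_cast
          ring
        · rw [Complex.zero_im, ← neg_eq_zero, ← Complex.I_mul_re, ← h2]
          congr 1
          norm_cast
          ring
      exact (mul_eq_zero.1 e).resolve_left (mul_ne_zero (zpow_ne_zero _ hz0) hzi)
    rcases hne with h | h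
    · exact h (by simpa [hu] using hu0 0)
    · exact h (by simpa [hu] using hu0 1)
  obtain ⟨n, hn⟩ := hc
  exact ⟨_, hB.isVariation hN hN0 hz c, ⟨n, t, hn⟩, hper c⟩

end LatticeVariations

end

noncomputable section

/-! ### Energies and amplitudes of the mode -/

section Thresholds

variable {V W : ℝ → ℝ} {X₀ Xπ : ℝ → C(unitInterval, ℝ)} {Λ : ℝ → ℝ}

/-- Near `0` the function `κ` is Lipschitz and exceeds `κ(0)/2`. The growth of `r²` then dominates
the variation `r² L |Δr|` caused by `κ`, provided `r L ≤ κ(0)/2`. -/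
theorem exists_strictMonoOn_sq_mul {κ : ℝ → ℝ} (hκ : ContDiffAt ℝ 1 κ 0) (h0 : 0 < κ 0) :
    ∃ R > 0, ContinuousOn (fun r => r ^ 2 * κ r) (Set.Icc 0 R) ∧
      StrictMonoOn (fun r => r ^ 2 * κ r) (Set.Icc 0 R) := by
  obtain ⟨L, s, hs, hL⟩ := hκ.exists_lipschitzOnWith
  obtain ⟨δ, hδ, hb⟩ := Metric.eventually_nhds_iff.1
    ((hκ.continuousAt.eventually (lt_mem_nhds (half_lt_self h0))).and hs)
  have hLp : (0 : ℝ) < L + 1 := by positivity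
  set R := min (δ / 2) (κ 0 / 2 / (L + 1)) with hR
  have hRδ : R < δ := (min_le_left _ _).trans_lt (half_lt_self hδ)
  have hRL : R * (L + 1) ≤ κ 0 / 2 := (le_div_iff₀ hLp).1 (min_le_right _ _)
  have hmem : ∀ r ∈ Set.Icc 0 R, κ 0 / 2 < κ r ∧ r ∈ s := fun r hr => hb (by
    rw [dist_zero_right, Real.norm_of_nonneg hr.1]
    exact hr.2.trans_lt hRδ)
  refine ⟨R, by positivity, (continuousOn_pow 2).mul (hL.continuousOn.mono fun r hr =>
    (hmem r hr).2), fun r₁ h₁ r₂ h₂ h12 => ?_⟩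
  have h3 := hL.dist_le_mul r₂ (hmem r₂ h₂).2 r₁ (hmem r₁ h₁).2
  rw [Real.dist_eq, Real.dist_eq, abs_of_pos (sub_pos.2 h12)] at h3
  have h4 := (abs_le.1 h3).1
  have h5 := (hmem r₂ h₂).1
  have h6 : r₁ * L ≤ κ 0 / 2 := by
    have : r₁ * L ≤ R * (L + 1) := by
      have := h₁.2
      have := h₁.1
      gcongr
      linarith
    linarith
  have h7 : 0 < r₂ + r₁ := add_pos_of_pos_of_nonneg (h₁.1.trans_lt h12) h₁.1
  have h8 : 0 < (r₂ ^ 2 - r₁ ^ 2) * (κ r₂ - κ 0 / 2) := mul_pos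
    (by nlinarith [sub_pos.2 h12]) (sub_pos.2 h5)
  have h9 : r₁ ^ 2 * (-(L * (r₂ - r₁))) ≤ r₁ ^ 2 * (κ r₂ - κ r₁) :=
    mul_le_mul_of_nonneg_left h4 (sq_nonneg _)
  have h10 : r₁ * L * (r₁ * (r₂ - r₁)) ≤ κ 0 / 2 * (r₁ * (r₂ - r₁)) :=
    mul_le_mul_of_nonneg_right h6 (mul_nonneg h₁.1 (sub_pos.2 h12).le)
  have h11 : 0 ≤ κ 0 / 2 * (r₂ * (r₂ - r₁)) :=
    mul_nonneg (half_pos h0).le (mul_nonneg h₂.1 (sub_pos.2 h12).le)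
  change r₁ ^ 2 * κ r₁ < r₂ ^ 2 * κ r₂
  linarith

/-- Amplitudes in `(0, R]` parametrize the mode, with energies `e`. -/
structure IsEnergyChart (V W : ℝ → ℝ) (X₀ Xπ : ℝ → C(unitInterval, ℝ)) (Λ : ℝ → ℝ)
    (Q₀ Qπ : ℝ → ℝ → ℝ) (w e : ℝ → ℝ) (R : ℝ) : Prop where
  pos : 0 < R
  zero : e 0 = 0
  continuousOn : ContinuousOn e (Set.Icc 0 R)
  strictMonoOn : StrictMonoOn e (Set.Icc 0 R)
  tendsto : Tendsto (fun r => e r / r ^ 2) (𝓝[>] 0) (𝓝 (piFreqSq V W / 2))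
  mode : ∀ r, 0 < r → r ≤ R → Q₀ (e r) = branchOsc X₀ Λ r ∧ Qπ (e r) = branchOsc Xπ Λ r ∧
    2 * Real.pi / w (e r) = 2 * √(Λ r)

/-- The interval of amplitudes is shrunk until its energies lie in the range where the given mode is
known to be on the branch. -/
theorem IsOutOfPhaseMode.exists_isEnergyChart (hV : IsPotential V) (hW : IsPotential W)
    (hb : IsModeBranch V W X₀ Xπ Λ) {Q₀ Qπ : ℝ → ℝ → ℝ} {w : ℝ → ℝ}
    (hm : IsOutOfPhaseMode V W Q₀ Qπ w) :
    ∃ e R, IsEnergyChart V W X₀ Xπ Λ Q₀ Qπ w e R := by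
  obtain ⟨κ, hκ, hκ0, he⟩ := hb.exists_energy_eq hV hW
  obtain ⟨hr, h⟩ := hm.eventually_eq_branch hV hW hb
  have hκpos : 0 < κ 0 := by
    rw [hκ0]
    exact half_pos (piFreqSq_pos hV hW)
  obtain ⟨R, hR, hc, hmono⟩ := exists_strictMonoOn_sq_mul (hκ.of_le (by simp)) hκpos
  rw [← funext he] at hc hmono
  set e := branchEnergy V W X₀ Xπ with hed
  have he0 : e 0 = 0 := by rw [he]; simp
  have hev := h.and (hr.eventually (Ioo_mem_nhdsGT hR))
  obtain ⟨E, hE, hEs'⟩ : ∃ E : ℝ, 0 < E ∧ ∀ ε, 0 < ε → ε < E → _ := by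
    obtain ⟨E, hE, hEs⟩ := mem_nhdsGT_iff_exists_Ioo_subset.1 hev
    exact ⟨E, hE, fun ε h0 h1 => hEs ⟨h0, h1⟩⟩
  have hlim : Tendsto e (𝓝[Set.Icc 0 R] 0) (𝓝 0) := by
    have := hc 0 ⟨le_rfl, hR.le⟩
    rwa [ContinuousWithinAt, he0] at this
  have hlim' : ∀ᶠ r in 𝓝[>] 0, e r < E := by
    have h1 : 𝓝[>] (0 : ℝ) ≤ 𝓝[Set.Icc 0 R] 0 := by
      rw [nhdsWithin_Icc_eq_nhdsGE hR]
      exact nhdsWithin_mono _ Set.Ioi_subset_Ici_self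
    exact (hlim.mono_left h1).eventually (gt_mem_nhds hE)
  obtain ⟨R', ⟨hR'E, hR'⟩⟩ := (hlim'.and (Ioo_mem_nhdsGT hR)).exists
  have hsub : Set.Icc 0 R' ⊆ Set.Icc 0 R := Set.Icc_subset_Icc_right hR'.2.le
  refine ⟨e, R', hR'.1, he0, hc.mono hsub, hmono.mono hsub, ?_, fun r h0 h1 => ?_⟩
  · rw [← hκ0]
    refine (hκ.continuousAt.tendsto.mono_left nhdsWithin_le_nhds).congr' ?_
    filter_upwards [self_mem_nhdsWithin] with r hr
    have hr : (0 : ℝ) < r := hr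
    rw [he, mul_div_cancel_left₀ _ (by positivity)]
  · have hrR : r ∈ Set.Icc 0 R := hsub ⟨h0.le, h1⟩
    have e0 : 0 < e r := he0 ▸ hmono ⟨le_rfl, hR.le⟩ hrR h0
    have e1 : e r < E := (hmono.monotoneOn hrR ⟨hR'.1.le, hR'.2.le⟩ h1).trans_lt hR'E
    obtain ⟨⟨k1, k2, k3, k4, k5⟩, k6⟩ := hEs' (e r) e0 e1
    -- The mode of energy `e r` is the branch point of amplitude `Q_π(0)`, which has the same energy
    -- as `r`; strict monotonicity of the energy identifies the two amplitudes.
    have k7 : Qπ (e r) 0 = r := hmono.injOn ⟨k6.1.le, k6.2.le⟩ hrR k1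
    rw [k7] at k2 k3 k5
    refine ⟨k2, k3, ?_⟩
    rw [← k5, Real.sqrt_sq (by positivity), mul_div_assoc]

namespace IsEnergyChart

variable {Q₀ Qπ : ℝ → ℝ → ℝ} {w e : ℝ → ℝ} {R : ℝ}

theorem mono (h : IsEnergyChart V W X₀ Xπ Λ Q₀ Qπ w e R) {R' : ℝ} (h0 : 0 < R') (h1 : R' ≤ R) :
    IsEnergyChart V W X₀ Xπ Λ Q₀ Qπ w e R' where
  pos := h0
  zero := h.zero
  continuousOn := h.continuousOn.mono (Set.Icc_subset_Icc_right h1)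
  strictMonoOn := h.strictMonoOn.mono (Set.Icc_subset_Icc_right h1)
  tendsto := h.tendsto
  mode r h2 h3 := h.mode r h2 (h3.trans h1)

theorem energy_pos (h : IsEnergyChart V W X₀ Xπ Λ Q₀ Qπ w e R) {r : ℝ} (h0 : 0 < r) (h1 : r ≤ R) :
    0 < e r :=
  h.zero ▸ h.strictMonoOn ⟨le_rfl, h.pos.le⟩ ⟨h0.le, h1⟩ h0

theorem exists_eq (h : IsEnergyChart V W X₀ Xπ Λ Q₀ Qπ w e R) {a b ε : ℝ} (ha : 0 ≤ a) (hab : a ≤ b)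
    (hb : b ≤ R) (h0 : e a < ε) (h1 : ε < e b) : ∃ r, a < r ∧ r < b ∧ e r = ε := by
  obtain ⟨r, hr, hre⟩ := intermediate_value_Ioo hab
    (h.continuousOn.mono (Set.Icc_subset_Icc ha hb)) ⟨h0, h1⟩
  exact ⟨r, hr.1, hr.2, hre⟩

end IsEnergyChart

/-! ### Bifurcation thresholds on finite lattices -/

/-- On `N = 2M` sites, `π / M = 2π / N` is the smallest positive wave number. It breaks the symmetry
`n ↦ n + 2` only if `M ≥ 2`. -/
theorem exp_pi_div {M : ℕ} (hM : 2 ≤ M) :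
    Complex.exp (-((Real.pi / M : ℝ) * Complex.I)) ^ (M + M) = 1 ∧
      Complex.exp (-((Real.pi / M : ℝ) * Complex.I)) ^ 2 ≠ 1 := by
  have hM0 : (M : ℂ) ≠ 0 := by
    have : M ≠ 0 := by omega
    exact_mod_cast this
  constructor
  · rw [← Complex.exp_nat_mul, Complex.exp_eq_one_iff]
    refine ⟨-1, ?_⟩
    push_cast
    field_simp
    ring
  · rw [← Complex.exp_nat_mul, Ne, Complex.exp_eq_one_iff]
    rintro ⟨n, hn⟩
    have h1 : (1 : ℂ) = ((-n * M : ℤ) : ℂ) := by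
      have h2 : (2 * Real.pi * Complex.I : ℂ) ≠ 0 := by
        simp [Real.pi_ne_zero, Complex.I_ne_zero]
      refine mul_right_cancel₀ h2 ?_
      push_cast at hn ⊢
      field_simp at hn
      linear_combination -(2 * Real.pi * Complex.I : ℂ) * hn
    have h2 : (1 : ℤ) = -n * M := by exact_mod_cast h1
    have h3 : (M : ℤ) ∣ 1 := ⟨-n, by rw [h2, mul_comm]⟩
    have h4 := Int.le_of_dvd one_pos h3
    omega

/-- The sign of the even determinant decides on the stability of the mode on finite lattices. -/
theorem IsModeBranch.exists_lattice_threshold (hV : IsPotential V) (hW : IsPotential W)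
    (hb : IsModeBranch V W X₀ Xπ Λ) {δ₀ : ℝ} (hδ₀ : 0 < δ₀) : ∃ δ R, 0 < R ∧ R ≤ δ ∧ δ ≤ δ₀ ∧
      (∀ r (M : ℕ), |r| < R → 0 < M →
        (∀ q, Real.pi / M ≤ |q| → |q| < δ → modeEven V W X₀ Xπ Λ (r, q) < 0) →
        ¬ HasBreakingPeriodicVariation V W (M + M) (dimer (branchOsc X₀ Λ r) (branchOsc Xπ Λ r))
          (2 * √(Λ r)) ∧
        ∀ μ, 1 < μ → ¬ IsRealMultiplier V W (M + M) (dimer (branchOsc X₀ Λ r) (branchOsc Xπ Λ r))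
          (2 * √(Λ r)) μ) ∧
      (∀ r (M : ℕ), |r| < R → 2 ≤ M → Real.pi / M < δ →
        modeEven V W X₀ Xπ Λ (r, Real.pi / M) = 0 →
        HasBreakingPeriodicVariation V W (M + M) (dimer (branchOsc X₀ Λ r) (branchOsc Xπ Λ r))
          (2 * √(Λ r))) ∧
      ∀ m, 1 < m → ∃ η > 0, ∀ r (M : ℕ), |r| < R → 2 ≤ M → Real.pi / M < δ →
        0 < modeEven V W X₀ Xπ Λ (r, Real.pi / M) → modeEven V W X₀ Xπ Λ (r, Real.pi / M) < η →
        ∃ μ, 1 < μ ∧ μ < m ∧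
          IsRealMultiplier V W (M + M) (dimer (branchOsc X₀ Λ r) (branchOsc Xπ Λ r))
            (2 * √(Λ r)) μ := by
  obtain ⟨δ, ρ, hρ, hρδ, hδ, t1, t2, t3, t4⟩ := hb.exists_match_threshold hV hW hδ₀
  obtain ⟨ρ', hρ', hreg⟩ := Metric.eventually_nhds_iff.1 (hb.eventually_isRegularAmplitude hV hW)
  have hreg' : ∀ r, |r| < min ρ ρ' → IsRegularAmplitude V W X₀ Xπ Λ r := fun r hr => hreg (by
    rw [dist_zero_right]
    exact hr.trans_le (min_le_right _ _))
  have hpos : ∀ M : ℕ, 2 ≤ M → 0 < Real.pi / M := fun M hM =>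
    div_pos Real.pi_pos (by exact_mod_cast (by omega : 0 < M))
  refine ⟨δ, min ρ ρ', lt_min hρ hρ', (min_le_left _ _).trans hρδ, hδ, fun r M hr hM hneg =>
    ⟨fun hB => ?_, fun μ hμ hmul => ?_⟩, fun r M hr hM hq h0 => ?_, fun m hm => ?_⟩
  · obtain ⟨q, h1, h2, h3, h4⟩ := (hreg' r hr).exists_hasMatch_of_breaking hM hB
    exact t1 r q 0 (hr.trans_le (min_le_left _ _)) h1 h2 (hneg q h3) le_rfl zero_le_one h4
  · obtain ⟨q, k, h1, h2, h3, h4, h5⟩ := (hreg' r hr).exists_hasMatch_of_multiplier hM hμ hmul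
    by_cases hq : q = 0
    · exact t2 r k (hr.trans_le (min_le_left _ _)) h3 h4 (hq ▸ h5)
    · exact t1 r q k (hr.trans_le (min_le_left _ _)) h1 hq (hneg q (h2 hq)) h3.le h4 h5
  · obtain ⟨z1, z2⟩ := exp_pi_div hM
    have := t3 r _ (hr.trans_le (min_le_left _ _)) (by rwa [abs_of_pos (hpos M hM)]) h0
    obtain ⟨ξ, h1, h2, h3⟩ := (hreg' r hr).exists_variation le_rfl zero_lt_one this ⟨M, rfl⟩
      (by omega) z1 z2
    exact ⟨ξ, h1, h2, by simpa using h3⟩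
  · obtain ⟨η, hη, ht⟩ := t4 ((m - 1) / (m + 1)) (div_pos (by linarith) (by linarith))
    refine ⟨η, hη, fun r M hr hM hq h0 h1 => ?_⟩
    obtain ⟨z1, z2⟩ := exp_pi_div hM
    obtain ⟨k, hk0, hk1, hk⟩ := ht r _ (hr.trans_le (min_le_left _ _))
      (by rwa [abs_of_pos (hpos M hM)]) (hpos M hM).ne' h0 h1
    rw [lt_div_iff₀ (by linarith)] at hk1
    have hk2 : k < 1 := by nlinarith
    obtain ⟨ξ, h1, ⟨n, t, h2⟩, h3⟩ := (hreg' r hr).exists_variation hk0.le hk2 hk ⟨M, rfl⟩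
      (by omega) z1 z2
    have hk3 := sub_pos.2 hk2
    refine ⟨(1 + k) / (1 - k), ?_, ?_, ξ, h1, ?_, h3⟩
    · rw [one_lt_div hk3]
      linarith
    · rw [div_lt_iff₀ hk3]
      linarith
    · by_contra! h0
      exact h2 (by rw [h0, h0])

end Thresholds

end

noncomputable section

/-! ### Threshold curves -/

section ThresholdCurve

variable {G : ℝ × ℝ → ℝ} {a c : ℝ}

/-- `G(r, q) = a r² - c q² + o(r² + q²)`, in a form which also controls increments. -/
structure HasQuadraticExpansion (G : ℝ × ℝ → ℝ) (a c : ℝ) : Prop where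
  zero : G (0, 0) = 0
  even : ∀ r q, G (r, -q) = G (r, q)
  increment : ∀ ε > 0, ∃ δ > 0, (∀ q r₁ r₂, |q| < δ → 0 ≤ r₁ → r₁ ≤ r₂ → r₂ < δ →
      |G (r₂, q) - G (r₁, q) - a * (r₂ ^ 2 - r₁ ^ 2)| ≤ ε * (r₂ ^ 2 - r₁ ^ 2)) ∧
    ∀ r q₁ q₂, |r| < δ → 0 ≤ q₁ → q₁ ≤ q₂ → q₂ < δ →
      |G (r, q₂) - G (r, q₁) + c * (q₂ ^ 2 - q₁ ^ 2)| ≤ ε * (q₂ ^ 2 - q₁ ^ 2)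

namespace HasQuadraticExpansion

theorem abs_momentum (h : HasQuadraticExpansion G a c) (r q : ℝ) : G (r, |q|) = G (r, q) := by
  rcases abs_choice q with e | e <;> rw [e]
  exact h.even r q

theorem exists_abs_sub_le (h : HasQuadraticExpansion G a c) {ε : ℝ} (hε : 0 < ε) :
    ∃ δ > 0, ∀ r q, 0 ≤ r → r < δ → |q| < δ →
      |G (r, q) - (a * r ^ 2 - c * q ^ 2)| ≤ ε * (r ^ 2 + q ^ 2) := by
  obtain ⟨δ, hδ, h1, h2⟩ := h.increment ε hε
  refine ⟨δ, hδ, fun r q hr hrδ hq => ?_⟩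
  have k1 := h1 q 0 r hq le_rfl hr hrδ
  have k2 := h2 0 0 |q| (by rwa [abs_zero]) le_rfl (abs_nonneg q) hq
  rw [h.abs_momentum, h.zero, sq_abs] at k2
  rw [abs_le] at *
  constructor <;> nlinarith

/-- Both quadratic terms are nonpositive, and an error with half the smaller coefficient cannot
overcome them. -/
theorem exists_neg (h : HasQuadraticExpansion G a c) (ha : a < 0) (hc : 0 < c) :
    ∃ δ > 0, ∀ r q, 0 ≤ r → r < δ → q ≠ 0 → |q| < δ → G (r, q) < 0 := by
  obtain ⟨δ, hδ, hd⟩ := h.exists_abs_sub_le (half_pos (lt_min (neg_pos.2 ha) hc))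
  refine ⟨δ, hδ, fun r q hr hrδ hq0 hq => ?_⟩
  have h1 := (abs_le.1 (hd r q hr hrδ hq)).2
  have h2 := min_le_left (-a) c
  have h3 := min_le_right (-a) c
  have h4 : 0 < q ^ 2 := by positivity
  have h5 : min (-a) c / 2 * r ^ 2 ≤ -a / 2 * r ^ 2 := by gcongr
  have h6 : min (-a) c / 2 * q ^ 2 ≤ c / 2 * q ^ 2 := by gcongr
  have h7 : 0 ≤ -a * r ^ 2 := mul_nonneg (by linarith) (sq_nonneg r)
  have h8 : 0 < c * q ^ 2 := mul_pos hc h4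
  linarith

/-- Control of increments, rather than of values alone, yields strict monotonicity of `G` in `r²`
and in `q²`. -/
theorem exists_monotone (h : HasQuadraticExpansion G a c) (ha : 0 < a) (hc : 0 < c) :
    ∃ δ > 0, (∀ q r₁ r₂, |q| < δ → 0 ≤ r₁ → r₁ ≤ r₂ → r₂ < δ →
        a / 2 * (r₂ ^ 2 - r₁ ^ 2) ≤ G (r₂, q) - G (r₁, q) ∧
          G (r₂, q) - G (r₁, q) ≤ 2 * a * (r₂ ^ 2 - r₁ ^ 2)) ∧
      ∀ r q₁ q₂, |r| < δ → 0 ≤ q₁ → q₁ ≤ q₂ → q₂ < δ →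
        c / 2 * (q₂ ^ 2 - q₁ ^ 2) ≤ G (r, q₁) - G (r, q₂) ∧
          G (r, q₁) - G (r, q₂) ≤ 2 * c * (q₂ ^ 2 - q₁ ^ 2) := by
  obtain ⟨δ, hδ, h1, h2⟩ := h.increment _ (half_pos (lt_min ha hc))
  have m1 := min_le_left a c
  have m2 := min_le_right a c
  refine ⟨δ, hδ, fun q r₁ r₂ k0 k1 k2 k3 => ?_, fun r q₁ q₂ k0 k1 k2 k3 => ?_⟩
  · have h3 := abs_le.1 (h1 q r₁ r₂ k0 k1 k2 k3)
    have h4 : 0 ≤ r₂ ^ 2 - r₁ ^ 2 := sub_nonneg.2 (pow_le_pow_left₀ k1 k2 2)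
    have h5 : min a c / 2 * (r₂ ^ 2 - r₁ ^ 2) ≤ a / 2 * (r₂ ^ 2 - r₁ ^ 2) := by gcongr
    have h6 := mul_nonneg ha.le h4
    constructor <;> linarith [h3.1, h3.2]
  · have h3 := abs_le.1 (h2 r q₁ q₂ k0 k1 k2 k3)
    have h4 : 0 ≤ q₂ ^ 2 - q₁ ^ 2 := sub_nonneg.2 (pow_le_pow_left₀ k1 k2 2)
    have h5 : min a c / 2 * (q₂ ^ 2 - q₁ ^ 2) ≤ c / 2 * (q₂ ^ 2 - q₁ ^ 2) := by gcongr
    have h6 := mul_nonneg hc.le h4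
    constructor <;> linarith [h3.1, h3.2]

/-- For small `q > 0` the function is negative at `r = 0` and positive at a fixed `R'`, so it
vanishes in between. -/
theorem exists_root (h : HasQuadraticExpansion G a c) (ha : 0 < a) (hc : 0 < c) {R : ℝ}
    (hR : 0 < R) : ∀ᶠ q in 𝓝[>] 0, ∃ r, 0 < r ∧ r < R ∧ G (r, q) = 0 := by
  obtain ⟨δ, hδ, h1, h2⟩ := h.exists_monotone ha hc
  set R' := min R δ / 2 with hR'
  have hR'0 : 0 < R' := by positivity
  have hm := half_lt_self (lt_min hR hδ)
  have hR'R : R' < R := hm.trans_le (min_le_left _ _)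
  have hR'δ : R' < δ := hm.trans_le (min_le_right _ _)
  have hlim : Tendsto (fun q : ℝ => 2 * c * q ^ 2) (𝓝[>] 0) (𝓝 0) := by
    have : Continuous fun q : ℝ => 2 * c * q ^ 2 := by fun_prop
    simpa using (this.tendsto 0).mono_left (nhdsWithin_le_nhds (s := Set.Ioi 0))
  filter_upwards [Ioo_mem_nhdsGT hδ, hlim.eventually
    (gt_mem_nhds (by positivity : 0 < a / 2 * R' ^ 2))] with q ⟨hq0, hqδ⟩ hq
  have hqa : |q| < δ := by rwa [abs_of_pos hq0]
  -- No continuity of `G` is assumed; the bounds on increments make it Lipschitz in `r`.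
  have hcont : ContinuousOn (fun r => G (r, q)) (Set.Icc 0 R') := by
    refine (LipschitzOnWith.of_le_add_mul (⟨2 * a * (2 * R'), by positivity⟩ : NNReal)
      fun x hx y hy => ?_).continuousOn
    have hK : 0 ≤ 2 * a * (2 * R') * |x - y| := by positivity
    rw [Real.dist_eq]
    change G (x, q) ≤ G (y, q) + 2 * a * (2 * R') * |x - y|
    rcases le_total x y with hxy | hxy
    · have k1 := (h1 q x y hqa hx.1 hxy (hy.2.trans_lt hR'δ)).1
      have k2 : 0 ≤ a / 2 * (y ^ 2 - x ^ 2) :=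
        mul_nonneg (half_pos ha).le (sub_nonneg.2 (pow_le_pow_left₀ hx.1 hxy 2))
      linarith
    · have k1 := (h1 q y x hqa hy.1 hxy (hx.2.trans_lt hR'δ)).2
      have k2 : x ^ 2 - y ^ 2 ≤ 2 * R' * (x - y) := by
        rw [sq_sub_sq]
        exact mul_le_mul_of_nonneg_right (by linarith [hx.2, hy.2]) (sub_nonneg.2 hxy)
      have k3 : 2 * a * (x ^ 2 - y ^ 2) ≤ 2 * a * (2 * R' * (x - y)) := by gcongr
      rw [abs_of_nonneg (sub_nonneg.2 hxy)]
      linarith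
  have k1 := h2 0 0 q (by rwa [abs_zero]) le_rfl hq0.le hqδ
  have k2 := (h1 q 0 R' hqa le_rfl hR'0.le hR'δ).1
  rw [h.zero] at k1
  have k3 : 0 < c / 2 * q ^ 2 := by positivity
  obtain ⟨r, hr, hr0⟩ := intermediate_value_Ioo hR'0.le hcont (⟨by linarith, by linarith⟩ :
    (0 : ℝ) ∈ Set.Ioo (G (0, q)) (G (R', q)))
  exact ⟨r, hr.1, hr.2.trans hR'R, hr0⟩

/-- The zero set of `G` is a curve `r = s(q)`, with `s(q)² ∼ (c / a) q²`. -/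
theorem exists_curve (h : HasQuadraticExpansion G a c) (ha : 0 < a) (hc : 0 < c) {R : ℝ}
    (hR : 0 < R) : ∃ s : ℝ → ℝ, (∀ᶠ q in 𝓝[>] 0, s q < R ∧ G (s q, q) = 0) ∧
      Tendsto s (𝓝[>] 0) (𝓝[>] 0) ∧ Tendsto (fun q => s q ^ 2 / q ^ 2) (𝓝[>] 0) (𝓝 (c / a)) := by
  obtain ⟨δ, hδ, h1⟩ := h.exists_abs_sub_le (half_pos ha)
  -- A root is chosen for each `q` that has one; the value at other `q` is irrelevant.
  have hroot : ∀ q : ℝ, ∃ r, (∃ r, 0 < r ∧ r < min R δ ∧ G (r, q) = 0) →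
      0 < r ∧ r < min R δ ∧ G (r, q) = 0 := fun q => by
    by_cases hq : ∃ r, 0 < r ∧ r < min R δ ∧ G (r, q) = 0
    · exact ⟨hq.choose, fun _ => hq.choose_spec⟩
    · exact ⟨0, fun h => absurd h hq⟩
  choose s hs using hroot
  have hs' : ∀ᶠ q in 𝓝[>] 0, 0 < s q ∧ s q < min R δ ∧ G (s q, q) = 0 :=
    (h.exists_root ha hc (lt_min hR hδ)).mono fun q hq => hs q hq
  set X := (c + a / 2) / (a / 2) with hX
  have hX0 : 0 < X := by positivity
  -- The expansion with error `a/2` first gives the crude bound `s² ≤ X q²`. With it, the refined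
  -- error is small relative to `q²` alone.
  have hbd : ∀ᶠ q in 𝓝[>] 0, s q ^ 2 ≤ X * q ^ 2 := by
    filter_upwards [hs', Ioo_mem_nhdsGT hδ] with q ⟨k1, k2, k3⟩ ⟨hq0, hqδ⟩
    have := (abs_le.1 (h1 (s q) q k1.le (k2.trans_le (min_le_right _ _))
      (by rwa [abs_of_pos hq0]))).1
    rw [k3] at this
    rw [hX, div_mul_eq_mul_div, le_div_iff₀ (half_pos ha)]
    linarith
  have hs0 : Tendsto s (𝓝[>] 0) (𝓝[>] 0) := by
    refine tendsto_nhdsWithin_iff.2 ⟨?_, hs'.mono fun q hq => hq.1⟩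
    have hlim : Tendsto (fun q : ℝ => √(X * q ^ 2)) (𝓝[>] 0) (𝓝 0) := by
      have : Continuous fun q : ℝ => √(X * q ^ 2) := by fun_prop
      simpa using (this.tendsto 0).mono_left (nhdsWithin_le_nhds (s := Set.Ioi 0))
    exact squeeze_zero' (hs'.mono fun q hq => hq.1.le) (hbd.mono fun q hq => Real.le_sqrt_of_sq_le hq)
      hlim
  refine ⟨s, hs'.mono fun q hq => ⟨hq.2.1.trans_le (min_le_left _ _), hq.2.2⟩, hs0, ?_⟩
  refine Metric.tendsto_nhds.2 fun ε hε => ?_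
  obtain ⟨δ', hδ', h2⟩ := h.exists_abs_sub_le (ε := a * ε / (2 * (X + 1))) (by positivity)
  filter_upwards [hs', hbd, Ioo_mem_nhdsGT hδ', hs0.eventually (Ioo_mem_nhdsGT hδ')] with q
    ⟨k1, k2, k3⟩ hq ⟨hq0, hqδ⟩ hsδ
  have h3 := h2 (s q) q k1.le hsδ.2 (by rwa [abs_of_pos hq0])
  rw [k3, zero_sub, abs_neg] at h3
  have hq2 : 0 < q ^ 2 := by positivity
  have h4 : a * ε / (2 * (X + 1)) * (s q ^ 2 + q ^ 2) ≤ a * ε / 2 * q ^ 2 := by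
    have : a * ε / (2 * (X + 1)) * (s q ^ 2 + q ^ 2) ≤
        a * ε / (2 * (X + 1)) * ((X + 1) * q ^ 2) := by
      gcongr
      linarith
    refine this.trans_eq ?_
    field_simp
  have h5 : s q ^ 2 / q ^ 2 - c / a = (a * s q ^ 2 - c * q ^ 2) / (a * q ^ 2) := by field_simp
  rw [Real.dist_eq, h5, abs_div, abs_of_pos (mul_pos ha hq2), div_lt_iff₀ (mul_pos ha hq2)]
  have : 0 < a * ε / 2 * q ^ 2 := by positivity
  linarith

end HasQuadraticExpansion

end ThresholdCurve

end

noncomputable section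

/-! ### Bifurcation of the mode -/

section Bifurcation

variable {V W : ℝ → ℝ} {Q₀ Qπ : ℝ → ℝ → ℝ} {w : ℝ → ℝ}

theorem eventually_evenAtTop_iff {p : ℕ → Prop} :
    (∀ᶠ N in evenAtTop, p N) ↔ ∀ᶠ N in atTop, Even N → p N :=
  eventually_inf_principal

instance : evenAtTop.NeBot := by
  refine inf_principal_neBot_iff.2 fun s hs => ?_
  obtain ⟨n, hn⟩ := mem_atTop_sets.1 hs
  exact ⟨n + n, hn _ (by omega), n, rfl⟩

theorem tendsto_evenAtTop_div {c : ℝ} (hc : 0 < c) :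
    Tendsto (fun N : ℕ => c / N) evenAtTop (𝓝[>] 0) := by
  refine tendsto_nhdsWithin_iff.2
    ⟨(tendsto_const_div_atTop_nhds_zero_nat c).mono_left inf_le_left, ?_⟩
  filter_upwards [(eventually_gt_atTop 0).filter_mono inf_le_left] with N hN
  exact div_pos hc (by exact_mod_cast hN)

/-- The symmetry-breaking perturbation at the smaller energy contradicts its absence below the
larger one. -/
theorem IsBifurcationEnergy.unique {N : ℕ} {E E' : ℝ} (h : IsBifurcationEnergy V W Q₀ Qπ w N E)
    (h' : IsBifurcationEnergy V W Q₀ Qπ w N E') : E = E' := by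
  rcases lt_trichotomy E E' with hlt | rfl | hlt
  · exact absurd h.2.2.1 (h'.2.1 E h.1 hlt).1
  · rfl
  · exact absurd h'.2.2.1 (h.2.1 E' h'.1 hlt).1

/-- Bifurcation energies tending to `0` would eventually fall below the energy that excludes
symmetry-breaking perturbations for all sizes. -/
theorem NeverBifurcates.not_bifurcates (h : NeverBifurcates V W Q₀ Qπ w) :
    ¬ Bifurcates V W Q₀ Qπ w := by
  obtain ⟨E, hE, h⟩ := h
  rintro ⟨e, he0, he⟩
  have heven : ∀ᶠ N : ℕ in evenAtTop, Even N :=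
    eventually_evenAtTop_iff.2 (Eventually.of_forall fun _ => id)
  obtain ⟨N, h1, h2, h3, h4⟩ := ((he0.eventually (gt_mem_nhds hE)).and (he.and
    (heven.and ((eventually_ge_atTop 2).filter_mono inf_le_left)))).exists
  exact (h N h4 h3 (e N) h2.1 h1).1 h2.2.2.1

variable {X₀ Xπ : ℝ → C(unitInterval, ℝ)} {Λ e : ℝ → ℝ} {R a c : ℝ}

/-- For `a < 0` the even determinant is negative at all small `r` and all small `q ≠ 0`. The
resulting energy bound does not depend on the number of sites. -/
theorem IsModeBranch.neverBifurcates (hV : IsPotential V) (hW : IsPotential W)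
    (hb : IsModeBranch V W X₀ Xπ Λ) (he : IsEnergyChart V W X₀ Xπ Λ Q₀ Qπ w e R)
    (hG : HasQuadraticExpansion (modeEven V W X₀ Xπ Λ) a c) (ha : a < 0) (hc : 0 < c) :
    NeverBifurcates V W Q₀ Qπ w := by
  obtain ⟨δ₀, hδ₀, hneg⟩ := hG.exists_neg ha hc
  obtain ⟨δ, ρ, hρ, hρδ, hδ, t1, -⟩ := hb.exists_lattice_threshold hV hW hδ₀
  have he := he.mono (lt_min he.pos hρ) (min_le_left _ _)
  refine ⟨e (min R ρ), he.energy_pos he.pos le_rfl, fun N hN2 ⟨M, hM⟩ ε h0 h1 => ?_⟩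
  rw [hM]
  rw [← he.zero] at h0
  obtain ⟨r, hr0, hr1, rfl⟩ := he.exists_eq le_rfl he.pos.le le_rfl h0 h1
  obtain ⟨m1, m2, m3⟩ := he.mode r hr0 hr1.le
  have hrρ : r < ρ := hr1.trans_le (min_le_right _ _)
  have hM0 : 0 < M := by omega
  rw [m1, m2, m3]
  refine t1 r M (by rwa [abs_of_pos hr0]) hM0 fun q hq hqδ =>
    hneg r q hr0.le (hrρ.trans_le (hρδ.trans hδ)) ?_ (hqδ.trans_le hδ)
  have : 0 < Real.pi / M := div_pos Real.pi_pos (by exact_mod_cast hM0)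
  exact abs_pos.1 (this.trans_le hq)

/-- The even determinant increases with `r` and decreases with `|q|`. If it vanishes at `(s, π/M)`,
then for `r < s` it is negative at every small admissible momentum, while slightly above `s` it is
positive and small at `π/M`. -/
theorem IsModeBranch.exists_isBifurcationEnergy (hV : IsPotential V) (hW : IsPotential W)
    (hb : IsModeBranch V W X₀ Xπ Λ) (he : IsEnergyChart V W X₀ Xπ Λ Q₀ Qπ w e R)
    (hG : HasQuadraticExpansion (modeEven V W X₀ Xπ Λ) a c) (ha : 0 < a) (hc : 0 < c) :
    ∃ δ > 0, ∃ R' > 0, ∀ s, 0 < s → s < R' → ∀ M : ℕ, 2 ≤ M → Real.pi / M < δ →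
      modeEven V W X₀ Xπ Λ (s, Real.pi / M) = 0 →
      IsBifurcationEnergy V W Q₀ Qπ w (M + M) (e s) := by
  obtain ⟨δ₀, hδ₀, g1, g2⟩ := hG.exists_monotone ha hc
  obtain ⟨δ, ρ, hρ, hρδ, hδ, t1, t2, t3⟩ := hb.exists_lattice_threshold hV hW hδ₀
  have he := he.mono (lt_min he.pos hρ) (min_le_left _ _)
  refine ⟨δ, hρ.trans_le hρδ, min R ρ, he.pos, fun s hs0 hs M hM hq hs1 => ?_⟩
  have hRρ : min R ρ ≤ ρ := min_le_right _ _
  have hq0 : 0 < Real.pi / M := div_pos Real.pi_pos (by exact_mod_cast (by omega : 0 < M))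
  have hqa : |Real.pi / M| < δ₀ := by
    rw [abs_of_pos hq0]
    exact hq.trans_le hδ
  refine ⟨he.energy_pos hs0 hs.le, fun ε h0 h1 => ?_, ?_, fun m hm => ?_⟩
  · rw [← he.zero] at h0
    obtain ⟨r, hr0, hr1, rfl⟩ := he.exists_eq le_rfl hs0.le hs.le h0 h1
    obtain ⟨m1, m2, m3⟩ := he.mode r hr0 (hr1.trans hs).le
    have hrρ : r < ρ := (hr1.trans hs).trans_le hRρ
    rw [m1, m2, m3]
    refine t1 r M (by rwa [abs_of_pos hr0]) (by omega) fun q hq1 hqδ => ?_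
    rw [← hG.abs_momentum]
    have k1 := (g2 r _ |q| (by rw [abs_of_pos hr0]; exact hrρ.trans_le (hρδ.trans hδ)) hq0.le hq1
      (hqδ.trans_le hδ)).1
    have k2 := (g1 _ r s hqa hr0.le hr1.le ((hs.trans_le hRρ).trans_le (hρδ.trans hδ))).1
    have k3 : 0 ≤ c / 2 * (|q| ^ 2 - (Real.pi / M) ^ 2) :=
      mul_nonneg (half_pos hc).le (sub_nonneg.2 (pow_le_pow_left₀ hq0.le hq1 2))
    have k4 : 0 < a / 2 * (s ^ 2 - r ^ 2) :=
      mul_pos (half_pos ha) (sub_pos.2 (pow_lt_pow_left₀ hr1 hr0.le two_ne_zero))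
    linarith
  · obtain ⟨m1, m2, m3⟩ := he.mode s hs0 hs.le
    rw [m1, m2, m3]
    exact t2 s M (by rw [abs_of_pos hs0]; exact hs.trans_le hRρ) hM hq hs1
  · obtain ⟨η, hη, t4⟩ := t3 m hm
    have hlim : Tendsto (fun r : ℝ => 2 * a * (r ^ 2 - s ^ 2)) (𝓝[>] s) (𝓝 0) := by
      have : Continuous fun r : ℝ => 2 * a * (r ^ 2 - s ^ 2) := by fun_prop
      simpa using (this.tendsto s).mono_left (nhdsWithin_le_nhds (s := Set.Ioi s))
    -- Up to the amplitude `r₁` the even determinant remains below `η`, so the multiplier it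
    -- produces stays below `m`.
    obtain ⟨r₁, k1, k2⟩ := ((hlim.eventually (gt_mem_nhds hη)).and (Ioo_mem_nhdsGT hs)).exists
    have hsr : e s < e r₁ := he.strictMonoOn ⟨hs0.le, hs.le⟩ ⟨(hs0.trans k2.1).le, k2.2.le⟩ k2.1
    filter_upwards [Ioo_mem_nhdsGT hsr] with ε hε
    obtain ⟨r, hr0, hr1, rfl⟩ := he.exists_eq hs0.le k2.1.le k2.2.le hε.1 hε.2
    have hrpos := hs0.trans hr0
    have hrR := hr1.trans k2.2
    obtain ⟨m1, m2, m3⟩ := he.mode r hrpos hrR.le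
    rw [m1, m2, m3]
    have k3 := g1 _ s r hqa hs0.le hr0.le ((hrR.trans_le hRρ).trans_le (hρδ.trans hδ))
    rw [hs1, sub_zero] at k3
    have k4 : 0 < a / 2 * (r ^ 2 - s ^ 2) :=
      mul_pos (half_pos ha) (sub_pos.2 (pow_lt_pow_left₀ hr0 hs0.le two_ne_zero))
    have k5 : 2 * a * (r ^ 2 - s ^ 2) ≤ 2 * a * (r₁ ^ 2 - s ^ 2) := by gcongr
    exact t4 r M (by rw [abs_of_pos hrpos]; exact hrR.trans_le hRρ) hM hq (by linarith) (by linarith)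

/-- With `q = 2π/N` this replaces `q²` by `4 sin²(π/N)`. -/
theorem isEquivalent_sin_sq {f : ℝ → ℝ} {C : ℝ} (hC : C ≠ 0)
    (hf : Tendsto (fun q => f q / q ^ 2) (𝓝[>] 0) (𝓝 C)) :
    f ~[𝓝[>] 0] fun q => 4 * C * Real.sin (q / 2) ^ 2 := by
  refine isEquivalent_of_tendsto_one ?_
  have h1 : Tendsto (fun q : ℝ => Real.sinc (q / 2)) (𝓝[>] 0) (𝓝 1) := by
    have : Continuous fun q : ℝ => Real.sinc (q / 2) := Real.continuous_sinc.comp (by fun_prop)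
    simpa using (this.tendsto 0).mono_left (nhdsWithin_le_nhds (s := Set.Ioi 0))
  have h2 := (hf.div_const C).div (h1.pow 2) (by norm_num)
  rw [div_self hC, one_pow, div_one] at h2
  refine h2.congr' ?_
  filter_upwards [self_mem_nhdsWithin] with q hq
  have hq : (0 : ℝ) < q := hq
  simp only [Pi.div_apply]
  rw [Real.sinc_of_ne_zero (by positivity), div_pow, div_pow, div_div, div_div]
  congr 1
  field_simp
  ring

/-- The threshold amplitude at `q = 2π/N` satisfies `s² ∼ (c/a) q²`, and the energy is `Ω s²/2` to
leading order. -/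
theorem IsModeBranch.exists_areBifurcationEnergies (hV : IsPotential V) (hW : IsPotential W)
    (hb : IsModeBranch V W X₀ Xπ Λ) (he : IsEnergyChart V W X₀ Xπ Λ Q₀ Qπ w e R)
    (hG : HasQuadraticExpansion (modeEven V W X₀ Xπ Λ) a c) (ha : 0 < a) (hc : 0 < c) :
    ∃ E, AreBifurcationEnergies V W Q₀ Qπ w E ∧ E ~[evenAtTop] fun N : ℕ =>
      4 * (piFreqSq V W / 2 * (c / a)) * Real.sin (Real.pi / N) ^ 2 := by
  have hΩ := piFreqSq_pos hV hW
  obtain ⟨δ, hδ, R', hR', hbif⟩ := hb.exists_isBifurcationEnergy hV hW he hG ha hc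
  obtain ⟨s, hs, hs0, hs2⟩ := hG.exists_curve ha hc hR'
  have hq := tendsto_evenAtTop_div (mul_pos two_pos Real.pi_pos)
  have hlim : Tendsto (fun q => e (s q) / q ^ 2) (𝓝[>] 0) (𝓝 (piFreqSq V W / 2 * (c / a))) := by
    refine ((he.tendsto.comp hs0).mul hs2).congr' ?_
    filter_upwards [hs0.eventually self_mem_nhdsWithin] with q h0
    have h0 : 0 < s q := h0
    have : s q ^ 2 ≠ 0 := by positivity
    simp only [Function.comp_apply]
    rw [div_mul_div_cancel₀ this]
  have heq := (isEquivalent_sin_sq (by positivity) hlim).comp_tendsto hq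
  have hE : (fun N : ℕ => e (s (2 * Real.pi / N))) ~[evenAtTop] fun N : ℕ =>
      4 * (piFreqSq V W / 2 * (c / a)) * Real.sin (Real.pi / N) ^ 2 := by
    refine heq.congr_right (Eventually.of_forall fun N => ?_)
    simp only [Function.comp_apply]
    rw [show 2 * Real.pi / N / 2 = Real.pi / N by ring]
  refine ⟨_, ⟨hE.symm.tendsto_nhds ?_, ?_⟩, hE⟩
  · have h1 : Continuous fun q : ℝ => 4 * (piFreqSq V W / 2 * (c / a)) * Real.sin q ^ 2 := by
      fun_prop
    have h2 := (h1.tendsto 0).comp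
      (tendsto_nhds_of_tendsto_nhdsWithin (tendsto_evenAtTop_div Real.pi_pos))
    simpa [Function.comp_def] using h2
  · have hev := (hs.and ((hs0.eventually self_mem_nhdsWithin).and (Ioo_mem_nhdsGT hδ)))
    have hN := eventually_evenAtTop_iff.1 (hq.eventually hev)
    refine eventually_evenAtTop_iff.2 ?_
    filter_upwards [hN, eventually_ge_atTop 4] with N h1 h2 hEv
    obtain ⟨⟨k1, k2⟩, k3, k4⟩ := h1 hEv
    obtain ⟨M, hM⟩ := hEv
    have hqM : 2 * Real.pi / N = Real.pi / M := by
      rw [hM, ← two_mul, Nat.cast_mul, Nat.cast_two, mul_div_mul_left _ _ two_ne_zero]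
    rw [hqM] at k1 k2 k3 k4 ⊢
    rw [hM]
    exact hbif _ k3 k1 M (by omega) k4.2 k2

theorem AreBifurcationEnergies.eventuallyEq {E E' : ℕ → ℝ}
    (h : AreBifurcationEnergies V W Q₀ Qπ w E) (h' : AreBifurcationEnergies V W Q₀ Qπ w E') :
    E =ᶠ[evenAtTop] E' := by
  filter_upwards [h.2, h'.2] with N h1 h2 using h1.unique h2

end Bifurcation

/-! ### The criterion -/

/-- The nonlinearity `D` which decides on the bifurcation of the mode. -/
def modeNonlinearity (V W : ℝ → ℝ) : ℝ :=
  3 * (potentialCoeff V 4 + 16 * potentialCoeff W 4) +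
    2 * potentialCoeff V 3 ^ 2 / (3 * potentialCoeff V 2 + 16 * potentialCoeff W 2) -
    4 * potentialCoeff V 3 ^ 2 / potentialCoeff V 2

section Criterion

variable {V W : ℝ → ℝ} {Q₀ Qπ : ℝ → ℝ → ℝ} {w : ℝ → ℝ}

/-- The stiffness is a common positive factor of both coefficients, so the sign of the nonlinearity
decides and the stiffness cancels in the threshold. -/
theorem IsModeBranch.hasQuadraticExpansion (hV : IsPotential V) (hW : IsPotential W)
    {X₀ Xπ : ℝ → C(unitInterval, ℝ)} {Λ : ℝ → ℝ} (hb : IsModeBranch V W X₀ Xπ Λ) :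
    HasQuadraticExpansion (modeEven V W X₀ Xπ Λ) (evenStiffness V W * (modeNonlinearity V W / 4))
      (evenStiffness V W * (potentialCoeff W 2 / 2)) where
  zero := hb.modeEven_zero hV hW
  even r q := evenDet_modeOp_neg _ r q
  increment _ hε := hb.exists_modeEven_expansion hV hW (hb.tendsto_frequency hV hW) hε

theorem IsOutOfPhaseMode.neverBifurcates (hV : IsPotential V) (hW : IsPotential W)
    (hm : IsOutOfPhaseMode V W Q₀ Qπ w) (hD : modeNonlinearity V W < 0) :
    NeverBifurcates V W Q₀ Qπ w := by
  obtain ⟨X₀, Xπ, Λ, hb⟩ := exists_isModeBranch hV hW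
  obtain ⟨e, R, he⟩ := hm.exists_isEnergyChart hV hW hb
  exact hb.neverBifurcates hV hW he (hb.hasQuadraticExpansion hV hW)
    (mul_neg_of_pos_of_neg (evenStiffness_pos hV hW) (by linarith))
    (mul_pos (evenStiffness_pos hV hW) (half_pos hW.coeff_two_pos))

theorem IsOutOfPhaseMode.exists_areBifurcationEnergies (hV : IsPotential V) (hW : IsPotential W)
    (hm : IsOutOfPhaseMode V W Q₀ Qπ w) (hD : 0 < modeNonlinearity V W) :
    ∃ E, AreBifurcationEnergies V W Q₀ Qπ w E ∧ E ~[evenAtTop] fun N : ℕ =>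
      4 * piFreqSq V W * potentialCoeff W 2 / modeNonlinearity V W *
        Real.sin (Real.pi / N) ^ 2 := by
  obtain ⟨X₀, Xπ, Λ, hb⟩ := exists_isModeBranch hV hW
  obtain ⟨e, R, he⟩ := hm.exists_isEnergyChart hV hW hb
  have hK := evenStiffness_pos hV hW
  have := hb.exists_areBifurcationEnergies hV hW he (hb.hasQuadraticExpansion hV hW)
    (mul_pos hK (by linarith)) (mul_pos hK (half_pos hW.coeff_two_pos))
  have hC : 4 * (piFreqSq V W / 2 * (evenStiffness V W * (potentialCoeff W 2 / 2) /
      (evenStiffness V W * (modeNonlinearity V W / 4)))) =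
      4 * piFreqSq V W * potentialCoeff W 2 / modeNonlinearity V W := by
    field_simp
    ring
  rwa [hC] at this

theorem IsOutOfPhaseMode.bifurcates_iff (hV : IsPotential V) (hW : IsPotential W)
    (hm : IsOutOfPhaseMode V W Q₀ Qπ w) (hD : modeNonlinearity V W ≠ 0) :
    Bifurcates V W Q₀ Qπ w ↔ 0 < modeNonlinearity V W := by
  refine ⟨fun h => ?_, fun h => ?_⟩
  · by_contra hcon
    exact (hm.neverBifurcates hV hW (lt_of_le_of_ne (not_lt.1 hcon) hD)).not_bifurcates h
  · obtain ⟨E, hE, -⟩ := hm.exists_areBifurcationEnergies hV hW h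
    exact ⟨E, hE⟩

/-- On each large lattice the bifurcation energy is unique, so every admissible sequence inherits
the asymptotics of the constructed one. -/
theorem IsOutOfPhaseMode.isEquivalent (hV : IsPotential V) (hW : IsPotential W)
    (hm : IsOutOfPhaseMode V W Q₀ Qπ w) (hD : modeNonlinearity V W ≠ 0) {E : ℕ → ℝ}
    (hE : AreBifurcationEnergies V W Q₀ Qπ w E) : E ~[evenAtTop] fun N : ℕ =>
      4 * piFreqSq V W * potentialCoeff W 2 / modeNonlinearity V W *
        Real.sin (Real.pi / N) ^ 2 := by
  obtain ⟨E', hE', h⟩ := hm.exists_areBifurcationEnergies hV hW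
    ((hm.bifurcates_iff hV hW hD).1 ⟨E, hE⟩)
  exact h.congr_left (hE'.eventuallyEq hE)

theorem nonlinearity_pos_iff {v₂ v₃ v₄ φ₂ φ₄ : ℝ} (hv : 0 < v₂) (hφ : 0 < φ₂) :
    0 < 3 * (v₄ + 16 * φ₄) + 2 * v₃ ^ 2 / (3 * v₂ + 16 * φ₂) - 4 * v₃ ^ 2 / v₂ ↔
      v₃ ^ 2 < 3 * v₂ * (v₄ + 16 * φ₄) * (3 * v₂ + 16 * φ₂) / (2 * (5 * v₂ + 32 * φ₂)) := by
  have h : 3 * (v₄ + 16 * φ₄) + 2 * v₃ ^ 2 / (3 * v₂ + 16 * φ₂) - 4 * v₃ ^ 2 / v₂ =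
      (3 * v₂ * (v₄ + 16 * φ₄) * (3 * v₂ + 16 * φ₂) - v₃ ^ 2 * (2 * (5 * v₂ + 32 * φ₂))) /
        (v₂ * (3 * v₂ + 16 * φ₂)) := by
    field_simp
    ring
  rw [h, div_pos_iff_of_pos_right (by positivity), sub_pos, lt_div_iff₀ (by positivity)]

/-- Substituting `v₃² = 9 v₂ v₄ / 10` cancels the pure onsite contribution; what is left is
proportional to the distance of `φ₄` from its threshold. -/
theorem nonlinearity_eq_of_isochronous {v₂ v₃ v₄ φ₂ φ₄ : ℝ} (hv : 0 < v₂) (hφ : 0 < φ₂)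
    (h : 10 * v₃ ^ 2 = 9 * v₂ * v₄) :
    3 * (v₄ + 16 * φ₄) + 2 * v₃ ^ 2 / (3 * v₂ + 16 * φ₂) - 4 * v₃ ^ 2 / v₂ =
      48 * (φ₄ - 1 / 5 * (v₄ * φ₂ / (3 * v₂ + 16 * φ₂))) := by
  have h3 : v₃ ^ 2 = 9 * v₂ * v₄ / 10 := by linarith
  rw [h3]
  field_simp
  ring

theorem onsite_term_neg {v₂ v₃ φ₂ : ℝ} (hv : 0 < v₂) (hφ : 0 < φ₂) (h : v₃ ≠ 0) :
    2 * v₃ ^ 2 / (3 * v₂ + 16 * φ₂) - 4 * v₃ ^ 2 / v₂ < 0 := by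
  have h3 : 0 < v₃ ^ 2 := by positivity
  rw [sub_neg]
  exact div_lt_div₀ (by linarith) (by linarith) (by linarith) hv

theorem potentialCoeff_four_of_harmonic {φ : ℝ} (h : ∀ᶠ x in 𝓝 0, W x = φ / 2 * x ^ 2) :
    potentialCoeff W 4 = 0 := by
  have h1 : W =ᶠ[𝓝 0] fun x => φ / 2 * x ^ 2 := h
  rw [potentialCoeff, h1.iteratedDeriv_eq]
  simp

end Criterion

end

theorem mainTheorem5 (V W : ℝ → ℝ) (hV : IsPotential V) (hW : IsPotential W)
    (v₂ v₃ v₄ φ₂ φ₄ : ℝ)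
    (hv₂ : v₂ = potentialCoeff V 2) (hv₃ : v₃ = potentialCoeff V 3)
    (hv₄ : v₄ = potentialCoeff V 4) (hφ₂ : φ₂ = potentialCoeff W 2)
    (hφ₄ : φ₄ = potentialCoeff W 4) :
    (∃ Q₀ Qπ ω, IsOutOfPhaseMode V W Q₀ Qπ ω) ∧
    (∃ q ω₀, IsOnsiteMode V q ω₀) ∧
    (v₃ ≠ 0 → 2 * v₃ ^ 2 / (3 * v₂ + 16 * φ₂) - 4 * v₃ ^ 2 / v₂ < 0) ∧
    (∀ q ω₀, IsOnsiteMode V q ω₀ → PartiallyIsochronous ω₀ v₂ →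
      10 * v₃ ^ 2 = 9 * v₂ * v₄) ∧
    ∀ Q₀ Qπ ω, IsOutOfPhaseMode V W Q₀ Qπ ω →
      (IsochronousUpToOrder ω (v₂ + 4 * φ₂) 1 ↔
        3 * (v₄ + 16 * φ₄) + 2 * v₃ ^ 2 / (3 * v₂ + 16 * φ₂) - 4 * v₃ ^ 2 / v₂ ≠ 0) ∧
      (IsochronousUpToOrder ω (v₂ + 4 * φ₂) 1 →
        (∀ E, AreBifurcationEnergies V W Q₀ Qπ ω E →
          E ~[evenAtTop] fun N : ℕ =>
            4 * (v₂ + 4 * φ₂) * φ₂ /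
              (3 * (v₄ + 16 * φ₄) + 2 * v₃ ^ 2 / (3 * v₂ + 16 * φ₂) - 4 * v₃ ^ 2 / v₂)
              * Real.sin (Real.pi / N) ^ 2) ∧
        (Bifurcates V W Q₀ Qπ ω ↔
          v₃ ^ 2 < 3 * v₂ * (v₄ + 16 * φ₄) * (3 * v₂ + 16 * φ₂) /
            (2 * (5 * v₂ + 32 * φ₂))) ∧
        (¬ Bifurcates V W Q₀ Qπ ω → NeverBifurcates V W Q₀ Qπ ω) ∧
        (10 * v₃ ^ 2 = 9 * v₂ * v₄ →
          (Bifurcates V W Q₀ Qπ ω ↔ 1 / 5 * (v₄ * φ₂ / (3 * v₂ + 16 * φ₂)) < φ₄) ∧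
          ((∀ᶠ x in 𝓝 0, W x = φ₂ / 2 * x ^ 2) → NeverBifurcates V W Q₀ Qπ ω))) := by
  subst hv₂ hv₃ hv₄ hφ₂ hφ₄
  have hv := hV.coeff_two_pos
  have hφ := hW.coeff_two_pos
  refine ⟨exists_isOutOfPhaseMode hV hW, exists_isOnsiteMode hV, onsite_term_neg hv hφ,
    fun q w hq hp => hq.coeff_eq_of_partiallyIsochronous hV hp, fun Q₀ Qπ w hm => ?_⟩
  have hiso := hm.isochronousUpToOrder_one_iff hV hW
  refine ⟨hiso, fun hni => ?_⟩
  have hD : modeNonlinearity V W ≠ 0 := hiso.1 hni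
  have hbif := hm.bifurcates_iff hV hW hD
  have hnever : ¬ 0 < modeNonlinearity V W → NeverBifurcates V W Q₀ Qπ w := fun h =>
    hm.neverBifurcates hV hW (lt_of_le_of_ne (not_lt.1 h) hD)
  refine ⟨fun E hE => hm.isEquivalent hV hW hD hE, hbif.trans (nonlinearity_pos_iff hv hφ),
    fun h => hnever (mt hbif.2 h), fun h => ?_⟩
  have hD' : modeNonlinearity V W = _ := nonlinearity_eq_of_isochronous hv hφ h
  have hpos := hD' ▸ (mul_pos_iff_of_pos_left (by norm_num : (0 : ℝ) < 48)).trans sub_pos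
  refine ⟨hbif.trans hpos, fun hharm => hnever fun h0 => ?_⟩
  -- The relation `10 v₃² = 9 v₂ v₄` forces `v₄ ≥ 0`. The threshold for `φ₄` is then nonnegative,
  -- and harmonic coupling with `φ₄ = 0` cannot exceed it.
  have h4 : 0 ≤ potentialCoeff V 4 := by
    by_contra! hneg
    nlinarith [mul_neg_of_pos_of_neg hv hneg, sq_nonneg (potentialCoeff V 3)]
  have := hpos.1 h0
  rw [potentialCoeff_four_of_harmonic hharm] at this
  exact absurd this (not_lt.2 (by positivity))
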